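/- **Setting.** Let $d\ge 1$, $p>1$, $\alpha\in[0,1]$, $g\in\mathbb L_1(\mathbb R^d)$. For $U\in\mathbb L_1(\mathbb R^d)$ write $\check U(t)=\int U(x)e^{-i\sum_jx_jt_j}dx$, and $[f\star g](x)=\int f(x-z)g(z)dz$. One observes $Z_1,\dots,Z_n$ i.i.d. in $\mathbb R^d$ with density $\mathfrak p=(1-\alpha)f+\alpha[f\star g]$; $\mathbb E_f$ is the expectation under their law. Assume: if $\alpha\ne1$, there is $\varepsilon>0$ with $|1-\alpha+\alpha\check g(t)|\ge\varepsilon$ for all $t$; if $\alpha=1$, there are $\mu\in(0,\infty)^d$, $\Upsilon_0>0$ with $|\check g(t)|\ge\Upsilon_0\prod_j(1+t_j^2)^{-\mu_j/2}$ for all $t$. Put $\lambda_j=\mu_j$ if $\alpha=1$ and $\lambda_j=0$ if $\alpha<1$. Let $K(x)=\prod_{j=1}^d\mathcal K(x_j)$ be continuous, where $\mathcal K:\mathbb R\to\mathbb R$ is bounded, $\int\mathcal K=1$, $\operatorname{supp}\mathcal K\subset[-c_{\mathcal K},c_{\mathcal K}]$, $c_{\mathcal K}\ge1$, and for some $\mathbf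 k_1,\mathbf k_2>0$ $$\int|\check K(t)|\prod_j(1+t_j^2)^{\lambda_j/2}dt\le\mathbf k_1,\qquad \int|\check K(t)|^2\prod_j(1+t_j^2)^{\lambda_j}dt\le\mathbf k_2^2 .$$ **Estimator.** Let $\mathcal H=\{e^k:k\in\mathbb Z\}$, $\mathcal H^d_{\rm isotr}=\{(h,\dots,h):h\in\mathcal H\}$, and let $\mathbf H$ be $\mathcal H^d$ or $\mathcal H^d_{\rm isotr}$; $\vee$ and $\ge$ are coordinatewise. With $K_{h}(t)=(\prod_jh_j)^{-1}K(t_1/h_1,\dots,t_d/h_d)$ let, for each $h\in(0,\infty)^d$, $M(\cdot,h)\in\mathbb L_2(\mathbb R^d)$ solve $K_{h}(y)=(1-\alpha)M(y,h)+\alpha\int g(t-y)M(t,h)dt$ for all $y\in\mathbb R^d$. Put $\hat f_{h}(x)=n^{-1}\sum_iM(Z_i-x,h)$, $\hat\sigma^2(x,h)=n^{-1}\sum_iM^2(Z_i-x,h)$, $$M_\infty=\big[(2\pi)^{-d}\{\varepsilon^{-1}\|\check K\|_1 1_{\alpha\ne1}+\Upsilon_0^{-1}\mathbf k_11_{\alpha=1}\}\big]\vee1,$$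 $$\lambda_n(h)=4\ln M_\infty+6\ln n+(8p+26)\sum_j(1+\lambda_j)|\ln h_j|,$$ $$\hat U_n(x,h)=\sqrt{\tfrac{2\lambda_n(h)\hat\sigma^2(x,h)}{n}}+\frac{4M_\infty\lambda_n(h)}{3n\prod_jh_j(h_j\wedge1)^{\lambda_j}},\qquad \hat U_n^*(x,h)=\sup_{\eta\in\mathbf H,\ \eta\ge h}\hat U_n(x,\eta),$$ $$\hat{\mathcal R}_{h}(x)=\sup_{\eta\in\mathbf H}\big[|\hat f_{h\vee\eta}(x)-\hat f_{\eta}(x)|-4\hat U_n(x,h\vee\eta)-4\hat U_n(x,\eta)\big]_+ .$$ Let $\mathbf h(\cdot)$ be a jointly measurable function of the data and of $x$, with values in $\mathbf H$, such that for all $x$ $$\hat{\mathcal R}_{\mathbf h(x)}(x)+8\hat U^*_n(x,\mathbf h(x))\le\inf_{h\in\mathbf H}\big[\hat{\mathcal R}_{h}(x)+8\hat U_n^*(x,h)\big]+\delta(x),$$ where $\delta\ge0$ is a deterministic measurable function with $\|\delta\|_p\le n^{-1/2}$ (an exact minimiser is the case $\delta=0$). The estimator is $\hat f_{\mathbf h(\cdot)}(x)=\hat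 f_{\mathbf h(x)}(x)$, with risk $\mathcal R_n^{(p)}[\hat f_{\mathbf h(\cdot)},f]=(\mathbb E_f\|\hat f_{\mathbf h(\cdot)}-f\|_p^p)^{1/p}$. **Classes.** Let $\mathbb B_{s,d}(R)$ be the closed ball of radius $R$ in $\mathbb L_s(\mathbb R^d)$, let $\|\lambda\|_{u,\infty}=\inf\{C:\nu_d(|\lambda|>z)\le C^uz^{-u}\ \forall z>0\}$ ($\nu_d$ = Lebesgue measure), $\mathbb B^{(\infty)}_{u,d}(D)=\{\|\lambda\|_{u,\infty}<D\}$ for $u<\infty$ and $\mathbb B^{(\infty)}_{\infty,d}(D)=\mathbb B_{\infty,d}(D)$. $\mathbb F_{g,u}(R,D)$ is the set of $f\in\mathbb B_{1,d}(R)$ such that $(1-\alpha)f+\alpha[f\star g]$ is a probability density and belongs to $\mathbb B^{(\infty)}_{u,d}(D)$. **Quantities.** For $D>0$ let $$a=\{196[(c_1\sqrt{c_3})\vee(c_2c_3)]\}^{-1},\quad c_1=M_2\sqrt{2D},\quad c_2=\tfrac43M_\infty,\quad c_3=2\max\{4\ln M_\infty,(8p+26)\max_j(1+\lambda_j)\},$$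 $$M_2=\big[(2\pi)^{-d}\{\varepsilon^{-1}\|\check K\|_21_{\alpha\neq1}+\Upsilon_0^{-1}\mathbf k_21_{\alpha=1}\}\big]\vee1,$$ $$F_n(h)=\frac{\sqrt{\ln n+\sum_j|\ln h_j|}}{\sqrt n\prod_jh_j^{1/2}(h_j\wedge1)^{\lambda_j}},\qquad G_n(h)=\frac{\ln n+\sum_j|\ln h_j|}{n\prod_jh_j(h_j\wedge1)^{\lambda_j}},$$ $\mathfrak H(v)=\{h\in\mathbf H:G_n(h)\le av\}$, $\mathfrak H(v,z)=\{h\in\mathfrak H(v):F_n(h)\le avz^{-1/2}\}$, and $l_{\mathbf H}(v)=v^{p-1}(1+|\ln v|)^{t(\mathbf H)}$ with $t(\mathcal H^d)=d-1$, $t(\mathcal H^d_{\rm isotr})=0$. For a class $\mathbb F$ of functions, with $\mathbf e_j$ the canonical basis and $h\in\mathcal H$, let $$b^*_{h,f,j}(x)=\Big|\int_{\mathbb R}\mathcal K(y)f(x+yh\mathbf e_j)dy-f(x)\Big|,\qquad b_{h,f,j}=\sup_{\eta\in\mathcal H,\eta\le h}b^*_{\eta,f,j},$$ $$\mathbf B_{j,s,\mathbb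 F}(h)=\sup_{f\in\mathbb F}\|b_{h,f,j}\|_s,\qquad \mathbf B^*_{j,s,\mathbb F}(h)=\sup_{f\in\mathbb F}\sum_{\eta\in\mathcal H,\eta\le h}\|b^*_{\eta,f,j}\|_s .$$ Let $\mathbf c=(20d)^{-1}[\max(2c_{\mathcal K}\|\mathcal K\|_\infty,\|\mathcal K\|_1)]^{-d}$, $\bar J(h,v)=\{j:\mathbf B_{j,\infty,\mathbb F}(h_j)>\mathbf cv\}$, and (with $z^{-\infty}=0$) $$\mathbb L_{\vec s}(v,\mathbb F,u)=\inf_{z\ge2}\ \inf_{h\in\mathfrak H(v,z)}\Big[\sum_{j\in\bar J(h,v)}v^{-s_j}\mathbf B_{j,s_j,\mathbb F}(h_j)^{s_j}+z^{-u}\Big],$$ $$\mathbb L_{\vec s}(v,\mathbb F)=\inf_{h\in\mathfrak H(v)}\Big[\sum_{j\in\bar J(h,v)}v^{-s_j}\mathbf B_{j,s_j,\mathbb F}(h_j)^{s_j}+v^{-2}F_n^2(h)\Big].$$ **Theorem.** There is a finite constant $\mathbf C_p$, depending only on the setting ($d,p,\alpha,g,\mathcal K$ and the constants of the assumptions), such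 that for all $R>1$, $D>0$, $q\in(1,\infty]$, $u\in(p/2,\infty]$ with $u\ge q$, $\vec s\in(1,\infty)^d$ and $\vec q\in[p,\infty)^d$ there is a finite constant $C^{(2)}$, depending only on these and on the setting, such that for every $n\ge3$, $0<\underline v\le\overline v<\infty$, $\mathbf H\in\{\mathcal H^d,\mathcal H^d_{\rm isotr}\}$ and $\mathbb F\subset\mathbb B_{q,d}(D)\cap\mathbb F_{g,u}(R,D)$, $$\sup_{f\in\mathbb F}\mathcal R^{(p)}_n[\hat f_{\mathbf h(\cdot)},f]\le C^{(2)}\Big[l_{\mathbf H}(\underline v)+\int_{\underline v}^{\overline v}v^{p-1}\big[\mathbb L_{\vec s}(v,\mathbb F,u)\wedge\mathbb L_{\vec s}(v,\mathbb F)\big]dv+T\Big]^{1/p}+\mathbf C_pn^{-1/2}$$ with $T=\overline v^{\,p}\,\mathbb L_{\vec q}(\overline v,\mathbb F,u)$. If moreover $q\in(p,\infty)$, the same bound holds with $T=\overline v^{\,p-q}$; and if $q=\infty$, it holds with $T=\mathbb L_{\vec s}(\overline v,\mathbb F,u)$. Finally, if $\mathbf H=\mathcal H^d_{\rm isotr}$,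 all these assertions remain true for every $\vec s\in[1,\infty)^d$ if $\mathbf B_{j,s_j,\mathbb F}$ is replaced by $\mathbf B^*_{j,s_j,\mathbb F}$ in the definitions of $\mathbb L_{\vec s}(v,\mathbb F,u)$ and $\mathbb L_{\vec s}(v,\mathbb F)$ (and of $\mathbb L_{\vec q}$), the set $\bar J(h,v)$ being unchanged. -/

import Mathlib

open MeasureTheory Set
open scoped ENNReal NNReal

noncomputable section

namespace ConvDensity

/-! ### Function spaces on `ℝ^d` -/

/-- The Fourier transform `Ǔ(t) = ∫ U(x) exp(-i ∑ x_j t_j) dx`. -/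
def fourierTr {d : ℕ} (U : (Fin d → ℝ) → ℝ) (t : Fin d → ℝ) : ℂ :=
  ∫ x : Fin d → ℝ, (U x : ℂ) * Complex.exp (-(Complex.I * ((∑ j, x j * t j : ℝ) : ℂ)))

/-- The convolution `[f ⋆ g](x) = ∫ f(x - z) g(z) dz`. -/
def conv {d : ℕ} (f g : (Fin d → ℝ) → ℝ) (x : Fin d → ℝ) : ℝ :=
  ∫ z : Fin d → ℝ, f (x - z) * g z

/-- The ball `𝔹_{s,d}(R)` of radius `R` in `L_s(ℝ^d)`. -/
def lpBall (d : ℕ) (s : ℝ≥0∞) (R : ℝ) : Set ((Fin d → ℝ) → ℝ) :=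
  {f | MemLp f s volume ∧ eLpNorm f s volume ≤ ENNReal.ofReal R}

/-- The weak-type norm `‖f‖_{u,∞}`, for a finite exponent `u`. -/
def weakNorm {d : ℕ} (u : ℝ) (f : (Fin d → ℝ) → ℝ) : ℝ≥0∞ :=
  sInf {C : ℝ≥0∞ | ∀ z : ℝ, 0 < z →
    volume {x : Fin d → ℝ | z < |f x|} ≤ C ^ u * ENNReal.ofReal z ^ (-u)}

/-- The ball of radius `D` in weak `L_u(ℝ^d)`; for `u = ∞` it is the ball in `L_∞(ℝ^d)`. -/
def weakBall (d : ℕ) (u : ℝ≥0∞) (D : ℝ) : Set ((Fin d → ℝ) → ℝ) :=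
  {f | if u = ∞ then f ∈ lpBall d ∞ D
       else AEStronglyMeasurable f volume ∧ weakNorm u.toReal f < ENNReal.ofReal D}

/-- The set of probability densities on `ℝ^d`. -/
def probDensities (d : ℕ) : Set ((Fin d → ℝ) → ℝ) :=
  {f | Integrable f volume ∧ (∀ᵐ x, 0 ≤ f x) ∧ ∫ x, f x = 1}

/-! ### The model and the kernel -/

/-- The data of the estimation problem: `α` and `g` of the convolution structure density model,
the constants `ε` (used for `α ≠ 1`), `Υ₀`, `μ` (used for `α = 1`) of the noise condition,
the univariate kernel `𝒦` with the half-width `cK` of its support, the constants `k₁`, `k₂` of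
the kernel condition and the exponent `p` of the loss. The conditions on these data are
`Setting.Valid`. -/
structure Setting (d : ℕ) where
  α : ℝ
  g : (Fin d → ℝ) → ℝ
  ε : ℝ
  Υ₀ : ℝ
  μ : Fin d → ℝ
  𝒦 : ℝ → ℝ
  cK : ℝ
  k₁ : ℝ
  k₂ : ℝ
  p : ℝ

variable {d : ℕ}

namespace Setting

/-- `λ(α) = μ` if `α = 1` and `λ(α) = 0` otherwise. -/
def lam (S : Setting d) (j : Fin d) : ℝ := if S.α = 1 then S.μ j else 0

/-- The product kernel `K(x) = ∏ 𝒦(x_j)`. -/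
def K (S : Setting d) (x : Fin d → ℝ) : ℝ := ∏ j, S.𝒦 (x j)

/-- `K_h(t) = (∏ h_j)⁻¹ K(t_1/h_1, …, t_d/h_d)`. -/
def Kh (S : Setting d) (h t : Fin d → ℝ) : ℝ := (∏ j, h j)⁻¹ * S.K (fun j => t j / h j)

/-- The standing conditions on the model and on the kernel. -/
structure Valid (S : Setting d) : Prop where
  alpha_mem : S.α ∈ Icc (0 : ℝ) 1
  g_integrable : Integrable S.g volume
  noise_of_ne : S.α ≠ 1 → 0 < S.ε ∧
    ∀ t : Fin d → ℝ, S.ε ≤ ‖(1 - (S.α : ℂ)) + (S.α : ℂ) * fourierTr S.g t‖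
  noise_of_eq : S.α = 1 → (∀ j, 0 < S.μ j) ∧ 0 < S.Υ₀ ∧
    ∀ t : Fin d → ℝ, S.Υ₀ * ∏ j, (1 + t j ^ 2) ^ (-(S.μ j / 2)) ≤ ‖fourierTr S.g t‖
  kernel_continuous : Continuous S.K
  kernel_bounded : ∃ B : ℝ, ∀ y, |S.𝒦 y| ≤ B
  one_le_cK : 1 ≤ S.cK
  kernel_support : ∀ y, S.cK < |y| → S.𝒦 y = 0
  kernel_integral : ∫ y, S.𝒦 y = 1
  k₁_pos : 0 < S.k₁
  k₂_pos : 0 < S.k₂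
  kernel_fourier_one :
    ∫⁻ t : Fin d → ℝ,
      ENNReal.ofReal (‖fourierTr S.K t‖ * ∏ j, (1 + t j ^ 2) ^ (S.lam j / 2)) ≤
        ENNReal.ofReal S.k₁
  kernel_fourier_two :
    ∫⁻ t : Fin d → ℝ,
      ENNReal.ofReal (‖fourierTr S.K t‖ ^ 2 * ∏ j, (1 + t j ^ 2) ^ S.lam j) ≤
        ENNReal.ofReal (S.k₂ ^ 2)
  one_lt_p : 1 < S.p

/-- The density `𝔭 = (1 - α) f + α [f ⋆ g]` of an observation. -/
def obsDensity (S : Setting d) (f : (Fin d → ℝ) → ℝ) (x : Fin d → ℝ) : ℝ :=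
  (1 - S.α) * f x + S.α * conv f S.g x

/-- The law `ℙ_f` of `n` i.i.d. observations with density `𝔭`. -/
def sampleLaw (S : Setting d) (n : ℕ) (f : (Fin d → ℝ) → ℝ) : Measure (Fin n → Fin d → ℝ) :=
  Measure.pi fun _ => volume.withDensity fun x => ENNReal.ofReal (S.obsDensity f x)

/-- The class `𝔽_g(R)`. -/
def classF (S : Setting d) (R : ℝ) : Set ((Fin d → ℝ) → ℝ) :=
  {f | f ∈ lpBall d 1 R ∧ S.obsDensity f ∈ probDensities d}

/-- The class `𝔽_{g,u}(R, D)`. -/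
def classFu (S : Setting d) (u : ℝ≥0∞) (R D : ℝ) : Set ((Fin d → ℝ) → ℝ) :=
  {f | f ∈ S.classF R ∧ S.obsDensity f ∈ weakBall d u D}

/-- `M(·, h)` solves, in `L_2(ℝ^d)`, the operator equation
`K_h(y) = (1 - α) M(y, h) + α ∫ g(t - y) M(t, h) dt`, for every `h ∈ (0,∞)^d`. -/
def IsDeconvKernel (S : Setting d) (M : (Fin d → ℝ) → (Fin d → ℝ) → ℝ) : Prop :=
  ∀ h : Fin d → ℝ, (∀ j, 0 < h j) →
    Measurable (fun y => M y h) ∧ MemLp (fun y => M y h) 2 volume ∧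
    ∀ y, S.Kh h y = (1 - S.α) * M y h + S.α * ∫ t, S.g (t - y) * M t h

end Setting

/-! ### Bandwidths -/

/-- The grid `ℋ = {e^k : k ∈ ℤ}`. -/
def grid : Set ℝ := range fun k : ℤ => Real.exp k

/-- The two collections of multi-bandwidths: all of `ℋ^d`, or the isotropic ones. -/
inductive Family where
  | full : Family
  | isotropic : Family

/-- The set of multi-bandwidths of a collection. -/
def Family.toSet (d : ℕ) : Family → Set (Fin d → ℝ)
  | .full => {h | ∀ j, h j ∈ grid}
  | .isotropic => {h | ∃ t ∈ grid, h = fun _ => t}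

/-- The exponent `t(𝐇)`: `d - 1` for all of `ℋ^d` and `0` for the isotropic collection. -/
def Family.t (d : ℕ) : Family → ℕ
  | .full => d - 1
  | .isotropic => 0

namespace Setting

/-! ### The pointwise selection rule -/

/-- The constant `M_∞`. -/
def Minf (S : Setting d) : ℝ :=
  max (((2 * Real.pi) ^ d)⁻¹ *
    (if S.α = 1 then S.Υ₀⁻¹ * S.k₁ else S.ε⁻¹ * ∫ t, ‖fourierTr S.K t‖)) 1

/-- The function `λ_n(h)`. -/
def lamN (S : Setting d) (n : ℕ) (h : Fin d → ℝ) : ℝ :=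
  4 * Real.log S.Minf + 6 * Real.log n +
    (8 * S.p + 26) * ∑ j, (1 + S.lam j) * |Real.log (h j)|

/-- The kernel estimator `f̂_h(x) = n⁻¹ ∑ M(Z_i - x, h)`. -/
def kernelEst (M : (Fin d → ℝ) → (Fin d → ℝ) → ℝ) {n : ℕ} (z : Fin n → Fin d → ℝ)
    (x h : Fin d → ℝ) : ℝ :=
  (n : ℝ)⁻¹ * ∑ i, M (z i - x) h

/-- `σ̂²(x, h) = n⁻¹ ∑ M²(Z_i - x, h)`. -/
def sigmaHatSq (M : (Fin d → ℝ) → (Fin d → ℝ) → ℝ) {n : ℕ} (z : Fin n → Fin d → ℝ)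
    (x h : Fin d → ℝ) : ℝ :=
  (n : ℝ)⁻¹ * ∑ i, M (z i - x) h ^ 2

/-- The function `Û_n(x, h)`. -/
def Uhat (S : Setting d) (M : (Fin d → ℝ) → (Fin d → ℝ) → ℝ) {n : ℕ}
    (z : Fin n → Fin d → ℝ) (x h : Fin d → ℝ) : ℝ :=
  Real.sqrt (2 * S.lamN n h * sigmaHatSq M z x h / n) +
    4 * S.Minf * S.lamN n h / (3 * n * ∏ j, h j * min (h j) 1 ^ S.lam j)

/-- `R̂_h(x)`, with values in `[0, ∞]` (`ENNReal.ofReal` takes the positive part). -/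
def Rhat (S : Setting d) (M : (Fin d → ℝ) → (Fin d → ℝ) → ℝ) (H : Set (Fin d → ℝ)) {n : ℕ}
    (z : Fin n → Fin d → ℝ) (x h : Fin d → ℝ) : ℝ≥0∞ :=
  ⨆ η ∈ H, ENNReal.ofReal
    (|kernelEst M z x (h ⊔ η) - kernelEst M z x η| -
      4 * S.Uhat M z x (h ⊔ η) - 4 * S.Uhat M z x η)

/-- `Û*_n(x, h)`, the supremum of `Û_n(x, η)` over `η ∈ 𝐇` with `η ≥ h`. -/
def UhatStar (S : Setting d) (M : (Fin d → ℝ) → (Fin d → ℝ) → ℝ) (H : Set (Fin d → ℝ)) {n : ℕ}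
    (z : Fin n → Fin d → ℝ) (x h : Fin d → ℝ) : ℝ≥0∞ :=
  ⨆ η ∈ {η ∈ H | h ≤ η}, ENNReal.ofReal (S.Uhat M z x η)

/-- The criterion `R̂_h(x) + 8 Û*_n(x, h)` minimised by the selection rule. -/
def criterion (S : Setting d) (M : (Fin d → ℝ) → (Fin d → ℝ) → ℝ) (H : Set (Fin d → ℝ)) {n : ℕ}
    (z : Fin n → Fin d → ℝ) (x h : Fin d → ℝ) : ℝ≥0∞ :=
  S.Rhat M H z x h + 8 * S.UhatStar M H z x h

/-- `hsel` is a measurable version of the pointwise selection rule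
`𝐡(x) = arg inf_{h ∈ 𝐇} [R̂_h(x) + 8 Û*_n(x, h)]`. Over the infinite set `𝐇` the infimum need not
be attained (it is not when `|x|` is large), hence the infimum is to be reached up to `δ(x)`,
where `δ ≥ 0` and `‖δ‖_p ≤ n^{-1/2}`. For `δ = 0` this is an exact minimiser. -/
structure IsSelection (S : Setting d) (M : (Fin d → ℝ) → (Fin d → ℝ) → ℝ) (H : Set (Fin d → ℝ))
    (n : ℕ) (δ : (Fin d → ℝ) → ℝ)
    (hsel : (Fin n → Fin d → ℝ) → (Fin d → ℝ) → (Fin d → ℝ)) : Prop where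
  tol_measurable : Measurable δ
  tol_nonneg : ∀ x, 0 ≤ δ x
  tol_norm : eLpNorm δ (ENNReal.ofReal S.p) volume ≤ ENNReal.ofReal ((n : ℝ) ^ (-(1 / 2) : ℝ))
  measurable : Measurable fun y : (Fin n → Fin d → ℝ) × (Fin d → ℝ) => hsel y.1 y.2
  mem : ∀ z x, hsel z x ∈ H
  nearly_min : ∀ z x, S.criterion M H z x (hsel z x) ≤
    (⨅ h ∈ H, S.criterion M H z x h) + ENNReal.ofReal (δ x)

/-- The selected estimator `x ↦ f̂_{𝐡(x)}(x)`. -/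
def selectedEst (M : (Fin d → ℝ) → (Fin d → ℝ) → ℝ) {n : ℕ}
    (hsel : (Fin n → Fin d → ℝ) → (Fin d → ℝ) → (Fin d → ℝ))
    (z : Fin n → Fin d → ℝ) (x : Fin d → ℝ) : ℝ :=
  kernelEst M z x (hsel z x)

/-- The `L_p`-risk `(𝔼_f ‖f̂ - f‖_p^p)^{1/p}`. -/
def risk (S : Setting d) {n : ℕ} (fhat : (Fin n → Fin d → ℝ) → (Fin d → ℝ) → ℝ)
    (f : (Fin d → ℝ) → ℝ) : ℝ≥0∞ :=
  (∫⁻ z, eLpNorm (fun x => fhat z x - f x) (ENNReal.ofReal S.p) volume ^ S.p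
    ∂(S.sampleLaw n f)) ^ (1 / S.p)

/-! ### The quantities entering the bound -/

/-- The constant `M_2`. -/
def M2 (S : Setting d) : ℝ :=
  max (((2 * Real.pi) ^ d)⁻¹ *
    (if S.α = 1 then S.Υ₀⁻¹ * S.k₂
      else S.ε⁻¹ * Real.sqrt (∫ t, ‖fourierTr S.K t‖ ^ 2))) 1

/-- The constant `c_3 = 2 max {4 ln M_∞, (8p + 26) max_j [1 + λ_j(α)]}`. -/
def c3 (S : Setting d) : ℝ :=
  2 * max (4 * Real.log S.Minf) ((8 * S.p + 26) * ⨆ j, (1 + S.lam j))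

/-- The constant `a = {196 [(c_1 √c_3) ∨ (c_2 c_3)]}⁻¹`, with `c_1 = M_2 √(2D)` and
`c_2 = 4 M_∞ / 3`. -/
def a (S : Setting d) (D : ℝ) : ℝ :=
  (196 * max (S.M2 * Real.sqrt (2 * D) * Real.sqrt S.c3) (4 * S.Minf / 3 * S.c3))⁻¹

/-- The function `F_n(h)`. -/
def Fn (S : Setting d) (n : ℕ) (h : Fin d → ℝ) : ℝ :=
  Real.sqrt (Real.log n + ∑ j, |Real.log (h j)|) /
    (Real.sqrt n * ∏ j, h j ^ (1 / 2 : ℝ) * min (h j) 1 ^ S.lam j)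

/-- The function `G_n(h)`. -/
def Gn (S : Setting d) (n : ℕ) (h : Fin d → ℝ) : ℝ :=
  (Real.log n + ∑ j, |Real.log (h j)|) / (n * ∏ j, h j * min (h j) 1 ^ S.lam j)

/-- `ℌ(v) = {h ∈ 𝐇 : G_n(h) ≤ a v}`. -/
def frakH (S : Setting d) (D : ℝ) (H : Set (Fin d → ℝ)) (n : ℕ) (v : ℝ) : Set (Fin d → ℝ) :=
  {h ∈ H | S.Gn n h ≤ S.a D * v}

/-- `ℌ(v, z) = {h ∈ ℌ(v) : F_n(h) ≤ a v z^{-1/2}}`. -/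
def frakHz (S : Setting d) (D : ℝ) (H : Set (Fin d → ℝ)) (n : ℕ) (v z : ℝ) :
    Set (Fin d → ℝ) :=
  {h ∈ S.frakH D H n v | S.Fn n h ≤ S.a D * v * z ^ (-(1 / 2) : ℝ)}

/-- `l_𝐇(v) = v^{p-1} (1 + |ln v|)^{t(𝐇)}`. -/
def lH (S : Setting d) (Hf : Family) (v : ℝ) : ℝ :=
  v ^ (S.p - 1) * (1 + |Real.log v|) ^ Family.t d Hf

/-- `b*_{h,f,j}(x) = |∫ 𝒦(y) f(x + y h e_j) dy - f(x)|`. -/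
def bStar (S : Setting d) (h : ℝ) (f : (Fin d → ℝ) → ℝ) (j : Fin d) (x : Fin d → ℝ) : ℝ≥0∞ :=
  ENNReal.ofReal |(∫ y : ℝ, S.𝒦 y * f (x + (y * h) • Pi.single j (1 : ℝ))) - f x|

/-- `b_{h,f,j}(x) = sup_{η ∈ ℋ, η ≤ h} b*_{η,f,j}(x)`. -/
def bSup (S : Setting d) (h : ℝ) (f : (Fin d → ℝ) → ℝ) (j : Fin d) (x : Fin d → ℝ) : ℝ≥0∞ :=
  ⨆ η ∈ {η ∈ grid | η ≤ h}, S.bStar η f j x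

/-- `𝐁_{j,s,𝔽}(h) = sup_{f ∈ 𝔽} ‖b_{h,f,j}‖_s`. -/
def biasB (S : Setting d) (F : Set ((Fin d → ℝ) → ℝ)) (j : Fin d) (s : ℝ≥0∞) (h : ℝ) : ℝ≥0∞ :=
  ⨆ f ∈ F, eLpNorm (S.bSup h f j) s volume

/-- `𝐁*_{j,s,𝔽}(h) = sup_{f ∈ 𝔽} ∑_{η ∈ ℋ, η ≤ h} ‖b*_{η,f,j}‖_s`. -/
def biasBStar (S : Setting d) (F : Set ((Fin d → ℝ) → ℝ)) (j : Fin d) (s : ℝ≥0∞) (h : ℝ) :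
    ℝ≥0∞ :=
  ⨆ f ∈ F, ∑' η : {η : ℝ // η ∈ grid ∧ η ≤ h}, eLpNorm (S.bStar η f j) s volume

/-- The constant `𝐜 = (20 d)⁻¹ [max (2 c_𝒦 ‖𝒦‖_∞, ‖𝒦‖_1)]^{-d}`. -/
def cBold (S : Setting d) : ℝ :=
  (20 * (d : ℝ))⁻¹ *
    (max (2 * S.cK * (eLpNorm S.𝒦 ∞ volume).toReal) (eLpNorm S.𝒦 1 volume).toReal ^ d)⁻¹

open Classical in
/-- `J̄(h, v)`, the set of the `j` for which `𝐁_{j,∞,𝔽}(h_j) ≤ 𝐜 v` fails. -/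
def Jbar (S : Setting d) (F : Set ((Fin d → ℝ) → ℝ)) (h : Fin d → ℝ) (v : ℝ) : Finset (Fin d) :=
  Finset.univ.filter fun j => ¬ S.biasB F j ∞ (h j) ≤ ENNReal.ofReal (S.cBold * v)

/-- `z^{-u}` for `z ≥ 2`, with `z^{-∞} = 0`. -/
def negPow (z : ℝ) (u : ℝ≥0∞) : ℝ≥0∞ :=
  if u = ∞ then 0 else ENNReal.ofReal (z ^ (-u.toReal))

/-- `∑_{j ∈ J̄(h,v)} v^{-s_j} [B_{j,s_j}(h_j)]^{s_j}`, where `B` is `𝐁` or `𝐁*`. -/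
def biasSum (S : Setting d) (F : Set ((Fin d → ℝ) → ℝ))
    (B : Fin d → ℝ≥0∞ → ℝ → ℝ≥0∞) (s : Fin d → ℝ) (h : Fin d → ℝ) (v : ℝ) : ℝ≥0∞ :=
  ∑ j ∈ S.Jbar F h v,
    ENNReal.ofReal (v ^ (-s j)) * B j (ENNReal.ofReal (s j)) (h j) ^ s j

/-- `𝕃_s(v, 𝔽, u)`, formed with `B`. -/
def LLu (S : Setting d) (D : ℝ) (H : Set (Fin d → ℝ)) (n : ℕ) (F : Set ((Fin d → ℝ) → ℝ))
    (B : Fin d → ℝ≥0∞ → ℝ → ℝ≥0∞) (s : Fin d → ℝ) (v : ℝ) (u : ℝ≥0∞) : ℝ≥0∞ :=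
  ⨅ z ∈ Ici (2 : ℝ), ⨅ h ∈ S.frakHz D H n v z, (S.biasSum F B s h v + negPow z u)

/-- `𝕃_s(v, 𝔽)`, formed with `B`. -/
def LL (S : Setting d) (D : ℝ) (H : Set (Fin d → ℝ)) (n : ℕ) (F : Set ((Fin d → ℝ) → ℝ))
    (B : Fin d → ℝ≥0∞ → ℝ → ℝ≥0∞) (s : Fin d → ℝ) (v : ℝ) : ℝ≥0∞ :=
  ⨅ h ∈ S.frakH D H n v, (S.biasSum F B s h v + ENNReal.ofReal (v ^ (-2 : ℤ) * S.Fn n h ^ 2))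

/-- The right-hand side of the bound with last term `last`:
`C [l_𝐇(v₁) + ∫_{v₁}^{v₂} v^{p-1} [𝕃_s(v, 𝔽, u) ∧ 𝕃_s(v, 𝔽)] dv + last]^{1/p} + Cp n^{-1/2}`. -/
def upperBound (S : Setting d) (D : ℝ) (Hf : Family) (n : ℕ) (F : Set ((Fin d → ℝ) → ℝ))
    (B : Fin d → ℝ≥0∞ → ℝ → ℝ≥0∞) (s : Fin d → ℝ) (u : ℝ≥0∞) (v₁ v₂ : ℝ)
    (C Cp : ℝ≥0) (last : ℝ≥0∞) : ℝ≥0∞ :=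
  C * (ENNReal.ofReal (S.lH Hf v₁) +
      (∫⁻ v in Icc v₁ v₂, ENNReal.ofReal (v ^ (S.p - 1)) *
        min (S.LLu D (Hf.toSet d) n F B s v u) (S.LL D (Hf.toSet d) n F B s v)) +
      last) ^ (1 / S.p) +
    Cp * ENNReal.ofReal ((n : ℝ) ^ (-(1 / 2) : ℝ))

/-- The three bounds on the maximal risk over `F` of an estimator `fhat`: in general, for
`q ∈ (p, ∞)` and for `q = ∞`. -/
def MaxRiskBounds (S : Setting d) (D : ℝ) (Hf : Family) {n : ℕ} (F : Set ((Fin d → ℝ) → ℝ))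
    (B : Fin d → ℝ≥0∞ → ℝ → ℝ≥0∞) (s qv : Fin d → ℝ) (q u : ℝ≥0∞) (v₁ v₂ : ℝ) (C Cp : ℝ≥0)
    (fhat : (Fin n → Fin d → ℝ) → (Fin d → ℝ) → ℝ) : Prop :=
  ((⨆ f ∈ F, S.risk fhat f) ≤ S.upperBound D Hf n F B s u v₁ v₂ C Cp
      (ENNReal.ofReal (v₂ ^ S.p) * S.LLu D (Hf.toSet d) n F B qv v₂ u)) ∧
  (ENNReal.ofReal S.p < q → q < ∞ →
    (⨆ f ∈ F, S.risk fhat f) ≤ S.upperBound D Hf n F B s u v₁ v₂ C Cp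
      (ENNReal.ofReal (v₂ ^ (S.p - q.toReal)))) ∧
  (q = ∞ →
    (⨆ f ∈ F, S.risk fhat f) ≤ S.upperBound D Hf n F B s u v₁ v₂ C Cp
      (S.LLu D (Hf.toSet d) n F B s v₂ u))

end Setting

end ConvDensity

end

/-! The selected estimator satisfies a pointwise oracle inequality, and the theorem is a computation
of the `L_p` norm of its right-hand side.

Oracle inequality. Because `M(·, h)` solves the deconvolution equation, the mean of `f̂_h` is the
kernel smoother of `f` (`IsDeconvKernel.integral_eq_smooth`). Passing from `f̂_{𝐡(x)}` to `f̂_h`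
through `f̂_{h ∨ 𝐡(x)}` bounds the error, for almost every `x` and every `h` of the family at once,
by `3 biasSup + 80 UbarStar + 20 remainder + δ` (`IsSelection.oracle`). Here `biasSup` compares the
smoothers at `h ∨ η` and `η`, `UbarStar` is the largest theoretical Bernstein bound above `h`, and
`remainder` collects the deviations beyond Bernstein's bound and the discrepancies, beyond a factor
4, between empirical and theoretical bounds.

Remainder. At fixed `x` and `h` the moments of these excesses are at most a constant times `(b/√n)^p
(n σ²(x,h)/b²) exp(-λ_n(h)/4)`. The factor `σ²` makes the bound integrable in `x`, since the
integral of `σ²(·,h)` is at most the squared `L_2` norm of `M(·,h)`; the exponential makes it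
summable over the grid. The remainder thus costs only `n^{-1/2}`
(`IsDeconvKernel.exists_remainder_le`). The sup and `L_2` norms of `M(·,h)` are found on the Fourier
side, by dividing the transform of `K_h` by the noise multiplier.

Main term. Let `A(x)` be the infimum over `h` of `3 biasSup + 80 UbarStar`. The integral of `A^p` is
split by levels (`exists_lintegral_rpow_le_of_level_sets`). Letting `h` tend to infinity shows that
`A` is bounded by a maximal function of `f`, whose weak type estimate gives `l_𝐇` below `v₁`;
composing `d` one-dimensional maximal functions costs `d - 1` logarithms, whereas the isotropic
family needs only one maximal function over cubes. At an intermediate level `v`, each `h` in `ℌ(v)`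
gives `A ≤ C v + 3 ∑_{j ∈ J̄} β_j + 80 noiseSup`; Markov's inequality with exponents `s_j` handles
the `β_j`, and the noise is handled either by the total mass of the density, which gives `v^{-2}
F_n²`, or by its weak `L_u` norm, which gives `z^{-u}`. Above `v₂` the same splitting with exponents
`q_j ≥ p`, the `L_q` boundedness of the maximal function, or the boundedness of `A` for `q = ∞`
gives the three last terms.

Bias. Bandwidths are changed one coordinate at a time, and each change is a coordinate average of
`b*_{h,f,j}` in the other coordinates. In general these averages are dominated by iterated maximal
functions, which are bounded on `L_s` for `s > 1` and preserve essential upper bounds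
(`Valid.biasControlled`). For isotropic bandwidths one telescopes along the grid and uses Young's
and Minkowski's inequalities instead, which allows `s = 1` and produces the sums `𝐁*`
(`Valid.biasControlled_isotropic`). -/

namespace ConvDensity

/-! ### Layer cake formulas and Marcinkiewicz interpolation. -/

section LayerCake

variable {α : Type*} [MeasurableSpace α] {μ : Measure α}

theorem lintegral_Ioc_rpow {a r : ℝ} (ha : 0 ≤ a) (hr : 0 < r) :
    ∫⁻ t in Ioc 0 a, ENNReal.ofReal (t ^ (r - 1)) = ENNReal.ofReal (a ^ r / r) := by
  rw [← ofReal_integral_eq_lintegral_ofReal]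
  · rw [← intervalIntegral.integral_of_le ha, integral_rpow (Or.inl (by linarith))]
    simp [Real.zero_rpow hr.ne']
  · exact (intervalIntegrable_iff_integrableOn_Ioc_of_le ha).1
      (intervalIntegral.intervalIntegrable_rpow' (by linarith))
  · filter_upwards [ae_restrict_mem measurableSet_Ioc] with t ht
    exact Real.rpow_nonneg ht.1.le _

theorem lintegral_Ioi_rpow {a r : ℝ} (ha : 0 < a) (hr : 0 < r) :
    ∫⁻ t in Ioi a, ENNReal.ofReal (t ^ (-r - 1)) = ENNReal.ofReal (a ^ (-r) / r) := by
  rw [← ofReal_integral_eq_lintegral_ofReal]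
  · rw [integral_Ioi_rpow_of_lt (by linarith) ha]
    congr 1
    rw [show -r - 1 + 1 = -r by ring, div_neg, neg_div, neg_neg]
  · exact integrableOn_Ioi_rpow_of_lt (by linarith) ha
  · filter_upwards [ae_restrict_mem measurableSet_Ioi] with t ht
    exact Real.rpow_nonneg (ha.trans ht).le _

/-- The functions met below may take the value `∞`, so the real-valued layer cake formula is applied
to the truncations `min (F x) n`, and monotone convergence removes the truncation. -/
theorem lintegral_rpow_le_layercake {F : α → ℝ≥0∞} (hF : Measurable F) {p : ℝ} (hp : 0 < p) :
    ∫⁻ x, F x ^ p ∂μ ≤ ENNReal.ofReal p *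
      ∫⁻ t in Ioi (0 : ℝ), μ {x | ENNReal.ofReal t < F x} * ENNReal.ofReal (t ^ (p - 1)) := by
  have key : ∀ n : ℕ, ∫⁻ x, (min (F x) n) ^ p ∂μ ≤ ENNReal.ofReal p *
      ∫⁻ t in Ioi (0 : ℝ), μ {x | ENNReal.ofReal t < F x} * ENNReal.ofReal (t ^ (p - 1)) := by
    intro n
    have hfin : ∀ x, min (F x) n ≠ ∞ := fun x => (min_lt_of_right_lt (by simp)).ne
    have h := lintegral_rpow_eq_lintegral_meas_lt_mul μ (f := fun x => (min (F x) n).toReal)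
      (Filter.Eventually.of_forall fun x => ENNReal.toReal_nonneg)
      (hF.min measurable_const).ennreal_toReal.aemeasurable hp
    have h2 : ∀ x, ENNReal.ofReal ((min (F x) n).toReal ^ p) = (min (F x) n) ^ p := fun x => by
      rw [← ENNReal.ofReal_rpow_of_nonneg ENNReal.toReal_nonneg hp.le,
        ENNReal.ofReal_toReal (hfin x)]
    simp only [h2] at h
    rw [h]
    gcongr ENNReal.ofReal p * ?_
    refine setLIntegral_mono' measurableSet_Ioi fun t ht => ?_
    gcongr with x
    intro hx
    exact ((ENNReal.ofReal_lt_iff_lt_toReal (le_of_lt ht) (hfin x)).2 hx).trans_le (min_le_left _ _)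
  have hmono : Monotone fun (n : ℕ) x => (min (F x) (n : ℝ≥0∞)) ^ p := by
    intro m n hmn x
    dsimp only
    gcongr
  have hsup : ∀ x, F x ^ p = ⨆ n : ℕ, (min (F x) (n : ℝ≥0∞)) ^ p := by
    intro x
    apply le_antisymm
    · rcases eq_or_ne (F x) ∞ with h | h
      · simp only [h, le_top, inf_of_le_right, ENNReal.top_rpow_of_pos hp]
        rw [top_le_iff, iSup_eq_top]
        intro b hb
        obtain ⟨n, hn⟩ := ENNReal.exists_nat_gt (r := b ^ (1 / p)) (by
          exact ENNReal.rpow_ne_top_of_nonneg (by positivity) hb.ne)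
        refine ⟨n, ?_⟩
        have := ENNReal.rpow_lt_rpow hn hp
        rwa [← ENNReal.rpow_mul, one_div, inv_mul_cancel₀ hp.ne', ENNReal.rpow_one] at this
      · obtain ⟨n, hn⟩ := ENNReal.exists_nat_gt h
        refine le_iSup_of_le n ?_
        rw [min_eq_left hn.le]
    · exact iSup_le fun n => by gcongr; exact min_le_left _ _
  simp_rw [hsup]
  rw [lintegral_iSup (fun n => (hF.min measurable_const).pow_const p) hmono]
  exact iSup_le key

/-- Integral of a power over a level set, from a polynomial tail of higher order. -/
theorem lintegral_rpow_tail_le {F : α → ℝ≥0∞} (hF : Measurable F) {p r τ : ℝ} (hp : 0 < p)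
    (hr : p < r) (hτ : 0 < τ) {A : ℝ≥0∞}
    (h : ∀ t, τ ≤ t → μ {x | ENNReal.ofReal t < F x} ≤ A * ENNReal.ofReal (t ^ (-r))) :
    ∫⁻ x in {x | ENNReal.ofReal τ < F x}, F x ^ p ∂μ ≤
      ENNReal.ofReal (r / (r - p)) * A * ENNReal.ofReal (τ ^ (p - r)) := by
  have hms : MeasurableSet {x | ENNReal.ofReal τ < F x} := measurableSet_lt measurable_const hF
  refine (lintegral_rpow_le_layercake (μ := μ.restrict {x | ENNReal.ofReal τ < F x}) hF hp).trans ?_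
  rw [← Ioc_union_Ioi_eq_Ioi hτ.le, lintegral_union measurableSet_Ioi
    (Set.Ioc_disjoint_Ioi le_rfl)]
  -- Below `τ` the restricted level sets are all contained in `{F > τ}`, so their measure is bounded
  -- by the tail at `τ` itself.
  have h1 : ∫⁻ t in Ioc 0 τ, (μ.restrict {x | ENNReal.ofReal τ < F x})
      {x | ENNReal.ofReal t < F x} * ENNReal.ofReal (t ^ (p - 1)) ≤
      A * ENNReal.ofReal (τ ^ (-r)) * ENNReal.ofReal (τ ^ p / p) := by
    rw [← lintegral_Ioc_rpow hτ.le hp, ← lintegral_const_mul _ (by fun_prop)]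
    gcongr with t
    refine (measure_mono (subset_univ _)).trans ?_
    rw [Measure.restrict_apply_univ]
    exact h τ le_rfl
  have h2 : ∫⁻ t in Ioi τ, (μ.restrict {x | ENNReal.ofReal τ < F x})
      {x | ENNReal.ofReal t < F x} * ENNReal.ofReal (t ^ (p - 1)) ≤
      A * ENNReal.ofReal (τ ^ (-(r - p)) / (r - p)) := by
    rw [← lintegral_Ioi_rpow hτ (by linarith), ← lintegral_const_mul _ (by fun_prop)]
    refine setLIntegral_mono' measurableSet_Ioi fun t ht => ?_
    have ht0 : 0 < t := hτ.trans ht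
    calc _ ≤ A * ENNReal.ofReal (t ^ (-r)) * ENNReal.ofReal (t ^ (p - 1)) := by
          gcongr
          exact (Measure.restrict_apply_le _ _).trans (h t (le_of_lt ht))
      _ = _ := by
          rw [mul_assoc, ← ENNReal.ofReal_mul (by positivity), ← Real.rpow_add ht0]
          congr 3; ring
  refine (mul_le_mul_right (add_le_add h1 h2) _).trans (le_of_eq ?_)
  have hrp : 0 < r - p := by linarith
  have e1 : τ ^ (-r) * (τ ^ p / p) = τ ^ (p - r) / p := by
    rw [← mul_div_assoc, ← Real.rpow_add hτ]; congr 2; ring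
  have e2 : -(r - p) = p - r := by ring
  rw [mul_assoc, ← ENNReal.ofReal_mul (by positivity), e1, e2, ← mul_add,
    ← ENNReal.ofReal_add (by positivity) (by positivity), mul_left_comm,
    ← ENNReal.ofReal_mul hp.le, mul_comm (ENNReal.ofReal (r / (r - p))) A, mul_assoc,
    ← ENNReal.ofReal_mul (div_nonneg (by linarith) hrp.le)]
  congr 2
  field_simp
  ring

/-- The indicator cuts the integral off at `2 y`. This is the inner integral that appears after
Tonelli in the interpolation argument. -/
theorem lintegral_Ioi_rpow_indicator_le (y : ℝ≥0∞) {r : ℝ} (hr : 0 < r) :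
    ∫⁻ t in Ioi (0 : ℝ), ENNReal.ofReal (t ^ (r - 1)) *
      (if ENNReal.ofReal (t / 2) < y then 1 else 0) ≤
      ENNReal.ofReal (2 ^ r / r) * y ^ r := by
  rcases eq_or_ne y ∞ with rfl | hy
  · rw [ENNReal.top_rpow_of_pos hr, ENNReal.mul_top (by simp; positivity)]
    exact le_top
  · calc _ ≤ ∫⁻ t in Ioi (0 : ℝ), (Ioc 0 (2 * y.toReal)).indicator
          (fun t => ENNReal.ofReal (t ^ (r - 1))) t := by
          refine setLIntegral_mono' measurableSet_Ioi fun t ht => ?_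
          have ht' : 0 < t := ht
          split_ifs with h
          · rw [ENNReal.ofReal_lt_iff_lt_toReal (by positivity) hy] at h
            rw [indicator_of_mem (show t ∈ Ioc 0 (2 * y.toReal) from ⟨ht, by linarith⟩), mul_one]
          · simp
      _ ≤ ∫⁻ t, (Ioc 0 (2 * y.toReal)).indicator (fun t => ENNReal.ofReal (t ^ (r - 1))) t :=
          setLIntegral_le_lintegral _ _
      _ = ENNReal.ofReal ((2 * y.toReal) ^ r / r) := by
          rw [lintegral_indicator measurableSet_Ioc, lintegral_Ioc_rpow (by positivity) hr]
      _ = _ := by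
          rw [Real.mul_rpow (by norm_num) (by positivity), mul_div_right_comm,
            ENNReal.ofReal_mul (by positivity),
            ← ENNReal.ofReal_rpow_of_nonneg ENNReal.toReal_nonneg hr.le, ENNReal.ofReal_toReal hy]

/-- `F` is controlled by `φ` as a maximal function is: the truncated weak type inequality. -/
def WeakControl (μ : Measure α) (C : ℝ≥0∞) (F φ : α → ℝ≥0∞) : Prop :=
  ∀ t : ℝ, 0 < t → μ {x | ENNReal.ofReal t < F x} ≤
    C * ENNReal.ofReal t⁻¹ * ∫⁻ x in {x | ENNReal.ofReal (t / 2) < φ x}, φ x ∂μ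

/-- Marcinkiewicz interpolation: the truncated weak type bound is inserted in the layer cake formula
and the integrals are exchanged. The integral over the levels then produces `φ ^ (s - 1)`, and it
converges at zero because `s > 1`. -/
theorem WeakControl.lintegral_rpow_le [SFinite μ] {F φ : α → ℝ≥0∞} {C : ℝ≥0∞}
    (h : WeakControl μ C F φ) (hF : Measurable F) (hφ : Measurable φ) {s : ℝ} (hs : 1 < s) :
    ∫⁻ x, F x ^ s ∂μ ≤ C * ENNReal.ofReal (s * 2 ^ (s - 1) / (s - 1)) * ∫⁻ x, φ x ^ s ∂μ := by
  have hs1 : 0 < s - 1 := by linarith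
  have hm : Measurable (fun q : ℝ × α => φ q.2 *
      (ENNReal.ofReal (q.1 ^ (s - 1 - 1)) * (if ENNReal.ofReal (q.1 / 2) < φ q.2 then 1 else 0))) := by
    refine (hφ.comp measurable_snd).mul ((by fun_prop : Measurable fun q : ℝ × α =>
      ENNReal.ofReal (q.1 ^ (s - 1 - 1))).mul ?_)
    exact Measurable.ite (measurableSet_lt (by fun_prop) (hφ.comp measurable_snd))
      measurable_const measurable_const
  calc ∫⁻ x, F x ^ s ∂μ ≤ ENNReal.ofReal s * ∫⁻ t in Ioi (0 : ℝ),
        μ {x | ENNReal.ofReal t < F x} * ENNReal.ofReal (t ^ (s - 1)) :=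
        lintegral_rpow_le_layercake hF (by linarith)
    _ ≤ ENNReal.ofReal s * ∫⁻ t in Ioi (0 : ℝ), C * ∫⁻ x, φ x *
        (ENNReal.ofReal (t ^ (s - 1 - 1)) * (if ENNReal.ofReal (t / 2) < φ x then 1 else 0)) ∂μ := by
        gcongr ENNReal.ofReal s * ?_
        refine setLIntegral_mono' measurableSet_Ioi fun t ht => ?_
        have ht' : 0 < t := ht
        have hset : MeasurableSet {x | ENNReal.ofReal (t / 2) < φ x} :=
          measurableSet_lt measurable_const hφ
        calc _ ≤ C * ENNReal.ofReal t⁻¹ * (∫⁻ x in {x | ENNReal.ofReal (t / 2) < φ x}, φ x ∂μ) *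
              ENNReal.ofReal (t ^ (s - 1)) := by gcongr; exact h t ht
          _ = C * (ENNReal.ofReal (t ^ (s - 1 - 1)) *
              ∫⁻ x in {x | ENNReal.ofReal (t / 2) < φ x}, φ x ∂μ) := by
              have : ENNReal.ofReal (t ^ (s - 1 - 1)) =
                  ENNReal.ofReal t⁻¹ * ENNReal.ofReal (t ^ (s - 1)) := by
                rw [← ENNReal.ofReal_mul (by positivity), Real.rpow_sub_one ht'.ne' (s - 1)]
                congr 1; field_simp
              rw [this]; ring
          _ = _ := by
              rw [← lintegral_indicator hset, ← lintegral_const_mul _ (hφ.indicator hset)]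
              congr 2 with x
              by_cases hx : ENNReal.ofReal (t / 2) < φ x
              · rw [indicator_of_mem (by exact hx), if_pos hx]; ring
              · rw [indicator_of_notMem (by exact hx), if_neg hx]; ring
    _ = ENNReal.ofReal s * (C * ∫⁻ x, (φ x * ∫⁻ t in Ioi (0 : ℝ),
        (ENNReal.ofReal (t ^ (s - 1 - 1)) * (if ENNReal.ofReal (t / 2) < φ x then 1 else 0))) ∂μ) := by
        rw [lintegral_const_mul _ hm.lintegral_prod_right', lintegral_lintegral_swap hm.aemeasurable]
        congr 2
        refine lintegral_congr fun x => ?_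
        dsimp only
        rw [lintegral_const_mul]
        exact (by fun_prop : Measurable fun t : ℝ => ENNReal.ofReal (t ^ (s - 1 - 1))).mul
          (Measurable.ite (measurableSet_lt (by fun_prop) measurable_const)
            measurable_const measurable_const)
    _ ≤ ENNReal.ofReal s * (C * ∫⁻ x, φ x * (ENNReal.ofReal (2 ^ (s - 1) / (s - 1)) *
          φ x ^ (s - 1)) ∂μ) := by
        gcongr with x
        exact lintegral_Ioi_rpow_indicator_le _ hs1
    _ = _ := by
        have : ∀ x, φ x * (ENNReal.ofReal (2 ^ (s - 1) / (s - 1)) * φ x ^ (s - 1)) =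
            ENNReal.ofReal (2 ^ (s - 1) / (s - 1)) * φ x ^ s := by
          intro x
          have : φ x ^ s = φ x * φ x ^ (s - 1) := by
            conv_lhs => rw [show s = 1 + (s - 1) by ring]
            rw [ENNReal.rpow_add_of_nonneg _ _ zero_le_one hs1.le, ENNReal.rpow_one]
          rw [this]; ring
        simp_rw [this]
        rw [lintegral_const_mul _ (hφ.pow_const _), mul_div_assoc,
          ENNReal.ofReal_mul (by linarith)]
        ring

end LayerCake

end ConvDensity

/-! ### Logarithmic losses, and moments computed from level sets. -/

namespace ConvDensity

section LogGrowth

variable {α : Type*} [MeasurableSpace α] {μ : Measure α}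

theorem abs_log_half_le {v : ℝ} (hv : 0 < v) : 1 + |Real.log (v / 2)| ≤ 2 * (1 + |Real.log v|) := by
  rw [Real.log_div hv.ne' two_ne_zero]
  have h2 : Real.log 2 ≤ 1 := by linarith [Real.log_two_lt_d9]
  have h3 : 0 ≤ Real.log 2 := Real.log_nonneg (by norm_num)
  have := abs_sub (Real.log v) (Real.log 2)
  rw [abs_of_nonneg h3] at this
  linarith [abs_nonneg (Real.log v)]

/-- Weak control at level `v` reads off the tail integral of `φ` at level `v / 2`; replacing `v / 2`
by `v` inside the logarithm costs the factor `2 ^ k`. -/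
theorem WeakControl.measure_lt_le {F φ : α → ℝ≥0∞} {C A : ℝ≥0∞} {k : ℕ}
    (h : WeakControl μ C F φ)
    (hk : ∀ v : ℝ, 0 < v → ∫⁻ x in {x | ENNReal.ofReal v < φ x}, φ x ∂μ ≤
      A * ENNReal.ofReal ((1 + |Real.log v|) ^ k)) {v : ℝ} (hv : 0 < v) :
    μ {x | ENNReal.ofReal v < F x} ≤
      C * A * 2 ^ k * ENNReal.ofReal (v⁻¹ * (1 + |Real.log v|) ^ k) := by
  calc _ ≤ C * ENNReal.ofReal v⁻¹ * (A * ENNReal.ofReal ((1 + |Real.log (v / 2)|) ^ k)) :=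
        (h v hv).trans (by gcongr; exact hk _ (by positivity))
    _ ≤ C * ENNReal.ofReal v⁻¹ * (A * ENNReal.ofReal ((2 * (1 + |Real.log v|)) ^ k)) := by
        gcongr; exact abs_log_half_le hv
    _ = _ := by
        rw [mul_pow, ENNReal.ofReal_mul (by positivity), ENNReal.ofReal_mul (by positivity),
          ENNReal.ofReal_pow (by norm_num)]
        simp only [ENNReal.ofReal_ofNat]
        ring

theorem lintegral_Ioc_inv {v : ℝ} (hv : 0 < v) (hv1 : v ≤ 1) :
    ∫⁻ t in Ioc v 1, ENNReal.ofReal t⁻¹ = ENNReal.ofReal |Real.log v| := by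
  rw [← ofReal_integral_eq_lintegral_ofReal]
  · rw [← intervalIntegral.integral_of_le hv1, integral_inv_of_pos hv one_pos, one_div,
      Real.log_inv, abs_of_nonpos (Real.log_nonpos hv.le hv1)]
  · refine (ContinuousOn.integrableOn_Icc ?_).mono_set Ioc_subset_Icc_self
    exact continuousOn_inv₀.mono fun t ht => (hv.trans_le ht.1).ne'
  · filter_upwards [ae_restrict_mem measurableSet_Ioc] with t ht
    exact inv_nonneg.2 (hv.trans ht.1).le

/-- A maximal function loses one logarithm in the tail of the integral. -/
theorem WeakControl.tail_le {F φ : α → ℝ≥0∞} {C A B : ℝ≥0∞} {k : ℕ} {q : ℝ}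
    (h : WeakControl μ C F φ) (hF : Measurable F)
    (hk : ∀ v : ℝ, 0 < v → ∫⁻ x in {x | ENNReal.ofReal v < φ x}, φ x ∂μ ≤
      A * ENNReal.ofReal ((1 + |Real.log v|) ^ k)) (hq : 1 < q)
    (hB : ∫⁻ x, F x ^ q ∂μ ≤ B) {v : ℝ} (hv : 0 < v) :
    ∫⁻ x in {x | ENNReal.ofReal v < F x}, F x ∂μ ≤
      (2 * (C * A * 2 ^ k) + B * ENNReal.ofReal (1 / (q - 1))) *
        ENNReal.ofReal ((1 + |Real.log v|) ^ (k + 1)) := by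
  have hw := fun {v : ℝ} (hv : 0 < v) => h.measure_lt_le hk hv
  set L : ℝ := 1 + |Real.log v| with hL
  have hL1 : 1 ≤ L := by linarith [abs_nonneg (Real.log v)]
  set A' := C * A * 2 ^ k
  clear_value A'
  have hlc := lintegral_rpow_le_layercake (μ := μ.restrict {x | ENNReal.ofReal v < F x}) hF one_pos
  simp only [ENNReal.rpow_one, ENNReal.ofReal_one, one_mul, sub_self, Real.rpow_zero, mul_one]
    at hlc
  refine hlc.trans ?_
  -- Chebyshev with exponent `q > 1` makes the part `t > 1` converge; the weak type bound alone
  -- would diverge there.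
  have hbig : ∀ t : ℝ, 0 < t → μ {x | ENNReal.ofReal t < F x} ≤ B * ENNReal.ofReal (t ^ (-q)) := by
    intro t ht
    have h1 : {x | ENNReal.ofReal t < F x} ⊆ {x | ENNReal.ofReal (t ^ q) ≤ F x ^ q} := by
      intro x hx
      simp only [mem_ofPred_eq] at hx ⊢
      rw [← ENNReal.ofReal_rpow_of_pos ht]
      gcongr
    have h2 := mul_meas_ge_le_lintegral (μ := μ) (hF.pow_const q) (ENNReal.ofReal (t ^ q))
    have h3 : ENNReal.ofReal (t ^ q) ≠ 0 := by simp; positivity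
    rw [Real.rpow_neg ht.le, ENNReal.ofReal_inv_of_pos (by positivity), ← div_eq_mul_inv,
      ENNReal.le_div_iff_mul_le (Or.inl h3) (Or.inl ENNReal.ofReal_ne_top), mul_comm]
    exact (mul_le_mul_right (measure_mono h1) _).trans (h2.trans hB)
  have hsplit : Ioi (0 : ℝ) ⊆ Ioc 0 v ∪ (Ioc v 1 ∪ Ioi 1) := by
    intro t ht
    rcases le_or_gt t v with h1 | h1
    · exact Or.inl ⟨ht, h1⟩
    · rcases le_or_gt t 1 with h2 | h2
      · exact Or.inr (Or.inl ⟨h1, h2⟩)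
      · exact Or.inr (Or.inr h2)
  refine (lintegral_mono_set hsplit).trans ((lintegral_union_le _ _ _).trans
    ((add_le_add_right (lintegral_union_le _ _ _) _).trans ?_))
  have e1 : ∫⁻ t in Ioc 0 v, (μ.restrict {x | ENNReal.ofReal v < F x})
      {x | ENNReal.ofReal t < F x} ≤ A' * ENNReal.ofReal (L ^ (k + 1)) := by
    calc _ ≤ ∫⁻ t in Ioc 0 v, A' * ENNReal.ofReal (v⁻¹ * L ^ k) := by
          gcongr with t
          refine (measure_mono (subset_univ _)).trans ?_
          rw [Measure.restrict_apply_univ]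
          exact hw hv
      _ = A' * ENNReal.ofReal (L ^ k) := by
          rw [lintegral_const, Measure.restrict_apply_univ, Real.volume_Ioc, sub_zero, mul_assoc,
            ← ENNReal.ofReal_mul (by positivity)]
          congr 2; field_simp
      _ ≤ _ := by gcongr; omega
  -- Here the level sets have measure of order `t⁻¹` up to logarithms, and the integral of `dt / t`
  -- over `(v, 1]` is the additional logarithm. For `v > 1` the range is empty.
  have e2 : ∫⁻ t in Ioc v 1, (μ.restrict {x | ENNReal.ofReal v < F x})
      {x | ENNReal.ofReal t < F x} ≤ A' * ENNReal.ofReal (L ^ (k + 1)) := by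
    rcases le_or_gt v 1 with hv1 | hv1
    · calc _ ≤ ∫⁻ t in Ioc v 1, A' * ENNReal.ofReal (L ^ k) * ENNReal.ofReal t⁻¹ := by
            refine setLIntegral_mono' measurableSet_Ioc fun t ht => ?_
            have ht0 : 0 < t := hv.trans ht.1
            refine (Measure.restrict_apply_le _ _).trans ((hw ht0).trans ?_)
            rw [mul_assoc, ← ENNReal.ofReal_mul (by positivity), mul_comm t⁻¹]
            gcongr
            rw [hL, abs_of_nonpos (Real.log_nonpos ht0.le ht.2),
              abs_of_nonpos (Real.log_nonpos hv.le hv1)]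
            have := Real.log_le_log hv ht.1.le
            linarith
        _ = A' * ENNReal.ofReal (L ^ k * |Real.log v|) := by
            rw [lintegral_const_mul _ (by fun_prop), lintegral_Ioc_inv hv hv1, mul_assoc,
              ← ENNReal.ofReal_mul (by positivity)]
        _ ≤ _ := by
            gcongr
            rw [pow_succ]
            gcongr
            linarith
    · rw [Ioc_eq_empty (by simpa using hv1.le)]; simp
  have e3 : ∫⁻ t in Ioi 1, (μ.restrict {x | ENNReal.ofReal v < F x})
      {x | ENNReal.ofReal t < F x} ≤ B * ENNReal.ofReal (1 / (q - 1)) *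
        ENNReal.ofReal (L ^ (k + 1)) := by
    calc _ ≤ ∫⁻ t in Ioi 1, B * ENNReal.ofReal (t ^ (-(q - 1) - 1)) := by
          refine setLIntegral_mono' measurableSet_Ioi fun t ht => ?_
          refine (Measure.restrict_apply_le _ _).trans
            ((hbig t (zero_lt_one.trans ht)).trans (le_of_eq ?_))
          congr 3; ring
      _ = B * ENNReal.ofReal (1 / (q - 1)) := by
          rw [lintegral_const_mul _ (by fun_prop), lintegral_Ioi_rpow one_pos (by linarith),
            Real.one_rpow]
      _ ≤ _ := by
          refine le_mul_of_one_le_right' ?_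
          rw [← ENNReal.ofReal_one]
          exact ENNReal.ofReal_le_ofReal (one_le_pow₀ hL1)
  refine (add_le_add e1 (add_le_add e2 e3)).trans (le_of_eq ?_)
  ring

/-- Logarithms are weaker than powers: `1 + |log t|` is at most `(1 + |log v|) (1 + |log (t / v)|)`,
and the `k`-th power of the last factor is absorbed by `(t / v) ^ (-r / 2)`, which leaves an
integrable power of `t`. -/
theorem exists_lintegral_Ioc_rpow_log_le {r : ℝ} (hr : 0 < r) (k : ℕ) :
    ∃ C : ℝ≥0, ∀ v : ℝ, 0 < v →
      ∫⁻ t in Ioc 0 v, ENNReal.ofReal (t ^ (r - 1) * (1 + |Real.log t|) ^ k) ≤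
        C * ENNReal.ofReal (v ^ r * (1 + |Real.log v|) ^ k) := by
  -- The `k`-th power of `y ^ (-δ)` must not exceed `y ^ (-r / 2)`; dividing by `k + 1` rather than
  -- `k` also covers `k = 0`.
  set δ : ℝ := r / 2 / (k + 1) with hδ
  have hδ0 : 0 < δ := by positivity
  have hδk : δ * k ≤ r / 2 := by
    rw [hδ, div_mul_eq_mul_div, div_le_iff₀ (by positivity)]; nlinarith
  have hsmall : ∀ y : ℝ, 0 < y → y ≤ 1 → (1 + |Real.log y|) ^ k ≤
      (1 + 1 / δ) ^ k * y ^ (-(r / 2)) := by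
    intro y hy hy1
    have h1 : |Real.log y| ≤ y ^ (-δ) / δ := by
      rw [abs_of_nonpos (Real.log_nonpos hy.le hy1), ← Real.log_inv, Real.rpow_neg hy.le,
        ← Real.inv_rpow hy.le]
      exact Real.log_le_rpow_div (by positivity) hδ0
    have h2 : 1 ≤ y ^ (-δ) := Real.one_le_rpow_of_pos_of_le_one_of_nonpos hy hy1 (by linarith)
    calc (1 + |Real.log y|) ^ k ≤ ((1 + 1 / δ) * y ^ (-δ)) ^ k := by
          gcongr
          rw [add_mul, one_mul, one_div_mul_eq_div]
          linarith
      _ = (1 + 1 / δ) ^ k * y ^ (-(δ * k)) := by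
          rw [mul_pow, ← Real.rpow_mul_natCast hy.le, neg_mul]
      _ ≤ _ := by
          gcongr (1 + 1 / δ) ^ k * ?_
          exact Real.rpow_le_rpow_of_exponent_ge hy hy1 (by linarith)
  refine ⟨((1 + 1 / δ) ^ k / (r / 2)).toNNReal, fun v hv => ?_⟩
  have hpt : ∀ t ∈ Ioc 0 v, ENNReal.ofReal (t ^ (r - 1) * (1 + |Real.log t|) ^ k) ≤
      ENNReal.ofReal ((1 + |Real.log v|) ^ k * ((1 + 1 / δ) ^ k * v ^ (r / 2))) *
        ENNReal.ofReal (t ^ (r / 2 - 1)) := by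
    intro t ht
    have ht0 : 0 < t := ht.1
    rw [← ENNReal.ofReal_mul (by positivity)]
    apply ENNReal.ofReal_le_ofReal
    have h1 : 1 + |Real.log t| ≤ (1 + |Real.log v|) * (1 + |Real.log (t / v)|) := by
      rw [Real.log_div ht0.ne' hv.ne']
      have := abs_sub_abs_le_abs_sub (Real.log t) (Real.log v)
      nlinarith [abs_nonneg (Real.log v), abs_nonneg (Real.log t - Real.log v)]
    have h2 := hsmall (t / v) (by positivity) ((div_le_one hv).2 ht.2)
    calc t ^ (r - 1) * (1 + |Real.log t|) ^ k
        ≤ t ^ (r - 1) * ((1 + |Real.log v|) ^ k * ((1 + 1 / δ) ^ k * (t / v) ^ (-(r / 2)))) := by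
          gcongr
          calc _ ≤ ((1 + |Real.log v|) * (1 + |Real.log (t / v)|)) ^ k := by gcongr
            _ ≤ _ := by rw [mul_pow]; gcongr
      _ = _ := by
          have : t ^ (r / 2 - 1) = t ^ (r - 1) * (t ^ (r / 2))⁻¹ := by
            rw [show r / 2 - 1 = (r - 1) - r / 2 by ring, Real.rpow_sub ht0, div_eq_mul_inv]
          rw [Real.div_rpow ht0.le hv.le, Real.rpow_neg hv.le, Real.rpow_neg ht0.le, this]
          have := (Real.rpow_pos_of_pos ht0 (r / 2)).ne'
          have := (Real.rpow_pos_of_pos hv (r / 2)).ne'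
          field_simp
  refine (setLIntegral_mono' measurableSet_Ioc hpt).trans (le_of_eq ?_)
  rw [lintegral_const_mul _ (by fun_prop), lintegral_Ioc_rpow hv.le (by positivity),
    ← ENNReal.ofReal_mul (by positivity)]
  have : ((((1 + 1 / δ) ^ k / (r / 2)).toNNReal : ℝ≥0) : ℝ≥0∞) =
    ENNReal.ofReal ((1 + 1 / δ) ^ k / (r / 2)) := rfl
  rw [this, ← ENNReal.ofReal_mul (by positivity)]
  congr 1
  have : v ^ r = v ^ (r / 2) * v ^ (r / 2) := by rw [← Real.rpow_add hv]; congr 1; ring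
  rw [this]
  field_simp

/-- The skeleton of the risk bound. Outside `{F > c v₂}` the layer cake integral of `c⁻¹ F` is cut
at `v₁`: the first range uses the weak type bound, the second uses `Λ`, and levels above `v₂` do not
occur. On `{F > c v₂}` the integral is bounded by assumption. The constant is uniform in `F`, `Λ`,
`T`, `v₁` and `v₂`, which gives the uniformity over `n` and over the class. -/
theorem exists_lintegral_rpow_le_of_level_sets {p : ℝ} (hp : 1 < p) (k : ℕ) {c : ℝ} (hc : 0 < c)
    (K : ℝ≥0) : ∃ K' : ℝ≥0, ∀ (F : α → ℝ≥0∞) (Λ : ℝ → ℝ≥0∞) (T : ℝ≥0∞) (v₁ v₂ : ℝ),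
      Measurable F → 0 < v₁ → v₁ ≤ v₂ →
      (∀ v, 0 < v → μ {x | ENNReal.ofReal (c * v) < F x} ≤
        K * ENNReal.ofReal (v⁻¹ * (1 + |Real.log v|) ^ k)) →
      (∀ v, 0 < v → μ {x | ENNReal.ofReal (c * v) < F x} ≤ K * Λ v) →
      (∫⁻ x in {x | ENNReal.ofReal (c * v₂) < F x}, F x ^ p ∂μ ≤ K * T) →
      ∫⁻ x, F x ^ p ∂μ ≤ K' * (ENNReal.ofReal (v₁ ^ (p - 1) * (1 + |Real.log v₁|) ^ k) +
        (∫⁻ v in Icc v₁ v₂, ENNReal.ofReal (v ^ (p - 1)) * Λ v) + T) := by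
  obtain ⟨C, hC⟩ := exists_lintegral_Ioc_rpow_log_le (r := p - 1) (by linarith) k
  have hp0 : 0 < p := by linarith
  set a : ℝ≥0 := (c ^ p).toNNReal * p.toNNReal with ha
  refine ⟨a * K * C + a * K + K, fun F Λ T v₁ v₂ hF hv₁ hv h0 h1 h2 => ?_⟩
  have hv₂ : 0 < v₂ := hv₁.trans_le hv
  have hms : MeasurableSet {x | ENNReal.ofReal (c * v₂) < F x} := measurableSet_lt measurable_const hF
  rw [← lintegral_add_compl _ hms, add_comm]
  set ν := μ.restrict {x | ENNReal.ofReal (c * v₂) < F x}ᶜ with hν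
  have hlow : ∫⁻ x, F x ^ p ∂ν ≤ a * (K * (C * ENNReal.ofReal (v₁ ^ (p - 1) * (1 + |Real.log v₁|) ^ k))
      + K * ∫⁻ v in Icc v₁ v₂, ENNReal.ofReal (v ^ (p - 1)) * Λ v) := by
    have hcF : ∀ x, F x ^ p = ENNReal.ofReal (c ^ p) * (ENNReal.ofReal c⁻¹ * F x) ^ p := by
      intro x
      rw [ENNReal.mul_rpow_of_nonneg _ _ hp0.le, ← mul_assoc,
        ENNReal.ofReal_rpow_of_pos (by positivity), ← ENNReal.ofReal_mul (by positivity),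
        Real.inv_rpow hc.le, mul_inv_cancel₀ (by positivity), ENNReal.ofReal_one, one_mul]
    have hlt : ∀ (t : ℝ) x, ENNReal.ofReal t < ENNReal.ofReal c⁻¹ * F x ↔
        ENNReal.ofReal (c * t) < F x := by
      intro t x
      rw [ENNReal.ofReal_mul hc.le, ENNReal.ofReal_inv_of_pos hc, mul_comm _ (F x),
        ← div_eq_mul_inv, ENNReal.lt_div_iff_mul_lt (Or.inl (by simpa using hc))
          (Or.inl ENNReal.ofReal_ne_top), mul_comm]
    simp_rw [hcF]
    rw [lintegral_const_mul _ ((hF.const_mul _).pow_const _)]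
    have hlc := lintegral_rpow_le_layercake (μ := ν) (hF.const_mul (ENNReal.ofReal c⁻¹)) hp0
    simp_rw [hlt] at hlc
    have hcov : Ioi (0 : ℝ) ⊆ Ioc 0 v₁ ∪ (Icc v₁ v₂ ∪ Ioi v₂) := by
      intro t ht
      rcases le_or_gt t v₁ with h1 | h1
      · exact Or.inl ⟨ht, h1⟩
      · rcases le_or_gt t v₂ with h2 | h2
        · exact Or.inr (Or.inl ⟨h1.le, h2⟩)
        · exact Or.inr (Or.inr h2)
    have e1 : ∫⁻ t in Ioc 0 v₁, ν {x | ENNReal.ofReal (c * t) < F x} * ENNReal.ofReal (t ^ (p - 1))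
        ≤ K * (C * ENNReal.ofReal (v₁ ^ (p - 1) * (1 + |Real.log v₁|) ^ k)) := by
      refine le_trans ?_ (mul_le_mul_right (hC v₁ hv₁) _)
      rw [← lintegral_const_mul _ (by fun_prop)]
      refine setLIntegral_mono' measurableSet_Ioc fun t ht => ?_
      have ht0 : 0 < t := ht.1
      calc _ ≤ K * ENNReal.ofReal (t⁻¹ * (1 + |Real.log t|) ^ k) * ENNReal.ofReal (t ^ (p - 1)) := by
            gcongr
            exact (Measure.restrict_apply_le _ _).trans (h0 t ht0)
        _ = _ := by
            rw [mul_assoc, ← ENNReal.ofReal_mul (by positivity), Real.rpow_sub_one ht0.ne' (p - 1)]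
            congr 2
            field_simp
    have e2 : ∫⁻ t in Icc v₁ v₂, ν {x | ENNReal.ofReal (c * t) < F x} * ENNReal.ofReal (t ^ (p - 1))
        ≤ K * ∫⁻ v in Icc v₁ v₂, ENNReal.ofReal (v ^ (p - 1)) * Λ v := by
      rw [← lintegral_const_mul' _ _ ENNReal.coe_ne_top]
      refine setLIntegral_mono' measurableSet_Icc fun t ht => ?_
      calc _ ≤ K * Λ t * ENNReal.ofReal (t ^ (p - 1)) := by
            gcongr
            exact (Measure.restrict_apply_le _ _).trans (h1 t (hv₁.trans_le ht.1))
        _ = _ := by ring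
    have e3 : ∫⁻ t in Ioi v₂, ν {x | ENNReal.ofReal (c * t) < F x} * ENNReal.ofReal (t ^ (p - 1))
        ≤ 0 := by
      rw [← lintegral_zero (μ := volume.restrict (Ioi v₂))]
      refine setLIntegral_mono' measurableSet_Ioi fun t ht => ?_
      have : ν {x | ENNReal.ofReal (c * t) < F x} = 0 := by
        rw [hν, Measure.restrict_apply (measurableSet_lt measurable_const hF)]
        have : {x | ENNReal.ofReal (c * t) < F x} ∩ {x | ENNReal.ofReal (c * v₂) < F x}ᶜ = ∅ := by
          ext x
          simp only [mem_inter_iff, mem_ofPred_eq, mem_compl_iff, not_lt, mem_empty_iff_false,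
            iff_false, not_and, not_le]
          intro hx
          refine lt_of_le_of_lt (ENNReal.ofReal_le_ofReal ?_) hx
          have : v₂ < t := ht
          gcongr
        rw [this, measure_empty]
      simp [this]
    have := (lintegral_mono_set hcov).trans ((lintegral_union_le _ _ _).trans
      ((add_le_add_right (lintegral_union_le (μ := volume)
        (fun t => ν {x | ENNReal.ofReal (c * t) < F x} * ENNReal.ofReal (t ^ (p - 1))) _ _) _).trans
        (add_le_add e1 (add_le_add e2 e3))))
    rw [add_zero] at this
    refine (mul_le_mul_right (hlc.trans (mul_le_mul_right this _)) _).trans (le_of_eq ?_)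
    rw [← mul_assoc, ha, ENNReal.coe_mul]
    rfl
  refine (add_le_add hlow h2).trans ?_
  set X := ENNReal.ofReal (v₁ ^ (p - 1) * (1 + |Real.log v₁|) ^ k)
  set Y := ∫⁻ v in Icc v₁ v₂, ENNReal.ofReal (v ^ (p - 1)) * Λ v
  push_cast
  calc _ = a * K * C * X + a * K * Y + K * T := by ring
    _ ≤ (a * K * C + a * K + K) * X + (a * K * C + a * K + K) * Y +
        (a * K * C + a * K + K) * T := by
        gcongr
        · exact le_add_right (le_add_right le_rfl)
        · exact le_add_right (le_add_left le_rfl)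
        · exact le_add_left le_rfl
    _ = _ := by ring

end LogGrowth

end ConvDensity

/-! ### The maximal function over balls with radii on a geometric grid. -/

namespace ConvDensity

section Hardy

variable {E : Type*} [NormedAddCommGroup E] [MeasurableSpace E]

/-- The maximal function over the balls of radii `c e^k`, `k ∈ ℤ`. -/
noncomputable def hardy (μ : Measure E) (c : ℝ) (φ : E → ℝ≥0∞) (x : E) : ℝ≥0∞ :=
  ⨆ k : ℤ, (μ (Metric.closedBall x (c * Real.exp k)))⁻¹ *
    ∫⁻ y in Metric.closedBall x (c * Real.exp k), φ y ∂μ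

theorem hardy_le_add {μ : Measure E} {c : ℝ} {φ φ₁ φ₂ : E → ℝ≥0∞} (h₁ : Measurable φ₁)
    (h : ∀ x, φ x ≤ φ₁ x + φ₂ x) (x : E) :
    hardy μ c φ x ≤ hardy μ c φ₁ x + hardy μ c φ₂ x := by
  refine iSup_le fun k => ?_
  calc _ ≤ (μ (Metric.closedBall x (c * Real.exp k)))⁻¹ *
        ∫⁻ y in Metric.closedBall x (c * Real.exp k), (φ₁ y + φ₂ y) ∂μ := by
        gcongr; exact h _
    _ ≤ _ := by
        rw [lintegral_add_left h₁, mul_add]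
        exact add_le_add (le_iSup (fun k : ℤ => (μ (Metric.closedBall x (c * Real.exp k)))⁻¹ *
            ∫⁻ y in Metric.closedBall x (c * Real.exp k), φ₁ y ∂μ) k)
          (le_iSup (fun k : ℤ => (μ (Metric.closedBall x (c * Real.exp k)))⁻¹ *
            ∫⁻ y in Metric.closedBall x (c * Real.exp k), φ₂ y ∂μ) k)

theorem hardy_le_of_le {μ : Measure E} {c : ℝ} {φ : E → ℝ≥0∞} {w : ℝ≥0∞} (h : ∀ x, φ x ≤ w)
    (x : E) : hardy μ c φ x ≤ w := by
  refine iSup_le fun k => ?_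
  calc _ ≤ (μ (Metric.closedBall x (c * Real.exp k)))⁻¹ *
        ∫⁻ y in Metric.closedBall x (c * Real.exp k), w ∂μ := by
        gcongr; exact h _
    _ = w * (μ (Metric.closedBall x (c * Real.exp k)) *
          (μ (Metric.closedBall x (c * Real.exp k)))⁻¹) := by
        rw [setLIntegral_const]; ring
    _ ≤ w := mul_le_of_le_one_right' (ENNReal.mul_inv_le_one _)

variable [NormedSpace ℝ E] [BorelSpace E] [FiniteDimensional ℝ E] {μ : Measure E}
  [μ.IsAddHaarMeasure]

theorem measurable_hardy {c : ℝ} {φ : E → ℝ≥0∞} (hφ : Measurable φ) :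
    Measurable (hardy μ c φ) := by
  have : SecondCountableTopology E := secondCountable_of_proper
  refine Measurable.iSup fun k => ?_
  simp_rw [Measure.addHaar_closedBall_center]
  refine Measurable.const_mul ?_ _
  have h1 : MeasurableSet {q : E × E | dist q.2 q.1 ≤ c * Real.exp k} :=
    measurableSet_le (by fun_prop) measurable_const
  have h2 : Measurable ({q : E × E | dist q.2 q.1 ≤ c * Real.exp k}.indicator fun q => φ q.2) :=
    (hφ.comp measurable_snd).indicator h1
  have h3 := h2.lintegral_prod_right' (ν := μ)
  convert h3 using 2 with x
  rw [← lintegral_indicator Metric.isClosed_closedBall.measurableSet]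
  rfl

/-- Every point of the level set is the centre of a ball on which the mean of `φ` is at least `t`.
The Vitali covering lemma extracts disjoint balls whose enlargements by the factor 4 still cover,
and the integrals over the disjoint balls add up to at most the integral of `φ`. -/
theorem hardy_measure_lt_le [Nontrivial E] {c : ℝ} (hc : 0 < c) {φ : E → ℝ≥0∞} {t : ℝ}
    (ht : 0 < t) : μ {x | ENNReal.ofReal t < hardy μ c φ x} ≤
      4 ^ Module.finrank ℝ E * ENNReal.ofReal t⁻¹ * ∫⁻ x, φ x ∂μ := by
  have : SecondCountableTopology E := secondCountable_of_proper
  set n := Module.finrank ℝ E with hn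
  have hn0 : n ≠ 0 := Module.finrank_pos.ne'
  have htinv : ENNReal.ofReal t⁻¹ ≠ 0 := by simpa using ht
  rcases eq_or_ne (∫⁻ x, φ x ∂μ) ∞ with hI | hI
  · rw [hI, ENNReal.mul_top (mul_ne_zero (by simp) htinv)]; exact le_top
  set S := {x | ENNReal.ofReal t < hardy μ c φ x} with hS
  have hex : ∀ x : E, ∃ k : ℤ, x ∈ S → ENNReal.ofReal t * μ (Metric.closedBall x (c * Real.exp k)) ≤
      ∫⁻ y in Metric.closedBall x (c * Real.exp k), φ y ∂μ := by
    intro x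
    by_cases hx : x ∈ S
    · obtain ⟨k, hk⟩ := lt_iSup_iff.1 (show ENNReal.ofReal t < hardy μ c φ x from hx)
      refine ⟨k, fun _ => ?_⟩
      have hpos : μ (Metric.closedBall x (c * Real.exp k)) ≠ 0 :=
        (Metric.measure_closedBall_pos μ x (by positivity)).ne'
      have hfin : μ (Metric.closedBall x (c * Real.exp k)) ≠ ∞ := measure_closedBall_lt_top.ne
      rw [mul_comm, ← div_eq_mul_inv, ENNReal.lt_div_iff_mul_lt (Or.inl hpos) (Or.inl hfin)] at hk
      exact hk.le
    · exact ⟨0, fun h => absurd h hx⟩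
  choose k hk using hex
  set r : E → ℝ := fun x => c * Real.exp (k x) with hr
  have hr0 : ∀ x, 0 < r x := fun x => by positivity
  set m := μ (Metric.closedBall (0 : E) 1) with hm
  have hm0 : m ≠ 0 := (Metric.measure_closedBall_pos μ 0 one_pos).ne'
  have hmt : m ≠ ∞ := measure_closedBall_lt_top.ne
  -- Vitali's lemma needs bounded radii. A selected ball has volume at most `t⁻¹ ∫ φ`, which bounds
  -- `r ^ n`, and hence `r` when `r > 1`.
  set Q : ℝ := ((∫⁻ x, φ x ∂μ) / (ENNReal.ofReal t * m)).toReal with hQ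
  have hbd : ∀ x ∈ S, r x ≤ max 1 Q := by
    intro x hx
    rcases le_or_gt (r x) 1 with h1 | h1
    · exact le_max_of_le_left h1
    refine le_max_of_le_right ((le_self_pow₀ h1.le hn0).trans ?_)
    have h2 := (hk x hx).trans (setLIntegral_le_lintegral _ _)
    rw [Measure.addHaar_closedBall' μ x (hr0 x).le, mul_left_comm] at h2
    rw [hQ, ← ENNReal.ofReal_le_iff_le_toReal, ENNReal.le_div_iff_mul_le]
    · exact h2
    · left; exact mul_ne_zero (by simpa using ht) hm0
    · left; exact ENNReal.mul_ne_top ENNReal.ofReal_ne_top hmt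
    · exact ENNReal.div_ne_top hI (mul_ne_zero (by simpa using ht) hm0)
  obtain ⟨u, huS, hdis, hcov⟩ :=
    Vitali.exists_disjoint_subfamily_covering_enlargement_closedBall S id r (max 1 Q) hbd 4
      (by norm_num)
  have hcount : u.Countable := by
    refine hdis.countable_of_nonempty_interior fun x _ => ?_
    exact ⟨x, Metric.ball_subset_interior_closedBall (Metric.mem_ball_self (hr0 x))⟩
  calc μ S ≤ μ (⋃ b ∈ u, Metric.closedBall b (4 * r b)) := by
        refine measure_mono fun x hx => ?_
        obtain ⟨b, hb, hsub⟩ := hcov x hx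
        exact mem_biUnion hb (hsub (Metric.mem_closedBall_self (hr0 x).le))
    _ ≤ ∑' b : u, μ (Metric.closedBall (b : E) (4 * r b)) := measure_biUnion_le μ hcount _
    _ ≤ ∑' b : u, 4 ^ n * ENNReal.ofReal t⁻¹ *
          ∫⁻ y in Metric.closedBall (b : E) (r b), φ y ∂μ := by
        refine ENNReal.tsum_le_tsum fun b => ?_
        have h1 := hk b (huS b.2)
        rw [Measure.addHaar_closedBall_mul μ _ (by norm_num) (hr0 b).le]
        have h2 : ENNReal.ofReal (4 ^ n) = 4 ^ n := by
          rw [ENNReal.ofReal_pow (by norm_num)]; simp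
        rw [h2, mul_assoc]
        gcongr
        rw [← Measure.addHaar_closedBall_center μ (b : E), ENNReal.ofReal_inv_of_pos ht, mul_comm,
          ← div_eq_mul_inv, ENNReal.le_div_iff_mul_le (Or.inl (by simpa using ht))
            (Or.inl ENNReal.ofReal_ne_top), mul_comm]
        exact h1
    _ = 4 ^ n * ENNReal.ofReal t⁻¹ * ∫⁻ y in ⋃ b ∈ u, Metric.closedBall b (r b), φ y ∂μ := by
        rw [ENNReal.tsum_mul_left, lintegral_biUnion (t := u)
          (s := fun b => Metric.closedBall b (r b)) hcount
          (fun b _ => Metric.isClosed_closedBall.measurableSet) hdis]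
    _ ≤ _ := by gcongr; exact Measure.restrict_le_self

/-- The values of `φ` below `t / 2` contribute at most `t / 2` to any mean. The weak type bound is
therefore applied, at level `t / 2`, to the part of `φ` above `t / 2` only. -/
theorem hardy_weakControl [Nontrivial E] {c : ℝ} (hc : 0 < c) {φ : E → ℝ≥0∞}
    (hφ : Measurable φ) :
    WeakControl μ (2 * 4 ^ Module.finrank ℝ E) (hardy μ c φ) φ := by
  intro t ht
  have hset : MeasurableSet {x | ENNReal.ofReal (t / 2) < φ x} :=
    measurableSet_lt measurable_const hφ
  set ψ := {x | ENNReal.ofReal (t / 2) < φ x}.indicator φ with hψ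
  have h1 : ∀ x, φ x ≤ ENNReal.ofReal (t / 2) + ψ x := by
    intro x
    by_cases hx : ENNReal.ofReal (t / 2) < φ x
    · rw [hψ, indicator_of_mem (by exact hx)]; exact le_add_self
    · exact le_add_right (not_lt.1 hx)
  calc _ ≤ μ {x | ENNReal.ofReal (t / 2) < hardy μ c ψ x} := by
        refine measure_mono fun x hx => ?_
        simp only [mem_ofPred_eq] at hx ⊢
        by_contra hcon
        rw [not_lt] at hcon
        have h2 := hardy_le_add (μ := μ) (c := c) (φ₁ := fun _ => ENNReal.ofReal (t / 2))
          measurable_const h1 x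
        have h3 := h2.trans (add_le_add (hardy_le_of_le (fun _ => le_rfl) x) hcon)
        rw [← ENNReal.ofReal_add (by positivity) (by positivity), add_halves] at h3
        exact absurd hx (not_lt.2 h3)
    _ ≤ 4 ^ Module.finrank ℝ E * ENNReal.ofReal (t / 2)⁻¹ * ∫⁻ x, ψ x ∂μ :=
        hardy_measure_lt_le hc (by positivity)
    _ = _ := by
        rw [hψ, lintegral_indicator hset, inv_div, div_eq_mul_inv,
          ENNReal.ofReal_mul (by norm_num), ENNReal.ofReal_ofNat]
        ring

end Hardy

/-! ### Maximal functions in single coordinates and their compositions. -/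

section Coordinate

variable {d : ℕ}

/-- The maximal function in the `i`-th coordinate. -/
noncomputable def hardyCoord (c : ℝ) (i : Fin d) (φ : (Fin d → ℝ) → ℝ≥0∞) (x : Fin d → ℝ) : ℝ≥0∞ :=
  hardy volume c (fun t => φ (Function.update x i t)) (x i)

theorem measurable_update_prod (i : Fin d) :
    Measurable fun q : (Fin d → ℝ) × ℝ => Function.update q.1 i q.2 := by
  refine measurable_pi_lambda _ fun j => ?_
  rcases eq_or_ne j i with rfl | h
  · simpa using measurable_snd
  · simp only [Function.update_of_ne h]; fun_prop

theorem measurable_hardyCoord {c : ℝ} {i : Fin d} {φ : (Fin d → ℝ) → ℝ≥0∞} (hφ : Measurable φ) :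
    Measurable (hardyCoord c i φ) := by
  refine Measurable.iSup fun k => ?_
  simp_rw [Measure.addHaar_closedBall_center]
  refine Measurable.const_mul ?_ _
  have h1 : MeasurableSet {q : (Fin d → ℝ) × ℝ | dist q.2 (q.1 i) ≤ c * Real.exp k} :=
    measurableSet_le (by fun_prop) measurable_const
  have h2 := ((hφ.comp (measurable_update_prod i)).indicator h1).lintegral_prod_right'
    (ν := (volume : Measure ℝ))
  convert h2 using 2 with x
  rw [← lintegral_indicator Metric.isClosed_closedBall.measurableSet]
  rfl

/-- Both sides of the one-dimensional inequality are integrals in the `i`-th variable, so it may be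
integrated over the remaining variables. The constant is `2 * 4 ^ 1`. -/
theorem hardyCoord_weakControl {c : ℝ} (hc : 0 < c) (i : Fin d) {φ : (Fin d → ℝ) → ℝ≥0∞}
    (hφ : Measurable φ) : WeakControl volume 8 (hardyCoord c i φ) φ := by
  intro t ht
  have hs1 : MeasurableSet {x | ENNReal.ofReal t < hardyCoord c i φ x} :=
    measurableSet_lt measurable_const (measurable_hardyCoord hφ)
  have hs2 : MeasurableSet {x | ENNReal.ofReal (t / 2) < φ x} :=
    measurableSet_lt measurable_const hφ
  rw [← lintegral_indicator_one hs1, ← lintegral_indicator hs2,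
    ← lintegral_const_mul _ (hφ.indicator hs2)]
  refine lintegral_le_of_lmarginal_le {i} (measurable_one.indicator hs1)
    ((hφ.indicator hs2).const_mul _) fun x => ?_
  rw [lmarginal_singleton, lmarginal_singleton]
  have hφx : Measurable fun t => φ (Function.update x i t) :=
    hφ.comp (measurable_update x)
  have h := hardy_weakControl (μ := (volume : Measure ℝ)) hc hφx t ht
  rw [Module.finrank_self, ← lintegral_indicator_one
      (measurableSet_lt measurable_const (measurable_hardy hφx)), ← lintegral_indicator
      (measurableSet_lt measurable_const hφx), ← lintegral_const_mul _
      (hφx.indicator (measurableSet_lt measurable_const hφx))] at h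
  norm_num at h
  have e : ∀ s, hardyCoord c i φ (Function.update x i s) =
      hardy volume c (fun t => φ (Function.update x i t)) s := fun s => by simp [hardyCoord]
  refine le_of_eq_of_le (lintegral_congr fun s => ?_) (h.trans_eq (lintegral_congr fun s => ?_))
  · simp only [indicator, mem_ofPred_eq, e, Pi.one_apply]
  · rfl

/-- A null set of `ℝ^d` may meet a line in a large set, so the bound is not immediate on each line.
Weak control applied to the excess `φ - w`, which vanishes almost everywhere, shows that the maximal
function of the excess vanishes almost everywhere as well. -/
theorem hardyCoord_le_of_ae_le {c : ℝ} (hc : 0 < c) (i : Fin d) {φ : (Fin d → ℝ) → ℝ≥0∞}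
    (hφ : Measurable φ) {w : ℝ≥0∞} (h : ∀ᵐ x, φ x ≤ w) : ∀ᵐ x, hardyCoord c i φ x ≤ w := by
  set ψ : (Fin d → ℝ) → ℝ≥0∞ := fun x => φ x - w with hψ
  have hψm : Measurable ψ := hφ.sub_const w
  have h0 : ψ =ᵐ[volume] 0 := by
    filter_upwards [h] with x hx
    exact tsub_eq_zero_of_le hx
  have hz : ∀ᵐ x, ∀ n : ℕ, hardyCoord c i ψ x ≤ ENNReal.ofReal (1 / ((n : ℝ) + 1)) := by
    rw [ae_all_iff]
    intro n
    have := hardyCoord_weakControl hc i hψm (1 / ((n : ℝ) + 1)) (by positivity)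
    rw [lintegral_congr_ae (ae_restrict_of_ae h0)] at this
    simp only [Pi.zero_apply, lintegral_zero, mul_zero, nonpos_iff_eq_zero] at this
    rw [ae_iff]
    simpa using this
  filter_upwards [hz] with x hx
  have hx0 : hardyCoord c i ψ x = 0 := by
    refine le_antisymm (ge_of_tendsto' (x := Filter.atTop)
      (f := fun n : ℕ => ENNReal.ofReal (1 / ((n : ℝ) + 1))) ?_ hx)
      zero_le
    rw [← ENNReal.ofReal_zero]
    exact ENNReal.tendsto_ofReal tendsto_one_div_add_atTop_nhds_zero_nat
  have h1 := hardy_le_add (μ := (volume : Measure ℝ)) (c := c)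
    (φ := fun t => φ (Function.update x i t)) (φ₁ := fun _ => w)
    (φ₂ := fun t => ψ (Function.update x i t)) measurable_const
    (fun t => le_add_tsub) (x i)
  calc hardyCoord c i φ x ≤ w + hardyCoord c i ψ x :=
        h1.trans (add_le_add_left (hardy_le_of_le (fun _ => le_rfl) _) _)
    _ = w := by rw [hx0, add_zero]

/-- Composition of maximal functions in the coordinates of a list. -/
noncomputable def iterHardy (c : ℝ) : List (Fin d) → ((Fin d → ℝ) → ℝ≥0∞) → (Fin d → ℝ) → ℝ≥0∞
  | [], φ => φ
  | i :: l, φ => hardyCoord c i (iterHardy c l φ)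

theorem measurable_iterHardy {c : ℝ} {φ : (Fin d → ℝ) → ℝ≥0∞} (hφ : Measurable φ) :
    ∀ l : List (Fin d), Measurable (iterHardy c l φ)
  | [] => hφ
  | _ :: l => measurable_hardyCoord (measurable_iterHardy hφ l)

theorem iterHardy_le_of_ae_le {c : ℝ} (hc : 0 < c) {φ : (Fin d → ℝ) → ℝ≥0∞}
    (hφ : Measurable φ) {w : ℝ≥0∞} (h : ∀ᵐ x, φ x ≤ w) :
    ∀ l : List (Fin d), ∀ᵐ x, iterHardy c l φ x ≤ w
  | [] => h
  | i :: l => hardyCoord_le_of_ae_le hc i (measurable_iterHardy hφ l)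
      (iterHardy_le_of_ae_le hc hφ h l)

theorem exists_iterHardy_lintegral_rpow_le {s : ℝ} (hs : 1 < s) (l : List (Fin d)) :
    ∃ C : ℝ≥0, ∀ (c : ℝ) (φ : (Fin d → ℝ) → ℝ≥0∞), 0 < c → Measurable φ →
      ∫⁻ x, iterHardy c l φ x ^ s ≤ C * ∫⁻ x, φ x ^ s := by
  induction l with
  | nil => exact ⟨1, fun c φ _ _ => by simp [iterHardy]⟩
  | cons i l ih =>
    obtain ⟨C, hC⟩ := ih
    refine ⟨8 * (s * 2 ^ (s - 1) / (s - 1)).toNNReal * C, fun c φ hc hφ => ?_⟩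
    have h := (hardyCoord_weakControl hc i (measurable_iterHardy (c := c) hφ l)).lintegral_rpow_le
      (measurable_hardyCoord (measurable_iterHardy hφ l)) (measurable_iterHardy hφ l) hs
    refine h.trans ((mul_le_mul_right (hC c φ hc hφ) _).trans (le_of_eq ?_))
    push_cast
    rw [ENNReal.ofReal]
    ring

/-- Composing maximal functions loses one logarithm per coordinate. -/
theorem exists_iterHardy_tail_le {q : ℝ} (hq : 1 < q) (A B : ℝ≥0) (l : List (Fin d)) :
    ∃ C : ℝ≥0, ∀ (c : ℝ) (φ : (Fin d → ℝ) → ℝ≥0∞), 0 < c → Measurable φ →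
      ∫⁻ x, φ x ≤ A → ∫⁻ x, φ x ^ q ≤ B → ∀ v : ℝ, 0 < v →
      ∫⁻ x in {x | ENNReal.ofReal v < iterHardy c l φ x}, iterHardy c l φ x ≤
        C * ENNReal.ofReal ((1 + |Real.log v|) ^ l.length) := by
  induction l with
  | nil =>
    refine ⟨A, fun c φ _ _ hA _ v _ => ?_⟩
    simpa [iterHardy] using (setLIntegral_le_lintegral _ _).trans hA
  | cons i l ih =>
    obtain ⟨C, hC⟩ := ih
    obtain ⟨C', hC'⟩ := exists_iterHardy_lintegral_rpow_le hq (i :: l)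
    refine ⟨2 * (8 * C * 2 ^ l.length) + C' * B * (1 / (q - 1)).toNNReal,
      fun c φ hc hφ hA hB v hv => ?_⟩
    have h := (hardyCoord_weakControl hc i (measurable_iterHardy (c := c) hφ l)).tail_le
      (measurable_hardyCoord (measurable_iterHardy hφ l)) (hC c φ hc hφ hA hB) hq
      ((hC' c φ hc hφ).trans (mul_le_mul_right hB _)) hv
    refine h.trans (le_of_eq ?_)
    push_cast
    rfl

/-- The outermost maximal function enters through its weak type bound only and costs no logarithm.
The exponent is therefore the number of inner coordinates, which is where `d - 1` comes from. -/
theorem exists_iterHardy_measure_le {q : ℝ} (hq : 1 < q) (A B : ℝ≥0) (i : Fin d)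
    (l : List (Fin d)) :
    ∃ C : ℝ≥0, ∀ (c : ℝ) (φ : (Fin d → ℝ) → ℝ≥0∞), 0 < c → Measurable φ →
      ∫⁻ x, φ x ≤ A → ∫⁻ x, φ x ^ q ≤ B → ∀ v : ℝ, 0 < v →
      volume {x | ENNReal.ofReal v < iterHardy c (i :: l) φ x} ≤
        C * ENNReal.ofReal (v⁻¹ * (1 + |Real.log v|) ^ l.length) := by
  obtain ⟨C, hC⟩ := exists_iterHardy_tail_le hq A B l
  refine ⟨8 * C * 2 ^ l.length, fun c φ hc hφ hA hB v hv => ?_⟩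
  have h := (hardyCoord_weakControl hc i (measurable_iterHardy (c := c) hφ l)).measure_lt_le
    (hC c φ hc hφ hA hB) hv
  refine h.trans (le_of_eq ?_)
  push_cast
  rfl

end Coordinate

end ConvDensity

/-! ### Bernstein-type moment bounds for empirical means. -/

namespace ConvDensity

section Concentration

theorem exp_le_one_add_add_sq {u : ℝ} (hu : |u| ≤ 1) : Real.exp u ≤ 1 + u + u ^ 2 := by
  have := (abs_le.1 (Real.abs_exp_sub_one_sub_id_le hu)).2
  linarith

theorem exp_sub_one_le_mul_exp (v : ℝ) : Real.exp v - 1 ≤ v * Real.exp v := by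
  have h := Real.add_one_le_exp (-v)
  have h2 : Real.exp (-v) * Real.exp v = 1 := by rw [← Real.exp_add]; simp
  nlinarith [Real.exp_pos v]

theorem rpow_le_mul_exp {t p c : ℝ} (ht : 0 ≤ t) (hp : 0 < p) (hc : 0 < c) :
    t ^ p ≤ (c * p) ^ p * Real.exp (t / c) := by
  have h : t / (c * p) ≤ Real.exp (t / (c * p)) := by
    linarith [Real.add_one_le_exp (t / (c * p))]
  calc t ^ p = (c * p) ^ p * (t / (c * p)) ^ p := by
        rw [← Real.mul_rpow (by positivity) (by positivity)]; congr 1; field_simp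
    _ ≤ (c * p) ^ p * Real.exp (t / (c * p)) ^ p := by gcongr
    _ = _ := by rw [← Real.exp_mul]; congr 2; field_simp

/-- The deviation bound in Bernstein's inequality, with a doubled linear term. -/
noncomputable def bernsteinBound (l b v : ℝ) (n : ℕ) : ℝ :=
  Real.sqrt (2 * l * v / n) + 4 * b * l / (3 * n)

/-- Factoring out `b / n` leaves a function of the dimensionless variance `n v / b²`, in which all
exponents below are compared. -/
theorem bernsteinBound_eq {l b v : ℝ} {n : ℕ} (hn : 0 < n) (hb : 0 < b) :
    bernsteinBound l b v n = b / n * (Real.sqrt (2 * l * (n * v / b ^ 2)) + 4 * l / 3) := by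
  have hn' : (0 : ℝ) < n := by exact_mod_cast hn
  have : Real.sqrt (2 * l * (n * v / b ^ 2)) = n / b * Real.sqrt (2 * l * v / n) := by
    rw [show 2 * l * (n * v / b ^ 2) = (n / b) ^ 2 * (2 * l * v / n) by field_simp,
      Real.sqrt_mul (by positivity), Real.sqrt_sq (by positivity)]
  rw [this, bernsteinBound]
  field_simp

variable {Ω : Type*} [MeasurableSpace Ω] {P : Measure Ω} [IsProbabilityMeasure P]
  {φ : Ω → ℝ} {b : ℝ}

theorem integral_exp_sum_le {n : ℕ} {ψ : Ω → ℝ} {a : ℝ}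
    (ha : ∫ x, Real.exp (ψ x) ∂P ≤ Real.exp a) :
    ∫ z : Fin n → Ω, Real.exp (∑ i, ψ (z i)) ∂(Measure.pi fun _ => P) ≤ Real.exp (n * a) := by
  have := integral_fintype_prod_eq_pow (μ := P) (ι := Fin n) (fun x => Real.exp (ψ x))
  simp_rw [Real.exp_sum]
  rw [this, Fintype.card_fin, Real.exp_nat_mul]
  exact pow_le_pow_left₀ (integral_nonneg fun x => (Real.exp_pos _).le) ha n

theorem integrable_exp_sum {n : ℕ} {ψ : Ω → ℝ} (h : Integrable (fun x => Real.exp (ψ x)) P) :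
    Integrable (fun z : Fin n → Ω => Real.exp (∑ i, ψ (z i))) (Measure.pi fun _ => P) := by
  simp_rw [Real.exp_sum]
  exact Integrable.fintype_prod (f := fun _ x => Real.exp (ψ x)) fun _ => h

theorem integrable_exp_of_bound {ψ : Ω → ℝ} (hψ : Measurable ψ) {c : ℝ} (h : ∀ᵐ x ∂P, |ψ x| ≤ c) :
    Integrable (fun x => Real.exp (ψ x)) P := by
  refine Integrable.of_bound (C := Real.exp c) (by fun_prop) ?_
  filter_upwards [h] with x hx
  rw [Real.norm_of_nonneg (Real.exp_pos _).le]
  exact Real.exp_le_exp.2 ((le_abs_self _).trans hx)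

/-- The exponential is replaced by its quadratic majorant on `[-1, 1]`; the linear term has mean
zero and the quadratic term is a variance, hence at most the second moment. -/
theorem integral_exp_centered_le (hφ : Measurable φ) (hb : ∀ᵐ x ∂P, |φ x| ≤ b) {s : ℝ}
    (hs : |s| * (2 * b) ≤ 1) :
    ∫ x, Real.exp (s * (φ x - ∫ y, φ y ∂P)) ∂P ≤ Real.exp (s ^ 2 * ∫ x, φ x ^ 2 ∂P) := by
  set m := ∫ y, φ y ∂P with hm
  have hmb : |m| ≤ b := by
    have := norm_integral_le_of_norm_le_const (μ := P) (f := φ) (C := b) hb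
    simpa using this
  have hi : Integrable φ P := Integrable.of_bound hφ.aestronglyMeasurable b hb
  have hi2 : Integrable (fun x => φ x ^ 2) P := by
    refine Integrable.of_bound (by fun_prop) (b ^ 2) ?_
    filter_upwards [hb] with x hx
    rw [Real.norm_of_nonneg (by positivity), ← sq_abs]
    gcongr
  have hbd : ∀ᵐ x ∂P, |s * (φ x - m)| ≤ 1 := by
    filter_upwards [hb] with x hx
    rw [abs_mul]
    refine le_trans (mul_le_mul_of_nonneg_left ?_ (abs_nonneg s)) hs
    exact (abs_sub _ _).trans (by linarith)
  calc _ ≤ ∫ x, (1 + s * (φ x - m) + s ^ 2 * (φ x ^ 2 - 2 * m * φ x + m ^ 2)) ∂P := by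
        refine integral_mono_ae (integrable_exp_of_bound (by fun_prop) hbd) (by fun_prop) ?_
        filter_upwards [hbd] with x hx
        refine (exp_le_one_add_add_sq hx).trans (le_of_eq (by ring))
    _ = 1 + s ^ 2 * (∫ x, φ x ^ 2 ∂P - m ^ 2) := by
        rw [integral_add (by fun_prop) (by fun_prop), integral_add (by fun_prop) (by fun_prop),
          integral_const_mul, integral_const_mul, integral_sub hi (by fun_prop),
          integral_add (by fun_prop) (by fun_prop), integral_sub hi2 (by fun_prop),
          integral_const_mul]
        simp only [integral_const, probReal_univ, one_smul, ← hm]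
        ring
    _ ≤ 1 + s ^ 2 * ∫ x, φ x ^ 2 ∂P := by nlinarith [mul_nonneg (sq_nonneg s) (sq_nonneg m)]
    _ ≤ _ := by linarith [Real.add_one_le_exp (s ^ 2 * ∫ x, φ x ^ 2 ∂P)]

/-- The majorant is `exp + exp⁻¹ - 2` rather than a plain exponential: its expectation is then small
when the variance is small. That smallness is what makes the final bound integrable over `x ∈ ℝ^d`.
-/
theorem posPart_rpow_le_exp {y u s p : ℝ} (hs : 0 < s) (hp : 0 < p) (hu : 1 ≤ s * u) :
    max (|y| - u) 0 ^ p ≤ 8 * p ^ p * s ^ (-p) * Real.exp (-(s * u)) *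
      (Real.exp (s * y) + Real.exp (-s * y) - 2) := by
  have hcosh : ∀ a : ℝ, 0 ≤ Real.exp a + Real.exp (-a) - 2 := fun a => by
    linarith [Real.add_one_le_exp a, Real.add_one_le_exp (-a)]
  rcases le_or_gt |y| u with h | h
  · rw [max_eq_right (by linarith), Real.zero_rpow hp.ne', neg_mul]
    have := hcosh (s * y)
    positivity
  have hyu : 0 < |y| - u := by linarith
  rw [max_eq_left hyu.le]
  have hsym : Real.exp (s * y) + Real.exp (-s * y) = Real.exp (s * |y|) + Real.exp (-(s * |y|)) := by
    rcases abs_cases y with ⟨h, _⟩ | ⟨h, _⟩ <;> rw [h] <;> ring_nf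
  have ha : 1 ≤ s * |y| := hu.trans (by gcongr)
  have h1 : Real.exp (s * |y|) / 8 ≤ Real.exp (s * y) + Real.exp (-s * y) - 2 := by
    rw [hsym]
    have := Real.quadratic_le_exp_of_nonneg (show 0 ≤ s * |y| by positivity)
    have := Real.add_one_le_exp (-(s * |y|))
    nlinarith
  have h2 := rpow_le_mul_exp (t := s * (|y| - u)) (p := p) (c := 1) (by positivity) hp one_pos
  rw [Real.mul_rpow hs.le hyu.le, one_mul, div_one] at h2
  calc (|y| - u) ^ p = s ^ (-p) * (s ^ p * (|y| - u) ^ p) := by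
        rw [← mul_assoc, ← Real.rpow_add hs]; simp
    _ ≤ s ^ (-p) * (p ^ p * Real.exp (s * (|y| - u))) := by gcongr
    _ = 8 * p ^ p * s ^ (-p) * Real.exp (-(s * u)) * (Real.exp (s * |y|) / 8) := by
        rw [mul_sub, sub_eq_add_neg, Real.exp_add]; ring
    _ ≤ _ := by gcongr

theorem ofReal_rpow_eq_max (x : ℝ) {p : ℝ} (hp : 0 < p) :
    ENNReal.ofReal x ^ p = ENNReal.ofReal (max x 0 ^ p) := by
  rw [← ENNReal.ofReal_rpow_of_nonneg (le_max_right _ _) hp.le]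
  congr 1
  rcases le_total x 0 with h | h
  · rw [max_eq_right h, ENNReal.ofReal_of_nonpos h, ENNReal.ofReal_zero]
  · rw [max_eq_left h]

theorem lintegral_ofReal_le_of_le {X : Type*} [MeasurableSpace X] {ν : Measure X} {f g : X → ℝ}
    {a : ℝ} (hg : Integrable g ν) (h0 : ∀ x, 0 ≤ g x) (hfg : ∀ x, f x ≤ g x) (ha : ∫ x, g x ∂ν ≤ a) :
    ∫⁻ x, ENNReal.ofReal (f x) ∂ν ≤ ENNReal.ofReal a := by
  refine (lintegral_mono fun x => ENNReal.ofReal_le_ofReal (hfg x)).trans ?_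
  rw [← ofReal_integral_eq_lintegral_ofReal hg (Filter.Eventually.of_forall h0)]
  exact ENNReal.ofReal_le_ofReal ha

/-- Chernoff's method with the majorant above: each of the two exponential moments is at most `exp
v`, and `exp v - 1 ≤ v exp v` brings out the variance as a factor. -/
theorem lintegral_sum_deviation_le (hφ : Measurable φ) (hb : ∀ᵐ x ∂P, |φ x| ≤ b)
    {n : ℕ} {p s u : ℝ} (hp : 0 < p) (hs : 0 < s) (hsb : s * (2 * b) ≤ 1) (hu : 1 ≤ s * u) :
    ∫⁻ z : Fin n → Ω, ENNReal.ofReal (max (|∑ i, (φ (z i) - ∫ y, φ y ∂P)| - u) 0 ^ p)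
      ∂(Measure.pi fun _ => P) ≤
      ENNReal.ofReal (16 * p ^ p * s ^ (-p) * (n * (s ^ 2 * ∫ x, φ x ^ 2 ∂P)) *
        Real.exp (n * (s ^ 2 * ∫ x, φ x ^ 2 ∂P) - s * u)) := by
  set m := ∫ y, φ y ∂P with hm
  set v := n * (s ^ 2 * ∫ x, φ x ^ 2 ∂P) with hv
  set Q : Measure (Fin n → Ω) := Measure.pi fun _ => P
  have hint : ∀ r : ℝ, Integrable (fun z : Fin n → Ω => Real.exp (∑ i, r * (φ (z i) - m))) Q := by
    intro r
    refine integrable_exp_sum (integrable_exp_of_bound (ψ := fun x => r * (φ x - m))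
      (c := |r| * (b + |m|)) (by fun_prop) ?_)
    filter_upwards [hb] with x hx
    rw [abs_mul]
    gcongr
    exact (abs_sub _ _).trans (by linarith)
  have hle : ∀ r : ℝ, |r| = s →
      ∫ z : Fin n → Ω, Real.exp (∑ i, r * (φ (z i) - m)) ∂Q ≤ Real.exp v := by
    intro r hr
    have h1 := integral_exp_centered_le (s := r) hφ hb (by rw [hr]; exact hsb)
    rw [← sq_abs r, hr] at h1
    exact integral_exp_sum_le h1
  set c := 8 * p ^ p * s ^ (-p) * Real.exp (-(s * u)) with hc
  have hc0 : 0 ≤ c := by positivity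
  refine lintegral_ofReal_le_of_le (g := fun z => c * (Real.exp (∑ i, s * (φ (z i) - m)) +
    Real.exp (∑ i, -s * (φ (z i) - m)) - 2)) ?_ ?_ ?_ ?_
  · exact (((hint s).add (hint (-s))).sub (integrable_const _)).const_mul c
  · intro z
    have : ∑ i, -s * (φ (z i) - m) = -∑ i, s * (φ (z i) - m) := by
      rw [← Finset.sum_neg_distrib]; exact Finset.sum_congr rfl fun i _ => by ring
    rw [this]
    refine mul_nonneg hc0 ?_
    linarith [Real.add_one_le_exp (∑ i, s * (φ (z i) - m)),
      Real.add_one_le_exp (-∑ i, s * (φ (z i) - m))]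
  · intro z
    rw [← Finset.mul_sum, ← Finset.mul_sum]
    exact posPart_rpow_le_exp hs hp hu
  · have hadd : Integrable (fun z : Fin n → Ω => Real.exp (∑ i, s * (φ (z i) - m)) +
        Real.exp (∑ i, -s * (φ (z i) - m))) Q := (hint s).add (hint (-s))
    rw [integral_const_mul, integral_sub hadd (integrable_const _),
      integral_add (hint s) (hint (-s))]
    simp only [integral_const, probReal_univ, one_smul]
    have h1 := hle s (abs_of_pos hs)
    have h2 := hle (-s) (by rw [abs_neg, abs_of_pos hs])
    have h3 := exp_sub_one_le_mul_exp v
    calc _ ≤ c * (2 * (v * Real.exp v)) := by gcongr; linarith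
      _ = _ := by rw [hc, sub_eq_add_neg, Real.exp_add]; ring

/-- Moments of the excess of an empirical mean over Bernstein's bound. -/
theorem lintegral_mean_deviation_le (hφ : Measurable φ) (hb0 : 0 < b) (hb : ∀ᵐ x ∂P, |φ x| ≤ b)
    {n : ℕ} (hn : 0 < n) {p l : ℝ} (hp : 0 < p) (hl : 6 ≤ l) :
    ∫⁻ z : Fin n → Ω, ENNReal.ofReal (|(n : ℝ)⁻¹ * ∑ i, φ (z i) - ∫ y, φ y ∂P| -
      bernsteinBound l b (∫ x, φ x ^ 2 ∂P) n) ^ p ∂(Measure.pi fun _ => P) ≤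
      ENNReal.ofReal (16 * (2 * p) ^ p * ((b / Real.sqrt n) ^ p *
        (n * (∫ x, φ x ^ 2 ∂P) / b ^ 2) * Real.exp (-(l / 4)))) := by
  have hn' : (0 : ℝ) < n := by exact_mod_cast hn
  have hn1 : (1 : ℝ) ≤ n := by exact_mod_cast hn
  set v := ∫ x, φ x ^ 2 ∂P with hv
  have hv0 : 0 ≤ v := integral_nonneg fun x => sq_nonneg _
  have hvb : v ≤ b ^ 2 := by
    have := norm_integral_le_of_norm_le_const (μ := P) (f := fun x => φ x ^ 2) (C := b ^ 2) (by
      filter_upwards [hb] with x hx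
      rw [Real.norm_of_nonneg (by positivity), ← sq_abs]; gcongr)
    rw [probReal_univ, mul_one] at this
    exact (le_abs_self _).trans this
  set m := ∫ y, φ y ∂P
  set w := n * v / b ^ 2 with hw
  have hw0 : 0 ≤ w := by positivity
  have hwn : w ≤ n := by
    rw [hw, div_le_iff₀ (by positivity)]; gcongr
  -- The Chernoff parameter is `r / b`. For `w ≤ l` the linear term of the bound dominates and `r =
  -- 1/2` works; for `w > l` the Gaussian choice `r = √(l/w) / 2` works, with `w r² = l / 4`. The
  -- lower bound on `r` uses `w ≤ n` and controls `r ^ (-p)`.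
  obtain ⟨r, hr0, hr1, hrn, hexp, hone⟩ : ∃ r : ℝ, 0 < r ∧ r ≤ 1 / 2 ∧ 1 / (2 * Real.sqrt n) ≤ r ∧
      w * r ^ 2 - r * (Real.sqrt (2 * l * w) + 4 * l / 3) ≤ -(l / 4) ∧
      1 ≤ r * (Real.sqrt (2 * l * w) + 4 * l / 3) := by
    have hs0 := Real.sqrt_nonneg (2 * l * w)
    rcases le_or_gt w l with h | h
    · refine ⟨1 / 2, by norm_num, le_rfl, ?_, by linarith, by linarith⟩
      rw [one_div, one_div, inv_le_inv₀ (by positivity) (by norm_num)]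
      have := Real.one_le_sqrt.2 hn1
      linarith
    · have hwpos : 0 < w := by linarith
      have hsq : Real.sqrt (l / w) ^ 2 = l / w := Real.sq_sqrt (by positivity)
      have hprod : Real.sqrt (l / w) * Real.sqrt (2 * l * w) = l * Real.sqrt 2 := by
        rw [← Real.sqrt_mul (by positivity),
          show l / w * (2 * l * w) = l ^ 2 * 2 by field_simp,
          Real.sqrt_mul (by positivity), Real.sqrt_sq (by linarith)]
      have h2 : 1 ≤ Real.sqrt 2 := Real.one_le_sqrt.2 (by norm_num)
      have hle1 : Real.sqrt (l / w) ≤ 1 := Real.sqrt_le_one.2 ((div_le_one hwpos).2 h.le)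
      have hpos : 0 < Real.sqrt (l / w) := Real.sqrt_pos.2 (by positivity)
      have hwsq : w * Real.sqrt (l / w) ^ 2 = l := by rw [hsq]; field_simp
      refine ⟨Real.sqrt (l / w) / 2, by positivity, by linarith, ?_, ?_, ?_⟩
      · rw [one_div_le (by positivity) (by positivity), one_div_div, mul_comm]
        rw [div_le_iff₀ hpos, show Real.sqrt n * 2 * Real.sqrt (l / w) =
          2 * (Real.sqrt n * Real.sqrt (l / w)) by ring, ← Real.sqrt_mul (by positivity)]
        have : 1 ≤ Real.sqrt (n * (l / w)) := by
          refine Real.one_le_sqrt.2 ?_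
          rw [← mul_div_assoc, le_div_iff₀ hwpos]
          nlinarith
        linarith
      · nlinarith
      · nlinarith
  have hU := bernsteinBound_eq (l := l) (v := v) hn hb0
  rw [← hw] at hU
  set κ := Real.sqrt (2 * l * w) + 4 * l / 3
  have hκ : 0 < κ := by positivity
  have hmain := lintegral_sum_deviation_le (P := P) (n := n) (s := r / b) (u := b * κ) hφ hb hp
    (by positivity) (by field_simp; linarith) (by field_simp; exact hone)
  have hpt : ∀ z : Fin n → Ω, ENNReal.ofReal (|(n : ℝ)⁻¹ * ∑ i, φ (z i) - m| -
      bernsteinBound l b v n) ^ p = ENNReal.ofReal ((n : ℝ)⁻¹ ^ p) *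
        ENNReal.ofReal (max (|∑ i, (φ (z i) - m)| - b * κ) 0 ^ p) := by
    intro z
    rw [ofReal_rpow_eq_max _ hp, ← ENNReal.ofReal_mul (by positivity),
      ← Real.mul_rpow (by positivity) (by positivity), mul_max_of_nonneg _ _ (by positivity),
      mul_zero, hU]
    congr 4
    have : (n : ℝ)⁻¹ * ∑ i, φ (z i) - m = (n : ℝ)⁻¹ * ∑ i, (φ (z i) - m) := by
      rw [Finset.sum_sub_distrib]; simp; field_simp
    rw [this, abs_mul, abs_of_pos (show 0 < (n : ℝ)⁻¹ by positivity), mul_sub]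
    congr 1
    field_simp
  simp_rw [hpt]
  rw [lintegral_const_mul' _ _ ENNReal.ofReal_ne_top]
  refine (mul_le_mul_right hmain _).trans ?_
  rw [← ENNReal.ofReal_mul (by positivity)]
  apply ENNReal.ofReal_le_ofReal
  have e1 : n * ((r / b) ^ 2 * v) = w * r ^ 2 := by rw [hw]; field_simp
  have e2 : r / b * (b * κ) = r * κ := by field_simp
  rw [e1, e2]
  -- With `r` at least `1 / (2 √n)`, the scale `b / (n r)` is at most `2 b / √n`.
  have e3 : (n : ℝ)⁻¹ ^ p * (r / b) ^ (-p) ≤ 2 ^ p * (b / Real.sqrt n) ^ p := by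
    rw [Real.rpow_neg (by positivity), ← Real.inv_rpow (by positivity),
      ← Real.mul_rpow (by positivity) (by positivity),
      ← Real.mul_rpow (by positivity) (by positivity)]
    refine Real.rpow_le_rpow (by positivity) ?_ hp.le
    have hsn : Real.sqrt n * Real.sqrt n = n := Real.mul_self_sqrt hn'.le
    have hsn0 : 0 < Real.sqrt n := Real.sqrt_pos.2 hn'
    rw [div_le_iff₀ (by positivity)] at hrn
    have hninv : (n : ℝ)⁻¹ = (Real.sqrt n)⁻¹ * (Real.sqrt n)⁻¹ := by rw [← mul_inv, hsn]
    rw [inv_div, hninv, show (Real.sqrt n)⁻¹ * (Real.sqrt n)⁻¹ * (b / r) =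
      (1 / (Real.sqrt n * r)) * (b / Real.sqrt n) by field_simp]
    gcongr
    rw [div_le_iff₀ (by positivity)]
    linarith
  have e4 : w * r ^ 2 ≤ w := mul_le_of_le_one_right hw0 (by nlinarith)
  calc (n : ℝ)⁻¹ ^ p * (16 * p ^ p * (r / b) ^ (-p) * (w * r ^ 2) * Real.exp (w * r ^ 2 - r * κ))
      = 16 * p ^ p * ((n : ℝ)⁻¹ ^ p * (r / b) ^ (-p)) * (w * r ^ 2) *
          Real.exp (w * r ^ 2 - r * κ) := by ring
    _ ≤ 16 * p ^ p * (2 ^ p * (b / Real.sqrt n) ^ p) * w * Real.exp (-(l / 4)) := by gcongr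
    _ = _ := by rw [Real.mul_rpow (by norm_num) hp.le]; ring

end Concentration

end ConvDensity

/-! ### Comparison of the empirical and the theoretical Bernstein bounds. -/

namespace ConvDensity

section EmpiricalVariance

theorem exp_sub_one_ge_half {t : ℝ} (ht : 1 ≤ t) : Real.exp t ≤ 2 * (Real.exp t - 1) := by
  have := Real.add_one_le_exp t
  linarith

/-- If one bound exceeds four times the other, then the first variance exceeds sixteen times the
second plus `8 l`, a rare event, and the gap itself is no larger than the first variance. Squaring
the inequality between the square roots gives both. -/
theorem sqrt_gap_le {x y l : ℝ} (hx : 0 ≤ x) (hy : 0 ≤ y) (hl : 0 < l) :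
    (16 * y + 8 * l < x ∧ Real.sqrt (2 * l * x) + 4 * l / 3 -
      4 * (Real.sqrt (2 * l * y) + 4 * l / 3) ≤ x) ∨
    Real.sqrt (2 * l * x) + 4 * l / 3 - 4 * (Real.sqrt (2 * l * y) + 4 * l / 3) ≤ 0 := by
  set A := Real.sqrt (2 * l * x)
  set B := Real.sqrt (2 * l * y)
  have hA : A ^ 2 = 2 * l * x := Real.sq_sqrt (by positivity)
  have hB : B ^ 2 = 2 * l * y := Real.sq_sqrt (by positivity)
  have hA0 : 0 ≤ A := Real.sqrt_nonneg _
  have hB0 : 0 ≤ B := Real.sqrt_nonneg _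
  rcases le_or_gt A (4 * B + 4 * l) with h | h
  · right; linarith
  · left
    have h1 : 16 * y + 8 * l < x := by
      have : (4 * B + 4 * l) ^ 2 < A ^ 2 := by gcongr
      rw [hA] at this
      have h3 : 2 * l * (16 * y + 8 * l) ≤ (4 * B + 4 * l) ^ 2 := by nlinarith [mul_nonneg hB0 hl.le]
      exact lt_of_mul_lt_mul_left (h3.trans_lt this) (by positivity)
    refine ⟨h1, ?_⟩
    have : A ≤ x := by
      refine abs_le_of_sq_le_sq' ?_ hx |>.2
      rw [hA]; nlinarith
    linarith

theorem bernsteinBound_empirical_eq {Ω : Type*} {φ : Ω → ℝ} {b l : ℝ} {n : ℕ} (hn : 0 < n) (hb : 0 < b) (z : Fin n → Ω) :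
    bernsteinBound l b ((n : ℝ)⁻¹ * ∑ i, φ (z i) ^ 2) n =
      b / n * (Real.sqrt (2 * l * ∑ i, φ (z i) ^ 2 / b ^ 2) + 4 * l / 3) := by
  have hn' : (n : ℝ) ≠ 0 := by exact_mod_cast hn.ne'
  rw [bernsteinBound_eq hn hb, ← Finset.sum_div]
  congr 5
  field_simp

theorem ae_sq_div_sq_mem {Ω : Type*} [MeasurableSpace Ω] {P : Measure Ω} {φ : Ω → ℝ} {b : ℝ}
    (hb0 : 0 < b) (hb : ∀ᵐ x ∂P, |φ x| ≤ b) :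
    ∀ᵐ x ∂P, 0 ≤ φ x ^ 2 / b ^ 2 ∧ φ x ^ 2 / b ^ 2 ≤ 1 := by
  filter_upwards [hb] with x hx
  refine ⟨by positivity, ?_⟩
  rw [div_le_one (by positivity), ← sq_abs]
  gcongr

variable {Ω : Type*} [MeasurableSpace Ω] {P : Measure Ω} [IsProbabilityMeasure P]
  {φ : Ω → ℝ} {b : ℝ}

theorem integrable_sq_div (hφ : Measurable φ) (hb0 : 0 < b) (hb : ∀ᵐ x ∂P, |φ x| ≤ b) :
    Integrable (fun x => φ x ^ 2 / b ^ 2) P := by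
  refine Integrable.of_bound (by fun_prop) 1 ?_
  filter_upwards [ae_sq_div_sq_mem hb0 hb] with x hx
  rw [Real.norm_of_nonneg hx.1]
  exact hx.2

theorem integral_exp_sq_le (hφ : Measurable φ) (hb0 : 0 < b) (hb : ∀ᵐ x ∂P, |φ x| ≤ b) :
    ∫ x, Real.exp (φ x ^ 2 / b ^ 2) ∂P ≤ Real.exp (2 * ((∫ x, φ x ^ 2 ∂P) / b ^ 2)) := by
  have hi := integrable_sq_div hφ hb0 hb
  calc _ ≤ ∫ x, (1 + 2 * (φ x ^ 2 / b ^ 2)) ∂P := by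
        refine integral_mono_ae (integrable_exp_of_bound (c := 1) (by fun_prop) ?_) (by fun_prop) ?_
        · filter_upwards [ae_sq_div_sq_mem hb0 hb] with x hx
          rw [abs_of_nonneg hx.1]; exact hx.2
        · filter_upwards [ae_sq_div_sq_mem hb0 hb] with x hx
          have := exp_le_one_add_add_sq (u := φ x ^ 2 / b ^ 2) (by rw [abs_of_nonneg hx.1]; exact hx.2)
          nlinarith [hx.1, hx.2]
    _ = 1 + 2 * ((∫ x, φ x ^ 2 ∂P) / b ^ 2) := by
        rw [integral_add (by fun_prop) (by fun_prop), integral_const_mul, integral_div]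
        simp
    _ ≤ _ := by linarith [Real.add_one_le_exp (2 * ((∫ x, φ x ^ 2 ∂P) / b ^ 2))]

/-- For `t ∈ [0, 1]` one has `exp (-t / 2) ≤ 1 - t / 4`, the quadratic term being absorbed. This
controls the lower tail of the empirical variance; the preceding bound with positive exponent
controls the upper tail. -/
theorem integral_exp_neg_sq_le (hφ : Measurable φ) (hb0 : 0 < b) (hb : ∀ᵐ x ∂P, |φ x| ≤ b) :
    ∫ x, Real.exp (-(φ x ^ 2 / b ^ 2) / 2) ∂P ≤ Real.exp (-((∫ x, φ x ^ 2 ∂P) / b ^ 2) / 4) := by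
  have hi := integrable_sq_div hφ hb0 hb
  have hbd : ∀ᵐ x ∂P, |-(φ x ^ 2 / b ^ 2) / 2| ≤ 1 := by
    filter_upwards [ae_sq_div_sq_mem hb0 hb] with x hx
    rw [abs_div, abs_neg, abs_of_nonneg hx.1, abs_of_pos (by norm_num : (0 : ℝ) < 2)]
    linarith [hx.2]
  calc _ ≤ ∫ x, (1 - (φ x ^ 2 / b ^ 2) / 4) ∂P := by
        refine integral_mono_ae (integrable_exp_of_bound (c := 1) (by fun_prop) hbd)
          (by fun_prop) ?_
        filter_upwards [ae_sq_div_sq_mem hb0 hb, hbd] with x hx hx1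
        have := exp_le_one_add_add_sq hx1
        nlinarith [hx.1, hx.2]
    _ = 1 - ((∫ x, φ x ^ 2 ∂P) / b ^ 2) / 4 := by
        rw [integral_sub (by fun_prop) (by fun_prop), integral_div, integral_div]
        simp
    _ ≤ _ := by linarith [Real.add_one_le_exp (-((∫ x, φ x ^ 2 ∂P) / b ^ 2) / 4)]

theorem max_mul_rpow_le {a y t p : ℝ} (ha : 0 ≤ a) (hyt : max y 0 ^ p ≤ t) :
    max (a * y) 0 ^ p ≤ a ^ p * t := by
  have : max (a * y) 0 = a * max y 0 := by rw [mul_max_of_nonneg _ _ ha, mul_zero]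
  rw [this, Real.mul_rpow ha (le_max_right _ _)]
  gcongr

/-- A positive gap forces `w > 16 N + 8 l`, so that `exp ((w - 8 l) / 32 - N / 2)` and `w` are both
at least one. They may be inserted as factors: the first brings in the Laplace transform of `N`, the
second keeps the variance in the bound. -/
theorem gap_rpow_le_exp_neg {a w N l p : ℝ} (ha : 0 ≤ a) (hw : 0 ≤ w) (hN : 0 ≤ N) (hl : 6 ≤ l)
    (hp : 0 < p) :
    max (a * (Real.sqrt (2 * l * w) + 4 * l / 3) - 4 * (a * (Real.sqrt (2 * l * N) + 4 * l / 3))) 0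
      ^ p ≤ a ^ p * ((8 * p) ^ p * w * Real.exp (w / 8) * Real.exp ((w - 8 * l) / 32)) *
        Real.exp (-N / 2) := by
  have e : a * (Real.sqrt (2 * l * w) + 4 * l / 3) - 4 * (a * (Real.sqrt (2 * l * N) + 4 * l / 3)) =
      a * (Real.sqrt (2 * l * w) + 4 * l / 3 - 4 * (Real.sqrt (2 * l * N) + 4 * l / 3)) := by ring
  rw [e, mul_assoc (a ^ p)]
  refine max_mul_rpow_le ha ?_
  rcases sqrt_gap_le (l := l) hw hN (by linarith) with ⟨h1, h2⟩ | h
  · have h3 : max (Real.sqrt (2 * l * w) + 4 * l / 3 -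
        4 * (Real.sqrt (2 * l * N) + 4 * l / 3)) 0 ≤ w := max_le h2 hw
    have h4 : 1 ≤ Real.exp ((w - 8 * l) / 32 + -N / 2) := Real.one_le_exp (by linarith)
    have h5 : 1 ≤ w * Real.exp ((w - 8 * l) / 32 + -N / 2) :=
      one_le_mul_of_one_le_of_one_le (by linarith) h4
    calc _ ≤ w ^ p := Real.rpow_le_rpow (le_max_right _ _) h3 hp.le
      _ ≤ (8 * p) ^ p * Real.exp (w / 8) := rpow_le_mul_exp hw hp (by norm_num)
      _ ≤ (8 * p) ^ p * Real.exp (w / 8) * (w * Real.exp ((w - 8 * l) / 32 + -N / 2)) :=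
          le_mul_of_one_le_right (by positivity) h5
      _ = _ := by rw [Real.exp_add]; ring
  · rw [max_eq_right h, Real.zero_rpow hp.ne']
    positivity

/-- Now `N > 16 w + 8 l`, and half of the exponent `N` pays for `exp (-8 w - 4 l)`. Using `exp N -
1` instead of `exp N` leaves an expectation that is small with the variance. -/
theorem gap_rpow_le_exp {a w N l p : ℝ} (ha : 0 ≤ a) (hw : 0 ≤ w) (hN : 0 ≤ N) (hl : 6 ≤ l)
    (hp : 0 < p) :
    max (a * (Real.sqrt (2 * l * N) + 4 * l / 3) - 4 * (a * (Real.sqrt (2 * l * w) + 4 * l / 3))) 0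
      ^ p ≤ a ^ p * ((2 * p) ^ p * (2 * Real.exp (-(8 * w) - 4 * l))) * (Real.exp N - 1) := by
  have e : a * (Real.sqrt (2 * l * N) + 4 * l / 3) - 4 * (a * (Real.sqrt (2 * l * w) + 4 * l / 3)) =
      a * (Real.sqrt (2 * l * N) + 4 * l / 3 - 4 * (Real.sqrt (2 * l * w) + 4 * l / 3)) := by ring
  rw [e, mul_assoc (a ^ p)]
  refine max_mul_rpow_le ha ?_
  rcases sqrt_gap_le (l := l) hN hw (by linarith) with ⟨h1, h2⟩ | h
  · have h3 : max (Real.sqrt (2 * l * N) + 4 * l / 3 -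
        4 * (Real.sqrt (2 * l * w) + 4 * l / 3)) 0 ≤ N := max_le h2 hN
    have h4 : Real.exp (N / 2) ≤ Real.exp (-(8 * w) - 4 * l) * Real.exp N := by
      rw [← Real.exp_add]; exact Real.exp_le_exp.2 (by linarith)
    have h5 := exp_sub_one_ge_half (t := N) (by linarith)
    calc _ ≤ N ^ p := Real.rpow_le_rpow (le_max_right _ _) h3 hp.le
      _ ≤ (2 * p) ^ p * Real.exp (N / 2) := rpow_le_mul_exp hN hp (by norm_num)
      _ ≤ (2 * p) ^ p * (Real.exp (-(8 * w) - 4 * l) * (2 * (Real.exp N - 1))) :=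
          mul_le_mul_of_nonneg_left (h4.trans (mul_le_mul_of_nonneg_left h5 (Real.exp_pos _).le))
            (by positivity)
      _ = _ := by ring
  · rw [max_eq_right h, Real.zero_rpow hp.ne']
    have : 0 ≤ Real.exp N - 1 := by linarith [Real.one_le_exp hN]
    positivity

theorem lintegral_bernstein_sub_empirical_le (hφ : Measurable φ) (hb0 : 0 < b)
    (hb : ∀ᵐ x ∂P, |φ x| ≤ b) {n : ℕ} (hn : 0 < n) {p l : ℝ} (hp : 0 < p) (hl : 6 ≤ l) :
    ∫⁻ z : Fin n → Ω, ENNReal.ofReal (bernsteinBound l b (∫ x, φ x ^ 2 ∂P) n -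
      4 * bernsteinBound l b ((n : ℝ)⁻¹ * ∑ i, φ (z i) ^ 2) n) ^ p ∂(Measure.pi fun _ => P) ≤
      ENNReal.ofReal ((8 * p) ^ p * ((b / n) ^ p *
        (n * (∫ x, φ x ^ 2 ∂P) / b ^ 2) * Real.exp (-(l / 4)))) := by
  have hn' : (0 : ℝ) < n := by exact_mod_cast hn
  have hint : Integrable (fun z : Fin n → Ω => Real.exp (∑ i, -(φ (z i) ^ 2 / b ^ 2) / 2))
      (Measure.pi fun _ => P) := by
    refine integrable_exp_sum (ψ := fun x => -(φ x ^ 2 / b ^ 2) / 2)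
      (integrable_exp_of_bound (c := 1) (by fun_prop) ?_)
    filter_upwards [ae_sq_div_sq_mem hb0 hb] with x hx
    rw [abs_div, abs_neg, abs_of_nonneg hx.1, abs_of_pos (by norm_num : (0 : ℝ) < 2)]
    linarith [hx.2]
  have hI := integral_exp_sum_le (n := n) (ψ := fun x => -(φ x ^ 2 / b ^ 2) / 2)
    (integral_exp_neg_sq_le (P := P) hφ hb0 hb)
  have hv0 : 0 ≤ ∫ x, φ x ^ 2 ∂P := integral_nonneg fun x => sq_nonneg _
  generalize ∫ x, φ x ^ 2 ∂P = v at hI hv0 ⊢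
  have hw0 : 0 ≤ n * v / b ^ 2 := by positivity
  have e1 : (n : ℝ) * (-(v / b ^ 2) / 4) = -(n * v / b ^ 2) / 4 := by ring
  rw [e1] at hI
  simp_rw [ofReal_rpow_eq_max _ hp, bernsteinBound_eq (v := v) hn hb0,
    bernsteinBound_empirical_eq hn hb0]
  generalize n * v / b ^ 2 = w at hI hw0 ⊢
  have hbn : 0 ≤ b / n := by positivity
  generalize b / n = a at hbn ⊢
  have hc0 : 0 ≤ a ^ p * ((8 * p) ^ p * w * Real.exp (w / 8) * Real.exp ((w - 8 * l) / 32)) := by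
    positivity
  refine lintegral_ofReal_le_of_le (hint.const_mul _)
    (fun z => mul_nonneg hc0 (Real.exp_pos _).le) (fun z => ?_) ?_
  · have hsum : ∑ i, -(φ (z i) ^ 2 / b ^ 2) / 2 = -(∑ i, φ (z i) ^ 2 / b ^ 2) / 2 := by
      rw [← Finset.sum_neg_distrib, Finset.sum_div]
    rw [hsum]
    exact gap_rpow_le_exp_neg hbn hw0 (Finset.sum_nonneg fun i _ => by positivity) hl hp
  · rw [integral_const_mul]
    refine (mul_le_mul_of_nonneg_left hI hc0).trans ?_
    -- The exponents add up to `-3 w / 32 - l / 4`.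
    have e2 : Real.exp (w / 8) * Real.exp ((w - 8 * l) / 32) * Real.exp (-w / 4) ≤
        Real.exp (-(l / 4)) := by
      rw [← Real.exp_add, ← Real.exp_add]
      exact Real.exp_le_exp.2 (by linarith)
    have h0 : 0 ≤ (8 * p) ^ p * (a ^ p * w) := by positivity
    linarith [mul_le_mul_of_nonneg_left e2 h0]

theorem lintegral_empirical_sub_bernstein_le (hφ : Measurable φ) (hb0 : 0 < b)
    (hb : ∀ᵐ x ∂P, |φ x| ≤ b) {n : ℕ} (hn : 0 < n) {p l : ℝ} (hp : 0 < p) (hl : 6 ≤ l) :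
    ∫⁻ z : Fin n → Ω, ENNReal.ofReal (bernsteinBound l b ((n : ℝ)⁻¹ * ∑ i, φ (z i) ^ 2) n -
      4 * bernsteinBound l b (∫ x, φ x ^ 2 ∂P) n) ^ p ∂(Measure.pi fun _ => P) ≤
      ENNReal.ofReal (4 * (2 * p) ^ p * ((b / n) ^ p *
        (n * (∫ x, φ x ^ 2 ∂P) / b ^ 2) * Real.exp (-(l / 4)))) := by
  have hn' : (0 : ℝ) < n := by exact_mod_cast hn
  have hint : Integrable (fun z : Fin n → Ω => Real.exp (∑ i, φ (z i) ^ 2 / b ^ 2))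
      (Measure.pi fun _ => P) := by
    refine integrable_exp_sum (ψ := fun x => φ x ^ 2 / b ^ 2)
      (integrable_exp_of_bound (c := 1) (by fun_prop) ?_)
    filter_upwards [ae_sq_div_sq_mem hb0 hb] with x hx
    rw [abs_of_nonneg hx.1]; exact hx.2
  have hI := integral_exp_sum_le (n := n) (ψ := fun x => φ x ^ 2 / b ^ 2)
    (integral_exp_sq_le (P := P) hφ hb0 hb)
  have hv0 : 0 ≤ ∫ x, φ x ^ 2 ∂P := integral_nonneg fun x => sq_nonneg _
  generalize ∫ x, φ x ^ 2 ∂P = v at hI hv0 ⊢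
  have hw0 : 0 ≤ n * v / b ^ 2 := by positivity
  have e1 : (n : ℝ) * (2 * (v / b ^ 2)) = 2 * (n * v / b ^ 2) := by ring
  rw [e1] at hI
  simp_rw [ofReal_rpow_eq_max _ hp, bernsteinBound_eq (v := v) hn hb0,
    bernsteinBound_empirical_eq hn hb0]
  generalize n * v / b ^ 2 = w at hI hw0 ⊢
  have hbn : 0 ≤ b / n := by positivity
  generalize b / n = a at hbn ⊢
  have hc0 : 0 ≤ a ^ p * ((2 * p) ^ p * (2 * Real.exp (-(8 * w) - 4 * l))) := by positivity
  have hN0 : ∀ z : Fin n → Ω, 0 ≤ ∑ i, φ (z i) ^ 2 / b ^ 2 := fun z =>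
    Finset.sum_nonneg fun i _ => by positivity
  refine lintegral_ofReal_le_of_le ((hint.sub (integrable_const 1)).const_mul _)
    (fun z => mul_nonneg hc0 ?_) (fun z => gap_rpow_le_exp hbn hw0 (hN0 z) hl hp) ?_
  · have := Real.one_le_exp (hN0 z)
    simpa using this
  · simp only [Pi.sub_apply]
    rw [integral_const_mul, integral_sub hint (integrable_const _)]
    simp only [integral_const, probReal_univ, one_smul]
    have h1 := (sub_le_sub_right hI 1).trans (exp_sub_one_le_mul_exp (2 * w))
    refine (mul_le_mul_of_nonneg_left h1 hc0).trans ?_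
    have e2 : Real.exp (-(8 * w) - 4 * l) * Real.exp (2 * w) ≤ Real.exp (-(l / 4)) := by
      rw [← Real.exp_add]
      exact Real.exp_le_exp.2 (by linarith)
    have h0 : 0 ≤ 4 * (2 * p) ^ p * (a ^ p * w) := by positivity
    linarith [mul_le_mul_of_nonneg_left e2 h0]

end EmpiricalVariance

end ConvDensity

/-! ### Fourier transforms on `L²` and convolution equations. -/

namespace ConvDensity

section Fourier

open FourierTransform SchwartzMap
open scoped ContDiff

variable {V : Type*} [NormedAddCommGroup V] [InnerProductSpace ℝ V] [FiniteDimensional ℝ V]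
  [MeasurableSpace V] [BorelSpace V]

variable (V) in
/-- The Hilbert space of complex-valued square integrable functions. -/
abbrev L2C : Type _ := Lp (α := V) ℂ 2 volume

theorem ae_eq_of_forall_schwartz {f f' : V → ℂ} (hf : LocallyIntegrable f)
    (hf' : LocallyIntegrable f')
    (h : ∀ χ : 𝓢(V, ℂ), ∫ x, χ x * f x = ∫ x, χ x * f' x) : f =ᵐ[volume] f' := by
  refine ae_eq_of_integral_contDiff_smul_eq hf hf' fun g hg hgs => ?_
  have hgc : ContDiff ℝ ∞ fun x => (g x : ℂ) := Complex.ofRealCLM.contDiff.comp hg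
  have hgs' : HasCompactSupport fun x => (g x : ℂ) := hgs.comp_left (g := fun r : ℝ => (r : ℂ)) rfl
  have := h (hgs'.toSchwartzMap hgc)
  simpa [Complex.real_smul] using this

theorem integral_fourier_mul_eq_of_integrable {f g : V → ℂ} (hf : Integrable f)
    (hg : Integrable g) : ∫ ξ, 𝓕 f ξ * g ξ = ∫ x, f x * 𝓕 g x := by
  simpa using! VectorFourier.integral_fourierIntegral_smul_eq_flip (L := innerₗ V)
    Real.continuous_fourierChar continuous_inner hf hg

theorem integral_fourierInv_mul_eq_of_integrable {f g : V → ℂ} (hf : Integrable f)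
    (hg : Integrable g) : ∫ ξ, 𝓕⁻ f ξ * g ξ = ∫ x, f x * 𝓕⁻ g x := by
  have h := integral_fourier_mul_eq_of_integrable hf hg.comp_neg
  rw [← integral_neg_eq_self] at h
  simp only [neg_neg] at h
  simp_rw [Real.fourierInv_eq_fourier_neg]
  rw [h]
  congr 1 with x
  congr 1
  rw [Real.fourier_eq, Real.fourier_eq, ← integral_neg_eq_self]
  simp

theorem continuous_fourier_of_integrable {f : V → ℂ} (hf : Integrable f) : Continuous (𝓕 f) :=
  VectorFourier.fourierIntegral_continuous Real.continuous_fourierChar continuous_inner hf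

theorem continuous_fourierInv_of_integrable {f : V → ℂ} (hf : Integrable f) :
    Continuous (𝓕⁻ f) := by
  have : 𝓕⁻ f = fun x => 𝓕 f (-x) := funext fun x => Real.fourierInv_eq_fourier_neg f x
  rw [this]
  exact (continuous_fourier_of_integrable hf).comp continuous_neg

theorem locallyIntegrable_coe (f : L2C V) : LocallyIntegrable (f : V → ℂ) :=
  (Lp.memLp f).locallyIntegrable one_le_two

/-- On `L¹ ∩ L²` the Fourier transform in `L²` is given by the integral. -/
theorem coeFn_fourier_toLp {ψ : V → ℂ} (h1 : Integrable ψ) (h2 : MemLp ψ 2) :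
    (𝓕 (h2.toLp ψ) : L2C V) =ᵐ[volume] 𝓕 ψ := by
  refine ae_eq_of_forall_schwartz (locallyIntegrable_coe _)
    (continuous_fourier_of_integrable h1).locallyIntegrable fun χ => ?_
  have h := congrArg (fun T : TemperedDistribution V ℂ => T χ)
    (Lp.fourier_toTemperedDistribution_eq (h2.toLp ψ))
  simp only [TemperedDistribution.fourier_apply, Lp.toTemperedDistribution_apply, smul_eq_mul] at h
  rw [← h, ← integral_fourier_mul_eq_of_integrable χ.integrable h1]
  refine integral_congr_ae ?_
  filter_upwards [h2.coeFn_toLp] with x hx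
  rw [hx, SchwartzMap.fourier_coe]

/-- If the `L²` Fourier transform is integrable, then the inverse transform is an integral. -/
theorem ae_eq_fourierInv_of_integrable (N : L2C V)
    (h1 : Integrable ((𝓕 N : L2C V) : V → ℂ)) :
    (N : V → ℂ) =ᵐ[volume] 𝓕⁻ ((𝓕 N : L2C V) : V → ℂ) := by
  refine ae_eq_of_forall_schwartz (locallyIntegrable_coe _)
    (continuous_fourierInv_of_integrable h1).locallyIntegrable fun χ => ?_
  have h := congrArg (fun T : TemperedDistribution V ℂ => T χ)
    (Lp.fourierInv_toTemperedDistribution_eq (𝓕 N : L2C V))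
  simp only [TemperedDistribution.fourierInv_apply, Lp.toTemperedDistribution_apply,
    smul_eq_mul, fourierInv_fourier_eq] at h
  rw [← h, ← integral_fourierInv_mul_eq_of_integrable χ.integrable h1]
  simp_rw [SchwartzMap.fourierInv_coe]

/-- For Schwartz `ψ` this is the definition of the Fourier transform of a tempered distribution.
Both sides are continuous in `ψ` for the `L²` norm, and Schwartz functions are dense. -/
theorem integral_fourier_mul_Lp (ψ N : L2C V) :
    ∫ x, (𝓕 ψ : L2C V) x * N x = ∫ x, ψ x * (𝓕 N : L2C V) x := by
  have key : ∀ a b : L2C V, ((ContinuousLinearMap.mul ℂ ℂ).lpPairing volume 2 2 a) b =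
      ∫ x, a x * b x := fun a b => by
    rw [ContinuousLinearMap.lpPairing_eq_integral]; rfl
  rw [← key, ← key]
  refine DenseRange.induction_on (p := fun ψ : Lp (α := V) ℂ 2 =>
    ((ContinuousLinearMap.mul ℂ ℂ).lpPairing volume 2 2 (𝓕 ψ)) N =
      ((ContinuousLinearMap.mul ℂ ℂ).lpPairing volume 2 2 ψ) (𝓕 N))
    (SchwartzMap.denseRange_toLpCLM (E := V) (F := ℂ) (p := 2) (μ := volume) ENNReal.ofNat_ne_top)
      ψ ?_ ?_
  · refine isClosed_eq ?_ ?_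
    · exact (((ContinuousLinearMap.mul ℂ ℂ).lpPairing volume 2 2).flip N).continuous.comp
        (Lp.fourierTransformₗᵢ V ℂ).continuous
    · exact (((ContinuousLinearMap.mul ℂ ℂ).lpPairing volume 2 2).flip (𝓕 N)).continuous
  · intro f
    change ((ContinuousLinearMap.mul ℂ ℂ).lpPairing volume 2 2 (𝓕 (f.toLp 2 volume))) N =
      ((ContinuousLinearMap.mul ℂ ℂ).lpPairing volume 2 2 (f.toLp 2 volume)) (𝓕 N)
    rw [key, key, SchwartzMap.toLp_fourier_eq]
    have h := congrArg (fun T : TemperedDistribution V ℂ => T f)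
      (Lp.fourier_toTemperedDistribution_eq N)
    simp only [TemperedDistribution.fourier_apply, Lp.toTemperedDistribution_apply, smul_eq_mul] at h
    calc _ = ∫ x, (𝓕 f : 𝓢(V, ℂ)) x * N x := by
          refine integral_congr_ae ?_
          filter_upwards [(𝓕 f : 𝓢(V, ℂ)).coeFn_toLp 2 volume] with x hx
          rw [hx]
      _ = _ := h
      _ = _ := by
          refine integral_congr_ae ?_
          filter_upwards [f.coeFn_toLp 2 volume] with x hx
          rw [hx]

/-- The product `|N χ|` is at most `|N|² + |χ|²`, and each of the two resulting terms is the
integrand of a convolution of two integrable functions. -/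
theorem integrable_mul_of_sq {γ N χ : V → ℂ} (hγ : Integrable γ) (hN : MemLp N 2)
    (hχ : MemLp χ 2) :
    Integrable (fun q : V × V => γ (q.1 - q.2) * N q.1 * χ q.2) (volume.prod volume) := by
  have hN2 : Integrable fun x => ‖N x‖ ^ 2 := hN.norm.integrable_sq
  have hχ2 : Integrable fun x => ‖χ x‖ ^ 2 := hχ.norm.integrable_sq
  have hγ' : Integrable fun x => ‖γ (-x)‖ := hγ.norm.comp_neg
  have i1 := hN2.convolution_integrand (ContinuousLinearMap.mul ℝ ℝ) (hγ')
  have i2 := hχ2.convolution_integrand (ContinuousLinearMap.mul ℝ ℝ) (hγ.norm)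
  have hd := ((i1.swap).add i2)
  refine hd.mono ?_ ?_
  · have m1 : AEStronglyMeasurable (fun q : V × V => γ (q.1 - q.2)) (volume.prod volume) :=
      hγ.1.comp_quasiMeasurePreserving (quasiMeasurePreserving_sub volume volume)
    exact (m1.mul hN.1.comp_fst).mul hχ.1.comp_snd
  · refine Filter.Eventually.of_forall fun q => ?_
    simp only [Function.comp, Prod.swap, Pi.add_apply, ContinuousLinearMap.mul_apply', neg_sub,
      norm_mul]
    rw [Real.norm_of_nonneg (by positivity)]
    nlinarith [norm_nonneg (γ (q.1 - q.2)), mul_nonneg (norm_nonneg (γ (q.1 - q.2)))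
      (sq_nonneg (‖N q.1‖ - ‖χ q.2‖)), mul_nonneg (norm_nonneg (γ (q.1 - q.2)))
      (add_nonneg (sq_nonneg ‖N q.1‖) (sq_nonneg ‖χ q.2‖))]

/-- Fubini: a convolution becomes multiplication by `𝓕⁻ γ`. The inverse transform appears because
`γ` is convolved with a function that is already a Fourier transform. -/
theorem integral_mul_fourier_eq_fourier {γ φ : V → ℂ} (hγ : Integrable γ) (hφ : Integrable φ)
    (t : V) : ∫ y, γ (t - y) * 𝓕 φ y = 𝓕 (fun ξ => 𝓕⁻ γ ξ * φ ξ) t := by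
  have e0 := integral_sub_left_eq_self (fun s => γ s * 𝓕 φ (t - s)) volume t
  simp only [sub_sub_cancel] at e0
  rw [e0, Real.fourier_eq]
  have e1 : ∀ s, γ s * 𝓕 φ (t - s) = ∫ ξ, Real.fourierChar (-inner ℝ ξ (t - s)) • (γ s * φ ξ) := by
    intro s
    rw [Real.fourier_eq, ← integral_const_mul]
    congr 1 with ξ
    rw [Circle.smul_def, Circle.smul_def, smul_eq_mul, smul_eq_mul]; ring
  have e2 : ∀ ξ, Real.fourierChar (-inner ℝ ξ t) • (𝓕⁻ γ ξ * φ ξ) =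
      ∫ s, Real.fourierChar (-inner ℝ ξ (t - s)) • (γ s * φ ξ) := by
    intro ξ
    rw [Real.fourierInv_eq, ← integral_mul_const, Circle.smul_def, ← integral_smul]
    congr 1 with s
    rw [Circle.smul_def, Circle.smul_def, smul_eq_mul, smul_eq_mul, smul_eq_mul, ← mul_assoc,
      ← mul_assoc, ← mul_assoc, ← Circle.coe_mul, ← AddChar.map_add_eq_mul, inner_sub_right,
      real_inner_comm ξ s, neg_sub, sub_eq_neg_add]
  simp_rw [e1, e2]
  refine integral_integral_swap ?_
  have hi := hγ.mul_prod hφ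
  refine hi.mono ?_ ?_
  · have : Continuous fun q : V × V => (Real.fourierChar (-inner ℝ q.2 (t - q.1)) : ℂ) :=
      continuous_subtype_val.comp (Real.continuous_fourierChar.comp (by fun_prop))
    exact this.aestronglyMeasurable.smul hi.1
  · refine Filter.Eventually.of_forall fun q => ?_
    simp [Function.uncurry]

/-- The Fourier transform of the solution of a convolution equation in `L²`. -/
theorem fourier_mul_eq_of_convolution_eq {N k γ : V → ℂ} {a₀ a₁ : ℂ} (hγ : Integrable γ)
    (hN : MemLp N 2) (hk : Integrable k)
    (hEq : ∀ y, k y = a₀ * N y + a₁ * ∫ t, γ (t - y) * N t) :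
    ∀ᵐ ξ, 𝓕 k ξ = (a₀ + a₁ * 𝓕⁻ γ ξ) * (𝓕 (hN.toLp N) : L2C V) ξ := by
  set m : V → ℂ := fun ξ => a₀ + a₁ * 𝓕⁻ γ ξ with hm
  have hmc : Continuous m := by
    have := continuous_fourierInv_of_integrable hγ
    fun_prop
  have hmb : ∀ ξ, ‖m ξ‖ ≤ ‖a₀‖ + ‖a₁‖ * ∫ x, ‖γ x‖ := by
    intro ξ
    refine (norm_add_le _ _).trans ?_
    rw [norm_mul]
    gcongr
    rw [Real.fourierInv_eq]
    refine (norm_integral_le_integral_norm _).trans (le_of_eq ?_)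
    simp
  set FN := (𝓕 (hN.toLp N) : L2C V) with hFN
  have hmul2 : ∀ {f : V → ℂ} {q : ℝ≥0∞}, MemLp f q → MemLp (fun ξ => m ξ * f ξ) q := by
    intro f q hf
    refine (hf.const_mul ((‖a₀‖ + ‖a₁‖ * ∫ x, ‖γ x‖ : ℝ) : ℂ)).mono
      (hmc.aestronglyMeasurable.mul hf.1) (Filter.Eventually.of_forall fun ξ => ?_)
    rw [norm_mul, norm_mul, Complex.norm_real, Real.norm_eq_abs]
    gcongr
    exact (hmb ξ).trans (le_abs_self _)
  -- Since `N` is only in `L²`, the identity is tested against Schwartz functions and the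
  -- convolution is moved onto the test function. The product `m φ` need not be Schwartz, but it
  -- lies in `L¹ ∩ L²`, which suffices to identify its two Fourier transforms.
  refine ae_eq_of_forall_schwartz (continuous_fourier_of_integrable hk).locallyIntegrable
    ((hmul2 (Lp.memLp FN)).locallyIntegrable one_le_two) fun φ => ?_
  have hφ1 : Integrable φ := φ.integrable
  have hφ2 : MemLp φ 2 := φ.memLp 2 volume
  have hFφ : MemLp (𝓕 (φ : V → ℂ)) 2 := by
    rw [← SchwartzMap.fourier_coe]; exact (𝓕 φ : 𝓢(V, ℂ)).memLp 2 volume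
  have hmφ1 : Integrable fun ξ => m ξ * φ ξ := by
    have := hmul2 (memLp_one_iff_integrable.2 hφ1)
    exact memLp_one_iff_integrable.1 this
  have hmφ2 := hmul2 hφ2
  have hγφ1 : Integrable fun ξ => 𝓕⁻ γ ξ * φ ξ := by
    refine (hφ1.const_mul ((∫ x, ‖γ x‖ : ℝ) : ℂ)).mono
      ((continuous_fourierInv_of_integrable hγ).aestronglyMeasurable.mul hφ1.1)
      (Filter.Eventually.of_forall fun ξ => ?_)
    rw [norm_mul, norm_mul, Complex.norm_real, Real.norm_eq_abs]
    gcongr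
    rw [Real.fourierInv_eq]
    refine (norm_integral_le_integral_norm _).trans (le_trans (le_of_eq ?_) (le_abs_self _))
    simp
  have hint := integrable_mul_of_sq hγ hN hFφ
  have hi1 : Integrable fun y => 𝓕 (φ : V → ℂ) y * N y := by
    have := hFφ.integrable_mul hN
    exact this
  calc ∫ x, φ x * 𝓕 k x = ∫ y, 𝓕 (φ : V → ℂ) y * k y :=
        (integral_fourier_mul_eq_of_integrable hφ1 hk).symm
    _ = a₀ * (∫ y, 𝓕 (φ : V → ℂ) y * N y) +
        a₁ * ∫ y, ∫ t, γ (t - y) * N t * 𝓕 (φ : V → ℂ) y := by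
        have hs : Integrable fun y => ∫ t, γ (t - y) * N t * 𝓕 (φ : V → ℂ) y :=
          hint.integral_prod_right
        rw [← integral_const_mul, ← integral_const_mul, ← integral_add (hi1.const_mul _)
          (hs.const_mul _)]
        congr 1 with y
        rw [hEq y, integral_mul_const]
        ring
    _ = a₀ * (∫ y, 𝓕 (φ : V → ℂ) y * N y) +
        a₁ * ∫ t, 𝓕 (fun ξ => 𝓕⁻ γ ξ * φ ξ) t * N t := by
        rw [integral_integral_swap (f := fun y t => γ (t - y) * N t * 𝓕 (φ : V → ℂ) y) hint.swap]
        congr 3 with t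
        rw [← integral_mul_fourier_eq_fourier hγ hφ1, ← integral_mul_const]
        congr 1 with y
        ring
    _ = ∫ t, 𝓕 (fun ξ => m ξ * φ ξ) t * N t := by
        have hs : Integrable fun t => 𝓕 (fun ξ => 𝓕⁻ γ ξ * φ ξ) t * N t := by
          have := hint.integral_prod_left
          refine this.congr (Filter.Eventually.of_forall fun t => ?_)
          dsimp only
          rw [← integral_mul_fourier_eq_fourier hγ hφ1, ← integral_mul_const]
          congr 1 with y
          ring
        rw [← integral_const_mul, ← integral_const_mul, ← integral_add (hi1.const_mul _)
          (hs.const_mul _)]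
        congr 1 with t
        have : 𝓕 (fun ξ => m ξ * φ ξ) t =
            a₀ * 𝓕 (φ : V → ℂ) t + a₁ * 𝓕 (fun ξ => 𝓕⁻ γ ξ * φ ξ) t := by
          have hb : ∀ {f : V → ℂ}, Integrable f →
              Integrable fun v => Real.fourierChar (-inner ℝ v t) • f v := fun {f} hf =>
            (Real.fourierIntegral_convergent_iff t).2 hf
          rw [Real.fourier_eq, Real.fourier_eq, Real.fourier_eq, ← integral_const_mul,
            ← integral_const_mul, ← integral_add ((hb hφ1).const_mul _) ((hb hγφ1).const_mul _)]
          congr 1 with ξ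
          simp only [Circle.smul_def, smul_eq_mul, hm]
          ring
        rw [this]; ring
    _ = ∫ x, (𝓕 (hmφ2.toLp _) : L2C V) x * hN.toLp N x := by
        refine integral_congr_ae ?_
        filter_upwards [coeFn_fourier_toLp hmφ1 hmφ2, hN.coeFn_toLp] with x h1 h2
        rw [h1, h2]
    _ = ∫ x, (hmφ2.toLp _ : L2C V) x * FN x := integral_fourier_mul_Lp _ _
    _ = ∫ x, φ x * (m x * FN x) := by
        refine integral_congr_ae ?_
        filter_upwards [hmφ2.coeFn_toLp] with x h1
        rw [h1]; ring

end Fourier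

end ConvDensity

/-! ### Scaling in coordinates and elementary properties of the kernel. -/

namespace ConvDensity

section Scaling

variable {d : ℕ}

theorem map_mul_volume_pi {c : Fin d → ℝ} (hc : ∀ j, 0 < c j) :
    Measure.map (fun (x : Fin d → ℝ) j => c j * x j) volume =
      ENNReal.ofReal (∏ j, c j)⁻¹ • (volume : Measure (Fin d → ℝ)) := by
  have hp : 0 < ∏ j, c j := Finset.prod_pos fun j _ => hc j
  have hdet : (Matrix.diagonal c).det = ∏ j, c j := Matrix.det_diagonal
  have h := Real.smul_map_diagonal_volume_pi (D := c) (by rw [hdet]; exact hp.ne')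
  have hfun : ⇑(Matrix.toLin' (Matrix.diagonal c)) = fun (x : Fin d → ℝ) j => c j * x j := by
    ext x j
    simp [Matrix.toLin'_apply, Matrix.mulVec_diagonal]
  rw [hfun, hdet, abs_of_pos hp] at h
  conv_rhs => rw [← h, smul_smul, ← ENNReal.ofReal_mul (inv_nonneg.2 hp.le),
    inv_mul_cancel₀ hp.ne', ENNReal.ofReal_one, one_smul]

theorem measurableEmbedding_mul_pi {c : Fin d → ℝ} (hc : ∀ j, 0 < c j) :
    MeasurableEmbedding (fun (x : Fin d → ℝ) j => c j * x j) :=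
  (MeasurableEquiv.piCongrRight fun j =>
    (MeasurableEquiv.mulLeft₀ (c j) (hc j).ne')).measurableEmbedding

theorem lintegral_comp_mul_pi {c : Fin d → ℝ} (hc : ∀ j, 0 < c j) (F : (Fin d → ℝ) → ℝ≥0∞) :
    ∫⁻ x : Fin d → ℝ, F (fun j => c j * x j) = ENNReal.ofReal (∏ j, c j)⁻¹ * ∫⁻ x, F x := by
  rw [← (measurableEmbedding_mul_pi hc).lintegral_map, map_mul_volume_pi hc, lintegral_smul_measure,
    smul_eq_mul]

theorem integral_comp_mul_pi {E : Type*} [NormedAddCommGroup E] [NormedSpace ℝ E]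
    {c : Fin d → ℝ} (hc : ∀ j, 0 < c j) (F : (Fin d → ℝ) → E) :
    ∫ x : Fin d → ℝ, F (fun j => c j * x j) = (∏ j, c j)⁻¹ • ∫ x, F x := by
  rw [← (measurableEmbedding_mul_pi hc).integral_map, map_mul_volume_pi hc, integral_smul_measure,
    ENNReal.toReal_ofReal (inv_nonneg.2 (Finset.prod_nonneg fun j _ => (hc j).le))]

end Scaling

variable {d : ℕ}

namespace Setting

/-- The univariate kernel scaled by `h`. -/
noncomputable def scaledKernel (S : Setting d) (h t : ℝ) : ℝ := h⁻¹ * S.𝒦 (t / h)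

theorem Kh_eq_prod (S : Setting d) (h x : Fin d → ℝ) :
    S.Kh h x = ∏ j, S.scaledKernel (h j) (x j) := by
  simp only [Kh, K, scaledKernel, Finset.prod_mul_distrib, Finset.prod_inv_distrib]

namespace Valid

variable {S : Setting d}

/-- Only the product kernel is assumed continuous. Freezing all coordinates but one at a point where
`𝒦` does not vanish recovers `𝒦` up to a nonzero factor; such a point exists because the integral of
`𝒦` is one. -/
theorem continuous_univariate (hS : S.Valid) (hd : 1 ≤ d) : Continuous S.𝒦 := by
  obtain ⟨y₀, hy₀⟩ : ∃ y, S.𝒦 y ≠ 0 := by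
    by_contra! h
    have := hS.kernel_integral
    simp [h] at this
  let j : Fin d := ⟨0, hd⟩
  have h1 : Continuous fun t : ℝ => S.K (Function.update (fun _ => y₀) j t) :=
    hS.kernel_continuous.comp (by fun_prop)
  have h2 : ∀ t : ℝ, S.K (Function.update (fun _ => y₀) j t) =
      S.𝒦 t * ∏ i ∈ Finset.univ.erase j, S.𝒦 y₀ := by
    intro t
    rw [K, ← Finset.mul_prod_erase _ _ (Finset.mem_univ j), Function.update_self]
    congr 1
    refine Finset.prod_congr rfl fun i hi => ?_
    rw [Function.update_of_ne (Finset.ne_of_mem_erase hi)]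
  have h3 : ∏ i ∈ Finset.univ.erase j, S.𝒦 y₀ ≠ 0 := Finset.prod_ne_zero_iff.2 fun _ _ => hy₀
  refine (h1.div_const (∏ i ∈ Finset.univ.erase j, S.𝒦 y₀)).congr fun t => ?_
  rw [h2, mul_div_cancel_right₀ _ h3]

theorem cK_pos (hS : S.Valid) : 0 < S.cK := zero_lt_one.trans_le hS.one_le_cK

theorem hasCompactSupport_univariate (hS : S.Valid) : HasCompactSupport S.𝒦 := by
  refine HasCompactSupport.intro (isCompact_Icc (a := -S.cK) (b := S.cK)) fun x hx => ?_
  refine hS.kernel_support x ?_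
  by_contra! h
  exact hx (abs_le.1 h)

theorem integrable_univariate (hS : S.Valid) (hd : 1 ≤ d) : Integrable S.𝒦 :=
  (hS.continuous_univariate hd).integrable_of_hasCompactSupport hS.hasCompactSupport_univariate

theorem continuous_scaledKernel (hS : S.Valid) (hd : 1 ≤ d) (h : ℝ) :
    Continuous (S.scaledKernel h) :=
  continuous_const.mul ((hS.continuous_univariate hd).comp (by fun_prop))

theorem scaledKernel_eq_zero (hS : S.Valid) {h t : ℝ} (hh : 0 < h) (ht : S.cK * h < |t|) :
    S.scaledKernel h t = 0 := by
  rw [scaledKernel, hS.kernel_support, mul_zero]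
  rwa [abs_div, abs_of_pos hh, lt_div_iff₀ hh]

theorem integrable_scaledKernel (hS : S.Valid) (hd : 1 ≤ d) {h : ℝ} (hh : 0 < h) :
    Integrable (S.scaledKernel h) :=
  ((hS.integrable_univariate hd).comp_div hh.ne').const_mul _

theorem integral_scaledKernel (hS : S.Valid) {h : ℝ} (hh : 0 < h) :
    ∫ t, S.scaledKernel h t = 1 := by
  simp only [scaledKernel]
  rw [integral_const_mul, Measure.integral_comp_div (g := S.𝒦), hS.kernel_integral, abs_of_pos hh,
    smul_eq_mul, mul_one, inv_mul_cancel₀ hh.ne']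

theorem continuous_Kh (hS : S.Valid) (h : Fin d → ℝ) : Continuous (S.Kh h) :=
  continuous_const.mul (hS.kernel_continuous.comp (by fun_prop))

theorem integrable_Kh (hS : S.Valid) (hd : 1 ≤ d) {h : Fin d → ℝ} (hh : ∀ j, 0 < h j) :
    Integrable (S.Kh h) := by
  have : S.Kh h = fun x => ∏ j, S.scaledKernel (h j) (x j) := funext fun x => S.Kh_eq_prod h x
  rw [this]
  exact Integrable.fintype_prod (f := fun j => S.scaledKernel (h j))
    fun j => hS.integrable_scaledKernel hd (hh j)

end Valid

theorem fourierTr_Kh (S : Setting d) {h : Fin d → ℝ} (hh : ∀ j, 0 < h j) (t : Fin d → ℝ) :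
    fourierTr (S.Kh h) t = fourierTr S.K (fun j => h j * t j) := by
  have hp : 0 < ∏ j, h j := Finset.prod_pos fun j _ => hh j
  have e := integral_comp_mul_pi hh (fun x : Fin d → ℝ =>
    (S.Kh h x : ℂ) * Complex.exp (-(Complex.I * ((∑ j, x j * t j : ℝ) : ℂ))))
  rw [fourierTr, fourierTr]
  have e2 : ∀ x : Fin d → ℝ, S.Kh h (fun j => h j * x j) = (∏ j, h j)⁻¹ * S.K x := by
    intro x
    rw [Kh]
    congr 2
    ext j
    exact mul_div_cancel_left₀ _ (hh j).ne'
  simp only [e2] at e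
  have e3 : (∏ j, h j) • (∫ x : Fin d → ℝ, (((∏ j, h j)⁻¹ * S.K x : ℝ) : ℂ) *
      Complex.exp (-(Complex.I * ((∑ j, h j * x j * t j : ℝ) : ℂ)))) = ∫ x : Fin d → ℝ,
    (S.Kh h x : ℂ) * Complex.exp (-(Complex.I * ((∑ j, x j * t j : ℝ) : ℂ))) := by
    rw [e, smul_smul, mul_inv_cancel₀ hp.ne', one_smul]
  rw [← e3, ← integral_smul]
  congr 1 with x
  rw [Complex.real_smul, Complex.ofReal_mul, ← mul_assoc, ← mul_assoc, ← Complex.ofReal_mul,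
    mul_inv_cancel₀ hp.ne', Complex.ofReal_one, one_mul]
  congr 5
  refine Finset.sum_congr rfl fun j _ => ?_
  ring

end Setting

/-! ### Transfer between the two Fourier conventions, and the envelope of the deconvolution kernel.
-/

section Transfer

open FourierTransform

/-- The model uses the phase `∑ x_j t_j` on the product space, whereas `𝓕` uses `2π ⟨v, w⟩` on
Euclidean space; the conventions differ by the dilation `t = 2π w`. -/
theorem fourier_comp_ofLp (U : (Fin d → ℝ) → ℝ) (w : EuclideanSpace ℝ (Fin d)) :
    𝓕 (fun v : EuclideanSpace ℝ (Fin d) => (U v.ofLp : ℂ)) w =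
      fourierTr U (fun j => 2 * Real.pi * w j) := by
  rw [Real.fourier_eq, fourierTr]
  have := (PiLp.volume_preserving_ofLp (Fin d)).integral_comp
    (MeasurableEquiv.toLp 2 (Fin d → ℝ)).symm.measurableEmbedding (fun x : Fin d → ℝ =>
      (U x : ℂ) * Complex.exp (-(Complex.I * ((∑ j, x j * (2 * Real.pi * w j) : ℝ) : ℂ))))
  rw [← this]
  congr 1 with v
  rw [Circle.smul_def, Real.fourierChar_apply, smul_eq_mul, mul_comm]
  congr 2
  rw [PiLp.inner_apply]
  push_cast
  simp only [RCLike.inner_apply, conj_trivial, Finset.mul_sum, Finset.sum_mul, mul_neg, neg_mul,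
    neg_inj]
  push_cast
  refine Finset.sum_congr rfl fun j _ => ?_
  ring

theorem fourierInv_comp_ofLp (U : (Fin d → ℝ) → ℝ) (w : EuclideanSpace ℝ (Fin d)) :
    𝓕⁻ (fun v : EuclideanSpace ℝ (Fin d) => (U v.ofLp : ℂ)) w =
      fourierTr U (fun j => -(2 * Real.pi * w j)) := by
  rw [Real.fourierInv_eq_fourier_neg, fourier_comp_ofLp]
  simp

theorem lintegral_comp_ofLp (F : (Fin d → ℝ) → ℝ≥0∞) :
    ∫⁻ v : EuclideanSpace ℝ (Fin d), F v.ofLp = ∫⁻ x, F x :=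
  (PiLp.volume_preserving_ofLp (Fin d)).lintegral_comp_emb
    (MeasurableEquiv.toLp 2 (Fin d → ℝ)).symm.measurableEmbedding F

end Transfer

namespace Setting

/-- The constant in the lower bound for the Fourier transform of the noise. -/
noncomputable def noiseConst (S : Setting d) : ℝ := if S.α = 1 then S.Υ₀ else S.ε

theorem Valid.noiseConst_pos {S : Setting d} (hS : S.Valid) : 0 < S.noiseConst := by
  unfold noiseConst
  split_ifs with h
  · exact (hS.noise_of_eq h).2.1
  · exact (hS.noise_of_ne h).1

theorem Valid.lam_nonneg {S : Setting d} (hS : S.Valid) (j : Fin d) : 0 ≤ S.lam j := by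
  unfold lam
  split_ifs with h
  · exact ((hS.noise_of_eq h).1 j).le
  · exact le_rfl

theorem Valid.le_norm_multiplier {S : Setting d} (hS : S.Valid) (t : Fin d → ℝ) :
    S.noiseConst * ∏ j, (1 + t j ^ 2) ^ (-(S.lam j / 2)) ≤
      ‖(1 - (S.α : ℂ)) + (S.α : ℂ) * fourierTr S.g t‖ := by
  unfold noiseConst lam
  split_ifs with h
  · have := (hS.noise_of_eq h).2.2 t
    simpa [h] using this
  · have := (hS.noise_of_ne h).2 t
    simpa using this

/-- The source of the factors `(h_j ∧ 1)^{-λ_j}`: the growth of the inverse multiplier in `t` is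
rewritten in the scaled frequency `h t`, to which the assumptions on the kernel apply. -/
theorem one_add_sq_rpow_le {lam h t : ℝ} (hl : 0 ≤ lam) (hh : 0 < h) :
    (1 + t ^ 2) ^ (lam / 2) ≤ (min h 1 ^ lam)⁻¹ * (1 + (h * t) ^ 2) ^ (lam / 2) := by
  have hm : 0 < min h 1 := lt_min hh one_pos
  have hm1 : min h 1 ≤ 1 := min_le_right _ _
  have hmh : min h 1 ≤ h := min_le_left _ _
  have e : (min h 1 ^ lam)⁻¹ = ((min h 1 ^ 2)⁻¹) ^ (lam / 2) := by
    rw [Real.inv_rpow (by positivity), ← Real.rpow_natCast (min h 1) 2, ← Real.rpow_mul hm.le]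
    congr 2
    push_cast; ring
  rw [e, ← Real.mul_rpow (by positivity) (by positivity)]
  refine Real.rpow_le_rpow (by positivity) ?_ (by positivity)
  rw [← div_eq_inv_mul, le_div_iff₀ (by positivity)]
  have h1 : min h 1 ^ 2 ≤ 1 := pow_le_one₀ hm.le hm1
  have h2 : min h 1 ^ 2 ≤ h ^ 2 := by gcongr
  nlinarith [sq_nonneg t, mul_le_mul_of_nonneg_left h2 (sq_nonneg t)]

section Bounds

open FourierTransform

/-- The envelope of the Fourier transform of the deconvolution kernel. -/
theorem IsDeconvKernel.exists_fourier_le {S : Setting d} (hS : S.Valid) (hd : 1 ≤ d)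
    {M : (Fin d → ℝ) → (Fin d → ℝ) → ℝ} (hM : S.IsDeconvKernel M) {h : Fin d → ℝ}
    (hh : ∀ j, 0 < h j) (hN : MemLp (fun v : EuclideanSpace ℝ (Fin d) => (M v.ofLp h : ℂ)) 2) :
    ∀ᵐ ξ, ‖(𝓕 (hN.toLp _) : L2C (EuclideanSpace ℝ (Fin d))) ξ‖ ≤
      S.noiseConst⁻¹ * (∏ j, min (h j) 1 ^ S.lam j)⁻¹ *
        (‖fourierTr S.K (fun j => h j * (2 * Real.pi * ξ j))‖ *
          ∏ j, (1 + (h j * (2 * Real.pi * ξ j)) ^ 2) ^ (S.lam j / 2)) := by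
  have hmp := PiLp.volume_preserving_ofLp (Fin d)
  have hγ : Integrable fun v : EuclideanSpace ℝ (Fin d) => (S.g v.ofLp : ℂ) :=
    (hmp.integrable_comp_of_integrable hS.g_integrable).ofReal
  have hk : Integrable fun v : EuclideanSpace ℝ (Fin d) => (S.Kh h v.ofLp : ℂ) :=
    (hmp.integrable_comp_of_integrable (hS.integrable_Kh hd hh)).ofReal
  have key := fourier_mul_eq_of_convolution_eq (a₀ := 1 - (S.α : ℂ)) (a₁ := (S.α : ℂ)) hγ hN hk
    (by
      intro y
      have e := (hM h hh).2.2 y.ofLp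
      have e2 := hmp.integral_comp (MeasurableEquiv.toLp 2 (Fin d → ℝ)).symm.measurableEmbedding
        (fun t : Fin d → ℝ => S.g (t - y.ofLp) * M t h)
      rw [e, ← e2]
      push_cast
      congr 2
      rw [← integral_complex_ofReal]
      congr 1 with t
      simp)
  filter_upwards [key] with ξ hξ
  rw [fourier_comp_ofLp, fourierInv_comp_ofLp, fourierTr_Kh S hh] at hξ
  set N := (𝓕 (hN.toLp _) : L2C (EuclideanSpace ℝ (Fin d))) ξ
  have h1 := hS.le_norm_multiplier (fun j => -(2 * Real.pi * ξ j))
  have h2 : (S.noiseConst * ∏ j, (1 + (-(2 * Real.pi * ξ j)) ^ 2) ^ (-(S.lam j / 2))) * ‖N‖ ≤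
      ‖fourierTr S.K (fun j => h j * (2 * Real.pi * ξ j))‖ := by
    rw [hξ, norm_mul]; gcongr
  have hc := hS.noiseConst_pos
  have hprod : ∏ j, (1 + (-(2 * Real.pi * ξ j)) ^ 2) ^ (-(S.lam j / 2)) =
      (∏ j, (1 + (2 * Real.pi * ξ j) ^ 2) ^ (S.lam j / 2))⁻¹ := by
    rw [← Finset.prod_inv_distrib]
    refine Finset.prod_congr rfl fun j _ => ?_
    rw [Real.rpow_neg (by positivity), neg_sq]
  have hpos : 0 < ∏ j, (1 + (2 * Real.pi * ξ j) ^ 2) ^ (S.lam j / 2) :=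
    Finset.prod_pos fun j _ => by positivity
  have h3 : ∏ j, (1 + (2 * Real.pi * ξ j) ^ 2) ^ (S.lam j / 2) ≤
      (∏ j, min (h j) 1 ^ S.lam j)⁻¹ *
        ∏ j, (1 + (h j * (2 * Real.pi * ξ j)) ^ 2) ^ (S.lam j / 2) := by
    rw [← Finset.prod_inv_distrib, ← Finset.prod_mul_distrib]
    exact Finset.prod_le_prod (fun j _ => by positivity)
      fun j _ => one_add_sq_rpow_le (hS.lam_nonneg j) (hh j)
  rw [hprod] at h2
  generalize ‖fourierTr S.K (fun j => h j * (2 * Real.pi * ξ j))‖ = A at *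
  generalize (∏ j, (1 + (2 * Real.pi * ξ j) ^ 2) ^ (S.lam j / 2)) = B at *
  have hA : 0 ≤ A := le_trans (by positivity) h2
  calc ‖N‖ = S.noiseConst⁻¹ * B * (S.noiseConst * B⁻¹ * ‖N‖) := by field_simp
    _ ≤ S.noiseConst⁻¹ * B * A := by gcongr
    _ ≤ S.noiseConst⁻¹ * ((∏ j, min (h j) 1 ^ S.lam j)⁻¹ *
        ∏ j, (1 + (h j * (2 * Real.pi * ξ j)) ^ 2) ^ (S.lam j / 2)) * A := by gcongr
    _ = _ := by ring

theorem lintegral_comp_two_pi_mul {h : Fin d → ℝ} (hh : ∀ j, 0 < h j) (F : (Fin d → ℝ) → ℝ≥0∞) :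
    ∫⁻ ξ : EuclideanSpace ℝ (Fin d), F (fun j => h j * (2 * Real.pi * ξ j)) =
      ENNReal.ofReal (((2 * Real.pi) ^ d)⁻¹ * (∏ j, h j)⁻¹) * ∫⁻ x, F x := by
  rw [lintegral_comp_ofLp (fun x => F (fun j => h j * (2 * Real.pi * x j)))]
  have := lintegral_comp_mul_pi (c := fun j => h j * (2 * Real.pi))
    (fun j => mul_pos (hh j) (by positivity)) F
  simp only [mul_assoc] at this ⊢
  rw [this]
  congr 2
  rw [Finset.prod_mul_distrib, mul_inv, Finset.prod_const, Finset.card_univ, Fintype.card_fin,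
    mul_comm]

end Bounds

end Setting

end ConvDensity

/-! ### Sup-norm and `L_2` bounds for the deconvolution kernel. -/

namespace ConvDensity

variable {d : ℕ}

namespace Setting

open FourierTransform

theorem Valid.integrable_K {S : Setting d} (hS : S.Valid) (hd : 1 ≤ d) : Integrable S.K :=
  Integrable.fintype_prod (f := fun _ => S.𝒦) fun _ => hS.integrable_univariate hd

theorem continuous_fourierTr {U : (Fin d → ℝ) → ℝ} (hU : Integrable U) :
    Continuous (fourierTr U) := by
  have hk : Integrable fun v : EuclideanSpace ℝ (Fin d) => (U v.ofLp : ℂ) :=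
    ((PiLp.volume_preserving_ofLp (Fin d)).integrable_comp_of_integrable hU).ofReal
  have h := continuous_fourier_of_integrable hk
  have h2 : Continuous fun t : Fin d → ℝ =>
      𝓕 (fun v : EuclideanSpace ℝ (Fin d) => (U v.ofLp : ℂ))
        (WithLp.toLp 2 (fun j => t j / (2 * Real.pi))) :=
    h.comp ((PiLp.continuous_toLp 2 _).comp (by fun_prop))
  refine h2.congr fun t => ?_
  rw [fourier_comp_ofLp]
  congr 1 with j
  have := Real.pi_pos
  simp only
  field_simp

/-- The weight `(∏ h_j (h_j ∧ 1)^{λ_j})⁻¹`. -/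
noncomputable def weight (S : Setting d) (h : Fin d → ℝ) : ℝ :=
  (∏ j, h j * min (h j) 1 ^ S.lam j)⁻¹

theorem weight_nonneg (S : Setting d) {h : Fin d → ℝ} (hh : ∀ j, 0 < h j) : 0 ≤ S.weight h :=
  inv_nonneg.2 (Finset.prod_nonneg fun j _ =>
    mul_nonneg (hh j).le (Real.rpow_nonneg (le_min (hh j).le zero_le_one) _))

theorem weight_pos (S : Setting d) {h : Fin d → ℝ} (hh : ∀ j, 0 < h j) : 0 < S.weight h :=
  inv_pos.2 (Finset.prod_pos fun j _ =>
    mul_pos (hh j) (Real.rpow_pos_of_pos (lt_min (hh j) zero_lt_one) _))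

/-- For `α = 1` the assumption on `k₁` gives the bound directly. Otherwise `Minf` contains a Bochner
integral, and the assumption, whose weights equal one because `λ = 0`, is needed first to know that
the integrand is integrable. -/
theorem Valid.lintegral_fourierTr_le {S : Setting d} (hS : S.Valid) (hd : 1 ≤ d) :
    ENNReal.ofReal (S.noiseConst⁻¹ * ((2 * Real.pi) ^ d)⁻¹) *
      ∫⁻ t : Fin d → ℝ,
        ENNReal.ofReal (‖fourierTr S.K t‖ * ∏ j, (1 + t j ^ 2) ^ (S.lam j / 2)) ≤
      ENNReal.ofReal S.Minf := by
  have hc := inv_nonneg.2 hS.noiseConst_pos.le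
  have hpi : 0 ≤ ((2 * Real.pi) ^ d)⁻¹ := by positivity
  by_cases hα : S.α = 1
  · refine (mul_le_mul_right hS.kernel_fourier_one _).trans ?_
    rw [← ENNReal.ofReal_mul (by positivity)]
    refine ENNReal.ofReal_le_ofReal (le_trans (le_of_eq ?_) (le_max_left _ _))
    simp only [noiseConst, hα, if_true]
    ring
  · have h1 : ∀ t : Fin d → ℝ, ∏ j, (1 + t j ^ 2) ^ (S.lam j / 2) = 1 := by
      intro t
      simp [lam, hα]
    have hfin := hS.kernel_fourier_one
    simp only [h1, mul_one] at hfin ⊢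
    have hint : Integrable fun t => ‖fourierTr S.K t‖ := by
      refine ⟨(continuous_fourierTr (hS.integrable_K hd)).norm.aestronglyMeasurable, ?_⟩
      rw [hasFiniteIntegral_iff_norm]
      simp only [norm_norm]
      exact hfin.trans_lt ENNReal.ofReal_lt_top
    rw [← ofReal_integral_eq_lintegral_ofReal hint (Filter.Eventually.of_forall fun t => norm_nonneg _),
      ← ENNReal.ofReal_mul (by positivity)]
    refine ENNReal.ofReal_le_ofReal (le_trans (le_of_eq ?_) (le_max_left _ _))
    simp only [noiseConst, hα, if_false]
    ring

theorem prod_rpow_sq_inv (S : Setting d) {h : Fin d → ℝ} :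
    S.weight h = (∏ j, h j)⁻¹ * (∏ j, min (h j) 1 ^ S.lam j)⁻¹ := by
  rw [weight, Finset.prod_mul_distrib, mul_inv]

theorem memLp_comp_ofLp {f : (Fin d → ℝ) → ℝ} (hf : MemLp f 2) :
    MemLp (fun v : EuclideanSpace ℝ (Fin d) => (f v.ofLp : ℂ)) 2 :=
  (hf.comp_measurePreserving (PiLp.volume_preserving_ofLp (Fin d))).ofReal

/-- The sup-norm bound for the deconvolution kernel. -/
theorem IsDeconvKernel.ae_abs_le {S : Setting d} (hS : S.Valid) (hd : 1 ≤ d)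
    {M : (Fin d → ℝ) → (Fin d → ℝ) → ℝ} (hM : S.IsDeconvKernel M) {h : Fin d → ℝ}
    (hh : ∀ j, 0 < h j) : ∀ᵐ y, |M y h| ≤ S.Minf * S.weight h := by
  have hN := memLp_comp_ofLp (hM h hh).2.1
  have henv := hM.exists_fourier_le hS hd hh hN
  set FN := (𝓕 (hN.toLp _) : L2C (EuclideanSpace ℝ (Fin d))) with hFN
  have hc := inv_nonneg.2 hS.noiseConst_pos.le
  have hm : 0 ≤ (∏ j, min (h j) 1 ^ S.lam j)⁻¹ := inv_nonneg.2 (Finset.prod_nonneg fun j _ =>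
    Real.rpow_nonneg (le_min (hh j).le zero_le_one) _)
  have hph : 0 ≤ (∏ j, h j)⁻¹ := inv_nonneg.2 (Finset.prod_nonneg fun j _ => (hh j).le)
  have hM1 : 1 ≤ S.Minf := le_max_right _ _
  -- The substitution `t_j = 2π h_j ξ_j` in the envelope produces `(2π)^{-d} ∏ h_j⁻¹`. The kernel is
  -- then the inverse transform of an integrable function and is bounded by the `L¹` norm of that
  -- function.
  have hint : ∫⁻ ξ, ENNReal.ofReal ‖FN ξ‖ ≤ ENNReal.ofReal (S.Minf * S.weight h) := by
    calc ∫⁻ ξ, ENNReal.ofReal ‖FN ξ‖ ≤ ∫⁻ ξ : EuclideanSpace ℝ (Fin d),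
          ENNReal.ofReal (S.noiseConst⁻¹ * (∏ j, min (h j) 1 ^ S.lam j)⁻¹ *
        (‖fourierTr S.K (fun j => h j * (2 * Real.pi * ξ j))‖ *
          ∏ j, (1 + (h j * (2 * Real.pi * ξ j)) ^ 2) ^ (S.lam j / 2))) := by
          refine lintegral_mono_ae ?_
          filter_upwards [henv] with ξ hξ
          exact ENNReal.ofReal_le_ofReal hξ
      _ = ENNReal.ofReal (S.noiseConst⁻¹ * (∏ j, min (h j) 1 ^ S.lam j)⁻¹) *
          ∫⁻ ξ : EuclideanSpace ℝ (Fin d),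
            ENNReal.ofReal ((‖fourierTr S.K (fun j => h j * (2 * Real.pi * ξ j))‖ *
            ∏ j, (1 + (h j * (2 * Real.pi * ξ j)) ^ 2) ^ (S.lam j / 2))) := by
          rw [← lintegral_const_mul' _ _ ENNReal.ofReal_ne_top]
          simp_rw [← ENNReal.ofReal_mul (mul_nonneg hc hm)]
      _ = ENNReal.ofReal (S.noiseConst⁻¹ * (∏ j, min (h j) 1 ^ S.lam j)⁻¹) *
          (ENNReal.ofReal (((2 * Real.pi) ^ d)⁻¹ * (∏ j, h j)⁻¹) * ∫⁻ t : Fin d → ℝ,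
        ENNReal.ofReal (‖fourierTr S.K t‖ * ∏ j, (1 + t j ^ 2) ^ (S.lam j / 2))) := by
          rw [← lintegral_comp_two_pi_mul hh (fun t =>
            ENNReal.ofReal (‖fourierTr S.K t‖ * ∏ j, (1 + t j ^ 2) ^ (S.lam j / 2)))]
      _ = ENNReal.ofReal (S.weight h) * (ENNReal.ofReal (S.noiseConst⁻¹ * ((2 * Real.pi) ^ d)⁻¹) *
      ∫⁻ t : Fin d → ℝ,
        ENNReal.ofReal (‖fourierTr S.K t‖ * ∏ j, (1 + t j ^ 2) ^ (S.lam j / 2))) := by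
          rw [← mul_assoc, ← mul_assoc, ← ENNReal.ofReal_mul (by positivity),
            ← ENNReal.ofReal_mul (S.weight_nonneg hh)]
          congr 2
          rw [prod_rpow_sq_inv]
          ring
      _ ≤ ENNReal.ofReal (S.weight h) * ENNReal.ofReal S.Minf := by
          gcongr
          exact hS.lintegral_fourierTr_le hd
      _ = _ := by rw [← ENNReal.ofReal_mul (S.weight_nonneg hh), mul_comm]
  have hFNi : Integrable (FN : EuclideanSpace ℝ (Fin d) → ℂ) := by
    refine ⟨(Lp.memLp FN).1, ?_⟩
    rw [hasFiniteIntegral_iff_norm]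
    exact hint.trans_lt ENNReal.ofReal_lt_top
  have h1 := ae_eq_fourierInv_of_integrable (hN.toLp _) hFNi
  have h2 : ∀ᵐ v : EuclideanSpace ℝ (Fin d), |M v.ofLp h| ≤ S.Minf * S.weight h := by
    filter_upwards [h1, hN.coeFn_toLp] with v hv hv2
    have hw : 0 ≤ S.weight h := S.weight_nonneg hh
    have : |M v.ofLp h| = ‖𝓕⁻ (FN : EuclideanSpace ℝ (Fin d) → ℂ) v‖ := by
      rw [← hv, hv2, Complex.norm_real, Real.norm_eq_abs]
    rw [this, Real.fourierInv_eq]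
    refine (norm_integral_le_integral_norm _).trans ?_
    simp only [Circle.norm_smul]
    rw [integral_eq_lintegral_of_nonneg_ae (Filter.Eventually.of_forall fun _ => norm_nonneg _)
      hFNi.1.norm]
    exact ENNReal.toReal_le_of_le_ofReal (by positivity) hint
  exact (PiLp.volume_preserving_toLp (Fin d)).quasiMeasurePreserving.ae h2

/-- The `L_2`-bound for the deconvolution kernel. -/
theorem IsDeconvKernel.lintegral_sq_le {S : Setting d} (hS : S.Valid) (hd : 1 ≤ d)
    {M : (Fin d → ℝ) → (Fin d → ℝ) → ℝ} (hM : S.IsDeconvKernel M) :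
    ∃ C : ℝ≥0, ∀ h : Fin d → ℝ, (∀ j, 0 < h j) →
      ∫⁻ y, ENNReal.ofReal (M y h ^ 2) ≤
        C * ENNReal.ofReal (S.weight h ^ 2 * ∏ j, h j) := by
  refine ⟨Real.toNNReal ((S.noiseConst⁻¹) ^ 2 * ((2 * Real.pi) ^ d)⁻¹ * S.k₂ ^ 2),
    fun h hh => ?_⟩
  have hN := memLp_comp_ofLp (hM h hh).2.1
  have henv := hM.exists_fourier_le hS hd hh hN
  set FN := (𝓕 (hN.toLp _) : L2C (EuclideanSpace ℝ (Fin d))) with hFN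
  have hc := inv_nonneg.2 hS.noiseConst_pos.le
  have hm : 0 ≤ (∏ j, min (h j) 1 ^ S.lam j)⁻¹ := inv_nonneg.2 (Finset.prod_nonneg fun j _ =>
    Real.rpow_nonneg (le_min (hh j).le zero_le_one) _)
  have hph : 0 < ∏ j, h j := Finset.prod_pos fun j _ => hh j
  have hpl : ∀ f : L2C (EuclideanSpace ℝ (Fin d)),
      ∫⁻ ξ, ENNReal.ofReal (‖f ξ‖ ^ 2) = ENNReal.ofReal (‖f‖ ^ 2) := by
    intro f
    rw [Lp.norm_def, ENNReal.ofReal_pow ENNReal.toReal_nonneg,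
      ENNReal.ofReal_toReal (Lp.eLpNorm_ne_top f)]
    have h2 := eLpNorm_nnreal_pow_eq_lintegral (p := 2) (μ := volume)
      (f := (f : EuclideanSpace ℝ (Fin d) → ℂ)) two_ne_zero
    simp only [ENNReal.coe_ofNat, NNReal.coe_ofNat, ENNReal.rpow_ofNat] at h2
    rw [h2]
    simp_rw [← ofReal_norm, ENNReal.ofReal_pow (norm_nonneg _)]
  -- Plancherel. The envelope squared is then integrated by the same substitution, which leaves the
  -- weight squared times `∏ h_j`.
  have e1 : ∫⁻ y, ENNReal.ofReal (M y h ^ 2) = ∫⁻ ξ, ENNReal.ofReal (‖FN ξ‖ ^ 2) := by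
    rw [hpl, hFN, Lp.norm_fourier_eq, ← hpl, ← lintegral_comp_ofLp]
    refine lintegral_congr_ae ?_
    filter_upwards [hN.coeFn_toLp] with v hv
    rw [hv, Complex.norm_real, Real.norm_eq_abs, sq_abs]
  rw [e1]
  calc ∫⁻ ξ, ENNReal.ofReal (‖FN ξ‖ ^ 2) ≤ ∫⁻ ξ : EuclideanSpace ℝ (Fin d),
          ENNReal.ofReal ((S.noiseConst⁻¹ * (∏ j, min (h j) 1 ^ S.lam j)⁻¹) ^ 2 *
        (‖fourierTr S.K (fun j => h j * (2 * Real.pi * ξ j))‖ ^ 2 *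
          ∏ j, (1 + (h j * (2 * Real.pi * ξ j)) ^ 2) ^ (S.lam j))) := by
          refine lintegral_mono_ae ?_
          filter_upwards [henv] with ξ hξ
          refine ENNReal.ofReal_le_ofReal ?_
          refine (pow_le_pow_left₀ (norm_nonneg _) hξ 2).trans (le_of_eq ?_)
          rw [mul_pow, mul_pow (‖fourierTr S.K _‖), ← Finset.prod_pow]
          congr 2
          refine Finset.prod_congr rfl fun j _ => ?_
          rw [← Real.rpow_natCast, ← Real.rpow_mul (by positivity)]
          congr 1
          push_cast; ring
      _ = ENNReal.ofReal ((S.noiseConst⁻¹ * (∏ j, min (h j) 1 ^ S.lam j)⁻¹) ^ 2) *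
          ∫⁻ ξ : EuclideanSpace ℝ (Fin d),
            ENNReal.ofReal ((‖fourierTr S.K (fun j => h j * (2 * Real.pi * ξ j))‖ ^ 2 *
            ∏ j, (1 + (h j * (2 * Real.pi * ξ j)) ^ 2) ^ (S.lam j))) := by
          rw [← lintegral_const_mul' _ _ ENNReal.ofReal_ne_top]
          simp_rw [← ENNReal.ofReal_mul (sq_nonneg (S.noiseConst⁻¹ * _))]
      _ = ENNReal.ofReal ((S.noiseConst⁻¹ * (∏ j, min (h j) 1 ^ S.lam j)⁻¹) ^ 2) *
          (ENNReal.ofReal (((2 * Real.pi) ^ d)⁻¹ * (∏ j, h j)⁻¹) * ∫⁻ t : Fin d → ℝ,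
        ENNReal.ofReal (‖fourierTr S.K t‖ ^ 2 * ∏ j, (1 + t j ^ 2) ^ (S.lam j))) := by
          rw [← lintegral_comp_two_pi_mul hh (fun t =>
            ENNReal.ofReal (‖fourierTr S.K t‖ ^ 2 * ∏ j, (1 + t j ^ 2) ^ (S.lam j)))]
      _ ≤ ENNReal.ofReal ((S.noiseConst⁻¹ * (∏ j, min (h j) 1 ^ S.lam j)⁻¹) ^ 2) *
          (ENNReal.ofReal (((2 * Real.pi) ^ d)⁻¹ * (∏ j, h j)⁻¹) * ENNReal.ofReal (S.k₂ ^ 2)) := by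
          gcongr
          exact hS.kernel_fourier_two
      _ = _ := by
          rw [← ENNReal.ofReal_mul (by positivity), ← ENNReal.ofReal_mul (by positivity),
            ENNReal.ofNNReal_toNNReal, ← ENNReal.ofReal_mul (by positivity), prod_rpow_sq_inv]
          congr 1
          field_simp

end Setting

end ConvDensity

/-! ### Averages in successive coordinates. -/

namespace ConvDensity

section CoordinateAverages

variable {d : ℕ}

/-- The average of `φ` in the `i`-th coordinate against the kernel `k` centred at `x i`. -/
noncomputable def coordAvg (k : ℝ → ℝ≥0∞) (i : Fin d) (φ : (Fin d → ℝ) → ℝ≥0∞) (x : Fin d → ℝ) :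
    ℝ≥0∞ :=
  ∫⁻ t, k (t - x i) * φ (Function.update x i t)

/-- Successive coordinate averages along a list of coordinates. -/
noncomputable def iterAvg (k : Fin d → ℝ → ℝ≥0∞) :
    List (Fin d) → ((Fin d → ℝ) → ℝ≥0∞) → (Fin d → ℝ) → ℝ≥0∞
  | [], φ => φ
  | i :: l, φ => coordAvg (k i) i (iterAvg k l φ)

theorem measurable_coordAvg {k : ℝ → ℝ≥0∞} (hk : Measurable k) {i : Fin d}
    {φ : (Fin d → ℝ) → ℝ≥0∞} (hφ : Measurable φ) : Measurable (coordAvg k i φ) := by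
  refine Measurable.lintegral_prod_right'
    (f := fun q : (Fin d → ℝ) × ℝ => k (q.2 - q.1 i) * φ (Function.update q.1 i q.2)) ?_
  exact (hk.comp (by fun_prop)).mul (hφ.comp (measurable_update_prod i))

theorem measurable_iterAvg {k : Fin d → ℝ → ℝ≥0∞} (hk : ∀ i, Measurable (k i))
    {φ : (Fin d → ℝ) → ℝ≥0∞} (hφ : Measurable φ) :
    ∀ l : List (Fin d), Measurable (iterAvg k l φ)
  | [] => hφ
  | i :: l => measurable_coordAvg (hk i) (measurable_iterAvg hk hφ l)

theorem coordAvg_mono {k : ℝ → ℝ≥0∞} {i : Fin d} {φ φ' : (Fin d → ℝ) → ℝ≥0∞} (h : φ ≤ φ') :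
    coordAvg k i φ ≤ coordAvg k i φ' :=
  fun _ => lintegral_mono fun _ => mul_le_mul_right (h _) _

theorem iterAvg_mono {k : Fin d → ℝ → ℝ≥0∞} {φ φ' : (Fin d → ℝ) → ℝ≥0∞} (h : φ ≤ φ') :
    ∀ l : List (Fin d), iterAvg k l φ ≤ iterAvg k l φ'
  | [] => h
  | _ :: l => coordAvg_mono (iterAvg_mono h l)

/-- Tonelli, one coordinate at a time. Since no coordinate is repeated, updating one of them does
not move the centres of the averages still to be taken. -/
theorem lmarginal_prod_mul {k : Fin d → ℝ → ℝ≥0∞} (hk : ∀ i, Measurable (k i))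
    {φ : (Fin d → ℝ) → ℝ≥0∞} (hφ : Measurable φ) (l : List (Fin d)) (hl : l.Nodup)
    (x : Fin d → ℝ) :
    lmarginal (fun _ => volume) l.toFinset
      (fun y => (∏ i ∈ l.toFinset, k i (y i - x i)) * φ y) x = iterAvg k l φ x := by
  induction l generalizing x with
  | nil => simp [iterAvg]
  | cons i l ih =>
    rw [List.nodup_cons] at hl
    have hi : i ∉ l.toFinset := by simpa using hl.1
    have hm : ∀ (s : Finset (Fin d)) (x : Fin d → ℝ),
        Measurable fun y : Fin d → ℝ => (∏ i ∈ s, k i (y i - x i)) * φ y := fun s x =>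
      (Finset.measurable_prod _ fun i _ => (hk i).comp (by fun_prop)).mul hφ
    rw [List.toFinset_cons, lmarginal_insert _ (hm _ _) hi]
    simp only [iterAvg, coordAvg]
    refine lintegral_congr fun t => ?_
    rw [← ih hl.2]
    simp only [lmarginal]
    rw [← lintegral_const_mul]
    · refine lintegral_congr fun y => ?_
      rw [Finset.prod_insert hi, mul_assoc]
      congr 2
      · congr 1
        simp [Function.updateFinset, hi]
      · refine Finset.prod_congr rfl fun j hj => ?_
        have hji : j ≠ i := fun h => hi (h ▸ hj)
        rw [Function.update_of_ne hji]
    · exact (hm _ _).comp measurable_updateFinset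

theorem lintegral_prod_mul_eq_iterAvg {k : Fin d → ℝ → ℝ≥0∞} (hk : ∀ i, Measurable (k i))
    {φ : (Fin d → ℝ) → ℝ≥0∞} (hφ : Measurable φ) {l : List (Fin d)} (hl : l.Nodup)
    (hu : ∀ i, i ∈ l) (x : Fin d → ℝ) :
    ∫⁻ y : Fin d → ℝ, (∏ i, k i (y i - x i)) * φ y = iterAvg k l φ x := by
  rw [← lmarginal_prod_mul hk hφ l hl, volume_pi, lintegral_eq_lmarginal_univ x]
  have : l.toFinset = Finset.univ := by ext i; simp [hu]
  rw [this]

/-- A coordinate average over a kernel of bounded height and support is dominated by the maximal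
function in that coordinate. -/
theorem coordAvg_le_hardyCoord {k : ℝ → ℝ≥0∞} {c B : ℝ} (hc : 0 < c) {m : ℤ}
    (hk : ∀ t, k t ≤ ENNReal.ofReal (B * (Real.exp m)⁻¹))
    (hk0 : ∀ t, c * Real.exp m < |t| → k t = 0) {i : Fin d} {φ ψ : (Fin d → ℝ) → ℝ≥0∞}
    {A : ℝ≥0∞} (h : ∀ x, φ x ≤ A * ψ x) (hψ : Measurable ψ) (x : Fin d → ℝ) :
    coordAvg k i φ x ≤ ENNReal.ofReal (2 * c * B) * A * hardyCoord c i ψ x := by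
  have hr : 0 < Real.exp m := Real.exp_pos _
  have hvol : volume (Metric.closedBall (x i) (c * Real.exp m)) =
      ENNReal.ofReal (2 * (c * Real.exp m)) := Real.volume_closedBall _ _
  calc coordAvg k i φ x ≤ ∫⁻ t in Metric.closedBall (x i) (c * Real.exp m),
        ENNReal.ofReal (B * (Real.exp m)⁻¹) * (A * ψ (Function.update x i t)) := by
        rw [← lintegral_indicator Metric.isClosed_closedBall.measurableSet]
        refine lintegral_mono fun t => ?_
        by_cases ht : t ∈ Metric.closedBall (x i) (c * Real.exp m)
        · rw [indicator_of_mem ht]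
          exact mul_le_mul' (hk _) (h _)
        · rw [indicator_of_notMem ht, hk0, zero_mul]
          rw [Metric.mem_closedBall, Real.dist_eq, not_le] at ht
          exact ht
    _ = ENNReal.ofReal (2 * c * B) * A * ((volume (Metric.closedBall (x i) (c * Real.exp m)))⁻¹ *
        ∫⁻ t in Metric.closedBall (x i) (c * Real.exp m), ψ (Function.update x i t)) := by
        have hm : Measurable fun t => ψ (Function.update x i t) :=
          hψ.comp (measurable_update x)
        rw [lintegral_const_mul _ (hm.const_mul _), lintegral_const_mul _ hm, hvol,
          ← ENNReal.ofReal_inv_of_pos (by positivity)]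
        have e : ENNReal.ofReal (B * (Real.exp m)⁻¹) =
            ENNReal.ofReal (2 * c * B) * ENNReal.ofReal (2 * (c * Real.exp m))⁻¹ := by
          rw [← ENNReal.ofReal_mul' (by positivity)]
          congr 1
          field_simp
        rw [e]
        ring
    _ ≤ _ := by
        gcongr
        exact le_iSup (fun m : ℤ => (volume (Metric.closedBall (x i) (c * Real.exp m)))⁻¹ *
          ∫⁻ t in Metric.closedBall (x i) (c * Real.exp m), ψ (Function.update x i t)) m

theorem iterAvg_le_iterHardy {k : Fin d → ℝ → ℝ≥0∞} {c B : ℝ} (hc : 0 < c) {l : List (Fin d)}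
    {m : Fin d → ℤ} (hk : ∀ i ∈ l, ∀ t, k i t ≤ ENNReal.ofReal (B * (Real.exp (m i))⁻¹))
    (hk0 : ∀ i ∈ l, ∀ t, c * Real.exp (m i) < |t| → k i t = 0) {φ : (Fin d → ℝ) → ℝ≥0∞}
    (hφ : Measurable φ) (x : Fin d → ℝ) :
    iterAvg k l φ x ≤ ENNReal.ofReal (2 * c * B) ^ l.length * iterHardy c l φ x := by
  induction l generalizing x with
  | nil => simp [iterAvg, iterHardy]
  | cons i l ih =>
    simp only [List.mem_cons, forall_eq_or_imp] at hk hk0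
    simp only [iterAvg, iterHardy, List.length_cons, pow_succ']
    exact coordAvg_le_hardyCoord hc hk.1 hk0.1 (ih hk.2 hk0.2) (measurable_iterHardy hφ l) x

theorem update_add_eq (x : Fin d → ℝ) (i : Fin d) (u : ℝ) :
    Function.update x i (x i + u) = x + u • Pi.single i (1 : ℝ) := by
  ext j
  rcases eq_or_ne j i with rfl | h
  · simp
  · simp [h]

/-- Young's inequality for coordinate averages. -/
theorem lintegral_coordAvg_rpow_le {k : ℝ → ℝ≥0∞} (hk : Measurable k) {s : ℝ} (hs : 1 ≤ s)
    {i : Fin d} {φ : (Fin d → ℝ) → ℝ≥0∞} (hφ : Measurable φ) :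
    ∫⁻ x, coordAvg k i φ x ^ s ≤ (∫⁻ t, k t) ^ s * ∫⁻ x, φ x ^ s := by
  have hs0 : 0 < s := by linarith
  have hshift : ∀ x : Fin d → ℝ, coordAvg k i φ x =
      ∫⁻ u, φ (x + u • Pi.single i (1 : ℝ)) ∂(volume.withDensity k) := by
    intro x
    have hm : Measurable fun u : ℝ => φ (x + u • Pi.single i (1 : ℝ)) :=
      hφ.comp (by fun_prop)
    rw [lintegral_withDensity_eq_lintegral_mul _ hk hm, coordAvg,
      ← lintegral_add_left_eq_self _ (x i)]
    simp [update_add_eq]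
  -- Jensen's inequality for the finite measure with density `k`, in unnormalised form. Integrating
  -- in `x` and using translation invariance then gives the claim.
  have hJ : ∀ x : Fin d → ℝ, coordAvg k i φ x ^ s ≤ (∫⁻ t, k t) ^ (s - 1) *
      ∫⁻ u, k u * φ (x + u • Pi.single i (1 : ℝ)) ^ s := by
    intro x
    have hm : Measurable fun u : ℝ => φ (x + u • Pi.single i (1 : ℝ)) :=
      hφ.comp (by fun_prop)
    have h := eLpNorm_le_eLpNorm_mul_rpow_measure_univ (μ := volume.withDensity k)
      (p := 1) (q := ENNReal.ofReal s) (by simpa using ENNReal.ofReal_le_ofReal hs)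
      hm.aestronglyMeasurable
    rw [eLpNorm_one_eq_lintegral_enorm, eLpNorm_eq_lintegral_rpow_enorm_toReal
      (by simpa using hs0) ENNReal.ofReal_ne_top] at h
    simp only [enorm_eq_self, ENNReal.toReal_ofReal hs0.le, ENNReal.toReal_one] at h
    rw [withDensity_apply _ MeasurableSet.univ, setLIntegral_univ] at h
    rw [hshift]
    calc _ ≤ _ := ENNReal.rpow_le_rpow h hs0.le
      _ = _ := by
        rw [ENNReal.mul_rpow_of_nonneg _ _ hs0.le, ← ENNReal.rpow_mul, ← ENNReal.rpow_mul,
          one_div_mul_cancel hs0.ne', ENNReal.rpow_one, mul_comm,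
          lintegral_withDensity_eq_lintegral_mul _ hk (hm.pow_const s)]
        congr 2
        field_simp
  have hm2 : Measurable fun q : (Fin d → ℝ) × ℝ => k q.2 *
      φ (q.1 + q.2 • Pi.single i (1 : ℝ)) ^ s :=
    (hk.comp measurable_snd).mul ((hφ.comp (by fun_prop)).pow_const s)
  have hpow : (∫⁻ t, k t) ^ s = (∫⁻ t, k t) ^ (s - 1) * ∫⁻ t, k t := by
    conv_rhs => rw [← ENNReal.rpow_one (∫⁻ t, k t), ← ENNReal.rpow_mul, one_mul,
      ← ENNReal.rpow_add_of_nonneg _ _ (by linarith) zero_le_one]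
    simp
  calc ∫⁻ x, coordAvg k i φ x ^ s ≤ ∫⁻ x, (∫⁻ t, k t) ^ (s - 1) *
      ∫⁻ u, k u * φ (x + u • Pi.single i (1 : ℝ)) ^ s := lintegral_mono hJ
    _ = (∫⁻ t, k t) ^ (s - 1) * ∫⁻ u, ∫⁻ x, k u * φ (x + u • Pi.single i (1 : ℝ)) ^ s := by
        rw [lintegral_const_mul _ hm2.lintegral_prod_right', lintegral_lintegral_swap hm2.aemeasurable]
    _ = (∫⁻ t, k t) ^ (s - 1) * ∫⁻ u, k u * ∫⁻ x, φ x ^ s := by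
        congr 1
        refine lintegral_congr fun u => ?_
        have hm : Measurable fun x : Fin d → ℝ => φ (x + u • Pi.single i (1 : ℝ)) ^ s :=
          (hφ.comp (measurable_id.add_const _)).pow_const s
        rw [lintegral_const_mul _ hm, lintegral_add_right_eq_self (fun x => φ x ^ s)]
    _ = _ := by rw [lintegral_mul_const _ hk, hpow, mul_assoc]

theorem lintegral_iterAvg_rpow_le {k : Fin d → ℝ → ℝ≥0∞} (hk : ∀ i, Measurable (k i)) {A : ℝ≥0∞}
    (hA : ∀ i, ∫⁻ t, k i t ≤ A) {s : ℝ} (hs : 1 ≤ s) {φ : (Fin d → ℝ) → ℝ≥0∞}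
    (hφ : Measurable φ) (l : List (Fin d)) :
    ∫⁻ x, iterAvg k l φ x ^ s ≤ (A ^ s) ^ l.length * ∫⁻ x, φ x ^ s := by
  induction l with
  | nil => simp [iterAvg]
  | cons i l ih =>
    simp only [iterAvg, List.length_cons, pow_succ', mul_assoc]
    refine (lintegral_coordAvg_rpow_le (hk i) hs (measurable_iterAvg hk hφ l)).trans ?_
    gcongr
    exact hA i

/-- Fubini, with the `j`-th variable integrated inside the norm. The probability density `ρ` in that
variable is a dummy: it keeps the outer integral on all of `ℝ^d`, so that product formulas in all
coordinates remain applicable. -/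
theorem enorm_integral_le_lintegral_coord {G : (Fin d → ℝ) → ℝ} (hG : Integrable G) (j : Fin d)
    {ρ : ℝ → ℝ≥0∞} (hρ : Measurable ρ) (hρ1 : ∫⁻ t, ρ t = 1) :
    ‖∫ y, G y‖ₑ ≤ ∫⁻ y : Fin d → ℝ, ρ (y j) * ‖∫ t, G (Function.update y j t)‖ₑ := by
  obtain ⟨m, rfl⟩ : ∃ m, d = m + 1 := ⟨d - 1, by have := j.pos; omega⟩
  set e := MeasurableEquiv.piFinSuccAbove (fun _ : Fin (m + 1) => ℝ) j with he
  have hmp : MeasurePreserving e.symm volume volume :=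
    (volume_preserving_piFinSuccAbove (fun _ : Fin (m + 1) => ℝ) j).symm e
  have hes : ∀ q : ℝ × (Fin m → ℝ), e.symm q = j.insertNth q.1 q.2 := fun q => rfl
  rw [← hmp.integral_comp e.symm.measurableEmbedding, ← hmp.lintegral_comp_emb
    e.symm.measurableEmbedding]
  have hGi : Integrable (fun q => G (e.symm q)) (volume.prod volume) :=
    hmp.integrable_comp_of_integrable hG
  change ‖∫ q, G (e.symm q) ∂(volume.prod volume)‖ₑ ≤ ∫⁻ q, _ ∂(volume.prod volume)
  rw [integral_prod_symm _ hGi]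
  refine (enorm_integral_le_lintegral_enorm _).trans (le_of_eq ?_)
  simp only [hes, Fin.insertNth_apply_same, Fin.update_insertNth]
  have hm : AEMeasurable (fun y : Fin m → ℝ => ‖∫ t, G (j.insertNth t y)‖ₑ) :=
    (hGi.integral_prod_right).1.enorm
  rw [lintegral_prod_mul (g := fun y : Fin m → ℝ => ‖∫ t, G (j.insertNth t y)‖ₑ)
    hρ.aemeasurable hm, hρ1, one_mul]

theorem ae_integrable_update {G : (Fin d → ℝ) → ℝ} (hG : Integrable G) (j : Fin d) :
    ∀ᵐ y : Fin d → ℝ, Integrable fun t => G (Function.update y j t) := by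
  obtain ⟨m, rfl⟩ : ∃ m, d = m + 1 := ⟨d - 1, by have := j.pos; omega⟩
  set e := MeasurableEquiv.piFinSuccAbove (fun _ : Fin (m + 1) => ℝ) j with he
  have hmp' := volume_preserving_piFinSuccAbove (fun _ : Fin (m + 1) => ℝ) j
  have hmp : MeasurePreserving e.symm volume volume := hmp'.symm e
  have hGi : Integrable (fun q => G (e.symm q)) (volume.prod volume) :=
    hmp.integrable_comp_of_integrable hG
  have h1 := (Measure.quasiMeasurePreserving_snd (μ := (volume : Measure ℝ))).ae
    hGi.prod_left_ae
  have h2 := hmp'.quasiMeasurePreserving.ae h1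
  filter_upwards [h2] with y hy
  refine hy.congr (Filter.Eventually.of_forall fun t => ?_)
  dsimp only
  congr 1
  have : y = j.insertNth (e y).1 (e y).2 := (e.symm_apply_apply y).symm
  conv_rhs => rw [this, Fin.update_insertNth]
  rfl

end CoordinateAverages

end ConvDensity

/-! ### Kernel smoothers and the effect of changing one bandwidth. -/

namespace ConvDensity

variable {d : ℕ}

namespace Setting

/-- The kernel smoother `∫ K_h(y - x) f(y) dy`. -/
noncomputable def smooth (S : Setting d) (h : Fin d → ℝ) (f : (Fin d → ℝ) → ℝ) (x : Fin d → ℝ) : ℝ :=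
  ∫ y, S.Kh h (y - x) * f y

theorem measurable_bStar {S : Setting d} (hS : S.Valid) (hd : 1 ≤ d) {f : (Fin d → ℝ) → ℝ}
    (hf : Measurable f) (h : ℝ) (j : Fin d) : Measurable (S.bStar h f j) := by
  refine ENNReal.measurable_ofReal.comp (measurable_norm.comp (Measurable.sub ?_ hf))
  have : Measurable fun q : (Fin d → ℝ) × ℝ =>
      S.𝒦 q.2 * f (q.1 + (q.2 * h) • Pi.single j (1 : ℝ)) :=
    ((hS.continuous_univariate hd).measurable.comp measurable_snd).mul
      (hf.comp (by fun_prop))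
  exact this.stronglyMeasurable.integral_prod_right.measurable

theorem countable_grid : grid.Countable := countable_range _

theorem measurable_bSup {S : Setting d} (hS : S.Valid) (hd : 1 ≤ d) {f : (Fin d → ℝ) → ℝ}
    (hf : Measurable f) (h : ℝ) (j : Fin d) : Measurable (S.bSup h f j) :=
  Measurable.biSup _ (countable_grid.mono fun _ hη => hη.1) fun η _ => measurable_bStar hS hd hf η j

theorem bStar_eq (S : Setting d) {h : ℝ} (hh : 0 < h) (f : (Fin d → ℝ) → ℝ) (j : Fin d)
    (x : Fin d → ℝ) : S.bStar h f j x =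
      ‖(∫ t, S.scaledKernel h (t - x j) * f (Function.update x j t)) - f x‖ₑ := by
  rw [bStar, ← Real.norm_eq_abs, ofReal_norm]
  congr 2
  have h1 := integral_add_left_eq_self (μ := volume)
    (fun t => S.scaledKernel h (t - x j) * f (Function.update x j t)) (x j)
  rw [← h1]
  have h2 := Measure.integral_comp_mul_right
    (fun t => S.scaledKernel h t * f (Function.update x j (x j + t))) h
  simp only [add_sub_cancel_left]
  have h3 : ∫ t, S.scaledKernel h t * f (Function.update x j (x j + t)) =
      h * ∫ t, S.scaledKernel h (t * h) * f (Function.update x j (x j + t * h)) := by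
    rw [h2, abs_of_pos (inv_pos.2 hh), smul_eq_mul, ← mul_assoc, mul_inv_cancel₀ hh.ne', one_mul]
  rw [h3, ← integral_const_mul]
  congr 1 with t
  rw [update_add_eq, scaledKernel, mul_div_cancel_right₀ _ hh.ne', ← mul_assoc, ← mul_assoc,
    mul_inv_cancel₀ hh.ne', one_mul]

/-- The coordinates other than `j`. -/
def _root_.ConvDensity.coordsExcept (j : Fin d) : List (Fin d) :=
  (List.finRange d).filter (· ≠ j)

theorem _root_.ConvDensity.nodup_coordsExcept (j : Fin d) : (coordsExcept j).Nodup :=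
  (List.nodup_finRange d).filter _

theorem _root_.ConvDensity.mem_coordsExcept {i j : Fin d} : i ∈ coordsExcept j ↔ i ≠ j := by
  simp [coordsExcept]

theorem _root_.ConvDensity.iterAvg_append (k : Fin d → ℝ → ℝ≥0∞) (l l' : List (Fin d))
    (φ : (Fin d → ℝ) → ℝ≥0∞) : iterAvg k (l ++ l') φ = iterAvg k l (iterAvg k l' φ) := by
  induction l with
  | nil => rfl
  | cons i l ih => simp [iterAvg, ih]

/-- Averages along coordinates other than `j` never leave the hyperplane on which the `j`-th
coordinate equals `a`. -/
theorem _root_.ConvDensity.iterAvg_congr {k k' : Fin d → ℝ → ℝ≥0∞} {l : List (Fin d)} {j : Fin d}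
    (hj : j ∉ l) (hk : ∀ i ∈ l, k i = k' i) {φ φ' : (Fin d → ℝ) → ℝ≥0∞} {a : ℝ}
    (h : ∀ x, x j = a → φ x = φ' x) (x : Fin d → ℝ) (hx : x j = a) :
    iterAvg k l φ x = iterAvg k' l φ' x := by
  induction l generalizing x with
  | nil => exact h x hx
  | cons i l ih =>
    simp only [List.mem_cons, forall_eq_or_imp, not_or] at hj hk
    simp only [iterAvg, coordAvg]
    refine lintegral_congr fun t => ?_
    rw [hk.1, ih hj.2 hk.2 _ (by rw [Function.update_of_ne hj.1, hx])]

theorem Valid.integrable_Kh_mul {S : Setting d} (hS : S.Valid) {f : (Fin d → ℝ) → ℝ}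
    (hfi : Integrable f) (h : Fin d → ℝ) (x : Fin d → ℝ) :
    Integrable fun y => S.Kh h (y - x) * f y := by
  obtain ⟨B, hB⟩ := hS.kernel_bounded
  refine hfi.bdd_mul (c := |(∏ j, h j)⁻¹| * |B| ^ d)
    ((hS.continuous_Kh h).comp (by fun_prop)).aestronglyMeasurable
    (Filter.Eventually.of_forall fun y => ?_)
  rw [Kh, Real.norm_eq_abs, abs_mul, K, Finset.abs_prod]
  gcongr
  refine (Finset.prod_le_prod (fun i _ => abs_nonneg _)
    fun i _ => (hB _).trans (le_abs_self B)).trans ?_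
  simp

/-- Changing the bandwidth in a single coordinate. -/
theorem enorm_smooth_update_sub_le {S : Setting d} (hS : S.Valid) {f : (Fin d → ℝ) → ℝ}
    (hf : Measurable f) (hfi : Integrable f) (h : Fin d → ℝ) (j : Fin d) {r r' : ℝ} (hr : 0 < r)
    (hr' : 0 < r') (x : Fin d → ℝ) :
    ‖S.smooth (Function.update h j r) f x - S.smooth (Function.update h j r') f x‖ₑ ≤
      iterAvg (fun i t => ‖S.scaledKernel (h i) t‖ₑ) (coordsExcept j)
        (fun y => S.bStar r f j y + S.bStar r' f j y) x := by
  have hd : 1 ≤ d := j.pos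
  set ψ : (Fin d → ℝ) → ℝ≥0∞ := fun y => S.bStar r f j y + S.bStar r' f j y with hψ
  have hψm : Measurable ψ := (measurable_bStar hS hd hf r j).add (measurable_bStar hS hd hf r' j)
  -- Any probability density would do; it is integrated out at the end.
  set ρ : ℝ → ℝ≥0∞ := (Icc (0 : ℝ) 1).indicator 1 with hρ
  have hρm : Measurable ρ := measurable_one.indicator measurableSet_Icc
  have hρ1 : ∫⁻ t, ρ t = 1 := by
    rw [hρ, lintegral_indicator_one measurableSet_Icc]; simp
  have hρ1' : ∀ a : ℝ, ∫⁻ t, ρ (t - a) = 1 := fun a => by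
    rw [lintegral_sub_right_eq_self, hρ1]
  set P : (Fin d → ℝ) → ℝ := fun y => ∏ i ∈ Finset.univ.erase j, S.scaledKernel (h i) (y i - x i)
    with hP
  have hprod : ∀ (r : ℝ) (y : Fin d → ℝ), S.Kh (Function.update h j r) (y - x) =
      S.scaledKernel r (y j - x j) * P y := by
    intro r y
    rw [Kh_eq_prod, ← Finset.mul_prod_erase _ _ (Finset.mem_univ j)]
    simp only [Function.update_self, Pi.sub_apply]
    congr 1
    refine Finset.prod_congr rfl fun i hi => ?_
    rw [Function.update_of_ne (Finset.ne_of_mem_erase hi)]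
  have hPu : ∀ (y : Fin d → ℝ) (t : ℝ), P (Function.update y j t) = P y := by
    intro y t
    refine Finset.prod_congr rfl fun i hi => ?_
    rw [Function.update_of_ne (Finset.ne_of_mem_erase hi)]
  have hG1 := hS.integrable_Kh_mul hfi (Function.update h j r) x
  have hG2 := hS.integrable_Kh_mul hfi (Function.update h j r') x
  have hsub : S.smooth (Function.update h j r) f x - S.smooth (Function.update h j r') f x =
      ∫ y, (S.Kh (Function.update h j r) (y - x) * f y -
        S.Kh (Function.update h j r') (y - x) * f y) := (integral_sub hG1 hG2).symm
  rw [hsub]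
  refine (enorm_integral_le_lintegral_coord (hG1.sub hG2) j (ρ := fun t => ρ (t - x j))
    (hρm.comp (by fun_prop)) (hρ1' _)).trans ?_
  obtain ⟨B, hB⟩ := hS.kernel_bounded
  -- On a line in direction `j` the other kernel factors are constant, and what remains is a
  -- difference of two one-dimensional smoothers. Subtracting and adding the value of `f` at the
  -- centre bounds it by the two biases `b*`.
  have hae : ∀ᵐ y : Fin d → ℝ, ‖∫ t, (S.Kh (Function.update h j r) (Function.update y j t - x) *
      f (Function.update y j t) - S.Kh (Function.update h j r') (Function.update y j t - x) *
      f (Function.update y j t))‖ₑ ≤ ‖P y‖ₑ * ψ (Function.update y j (x j)) := by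
    filter_upwards [ae_integrable_update hfi j] with y hy
    have hi : ∀ r : ℝ, Integrable fun t => S.scaledKernel r (t - x j) * f (Function.update y j t) := by
      intro r
      refine hy.bdd_mul (c := |r⁻¹| * B) ((hS.continuous_scaledKernel hd r).comp
        (by fun_prop)).aestronglyMeasurable (Filter.Eventually.of_forall fun t => ?_)
      rw [scaledKernel, Real.norm_eq_abs, abs_mul]
      exact mul_le_mul_of_nonneg_left (hB _) (abs_nonneg _)
    have e : (∫ t, (S.Kh (Function.update h j r) (Function.update y j t - x) *
      f (Function.update y j t) - S.Kh (Function.update h j r') (Function.update y j t - x) *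
      f (Function.update y j t))) = P y * ((∫ t, S.scaledKernel r (t - x j) *
        f (Function.update y j t)) - ∫ t, S.scaledKernel r' (t - x j) *
        f (Function.update y j t)) := by
      rw [← integral_sub (hi r) (hi r'), ← integral_const_mul]
      congr 1 with t
      simp only [hprod, hPu, Function.update_self]
      ring
    rw [e, enorm_mul]
    gcongr
    simp only [hψ, bStar_eq S hr, bStar_eq S hr', Function.update_self, Function.update_idem]
    generalize (∫ t, S.scaledKernel r (t - x j) * f (Function.update y j t)) = a
    generalize (∫ t, S.scaledKernel r' (t - x j) * f (Function.update y j t)) = b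
    generalize f (Function.update y j (x j)) = c
    calc ‖a - b‖ₑ = ‖(a - c) - (b - c)‖ₑ := by congr 1; ring
      _ ≤ _ := enorm_sub_le
  set k : Fin d → ℝ → ℝ≥0∞ := Function.update (fun i t => ‖S.scaledKernel (h i) t‖ₑ) j ρ with hk
  have hkm : ∀ i, Measurable (k i) := by
    intro i
    rcases eq_or_ne i j with rfl | hij
    · simpa [hk] using hρm
    · simpa [hk, hij] using (hS.continuous_scaledKernel hd (h i)).measurable.enorm
  have hk2 : ∀ y : Fin d → ℝ, ρ (y j - x j) * ‖P y‖ₑ = ∏ i, k i (y i - x i) := by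
    intro y
    rw [← Finset.mul_prod_erase _ _ (Finset.mem_univ j), hP]
    simp only [hk, Function.update_self]
    congr 1
    rw [enorm_eq_nnnorm, nnnorm_prod, ENNReal.ofNNReal_finsetProd]
    refine Finset.prod_congr rfl fun i hi => ?_
    rw [Function.update_of_ne (Finset.ne_of_mem_erase hi), enorm_eq_nnnorm]
  have hφm : Measurable fun y : Fin d → ℝ => ψ (Function.update y j (x j)) :=
    hψm.comp ((measurable_update_prod j).comp (measurable_id.prodMk measurable_const))
  calc _ ≤ ∫⁻ y : Fin d → ℝ, (∏ i, k i (y i - x i)) * ψ (Function.update y j (x j)) := by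
        refine lintegral_mono_ae ?_
        filter_upwards [hae] with y hy
        rw [← hk2, mul_assoc]
        exact mul_le_mul_right hy _
    _ = iterAvg k (coordsExcept j) (iterAvg k [j] fun y => ψ (Function.update y j (x j))) x := by
        rw [← iterAvg_append]
        refine lintegral_prod_mul_eq_iterAvg hkm hφm ?_ ?_ x
        · rw [List.nodup_append]
          refine ⟨nodup_coordsExcept j, List.nodup_singleton j, ?_⟩
          intro a ha b hb
          rw [List.mem_singleton] at hb
          rw [hb]
          exact mem_coordsExcept.1 ha
        · intro i
          rw [List.mem_append, mem_coordsExcept, List.mem_singleton]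
          exact (em (i = j)).symm
    _ = _ := by
        refine iterAvg_congr (a := x j) (fun h => mem_coordsExcept.1 h rfl) (fun i hi => ?_)
          (fun y hy => ?_) x rfl
        · simp only [hk]
          rw [Function.update_of_ne (mem_coordsExcept.1 hi)]
        · simp only [iterAvg, coordAvg, Function.update_idem, hk, Function.update_self]
          have hm : Measurable fun t => ρ (t - y j) := hρm.comp (by fun_prop)
          rw [lintegral_mul_const _ hm, hρ1', one_mul, ← hy,
            Function.update_eq_self]

/-- A telescoping sum over the coordinates of `s`. At each step a single coordinate moves from `E`
to `D`, the remaining ones being a mixture of the two. -/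
theorem _root_.ConvDensity.enorm_piecewise_sub_le {Φ : (Fin d → ℝ) → ℝ} {D E : Fin d → ℝ}
    {T : Fin d → ℝ≥0∞} {s : Finset (Fin d)}
    (hT : ∀ a : Finset (Fin d), ∀ j ∈ s, j ∉ a → a ⊆ s →
      ‖Φ (Function.update (a.piecewise D E) j (D j)) -
        Φ (Function.update (a.piecewise D E) j (E j))‖ₑ ≤ T j) :
    ‖Φ (s.piecewise D E) - Φ E‖ₑ ≤ ∑ j ∈ s, T j := by
  induction s using Finset.induction_on with
  | empty => simp
  | insert j s hj ih =>
    rw [Finset.sum_insert hj, Finset.piecewise_insert]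
    have h1 := hT s j (Finset.mem_insert_self j s) hj (Finset.subset_insert j s)
    have h2 : Function.update (s.piecewise D E) j (E j) = s.piecewise D E := by
      rw [Function.update_eq_iff]
      simp [hj]
    rw [h2] at h1
    calc _ = ‖(Φ (Function.update (s.piecewise D E) j (D j)) - Φ (s.piecewise D E)) +
          (Φ (s.piecewise D E) - Φ E)‖ₑ := by congr 1; ring
      _ ≤ _ := (enorm_add_le _ _).trans (add_le_add h1 (ih fun a i hi hia has =>
          hT a i (Finset.mem_insert_of_mem hi) hia (has.trans (Finset.subset_insert j s))))

theorem Valid.exists_enorm_scaledKernel_le {S : Setting d} (hS : S.Valid) :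
    ∃ B : ℝ, 0 < B ∧ ∀ (m : ℤ) (t : ℝ),
      ‖S.scaledKernel (Real.exp m) t‖ₑ ≤ ENNReal.ofReal (B * (Real.exp m)⁻¹) := by
  obtain ⟨B, hB⟩ := hS.kernel_bounded
  refine ⟨|B| + 1, by positivity, fun m t => ?_⟩
  rw [← ofReal_norm]
  refine ENNReal.ofReal_le_ofReal ?_
  rw [scaledKernel, Real.norm_eq_abs, abs_mul, abs_of_pos (inv_pos.2 (Real.exp_pos _)), mul_comm]
  gcongr
  exact (hB _).trans ((le_abs_self B).trans (by linarith))

/-- Averages against the kernel with bandwidths from the grid are dominated by the iterated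
maximal function. -/
theorem Valid.exists_iterAvg_le_iterHardy {S : Setting d} (hS : S.Valid) (l : List (Fin d)) :
    ∃ C : ℝ≥0, ∀ (h : Fin d → ℝ) (φ : (Fin d → ℝ) → ℝ≥0∞) (x : Fin d → ℝ),
      (∀ i, h i ∈ grid) → Measurable φ →
      iterAvg (fun i t => ‖S.scaledKernel (h i) t‖ₑ) l φ x ≤ C * iterHardy S.cK l φ x := by
  obtain ⟨B, hB0, hB⟩ := hS.exists_enorm_scaledKernel_le
  refine ⟨Real.toNNReal (2 * S.cK * B) ^ l.length, fun h φ x hh hφ => ?_⟩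
  choose m hm using hh
  rw [ENNReal.coe_pow]
  refine iterAvg_le_iterHardy hS.cK_pos (m := m) (B := B) (fun i _ t => ?_) (fun i _ t ht => ?_) hφ x
  · rw [← hm]; exact hB _ _
  · rw [← hm, enorm_eq_zero]
    exact hS.scaledKernel_eq_zero (Real.exp_pos _) ht

theorem enorm_smooth_le_iterAvg {S : Setting d} (hS : S.Valid) (hd : 1 ≤ d) {f : (Fin d → ℝ) → ℝ}
    (hf : Measurable f) (h : Fin d → ℝ) (x : Fin d → ℝ) :
    ‖S.smooth h f x‖ₑ ≤
      iterAvg (fun i t => ‖S.scaledKernel (h i) t‖ₑ) (List.finRange d) (fun y => ‖f y‖ₑ) x := by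
  rw [← lintegral_prod_mul_eq_iterAvg
    (fun i => (hS.continuous_scaledKernel hd (h i)).measurable.enorm) hf.enorm
    (List.nodup_finRange d) (List.mem_finRange)]
  refine (enorm_integral_le_lintegral_enorm _).trans (le_of_eq (lintegral_congr fun y => ?_))
  rw [enorm_mul, Kh_eq_prod]
  congr 1
  rw [enorm_eq_nnnorm, nnnorm_prod, ENNReal.ofNNReal_finsetProd]
  rfl

/-- For equal bandwidths the kernel lives on a ball of the sup norm and its height is comparable to
the inverse volume. One maximal function over cubes then suffices, and no logarithm is lost. -/
theorem Valid.exists_enorm_smooth_le_hardy {S : Setting d} (hS : S.Valid) :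
    ∃ C : ℝ≥0, ∀ (m : ℤ) (f : (Fin d → ℝ) → ℝ) (x : Fin d → ℝ),
      ∫⁻ y, ‖S.Kh (fun _ => Real.exp m) (y - x) * f y‖ₑ ≤
        C * ((volume (Metric.closedBall x (S.cK * Real.exp m)))⁻¹ *
          ∫⁻ y in Metric.closedBall x (S.cK * Real.exp m), ‖f y‖ₑ) := by
  obtain ⟨B, hB0, hB⟩ := hS.exists_enorm_scaledKernel_le
  refine ⟨Real.toNNReal (2 * S.cK * B) ^ d, fun m f x => ?_⟩
  have hc := hS.cK_pos
  have hr : 0 < S.cK * Real.exp m := mul_pos hc (Real.exp_pos _)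
  have hbound : ∀ y : Fin d → ℝ, ‖S.Kh (fun _ => Real.exp m) (y - x)‖ₑ ≤
      ENNReal.ofReal (B * (Real.exp m)⁻¹) ^ d := by
    intro y
    rw [Kh_eq_prod, enorm_eq_nnnorm, nnnorm_prod, ENNReal.ofNNReal_finsetProd]
    refine (Finset.prod_le_pow_card _ _ (ENNReal.ofReal (B * (Real.exp m)⁻¹))
      fun i _ => hB m _).trans ?_
    simp
  have hzero : ∀ y ∉ Metric.closedBall x (S.cK * Real.exp m),
      S.Kh (fun _ => Real.exp m) (y - x) = 0 := by
    intro y hy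
    rw [Metric.mem_closedBall, dist_pi_le_iff hr.le] at hy
    push Not at hy
    obtain ⟨i, hi⟩ := hy
    rw [Kh_eq_prod]
    exact Finset.prod_eq_zero (Finset.mem_univ i) (hS.scaledKernel_eq_zero (Real.exp_pos _) hi)
  have hvol : volume (Metric.closedBall x (S.cK * Real.exp m)) =
      ENNReal.ofReal (2 * (S.cK * Real.exp m)) ^ d := by
    rw [Real.volume_pi_closedBall _ hr.le, ENNReal.ofReal_pow (by positivity)]
    simp
  calc _ ≤ ∫⁻ y in Metric.closedBall x (S.cK * Real.exp m),
        ENNReal.ofReal (B * (Real.exp m)⁻¹) ^ d * ‖f y‖ₑ := by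
        rw [← lintegral_indicator Metric.isClosed_closedBall.measurableSet]
        refine lintegral_mono fun y => ?_
        by_cases hy : y ∈ Metric.closedBall x (S.cK * Real.exp m)
        · rw [indicator_of_mem hy, enorm_mul]
          exact mul_le_mul_left (hbound y) _
        · rw [indicator_of_notMem hy]
          simp [hzero y hy]
    _ = _ := by
        rw [lintegral_const_mul' _ _ (ENNReal.pow_ne_top ENNReal.ofReal_ne_top), hvol, ← mul_assoc,
          ENNReal.inv_pow, ENNReal.coe_pow, ← mul_pow, ← ENNReal.ofReal_inv_of_pos (by positivity),
          ENNReal.ofNNReal_toNNReal, ← ENNReal.ofReal_mul (by positivity)]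
        congr 3
        field_simp

theorem Valid.integral_Kh_sub {S : Setting d} (hS : S.Valid) {h : Fin d → ℝ} (hh : ∀ j, 0 < h j)
    (x : Fin d → ℝ) : ∫ y, S.Kh h (y - x) = 1 := by
  rw [integral_sub_right_eq_self (S.Kh h)]
  simp_rw [Kh_eq_prod]
  rw [integral_fintype_prod_volume_eq_prod (fun j => S.scaledKernel (h j))]
  exact Finset.prod_eq_one fun j _ => hS.integral_scaledKernel (hh j)

/-- The kernel smoothers converge almost everywhere as the bandwidth tends to `0`. -/
theorem Valid.ae_tendsto_smooth {S : Setting d} (hS : S.Valid) (hd : 1 ≤ d) {f : (Fin d → ℝ) → ℝ}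
    (hfi : Integrable f) :
    ∀ᵐ x, Filter.Tendsto (fun k : ℕ => S.smooth (fun _ => Real.exp ((-k : ℤ) : ℝ)) f x)
      Filter.atTop (nhds (f x)) := by
  obtain ⟨C, hC⟩ := hS.exists_enorm_smooth_le_hardy
  have hc := hS.cK_pos
  -- Lebesgue's differentiation theorem: since the kernel has integral one, the error of the
  -- smoother is at most a constant times the mean of `|f - f x|` over a shrinking ball.
  filter_upwards [IsUnifLocDoublingMeasure.ae_tendsto_average_norm_sub volume
    hfi.locallyIntegrable 1] with x hx
  have hδ : Filter.Tendsto (fun k : ℕ => S.cK * Real.exp ((-k : ℤ) : ℝ)) Filter.atTop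
      (nhdsWithin 0 (Ioi 0)) := by
    rw [tendsto_nhdsWithin_iff]
    refine ⟨?_, Filter.Eventually.of_forall fun k => mul_pos hc (Real.exp_pos _)⟩
    have : Filter.Tendsto (fun k : ℕ => Real.exp (-(k : ℝ))) Filter.atTop (nhds 0) :=
      Real.tendsto_exp_neg_atTop_nhds_zero.comp tendsto_natCast_atTop_atTop
    simpa using this.const_mul S.cK
  have h1 := hx (fun _ : ℕ => x) (fun k : ℕ => S.cK * Real.exp ((-k : ℤ) : ℝ)) hδ
    (Filter.Eventually.of_forall fun k => Metric.mem_closedBall_self (by positivity))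
  rw [tendsto_iff_norm_sub_tendsto_zero]
  refine squeeze_zero (fun _ => norm_nonneg _) (fun k => ?_) (by simpa only [mul_zero] using h1.const_mul (C : ℝ))
  have hfl : IntegrableOn (fun y => f y - f x)
      (Metric.closedBall x (S.cK * Real.exp ((-k : ℤ) : ℝ))) :=
    hfi.integrableOn.sub (integrableOn_const (measure_closedBall_lt_top.ne))
  have hK : Integrable fun y => S.Kh (fun _ => Real.exp ((-k : ℤ) : ℝ)) (y - x) :=
    (hS.integrable_Kh hd fun _ => Real.exp_pos _).comp_sub_right x
  have e : S.smooth (fun _ => Real.exp ((-k : ℤ) : ℝ)) f x - f x =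
      ∫ y, S.Kh (fun _ => Real.exp ((-k : ℤ) : ℝ)) (y - x) * (f y - f x) := by
    simp_rw [mul_sub]
    rw [integral_sub (hS.integrable_Kh_mul hfi _ x) (hK.mul_const _), integral_mul_const,
      hS.integral_Kh_sub (fun _ => Real.exp_pos _), one_mul]
    rfl
  rw [e]
  have h2 := (enorm_integral_le_lintegral_enorm _).trans (hC (-k : ℤ) (fun y => f y - f x) x)
  have h3 := ENNReal.toReal_mono (ENNReal.mul_ne_top ENNReal.coe_ne_top (ENNReal.mul_ne_top
    (ENNReal.inv_ne_top.2 (Metric.measure_closedBall_pos _ _ (by positivity)).ne') hfl.2.ne)) h2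
  rw [toReal_enorm, ENNReal.toReal_mul, ENNReal.toReal_mul, ENNReal.toReal_inv,
    ← integral_norm_eq_lintegral_enorm hfl.1] at h3
  rw [average_eq, smul_eq_mul, measureReal_restrict_apply_univ]
  exact h3

end Setting

end ConvDensity

/-! ### Control of the bias terms by maximal functions. -/

namespace ConvDensity

variable {d : ℕ}

theorem eLpNorm_ofReal_rpow {X : Type*} [MeasurableSpace X] {μ : Measure X} {s : ℝ} (hs : 0 < s)
    (φ : X → ℝ≥0∞) : eLpNorm φ (ENNReal.ofReal s) μ ^ s = ∫⁻ x, φ x ^ s ∂μ := by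
  rw [eLpNorm_eq_lintegral_rpow_enorm_toReal (by simpa using hs) ENNReal.ofReal_ne_top,
    ENNReal.toReal_ofReal hs.le, ← ENNReal.rpow_mul, one_div_mul_cancel hs.ne', ENNReal.rpow_one]
  simp

/-- Minkowski's inequality for series. -/
theorem lintegral_tsum_rpow_le {X : Type*} [MeasurableSpace X] {μ : Measure X} {s : ℝ} (hs : 1 ≤ s)
    {T : ℕ → X → ℝ≥0∞} (hT : ∀ k, Measurable (T k)) :
    ∫⁻ x, (∑' k, T k x) ^ s ∂μ ≤ (∑' k, eLpNorm (T k) (ENNReal.ofReal s) μ) ^ s := by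
  have hs0 : 0 < s := by linarith
  have hfin : ∀ N, ∫⁻ x, (∑ k ∈ Finset.range N, T k x) ^ s ∂μ ≤
      (∑' k, eLpNorm (T k) (ENNReal.ofReal s) μ) ^ s := by
    intro N
    have h := eLpNorm_sum_le (μ := μ) (p := ENNReal.ofReal s) (s := Finset.range N) (f := T)
      (fun k _ => (hT k).aestronglyMeasurable) (by simpa using ENNReal.ofReal_le_ofReal hs)
    have h2 := ENNReal.rpow_le_rpow (h.trans (ENNReal.sum_le_tsum _)) hs0.le
    rw [eLpNorm_ofReal_rpow hs0] at h2
    simpa using h2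
  have hlim := lintegral_tendsto_of_tendsto_of_monotone (μ := μ)
    (f := fun N x => (∑ k ∈ Finset.range N, T k x) ^ s) (F := fun x => (∑' k, T k x) ^ s)
    (fun N => ((Finset.measurable_sum _ fun k _ => hT k).pow_const s).aemeasurable)
    (Filter.Eventually.of_forall fun x a b hab => ENNReal.rpow_le_rpow
      (Finset.sum_le_sum_of_subset (Finset.range_mono hab)) hs0.le)
    (Filter.Eventually.of_forall fun x =>
      (ENNReal.continuous_rpow_const.tendsto _).comp ENNReal.summable.hasSum.tendsto_sum_nat)
  exact le_of_tendsto' hlim hfin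

namespace Setting

/-- The bias term of the oracle inequality. -/
noncomputable def biasSup (S : Setting d) (H : Set (Fin d → ℝ)) (h : Fin d → ℝ)
    (f : (Fin d → ℝ) → ℝ) (x : Fin d → ℝ) : ℝ≥0∞ :=
  ⨆ η ∈ H, ‖S.smooth (h ⊔ η) f x - S.smooth η f x‖ₑ

theorem grid_pos {h : ℝ} (hh : h ∈ grid) : 0 < h := by
  obtain ⟨k, rfl⟩ := hh
  exact Real.exp_pos _

theorem mem_grid_of_mem_toSet {Hf : Family} {h : Fin d → ℝ} (hh : h ∈ Hf.toSet d) (j : Fin d) :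
    h j ∈ grid := by
  cases Hf with
  | full => exact hh j
  | isotropic => obtain ⟨t, ht, rfl⟩ := hh; exact ht

theorem bStar_le_bSup (S : Setting d) {h η : ℝ} (hη : η ∈ grid) (hle : η ≤ h)
    (f : (Fin d → ℝ) → ℝ) (j : Fin d) (x : Fin d → ℝ) : S.bStar η f j x ≤ S.bSup h f j x :=
  le_biSup (fun η => S.bStar η f j x) (show η ∈ {η ∈ grid | η ≤ h} from ⟨hη, hle⟩)

/-- When coordinate `j` moves, both bandwidths involved are at most `D j`, so both biases are below
`bSup (D j)`. The other coordinates only average it, and their mixed bandwidths stay on the grid,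
where the averages are dominated by maximal functions. -/
theorem Valid.exists_enorm_smooth_sub_le {S : Setting d} (hS : S.Valid) :
    ∃ C : ℝ≥0, ∀ (f : (Fin d → ℝ) → ℝ) (D E : Fin d → ℝ) (s : Finset (Fin d)) (x : Fin d → ℝ),
      Measurable f → Integrable f → (∀ j, D j ∈ grid) → (∀ j, E j ∈ grid) →
      (∀ j ∉ s, D j = E j) → (∀ j ∈ s, E j ≤ D j) →
      ‖S.smooth D f x - S.smooth E f x‖ₑ ≤
        C * ∑ j ∈ s, iterHardy S.cK (coordsExcept j) (S.bSup (D j) f j) x := by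
  choose C hC using hS.exists_iterAvg_le_iterHardy
  refine ⟨∑ j, C (coordsExcept j) * 2, fun f D E s x hf hfi hD hE hoff hon => ?_⟩
  have hDE : s.piecewise D E = D := by
    ext j
    by_cases hj : j ∈ s
    · simp [hj]
    · simp [hj, hoff j hj]
  have key := enorm_piecewise_sub_le (Φ := fun h => S.smooth h f x) (D := D) (E := E)
    (T := fun j => C (coordsExcept j) * 2 *
      iterHardy S.cK (coordsExcept j) (S.bSup (D j) f j) x) (s := s) ?_
  · rw [hDE] at key
    refine key.trans ?_
    rw [Finset.mul_sum]
    refine Finset.sum_le_sum fun j _ => ?_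
    gcongr
    have : C (coordsExcept j) * 2 ≤ ∑ j, C (coordsExcept j) * 2 :=
      Finset.single_le_sum (f := fun j => C (coordsExcept j) * 2) (fun _ _ => by positivity)
        (Finset.mem_univ j)
    exact_mod_cast this
  · intro a j hj _ _
    have hd : 1 ≤ d := j.pos
    have hbm := measurable_bSup hS hd hf (D j) j
    have hhyb : ∀ i, a.piecewise D E i ∈ grid := fun i => by
      by_cases hi : i ∈ a
      · simp [hi, hD]
      · simp [hi, hE]
    refine (enorm_smooth_update_sub_le hS hf hfi _ j (grid_pos (hD j)) (grid_pos (hE j)) x).trans ?_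
    have h2 : (fun y => S.bStar (D j) f j y + S.bStar (E j) f j y) ≤
        fun y => S.bSup (D j) f j y + S.bSup (D j) f j y := fun y =>
      add_le_add (S.bStar_le_bSup (hD j) le_rfl f j y) (S.bStar_le_bSup (hE j) (hon j hj) f j y)
    refine (iterAvg_mono h2 _ x).trans ?_
    have hlin : ∀ l : List (Fin d), ∀ y, iterAvg (fun i t => ‖S.scaledKernel (a.piecewise D E i) t‖ₑ) l
        (fun y => S.bSup (D j) f j y + S.bSup (D j) f j y) y =
        2 * iterAvg (fun i t => ‖S.scaledKernel (a.piecewise D E i) t‖ₑ) l (S.bSup (D j) f j) y := by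
      intro l
      induction l with
      | nil => intro y; simp [iterAvg, two_mul]
      | cons i l ih =>
        intro y
        simp only [iterAvg, coordAvg, ih]
        rw [← lintegral_const_mul' _ _ ENNReal.ofNat_ne_top]
        refine lintegral_congr fun t => ?_
        ring
    rw [hlin]
    calc _ ≤ 2 * (C (coordsExcept j) * iterHardy S.cK (coordsExcept j) (S.bSup (D j) f j) x) := by
          gcongr
          exact hC _ _ _ _ hhyb hbm
      _ = _ := by ring

/-- The bandwidths `h ∨ η` and `η` can differ only where `η_j ≤ h_j`, and there the larger one is
`h_j`; the bound therefore does not involve `η`. -/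
theorem Valid.exists_biasSup_le {S : Setting d} (hS : S.Valid) :
    ∃ C : ℝ≥0, ∀ (Hf : Family) (f : (Fin d → ℝ) → ℝ) (h : Fin d → ℝ) (x : Fin d → ℝ),
      Measurable f → Integrable f → h ∈ Hf.toSet d →
      S.biasSup (Hf.toSet d) h f x ≤
        C * ∑ j, iterHardy S.cK (coordsExcept j) (S.bSup (h j) f j) x := by
  obtain ⟨C, hC⟩ := hS.exists_enorm_smooth_sub_le
  refine ⟨C, fun Hf f h x hf hfi hh => iSup₂_le fun η hη => ?_⟩
  have hg : ∀ j, h j ∈ grid := mem_grid_of_mem_toSet hh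
  have hg' : ∀ j, η j ∈ grid := mem_grid_of_mem_toSet hη
  have hsup : ∀ j, (h ⊔ η) j ∈ grid := fun j => by
    rcases le_total (h j) (η j) with hle | hle
    · rw [Pi.sup_apply, sup_of_le_right hle]; exact hg' j
    · rw [Pi.sup_apply, sup_of_le_left hle]; exact hg j
  refine (hC f (h ⊔ η) η (Finset.univ.filter fun j => η j ≤ h j) x hf hfi hsup hg'
    (fun j hj => ?_) (fun j _ => le_sup_right)).trans ?_
  · simp only [Finset.mem_filter, Finset.mem_univ, true_and, not_le] at hj
    exact sup_of_le_right hj.le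
  · gcongr
    refine (Finset.sum_le_sum fun j hj => ?_).trans
      (Finset.sum_le_sum_of_subset (Finset.filter_subset _ _))
    rw [Finset.mem_filter] at hj
    rw [Pi.sup_apply, sup_of_le_left hj.2]

/-- The bias terms of a family are controlled, with the exponents `s`, by the quantities `N`. -/
def BiasControlled (S : Setting d) (Hf : Family)
    (N : ((Fin d → ℝ) → ℝ) → Fin d → ℝ≥0∞ → ℝ → ℝ≥0∞) (s : Fin d → ℝ) : Prop :=
  ∃ C : ℝ≥0, ∀ (f : (Fin d → ℝ) → ℝ) (h : Fin d → ℝ) (J : Finset (Fin d)) (w : ℝ≥0∞),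
    Measurable f → Integrable f → h ∈ Hf.toSet d → (∀ j ∉ J, ∀ᵐ x, S.bSup (h j) f j x ≤ w) →
    ∃ β : Fin d → (Fin d → ℝ) → ℝ≥0∞, (∀ j, Measurable (β j)) ∧
      (∀ᵐ x, S.biasSup (Hf.toSet d) h f x ≤ C * w + ∑ j ∈ J, β j x) ∧
      ∀ j, ∫⁻ x, β j x ^ s j ≤ C * N f j (ENNReal.ofReal (s j)) (h j) ^ s j

/-- Coordinates outside `J` contribute a multiple of `w`, because maximal functions do not increase
essential upper bounds. Those in `J` are kept as `β j` and estimated by the strong type inequality,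
which needs `s j > 1`. -/
theorem Valid.biasControlled {S : Setting d} (hS : S.Valid) (hd : 1 ≤ d) (Hf : Family)
    {s : Fin d → ℝ} (hs : ∀ j, 1 < s j) :
    S.BiasControlled Hf (fun f j s h => eLpNorm (S.bSup h f j) s volume) s := by
  obtain ⟨C, hC⟩ := hS.exists_biasSup_le
  choose C' hC' using fun j : Fin d => exists_iterHardy_lintegral_rpow_le (hs j) (coordsExcept j)
  refine ⟨C * d + ∑ j, (C ^ s j * C' j), fun f h J w hf hfi hh hw =>
    ⟨fun j x => C * iterHardy S.cK (coordsExcept j) (S.bSup (h j) f j) x, fun j => ?_, ?_,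
      fun j => ?_⟩⟩
  · exact (measurable_iterHardy (measurable_bSup hS hd hf _ _) _).const_mul _
  · have h1 : ∀ j ∉ J, ∀ᵐ x, iterHardy S.cK (coordsExcept j) (S.bSup (h j) f j) x ≤ w :=
      fun j hj => iterHardy_le_of_ae_le hS.cK_pos (measurable_bSup hS hd hf _ _) (hw j hj) _
    have h2 : ∀ᵐ x, ∀ j ∉ J, iterHardy S.cK (coordsExcept j) (S.bSup (h j) f j) x ≤ w := by
      rw [ae_all_iff]; intro j; rw [ae_all_iff]; exact h1 j
    filter_upwards [h2] with x hx
    refine (hC Hf f h x hf hfi hh).trans ?_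
    rw [← Finset.sum_add_sum_compl J, mul_add, add_comm, Finset.mul_sum J]
    refine add_le_add ?_ le_rfl
    calc (C : ℝ≥0∞) * ∑ j ∈ Jᶜ, iterHardy S.cK (coordsExcept j) (S.bSup (h j) f j) x ≤
          C * ∑ j ∈ Jᶜ, w := by
          gcongr with j hj
          exact hx j (by simpa using hj)
      _ ≤ C * (d * w) := by
          gcongr
          rw [Finset.sum_const, nsmul_eq_mul]
          gcongr
          exact_mod_cast (Finset.card_le_univ _).trans_eq (by simp)
      _ ≤ _ := by
          rw [← mul_assoc]
          gcongr
          exact_mod_cast (le_add_of_nonneg_right (by positivity) : C * (d : ℝ≥0) ≤ _)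
  · have hs0 : 0 < s j := by linarith [hs j]
    have hbm := measurable_bSup hS hd hf (h j) j
    simp_rw [ENNReal.mul_rpow_of_nonneg _ _ hs0.le]
    rw [lintegral_const_mul _ ((measurable_iterHardy hbm _).pow_const _)]
    rw [eLpNorm_ofReal_rpow hs0]
    calc _ ≤ (C : ℝ≥0∞) ^ s j * (C' j * ∫⁻ x, S.bSup (h j) f j x ^ s j) := by
          gcongr
          exact hC' j _ _ hS.cK_pos hbm
      _ ≤ _ := by
          rw [← mul_assoc]
          gcongr
          have : C ^ s j * C' j ≤ ∑ j, (C ^ s j * C' j) :=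
            Finset.single_le_sum (f := fun j => C ^ s j * C' j) (fun _ _ => by positivity)
              (Finset.mem_univ j)
          rw [← ENNReal.coe_rpow_of_nonneg _ hs0.le]
          exact_mod_cast this.trans (le_add_of_nonneg_left (by positivity))

end Setting

end ConvDensity

/-! ### Isotropic bandwidths, and the maximal function of a family. -/

namespace ConvDensity

variable {d : ℕ}

namespace Setting

theorem Valid.exists_lintegral_scaledKernel {S : Setting d} (hS : S.Valid) (hd : 1 ≤ d) :
    ∃ A : ℝ≥0, ∀ h : ℝ, 0 < h → ∫⁻ t, ‖S.scaledKernel h t‖ₑ ≤ A := by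
  refine ⟨(∫⁻ t, ‖S.𝒦 t‖ₑ).toNNReal, fun h hh => ?_⟩
  rw [ENNReal.coe_toNNReal (hS.integrable_univariate hd).2.ne]
  have h1 := integral_norm_eq_lintegral_enorm (hS.integrable_scaledKernel hd hh).1
  have h2 := integral_norm_eq_lintegral_enorm (hS.integrable_univariate hd).1
  have h3 : ∫ t, ‖S.scaledKernel h t‖ = ∫ t, ‖S.𝒦 t‖ := by
    simp only [scaledKernel, norm_mul]
    rw [integral_const_mul, Measure.integral_comp_div (g := fun t => ‖S.𝒦 t‖), smul_eq_mul,
      norm_inv, Real.norm_eq_abs, ← mul_assoc, inv_mul_cancel₀ (abs_pos.2 hh.ne').ne', one_mul]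
  rw [h1, h2] at h3
  exact ((ENNReal.toReal_eq_toReal_iff' (hS.integrable_scaledKernel hd hh).2.ne
    (hS.integrable_univariate hd).2.ne).1 h3).le

/-- For the isotropic family the sums of the norms of the biases may replace the norms of their
suprema. -/
theorem Valid.biasControlled_isotropic {S : Setting d} (hS : S.Valid) (hd : 1 ≤ d)
    {s : Fin d → ℝ} (hs : ∀ j, 1 ≤ s j) :
    S.BiasControlled .isotropic (fun f j s h =>
      ∑' η : {η : ℝ // η ∈ grid ∧ η ≤ h}, eLpNorm (S.bStar η f j) s volume) s := by
  obtain ⟨C, hC⟩ := hS.exists_enorm_smooth_sub_le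
  obtain ⟨A, hA⟩ := hS.exists_lintegral_scaledKernel hd
  refine ⟨C * d + ∑ j, (2 * (2 ^ d * (A + 1) ^ d)) ^ s j, fun f h J w hf hfi hh hw => ?_⟩
  obtain ⟨_, ⟨m₀, rfl⟩, rfl⟩ := hh
  set ρ : ℕ → ℝ := fun k => Real.exp ((m₀ - k : ℤ) : ℝ) with hρ
  have hρ0 : ρ 0 = Real.exp (m₀ : ℝ) := by simp [hρ]
  have hρg : ∀ k, ρ k ∈ grid := fun k => ⟨m₀ - k, rfl⟩
  have hρle : ∀ k, ρ k ≤ Real.exp (m₀ : ℝ) := fun k => by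
    simp only [hρ]; gcongr; linarith [Int.natCast_nonneg k]
  set D : ℕ → Fin d → ℝ := fun k => J.piecewise (fun _ => ρ k) (fun _ => Real.exp (m₀ : ℝ)) with hD
  have hDg : ∀ k j, D k j ∈ grid := fun k j => by
    by_cases hj : j ∈ J
    · simp [hD, hj, hρg]
    · simp only [hD, hj, not_false_eq_true, Finset.piecewise_eq_of_notMem]; exact ⟨m₀, rfl⟩
  set κ : Finset (Fin d) → ℕ → Fin d → ℝ → ℝ≥0∞ := fun a k i t =>
    ‖S.scaledKernel (a.piecewise (D k) (D (k + 1)) i) t‖ₑ with hκ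
  have hpg : ∀ (a : Finset (Fin d)) k i, a.piecewise (D k) (D (k + 1)) i ∈ grid := fun a k i => by
    by_cases hi : i ∈ a
    · simp [hi, hDg]
    · simp [hi, hDg]
  have hκm : ∀ a k i, Measurable (κ a k i) := fun a k i =>
    (hS.continuous_scaledKernel hd _).measurable.enorm
  have hκA : ∀ a k i, ∫⁻ t, κ a k i t ≤ (A + 1 : ℝ≥0) := fun a k i =>
    (hA _ (grid_pos (hpg a k i))).trans (by exact_mod_cast le_self_add)
  -- Summing over all subsets `a` covers every mixed bandwidth met while telescoping; it costs the
  -- factor `2 ^ d`.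
  set T : Fin d → ℕ → (Fin d → ℝ) → ℝ≥0∞ := fun j k x => ∑ a : Finset (Fin d),
    iterAvg (κ a k) (coordsExcept j) (fun y => S.bStar (ρ k) f j y + S.bStar (ρ (k + 1)) f j y) x
    with hT
  have hbm : ∀ k j, Measurable (S.bStar (ρ k) f j) := fun k j => measurable_bStar hS hd hf _ _
  have hTm : ∀ j k, Measurable (T j k) := fun j k =>
    Finset.measurable_sum _ fun a _ => measurable_iterAvg (hκm a k) ((hbm k j).add (hbm (k + 1) j)) _
  refine ⟨fun j x => ∑' k, T j k x, fun j => Measurable.tsum (hTm j), ?_, fun j => ?_⟩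
  · have h1 : ∀ j ∉ J, ∀ᵐ x, iterHardy S.cK (coordsExcept j) (S.bSup (Real.exp (m₀ : ℝ)) f j) x ≤ w :=
      fun j hj => iterHardy_le_of_ae_le hS.cK_pos (measurable_bSup hS hd hf _ _) (hw j hj) _
    have h2 : ∀ᵐ x, ∀ j ∉ J,
        iterHardy S.cK (coordsExcept j) (S.bSup (Real.exp (m₀ : ℝ)) f j) x ≤ w := by
      rw [ae_all_iff]; intro j; rw [ae_all_iff]; exact h1 j
    filter_upwards [h2] with x hx
    refine iSup₂_le fun η hη => ?_
    obtain ⟨_, ⟨m, rfl⟩, rfl⟩ := hη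
    -- If `η` is at least `h`, then `h ∨ η = η` and the difference is zero.
    rcases le_total m₀ m with hm | hm
    · have : ((fun _ => Real.exp (m₀ : ℝ)) ⊔ fun _ => Real.exp (m : ℝ) : Fin d → ℝ) =
          fun _ => Real.exp (m : ℝ) := by
        rw [sup_eq_right]; intro i; simpa using hm
      rw [this]; simp
    · have hsup : ((fun _ => Real.exp (m₀ : ℝ)) ⊔ fun _ => Real.exp (m : ℝ) : Fin d → ℝ) =
          fun _ => Real.exp (m₀ : ℝ) := by
        rw [sup_eq_left]; intro i; simpa using hm
      rw [hsup]
      obtain ⟨N, hN⟩ := Int.le.dest hm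
      have hmN : Real.exp (m : ℝ) = ρ N := by
        simp only [hρ]; congr 2; omega
      have hstep : ∀ k, ‖S.smooth (D k) f x - S.smooth (D (k + 1)) f x‖ₑ ≤ ∑ j ∈ J, T j k x := by
        intro k
        have hpw : J.piecewise (D k) (D (k + 1)) = D k := by
          ext j
          by_cases hj : j ∈ J <;> simp [hD, hj]
        have := enorm_piecewise_sub_le (Φ := fun h => S.smooth h f x) (D := D k) (E := D (k + 1))
          (T := fun j => T j k x) (s := J) (fun a j hj _ _ => by
            refine (enorm_smooth_update_sub_le hS hf hfi _ j (grid_pos (hDg k j))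
              (grid_pos (hDg (k + 1) j)) x).trans ?_
            have e1 : ∀ k, D k j = ρ k := fun k => by simp [hD, hj]
            rw [e1, e1]
            exact Finset.single_le_sum (f := fun a => iterAvg (κ a k) (coordsExcept j)
              (fun y => S.bStar (ρ k) f j y + S.bStar (ρ (k + 1)) f j y) x)
              (fun _ _ => zero_le) (Finset.mem_univ a))
        rwa [hpw] at this
      have hchain : ‖S.smooth (D 0) f x - S.smooth (D N) f x‖ₑ ≤
          ∑ k ∈ Finset.range N, ∑ j ∈ J, T j k x := by
        clear hN hmN
        induction N with
        | zero => simp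
        | succ N ih =>
          rw [Finset.sum_range_succ]
          calc _ = ‖(S.smooth (D 0) f x - S.smooth (D N) f x) +
              (S.smooth (D N) f x - S.smooth (D (N + 1)) f x)‖ₑ := by congr 1; ring
            _ ≤ _ := (enorm_add_le _ _).trans (add_le_add ih (hstep N))
      have hD0 : D 0 = fun _ => Real.exp (m₀ : ℝ) := by
        ext j
        by_cases hj : j ∈ J <;> simp [hD, hj, hρ0]
      have hlast := hC f (D N) (fun _ => Real.exp (m : ℝ)) Jᶜ x hf hfi (hDg N) (fun _ => ⟨m, rfl⟩)
        (fun j hj => by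
          have hj' : j ∈ J := by simpa using hj
          simp [hD, hj', hmN])
        (fun j hj => by
          have hj' : j ∉ J := by simpa using hj
          simpa [hD, hj'] using hm)
      rw [hD0] at hchain
      calc _ = ‖(S.smooth (D N) f x - S.smooth (fun _ => Real.exp (m : ℝ)) f x) +
            (S.smooth (fun _ => Real.exp (m₀ : ℝ)) f x - S.smooth (D N) f x)‖ₑ := by
            congr 1; ring
        _ ≤ C * ∑ j ∈ Jᶜ, iterHardy S.cK (coordsExcept j) (S.bSup (D N j) f j) x +
            ∑ k ∈ Finset.range N, ∑ j ∈ J, T j k x :=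
            (enorm_add_le _ _).trans (add_le_add hlast hchain)
        _ ≤ C * ∑ j ∈ Jᶜ, w + ∑ j ∈ J, ∑' k, T j k x := by
            refine add_le_add (mul_le_mul_right (Finset.sum_le_sum fun j hj => ?_) _) ?_
            · have hj' : j ∉ J := by simpa using hj
              have : D N j = Real.exp (m₀ : ℝ) := by simp [hD, hj']
              rw [this]
              exact hx j hj'
            · rw [Finset.sum_comm]
              exact Finset.sum_le_sum fun j _ => ENNReal.sum_le_tsum _
        _ ≤ _ := by
            refine add_le_add ?_ le_rfl
            calc _ ≤ (C : ℝ≥0∞) * (d * w) := by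
                  gcongr
                  rw [Finset.sum_const, nsmul_eq_mul]
                  gcongr
                  exact_mod_cast (Finset.card_le_univ _).trans_eq (by simp)
              _ ≤ _ := by
                  rw [← mul_assoc]
                  gcongr
                  exact_mod_cast (le_add_of_nonneg_right (by positivity) : C * (d : ℝ≥0) ≤ _)
  · have hs0 : 0 < s j := by linarith [hs j]
    have hs1 : 1 ≤ ENNReal.ofReal (s j) := by simpa using ENNReal.ofReal_le_ofReal (hs j)
    set b : ℕ → ℝ≥0∞ := fun k => eLpNorm (S.bStar (ρ k) f j) (ENNReal.ofReal (s j)) volume with hb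
    set N := ∑' η : {η : ℝ // η ∈ grid ∧ η ≤ Real.exp (m₀ : ℝ)},
      eLpNorm (S.bStar η f j) (ENNReal.ofReal (s j)) volume with hNdef
    have hlen : (coordsExcept j).length ≤ d := by
      have := List.length_filter_le (· ≠ j) (List.finRange d)
      simpa [coordsExcept] using this
    -- Young's inequality uses only the `L¹` norms of the scaled kernels, which do not depend on the
    -- bandwidth. No maximal function is needed for these terms, and `s j = 1` is allowed.
    have hTk : ∀ k, eLpNorm (T j k) (ENNReal.ofReal (s j)) volume ≤
        (2 ^ d * (A + 1) ^ d : ℝ≥0) * (b k + b (k + 1)) := by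
      intro k
      have e : T j k = ∑ a : Finset (Fin d), iterAvg (κ a k) (coordsExcept j)
          (fun y => S.bStar (ρ k) f j y + S.bStar (ρ (k + 1)) f j y) := by
        ext x; simp [hT]
      have hm := (hbm k j).add (hbm (k + 1) j)
      rw [e]
      refine (eLpNorm_sum_le (fun a _ =>
        (measurable_iterAvg (hκm a k) hm _).aestronglyMeasurable) hs1).trans ?_
      have hone : ∀ a : Finset (Fin d), eLpNorm (iterAvg (κ a k) (coordsExcept j)
          (fun y => S.bStar (ρ k) f j y + S.bStar (ρ (k + 1)) f j y)) (ENNReal.ofReal (s j)) volume ≤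
          ((A + 1) ^ d : ℝ≥0) * (b k + b (k + 1)) := by
        intro a
        rw [← ENNReal.rpow_le_rpow_iff hs0, eLpNorm_ofReal_rpow hs0]
        refine (lintegral_iterAvg_rpow_le (hκm a k) (hκA a k) (hs j) hm _).trans ?_
        rw [ENNReal.mul_rpow_of_nonneg _ _ hs0.le]
        refine mul_le_mul' ?_ ?_
        · rw [← ENNReal.rpow_natCast, ← ENNReal.rpow_mul, mul_comm, ENNReal.rpow_mul,
            ENNReal.rpow_natCast]
          refine ENNReal.rpow_le_rpow ?_ hs0.le
          have : (A + 1) ^ (coordsExcept j).length ≤ (A + 1) ^ d :=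
            pow_le_pow_right₀ le_add_self hlen
          exact_mod_cast this
        · rw [← eLpNorm_ofReal_rpow hs0]
          exact ENNReal.rpow_le_rpow (eLpNorm_add_le (hbm k j).aestronglyMeasurable
            (hbm (k + 1) j).aestronglyMeasurable hs1) hs0.le
      refine (Finset.sum_le_sum fun a _ => hone a).trans ?_
      rw [Finset.sum_const, nsmul_eq_mul, Finset.card_univ, Fintype.card_finset, Fintype.card_fin,
        ENNReal.coe_mul, mul_assoc]
      push_cast
      exact le_rfl
    have hinj : Function.Injective fun k => (⟨ρ k, hρg k, hρle k⟩ :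
        {η : ℝ // η ∈ grid ∧ η ≤ Real.exp (m₀ : ℝ)}) := by
      intro k k' hkk
      simp only [Subtype.mk.injEq, hρ, Real.exp_eq_exp, Int.cast_inj] at hkk
      omega
    have hsum : ∑' k, b k ≤ N := ENNReal.tsum_comp_le_tsum_of_injective hinj
      (fun η : {η : ℝ // η ∈ grid ∧ η ≤ Real.exp (m₀ : ℝ)} =>
        eLpNorm (S.bStar η f j) (ENNReal.ofReal (s j)) volume)
    have hsum' : ∑' k, b (k + 1) ≤ N :=
      (ENNReal.tsum_comp_le_tsum_of_injective (add_left_injective 1) b).trans hsum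
    refine (lintegral_tsum_rpow_le (hs j) (hTm j)).trans ?_
    have hle : ∑' k, eLpNorm (T j k) (ENNReal.ofReal (s j)) volume ≤
        (2 * (2 ^ d * (A + 1) ^ d) : ℝ≥0) * N := by
      refine (ENNReal.tsum_le_tsum hTk).trans ?_
      rw [ENNReal.tsum_mul_left, ENNReal.tsum_add]
      calc _ ≤ ((2 ^ d * (A + 1) ^ d : ℝ≥0) : ℝ≥0∞) * (N + N) := by gcongr
        _ = _ := by push_cast; ring
    refine (ENNReal.rpow_le_rpow hle hs0.le).trans ?_
    rw [ENNReal.mul_rpow_of_nonneg _ _ hs0.le, ← ENNReal.coe_rpow_of_nonneg _ hs0.le]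
    gcongr
    refine le_trans ?_ le_add_self
    exact Finset.single_le_sum (f := fun j => (2 * (2 ^ d * (A + 1) ^ d)) ^ s j)
      (fun _ _ => by positivity) (Finset.mem_univ j)

/-- The maximal function of the family. -/
noncomputable def maxFun (S : Setting d) (Hf : Family) (f : (Fin d → ℝ) → ℝ) :
    (Fin d → ℝ) → ℝ≥0∞ :=
  match Hf with
  | .full => iterHardy S.cK (List.finRange d) fun x => ‖f x‖ₑ
  | .isotropic => hardy volume S.cK fun x => ‖f x‖ₑ

theorem Valid.exists_enorm_smooth_le {S : Setting d} (hS : S.Valid) (hd : 1 ≤ d) :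
    ∃ C : ℝ≥0, ∀ (Hf : Family) (f : (Fin d → ℝ) → ℝ) (h x : Fin d → ℝ),
      Measurable f → h ∈ Hf.toSet d → ‖S.smooth h f x‖ₑ ≤ C * S.maxFun Hf f x := by
  obtain ⟨C₁, h₁⟩ := hS.exists_iterAvg_le_iterHardy (List.finRange d)
  obtain ⟨C₂, h₂⟩ := hS.exists_enorm_smooth_le_hardy
  refine ⟨C₁ + C₂, fun Hf f h x hf hh => ?_⟩
  cases Hf with
  | full =>
    refine ((enorm_smooth_le_iterAvg hS hd hf h x).trans (h₁ h _ x hh hf.enorm)).trans ?_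
    simp only [maxFun]
    gcongr
    exact le_self_add
  | isotropic =>
    obtain ⟨_, ⟨m, rfl⟩, rfl⟩ := hh
    refine ((enorm_integral_le_lintegral_enorm _).trans (h₂ m f x)).trans ?_
    simp only [maxFun]
    refine mul_le_mul' (by exact_mod_cast le_add_self) ?_
    exact le_iSup (fun m : ℤ => (volume (Metric.closedBall x (S.cK * Real.exp m)))⁻¹ *
      ∫⁻ y in Metric.closedBall x (S.cK * Real.exp m), ‖f y‖ₑ) m

theorem sup_mem_toSet {Hf : Family} {h η : Fin d → ℝ} (hh : h ∈ Hf.toSet d)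
    (hη : η ∈ Hf.toSet d) : h ⊔ η ∈ Hf.toSet d := by
  cases Hf with
  | full =>
    intro j
    rcases le_total (h j) (η j) with hle | hle
    · rw [Pi.sup_apply, sup_of_le_right hle]; exact hη j
    · rw [Pi.sup_apply, sup_of_le_left hle]; exact hh j
  | isotropic =>
    obtain ⟨t, ht, rfl⟩ := hh
    obtain ⟨r, hr, rfl⟩ := hη
    rcases le_total t r with hle | hle
    · exact ⟨r, hr, by ext; simp [hle]⟩
    · exact ⟨t, ht, by ext; simp [hle]⟩

theorem const_mem_toSet (Hf : Family) (m : ℤ) : (fun _ => Real.exp m) ∈ Hf.toSet d := by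
  cases Hf with
  | full => exact fun j => ⟨m, rfl⟩
  | isotropic => exact ⟨_, ⟨m, rfl⟩, rfl⟩

theorem Valid.exists_biasSup_le_maxFun {S : Setting d} (hS : S.Valid) (hd : 1 ≤ d) :
    ∃ C : ℝ≥0, ∀ (Hf : Family) (f : (Fin d → ℝ) → ℝ) (h x : Fin d → ℝ),
      Measurable f → h ∈ Hf.toSet d → S.biasSup (Hf.toSet d) h f x ≤ C * S.maxFun Hf f x := by
  obtain ⟨C, hC⟩ := hS.exists_enorm_smooth_le hd
  refine ⟨2 * C, fun Hf f h x hf hh => iSup₂_le fun η hη => ?_⟩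
  refine enorm_sub_le.trans ((add_le_add (hC Hf f _ x hf (sup_mem_toSet hh hη))
    (hC Hf f _ x hf hη)).trans (le_of_eq ?_))
  push_cast; ring

/-- Take `η` on the grid tending to zero: eventually `h ∨ η = h`, while the smoother at `η`
converges to `f`. The exceptional null set does not depend on `h`. -/
theorem Valid.ae_enorm_smooth_sub_le_biasSup {S : Setting d} (hS : S.Valid) (hd : 1 ≤ d)
    {f : (Fin d → ℝ) → ℝ} (hfi : Integrable f) (Hf : Family) :
    ∀ᵐ x, ∀ h ∈ Hf.toSet d, ‖S.smooth h f x - f x‖ₑ ≤ S.biasSup (Hf.toSet d) h f x := by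
  filter_upwards [hS.ae_tendsto_smooth hd hfi] with x hx h hh
  have ht : Filter.Tendsto (fun k : ℕ => ‖S.smooth h f x -
      S.smooth (fun _ => Real.exp ((-k : ℤ) : ℝ)) f x‖ₑ) Filter.atTop
      (nhds ‖S.smooth h f x - f x‖ₑ) := (tendsto_const_nhds.sub hx).enorm
  refine le_of_tendsto ht ?_
  have hpos : ∀ j, 0 < h j := fun j => grid_pos (mem_grid_of_mem_toSet hh j)
  have hz : Filter.Tendsto (fun k : ℕ => Real.exp ((-k : ℤ) : ℝ)) Filter.atTop (nhds 0) := by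
    have : Filter.Tendsto (fun k : ℕ => Real.exp (-(k : ℝ))) Filter.atTop (nhds 0) :=
      Real.tendsto_exp_neg_atTop_nhds_zero.comp tendsto_natCast_atTop_atTop
    simpa only [Int.cast_neg, Int.cast_natCast] using this
  have hev : ∀ᶠ k : ℕ in Filter.atTop, ∀ j, Real.exp ((-k : ℤ) : ℝ) ≤ h j :=
    Filter.eventually_all.2 fun j => hz.eventually_le_const (hpos j)
  filter_upwards [hev] with k hk
  have hsup : h ⊔ (fun _ => Real.exp ((-k : ℤ) : ℝ)) = h := sup_eq_left.2 hk
  have := le_iSup₂ (f := fun η (_ : η ∈ Hf.toSet d) => ‖S.smooth (h ⊔ η) f x - S.smooth η f x‖ₑ)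
    (fun _ => Real.exp ((-k : ℤ) : ℝ)) (const_mem_toSet Hf (-k : ℤ))
  rwa [hsup] at this

theorem Valid.exists_lintegral_maxFun_rpow_le {S : Setting d} (hS : S.Valid) (hd : 1 ≤ d) {q : ℝ}
    (hq : 1 < q) : ∃ C : ℝ≥0, ∀ (Hf : Family) (f : (Fin d → ℝ) → ℝ), Measurable f →
      ∫⁻ x, S.maxFun Hf f x ^ q ≤ C * ∫⁻ x, ‖f x‖ₑ ^ q := by
  have : Nonempty (Fin d) := ⟨⟨0, hd⟩⟩
  obtain ⟨C, hC⟩ := exists_iterHardy_lintegral_rpow_le hq (List.finRange d)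
  set C' : ℝ≥0 := (2 * 4 ^ Module.finrank ℝ (Fin d → ℝ)) *
    Real.toNNReal (q * 2 ^ (q - 1) / (q - 1)) with hC'
  refine ⟨C + C', fun Hf f hf => ?_⟩
  cases Hf with
  | full =>
    refine (hC _ _ hS.cK_pos hf.enorm).trans ?_
    gcongr
    exact le_self_add
  | isotropic =>
    refine ((hardy_weakControl hS.cK_pos hf.enorm).lintegral_rpow_le (measurable_hardy hf.enorm)
      hf.enorm hq).trans ?_
    gcongr
    push_cast
    exact le_add_self

/-- The two values of `t(𝐇)`: composing `d` coordinate maximal functions loses `d - 1` logarithms,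
whereas the maximal function over cubes has weak type `(1,1)`. -/
theorem Valid.exists_maxFun_measure_le {S : Setting d} (hS : S.Valid) (hd : 1 ≤ d) {q : ℝ}
    (hq : 1 < q) (A B : ℝ≥0) :
    ∃ C : ℝ≥0, ∀ (Hf : Family) (f : (Fin d → ℝ) → ℝ), Measurable f →
      ∫⁻ x, ‖f x‖ₑ ≤ A → ∫⁻ x, ‖f x‖ₑ ^ q ≤ B → ∀ v : ℝ, 0 < v →
      volume {x | ENNReal.ofReal v < S.maxFun Hf f x} ≤
        C * ENNReal.ofReal (v⁻¹ * (1 + |Real.log v|) ^ Hf.t d) := by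
  obtain ⟨m, rfl⟩ : ∃ m, d = m + 1 := ⟨d - 1, by omega⟩
  obtain ⟨C, hC⟩ := exists_iterHardy_measure_le hq A B (0 : Fin (m + 1))
    ((List.finRange m).map Fin.succ)
  refine ⟨C + 2 * 4 ^ Module.finrank ℝ (Fin (m + 1) → ℝ) * A, fun Hf f hf hA hB v hv => ?_⟩
  cases Hf with
  | full =>
    have h := hC S.cK _ hS.cK_pos hf.enorm hA hB v hv
    rw [← List.finRange_succ, List.length_map, List.length_finRange] at h
    refine h.trans ?_
    simp only [Family.t, Nat.add_sub_cancel]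
    gcongr
    exact le_self_add
  | isotropic =>
    have h := (hardy_weakControl (μ := volume) hS.cK_pos hf.enorm).measure_lt_le (A := A) (k := 0)
      (fun v _ => by
        simp only [pow_zero, ENNReal.ofReal_one, mul_one]
        exact (setLIntegral_le_lintegral _ _).trans hA) hv
    simp only [Family.t, pow_zero, mul_one] at h ⊢
    refine h.trans ?_
    gcongr
    push_cast
    exact le_add_self

theorem Valid.ae_maxFun_le {S : Setting d} (hS : S.Valid) {f : (Fin d → ℝ) → ℝ} (hf : Measurable f)
    {w : ℝ≥0∞} (h : ∀ᵐ x, ‖f x‖ₑ ≤ w) (Hf : Family) : ∀ᵐ x, S.maxFun Hf f x ≤ w := by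
  cases Hf with
  | full => exact iterHardy_le_of_ae_le hS.cK_pos hf.enorm h _
  | isotropic =>
    refine Filter.Eventually.of_forall fun x => iSup_le fun k => ?_
    calc _ ≤ (volume (Metric.closedBall x (S.cK * Real.exp k)))⁻¹ *
          ∫⁻ y in Metric.closedBall x (S.cK * Real.exp k), w := by
          gcongr 1
          exact lintegral_mono_ae (ae_restrict_of_ae h)
      _ = (volume (Metric.closedBall x (S.cK * Real.exp k)))⁻¹ *
          volume (Metric.closedBall x (S.cK * Real.exp k)) * w := by
          rw [lintegral_const, Measure.restrict_apply_univ]; ring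
      _ ≤ 1 * w := by gcongr; exact ENNReal.inv_mul_le_one _
      _ = w := one_mul w

end Setting

end ConvDensity

/-! ### The quantities `F_n` and `G_n` along the grid. -/

namespace ConvDensity

section GridSum

/-- A product of series is the series of the products. -/
theorem tsum_prod_pi {ι : Type*} (d : ℕ) (φ : ι → ℝ≥0∞) :
    ∑' k : Fin d → ι, ∏ j, φ (k j) = (∑' i, φ i) ^ d := by
  induction d with
  | zero => simp [tsum_fintype]
  | succ d ih =>
    rw [← (Fin.consEquiv fun _ : Fin (d + 1) => ι).tsum_eq, ENNReal.tsum_prod', pow_succ', ← ih,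
      ← ENNReal.tsum_mul_right]
    refine tsum_congr fun a => ?_
    rw [← ENNReal.tsum_mul_left]
    refine tsum_congr fun k => ?_
    simp [Fin.consEquiv, Fin.prod_univ_succ]

theorem tsum_ofReal_ne_top {ι : Type*} {φ : ι → ℝ} (h : Summable φ) (h0 : ∀ i, 0 ≤ φ i) :
    ∑' i, ENNReal.ofReal (φ i) ≠ ∞ := by
  rw [← ENNReal.ofReal_tsum_of_nonneg h0 h]
  exact ENNReal.ofReal_ne_top

theorem summable_one_add_mul_exp_neg : Summable fun m : ℕ => (1 + (m : ℝ)) * Real.exp (-m) := by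
  have h0 := Real.summable_exp_neg_nat
  have h1 := Real.summable_pow_mul_exp_neg_nat_mul 1 one_pos
  simp only [pow_one, neg_mul, one_mul] at h1
  simpa [add_mul] using h0.add h1

theorem summable_exp_neg_abs_int : Summable fun k : ℤ => Real.exp (-|(k : ℝ)|) := by
  refine Summable.of_nat_of_neg ?_ ?_
  · simpa using Real.summable_exp_neg_nat
  · simpa using Real.summable_exp_neg_nat

end GridSum

variable {d : ℕ}

namespace Setting

/-- The logarithmic factor of `F_n` and `G_n`. -/
noncomputable def logTerm (n : ℕ) (h : Fin d → ℝ) : ℝ := Real.log n + ∑ j, |Real.log (h j)|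

theorem one_le_log_of_three_le {n : ℕ} (hn : 3 ≤ n) : 1 ≤ Real.log n := by
  rw [Real.le_log_iff_exp_le (by positivity)]
  have h1 : Real.exp 1 < 3 := by linarith [Real.exp_one_lt_d9]
  have h2 : (3 : ℝ) ≤ n := by exact_mod_cast hn
  linarith

theorem one_le_logTerm {n : ℕ} (hn : 3 ≤ n) (h : Fin d → ℝ) : 1 ≤ logTerm n h := by
  have := one_le_log_of_three_le hn
  have h2 : 0 ≤ ∑ j, |Real.log (h j)| := Finset.sum_nonneg fun j _ => abs_nonneg _
  unfold logTerm
  linarith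

theorem one_le_Minf (S : Setting d) : 1 ≤ S.Minf := le_max_right _ _

theorem Valid.six_le_lamN {S : Setting d} (hS : S.Valid) {n : ℕ} (hn : 3 ≤ n) (h : Fin d → ℝ) :
    6 ≤ S.lamN n h := by
  have h1 := one_le_log_of_three_le hn
  have h2 := Real.log_nonneg S.one_le_Minf
  have h3 : 0 ≤ ∑ j, (1 + S.lam j) * |Real.log (h j)| := Finset.sum_nonneg fun j _ =>
    mul_nonneg (by linarith [hS.lam_nonneg j]) (abs_nonneg _)
  have h4 := hS.one_lt_p
  unfold lamN
  nlinarith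

theorem Valid.exists_lamN_le {S : Setting d} (hS : S.Valid) :
    ∃ C : ℝ, 0 < C ∧ ∀ (n : ℕ) (h : Fin d → ℝ), 3 ≤ n → S.lamN n h ≤ C * logTerm n h := by
  have h2 := Real.log_nonneg S.one_le_Minf
  have h4 := hS.one_lt_p
  have hl : 0 ≤ ∑ j, S.lam j := Finset.sum_nonneg fun j _ => hS.lam_nonneg j
  refine ⟨4 * Real.log S.Minf + 6 + (8 * S.p + 26) * (1 + ∑ j, S.lam j), by positivity,
    fun n h hn => ?_⟩
  have h1 := one_le_log_of_three_le hn
  have hL := one_le_logTerm hn h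
  have h3 : ∑ j, (1 + S.lam j) * |Real.log (h j)| ≤
      (1 + ∑ j, S.lam j) * ∑ j, |Real.log (h j)| := by
    rw [Finset.mul_sum]
    refine Finset.sum_le_sum fun j _ => mul_le_mul_of_nonneg_right ?_ (abs_nonneg _)
    have := Finset.single_le_sum (f := S.lam) (fun j _ => hS.lam_nonneg j) (Finset.mem_univ j)
    linarith
  have h0 : 0 ≤ ∑ j, |Real.log (h j)| := Finset.sum_nonneg fun j _ => abs_nonneg _
  have e1 : 4 * Real.log S.Minf ≤ 4 * Real.log S.Minf * logTerm n h :=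
    le_mul_of_one_le_right (by positivity) hL
  have e2 : 6 * Real.log n ≤ 6 * logTerm n h := by unfold logTerm; linarith
  have e3 : (1 + ∑ j, S.lam j) * ∑ j, |Real.log (h j)| ≤ (1 + ∑ j, S.lam j) * logTerm n h :=
    mul_le_mul_of_nonneg_left (by unfold logTerm; linarith) (by positivity)
  have e4 : (8 * S.p + 26) * ∑ j, (1 + S.lam j) * |Real.log (h j)| ≤
      (8 * S.p + 26) * ((1 + ∑ j, S.lam j) * logTerm n h) :=
    mul_le_mul_of_nonneg_left (h3.trans e3) (by linarith)
  unfold lamN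
  calc _ ≤ 4 * Real.log S.Minf * logTerm n h + 6 * logTerm n h +
      (8 * S.p + 26) * ((1 + ∑ j, S.lam j) * logTerm n h) := by linarith
    _ = _ := by ring

theorem Gn_eq (S : Setting d) (n : ℕ) (h : Fin d → ℝ) :
    S.Gn n h = logTerm n h * S.weight h / n := by
  rw [Gn, logTerm, weight, div_eq_mul_inv, mul_inv]
  ring

theorem Fn_sq (S : Setting d) {n : ℕ} (hn : 3 ≤ n) {h : Fin d → ℝ} (hh : ∀ j, 0 < h j) :
    S.Fn n h ^ 2 = logTerm n h * (S.weight h ^ 2 * ∏ j, h j) / n := by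
  have hL := one_le_logTerm hn h
  unfold logTerm at hL
  rw [Fn, div_pow, mul_pow, Real.sq_sqrt (by linarith), Real.sq_sqrt (by positivity), logTerm,
    prod_rpow_sq_inv]
  have hp : 0 < ∏ j, h j := Finset.prod_pos fun j _ => hh j
  have hm : 0 < ∏ j, min (h j) 1 ^ S.lam j := Finset.prod_pos fun j _ =>
    Real.rpow_pos_of_pos (lt_min (hh j) one_pos) _
  have e : (∏ j, h j ^ (1 / 2 : ℝ) * min (h j) 1 ^ S.lam j) ^ 2 =
      (∏ j, h j) * (∏ j, min (h j) 1 ^ S.lam j) ^ 2 := by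
    rw [Finset.prod_mul_distrib, mul_pow]
    congr 1
    rw [← Finset.prod_pow]
    refine Finset.prod_congr rfl fun j _ => ?_
    rw [← Real.rpow_natCast, ← Real.rpow_mul (hh j).le]
    norm_num
  rw [e]
  generalize (∏ j, min (h j) 1 ^ S.lam j) = A at *
  generalize ∏ j, h j = B at *
  field_simp

/-- Multiplying `h_j` by `exp (m_j)` increases the logarithmic factor at most additively. The sum is
turned into a product over the coordinates so that series over multi-indices factorise. -/
theorem logTerm_le {n : ℕ} (hn : 3 ≤ n) {h η : Fin d → ℝ} {m : Fin d → ℝ} (hh : ∀ j, 0 < h j)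
    (hm : ∀ j, 0 ≤ m j) (hη : ∀ j, η j = h j * Real.exp (m j)) :
    logTerm n η ≤ logTerm n h * ∏ j, (1 + m j) := by
  have hL := one_le_logTerm hn h
  have h1 : logTerm n η ≤ logTerm n h + ∑ j, m j := by
    unfold logTerm
    rw [add_assoc, ← Finset.sum_add_distrib]
    gcongr with j
    rw [hη, Real.log_mul (hh j).ne' (Real.exp_ne_zero _), Real.log_exp]
    exact (abs_add_le _ _).trans (by rw [abs_of_nonneg (hm j)])
  have h2 : 1 + ∑ j, m j ≤ ∏ j, (1 + m j) := by
    have : ∀ s : Finset (Fin d), 1 + ∑ j ∈ s, m j ≤ ∏ j ∈ s, (1 + m j) := by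
      intro s
      induction s using Finset.induction_on with
      | empty => simp
      | insert j s hj ih =>
        rw [Finset.sum_insert hj, Finset.prod_insert hj]
        have : 0 ≤ ∑ j ∈ s, m j := Finset.sum_nonneg fun j _ => hm j
        nlinarith [hm j, mul_nonneg (hm j) this]
    exact this _
  have h3 : 0 ≤ ∑ j, m j := Finset.sum_nonneg fun j _ => hm j
  nlinarith

theorem Valid.weight_le {S : Setting d} (hS : S.Valid) {h η : Fin d → ℝ} {m : Fin d → ℝ}
    (hh : ∀ j, 0 < h j) (hm : ∀ j, 0 ≤ m j) (hη : ∀ j, η j = h j * Real.exp (m j)) :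
    S.weight η ≤ S.weight h * ∏ j, Real.exp (-m j) := by
  unfold weight
  rw [← Finset.prod_inv_distrib, ← Finset.prod_inv_distrib, ← Finset.prod_mul_distrib]
  refine Finset.prod_le_prod (fun j _ => ?_) fun j _ => ?_
  · have : 0 < η j := by rw [hη]; exact mul_pos (hh j) (Real.exp_pos _)
    positivity
  · have hle : h j ≤ η j := by
      rw [hη]; exact le_mul_of_one_le_right (hh j).le (Real.one_le_exp (hm j))
    have h1 : min (h j) 1 ^ S.lam j ≤ min (η j) 1 ^ S.lam j :=
      Real.rpow_le_rpow (le_min (hh j).le zero_le_one) (min_le_min_right _ hle) (hS.lam_nonneg j)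
    have h2 : 0 < min (h j) 1 ^ S.lam j := Real.rpow_pos_of_pos (lt_min (hh j) one_pos) _
    rw [Real.exp_neg, ← mul_inv, hη]
    rw [hη] at h1
    refine inv_anti₀ (by have := hh j; positivity) ?_
    have := mul_le_mul_of_nonneg_left h1 (mul_pos (hh j) (Real.exp_pos (m j))).le
    linarith

theorem Valid.weight_sq_mul_le {S : Setting d} (hS : S.Valid) {h η : Fin d → ℝ} {m : Fin d → ℝ}
    (hh : ∀ j, 0 < h j) (hm : ∀ j, 0 ≤ m j) (hη : ∀ j, η j = h j * Real.exp (m j)) :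
    S.weight η ^ 2 * ∏ j, η j ≤ (S.weight h ^ 2 * ∏ j, h j) * ∏ j, Real.exp (-m j) := by
  have h1 := hS.weight_le hh hm hη
  have hη0 : ∀ j, 0 < η j := fun j => by rw [hη]; exact mul_pos (hh j) (Real.exp_pos _)
  have hw := S.weight_nonneg hη0
  have hp : 0 ≤ ∏ j, η j := Finset.prod_nonneg fun j _ => (hη0 j).le
  have e : ∏ j, η j = (∏ j, h j) * (∏ j, Real.exp (-m j))⁻¹ := by
    rw [← Finset.prod_inv_distrib, ← Finset.prod_mul_distrib]
    refine Finset.prod_congr rfl fun j _ => ?_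
    rw [hη, Real.exp_neg, inv_inv]
  have he : 0 < ∏ j, Real.exp (-m j) := Finset.prod_pos fun j _ => Real.exp_pos _
  calc S.weight η ^ 2 * ∏ j, η j ≤ (S.weight h * ∏ j, Real.exp (-m j)) ^ 2 * ∏ j, η j := by
        gcongr
    _ = _ := by
        rw [e]
        field_simp

theorem prod_one_add_mul_exp_neg_le_one {m : Fin d → ℝ} (hm : ∀ j, 0 ≤ m j) :
    (∏ j, (1 + m j)) * ∏ j, Real.exp (-m j) ≤ 1 := by
  rw [← Finset.prod_mul_distrib]
  refine Finset.prod_le_one (fun j _ => by have := hm j; positivity) fun j _ => ?_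
  rw [Real.exp_neg, ← div_eq_mul_inv, div_le_one (Real.exp_pos _), add_comm]
  exact Real.add_one_le_exp _

/-- The weight decays like `∏ exp (-m_j)` when the bandwidth grows, and this beats the growth `∏ (1
+ m_j)` of the logarithmic factor. -/
theorem Valid.Gn_mono {S : Setting d} (hS : S.Valid) {n : ℕ} (hn : 3 ≤ n) {h η : Fin d → ℝ}
    (hh : ∀ j, 0 < h j) (hle : h ≤ η) : S.Gn n η ≤ S.Gn n h := by
  have hη : ∀ j, η j = h j * Real.exp (Real.log (η j / h j)) := fun j => by
    rw [Real.exp_log (div_pos ((hh j).trans_le (hle j)) (hh j))]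
    have := (hh j).ne'
    field_simp
  have hm : ∀ j, 0 ≤ Real.log (η j / h j) := fun j =>
    Real.log_nonneg ((one_le_div (hh j)).2 (hle j))
  rw [Gn_eq, Gn_eq]
  refine div_le_div_of_nonneg_right ?_ (Nat.cast_nonneg n)
  have h1 := logTerm_le hn hh hm hη
  have h2 := hS.weight_le hh hm hη
  have h3 := prod_one_add_mul_exp_neg_le_one hm
  have hη0 : ∀ j, 0 < η j := fun j => (hh j).trans_le (hle j)
  have h4 := one_le_logTerm hn h
  calc _ ≤ (logTerm n h * ∏ j, (1 + Real.log (η j / h j))) *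
        (S.weight h * ∏ j, Real.exp (-Real.log (η j / h j))) :=
        mul_le_mul h1 h2 (S.weight_nonneg hη0) (le_trans (by linarith [one_le_logTerm hn η]) h1)
    _ = logTerm n h * S.weight h * ((∏ j, (1 + Real.log (η j / h j))) *
        ∏ j, Real.exp (-Real.log (η j / h j))) := by ring
    _ ≤ logTerm n h * S.weight h * 1 := by
        have := S.weight_nonneg hh
        gcongr
    _ = _ := mul_one _

theorem Valid.Fn_sq_le {S : Setting d} (hS : S.Valid) {n : ℕ} (hn : 3 ≤ n) {h η : Fin d → ℝ}
    {m : Fin d → ℝ} (hh : ∀ j, 0 < h j) (hm : ∀ j, 0 ≤ m j)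
    (hη : ∀ j, η j = h j * Real.exp (m j)) :
    S.Fn n η ^ 2 ≤ S.Fn n h ^ 2 * ∏ j, ((1 + m j) * Real.exp (-m j)) := by
  have hη0 : ∀ j, 0 < η j := fun j => by rw [hη]; exact mul_pos (hh j) (Real.exp_pos _)
  rw [Fn_sq S hn hh, Fn_sq S hn hη0, div_mul_eq_mul_div]
  refine div_le_div_of_nonneg_right ?_ (Nat.cast_nonneg n)
  have h1 := logTerm_le hn hh hm hη
  have h2 := hS.weight_sq_mul_le hh hm hη
  have hp : 0 ≤ ∏ j, η j := Finset.prod_nonneg fun j _ => (hη0 j).le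
  rw [Finset.prod_mul_distrib]
  calc _ ≤ (logTerm n h * ∏ j, (1 + m j)) *
        ((S.weight h ^ 2 * ∏ j, h j) * ∏ j, Real.exp (-m j)) :=
        mul_le_mul h1 h2 (by positivity) (le_trans (by linarith [one_le_logTerm hn η]) h1)
    _ = _ := by ring

/-- The bandwidths of the grid above `h` are indexed by multi-indices. -/
theorem exists_nat_of_grid_le {h η : Fin d → ℝ} (hh : ∀ j, h j ∈ grid) (hη : ∀ j, η j ∈ grid)
    (hle : h ≤ η) : ∃ m : Fin d → ℕ, η = fun j => h j * Real.exp (m j) := by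
  have : ∀ j, ∃ m : ℕ, η j = h j * Real.exp m := by
    intro j
    obtain ⟨a, ha⟩ := hh j
    obtain ⟨b, hb⟩ := hη j
    have hab : a ≤ b := by
      have h1 := hle j
      rw [← ha, ← hb] at h1
      exact_mod_cast Real.exp_le_exp.1 h1
    obtain ⟨m, hm⟩ := Int.le.dest hab
    refine ⟨m, ?_⟩
    rw [← ha, ← hb, ← Real.exp_add, ← hm]
    push_cast
    rfl
  choose m hm using this
  exact ⟨m, funext hm⟩

/-- Along the grid above `h` the ratio of `F_n²` to its value at `h` is at most `∏ (1 + m_j) exp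
(-m_j)`. This product is at most one, so a power `u ≥ 1` only helps, and its sum factorises. A union
bound over all larger bandwidths thus costs a constant. -/
theorem exists_tsum_Fn_le (S : Setting d) (hS : S.Valid) {u : ℝ} (hu : 1 ≤ u) :
    ∃ C : ℝ≥0, ∀ (n : ℕ) (h : Fin d → ℝ), 3 ≤ n → (∀ j, 0 < h j) →
      ∑' m : Fin d → ℕ, ENNReal.ofReal ((S.Fn n (fun j => h j * Real.exp (m j)) ^ 2) ^ u) ≤
        C * ENNReal.ofReal ((S.Fn n h ^ 2) ^ u) := by
  refine ⟨((∑' m : ℕ, ENNReal.ofReal ((1 + (m : ℝ)) * Real.exp (-m))) ^ d).toNNReal,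
    fun n h hn hh => ?_⟩
  rw [ENNReal.coe_toNNReal (ENNReal.pow_ne_top
    (tsum_ofReal_ne_top summable_one_add_mul_exp_neg fun m => by positivity)), ← tsum_prod_pi,
    ← ENNReal.tsum_mul_right]
  refine ENNReal.tsum_le_tsum fun m => ?_
  rw [← ENNReal.ofReal_prod_of_nonneg (fun j _ => by positivity), ← ENNReal.ofReal_mul'
    (by positivity)]
  refine ENNReal.ofReal_le_ofReal ?_
  have h1 := hS.Fn_sq_le hn hh (m := fun j => (m j : ℝ)) (fun j => Nat.cast_nonneg _)
    (fun j => rfl)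
  have hp0 : 0 ≤ ∏ j, ((1 + (m j : ℝ)) * Real.exp (-(m j : ℝ))) :=
    Finset.prod_nonneg fun j _ => by positivity
  have hp1 : ∏ j, ((1 + (m j : ℝ)) * Real.exp (-(m j : ℝ))) ≤ 1 := by
    rw [Finset.prod_mul_distrib]
    exact prod_one_add_mul_exp_neg_le_one fun j => Nat.cast_nonneg _
  calc _ ≤ (S.Fn n h ^ 2 * ∏ j, ((1 + (m j : ℝ)) * Real.exp (-(m j : ℝ)))) ^ u :=
        Real.rpow_le_rpow (by positivity) h1 (by linarith)
    _ = (S.Fn n h ^ 2) ^ u * (∏ j, ((1 + (m j : ℝ)) * Real.exp (-(m j : ℝ)))) ^ u :=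
        Real.mul_rpow (by positivity) hp0
    _ ≤ (S.Fn n h ^ 2) ^ u * ∏ j, ((1 + (m j : ℝ)) * Real.exp (-(m j : ℝ))) := by
        gcongr
        exact (Real.rpow_le_rpow_of_exponent_ge' hp0 hp1 zero_le_one hu).trans_eq (Real.rpow_one _)
    _ = _ := mul_comm _ _

end Setting

end ConvDensity

/-! ### Level sets of correlations. -/

namespace ConvDensity

section Correlation

variable {E : Type*} [AddCommGroup E] [MeasurableSpace E] [MeasurableAdd₂ E]
  {μ : Measure E} [SFinite μ]

theorem measurable_lintegral_mul_add {m ψ : E → ℝ≥0∞} (hm : Measurable m) (hψ : Measurable ψ) :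
    Measurable fun x => ∫⁻ y, m y * ψ (y + x) ∂μ :=
  ((hm.comp measurable_snd).mul
    (hψ.comp (measurable_snd.add measurable_fst))).lintegral_prod_right'
    (f := fun q : E × E => m q.2 * ψ (q.2 + q.1))

variable [μ.IsAddLeftInvariant]

theorem lintegral_lintegral_mul_add {m ψ : E → ℝ≥0∞} (hm : Measurable m) (hψ : Measurable ψ) :
    ∫⁻ x, ∫⁻ y, m y * ψ (y + x) ∂μ ∂μ = (∫⁻ y, m y ∂μ) * ∫⁻ x, ψ x ∂μ := by
  rw [lintegral_lintegral_swap]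
  · have : ∀ y, ∫⁻ x, m y * ψ (y + x) ∂μ = m y * ∫⁻ x, ψ x ∂μ := fun y => by
      have hy : Measurable fun x => ψ (y + x) := hψ.comp (measurable_const_add y)
      rw [lintegral_const_mul _ hy, lintegral_add_left_eq_self]
    simp_rw [this]
    rw [lintegral_mul_const _ hm]
  · exact ((hm.comp measurable_snd).mul
      (hψ.comp (measurable_snd.add measurable_fst))).aemeasurable

/-- Tonelli and translation invariance give the integral of the correlation as a product of masses;
Markov's inequality does the rest. -/
theorem measure_lintegral_mul_add_le {m ψ : E → ℝ≥0∞} (hm : Measurable m) (hψ : Measurable ψ)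
    {V τ : ℝ} (hV : 0 < V) (hτ : 0 < τ) (hmV : ∫⁻ y, m y ∂μ ≤ ENNReal.ofReal V) :
    μ {x | ENNReal.ofReal (V * τ) < ∫⁻ y, m y * ψ (y + x) ∂μ} ≤
      ENNReal.ofReal τ⁻¹ * ∫⁻ x, ψ x ∂μ := by
  have hpos : ENNReal.ofReal (V * τ) ≠ 0 := by simp; positivity
  have hsub : {x | ENNReal.ofReal (V * τ) < ∫⁻ y, m y * ψ (y + x) ∂μ} ⊆
      {x | ENNReal.ofReal (V * τ) ≤ ∫⁻ y, m y * ψ (y + x) ∂μ} := by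
    intro x hx
    simp only [mem_ofPred_eq] at hx ⊢
    exact hx.le
  calc _ ≤ μ {x | ENNReal.ofReal (V * τ) ≤ ∫⁻ y, m y * ψ (y + x) ∂μ} := measure_mono hsub
    _ ≤ (∫⁻ x, ∫⁻ y, m y * ψ (y + x) ∂μ ∂μ) / ENNReal.ofReal (V * τ) :=
        meas_ge_le_lintegral_div (measurable_lintegral_mul_add hm hψ).aemeasurable hpos
          ENNReal.ofReal_ne_top
    _ ≤ (ENNReal.ofReal V * ∫⁻ x, ψ x ∂μ) / ENNReal.ofReal (V * τ) := by
        rw [lintegral_lintegral_mul_add hm hψ]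
        gcongr
    _ = _ := by
        rw [div_eq_mul_inv, ← ENNReal.ofReal_inv_of_pos (by positivity), mul_right_comm,
          ← ENNReal.ofReal_mul hV.le, mul_inv, mul_inv_cancel_left₀ hV.ne']

/-- The weak-type bound for the correlation of an integrable function with a function in weak
`L_u`. -/
theorem measure_lintegral_mul_add_le_of_weak {m ψ : E → ℝ≥0∞} (hm : Measurable m)
    (hψ : Measurable ψ) {V τ u : ℝ} (hV : 0 < V) (hτ : 0 < τ) (hu : 1 < u) {A : ℝ≥0∞}
    (hmV : ∫⁻ y, m y ∂μ ≤ ENNReal.ofReal V)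
    (hA : ∀ z : ℝ, 0 < z → μ {x | ENNReal.ofReal z < ψ x} ≤ A * ENNReal.ofReal (z ^ (-u))) :
    μ {x | ENNReal.ofReal (V * τ) < ∫⁻ y, m y * ψ (y + x) ∂μ} ≤
      ENNReal.ofReal (u / (u - 1) * 2 ^ u) * A * ENNReal.ofReal (τ ^ (-u)) := by
  have hset : MeasurableSet {x | ENNReal.ofReal (τ / 2) < ψ x} :=
    measurableSet_lt measurable_const hψ
  -- The part of `ψ` below `τ / 2` contributes at most half of the level, and the part above is
  -- integrable because `u > 1`.
  set ψ' : E → ℝ≥0∞ := {x | ENNReal.ofReal (τ / 2) < ψ x}.indicator ψ with hψ'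
  have hψ'm : Measurable ψ' := hψ.indicator hset
  have hsplit : ∀ x, ψ x ≤ ENNReal.ofReal (τ / 2) + ψ' x := by
    intro x
    by_cases hx : ENNReal.ofReal (τ / 2) < ψ x
    · rw [hψ', indicator_of_mem (show x ∈ {x | ENNReal.ofReal (τ / 2) < ψ x} from hx)]
      exact le_add_self
    · exact (not_lt.1 hx).trans le_self_add
  have hsub : {x | ENNReal.ofReal (V * τ) < ∫⁻ y, m y * ψ (y + x) ∂μ} ⊆
      {x | ENNReal.ofReal (V * (τ / 2)) < ∫⁻ y, m y * ψ' (y + x) ∂μ} := by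
    intro x hx
    simp only [mem_ofPred_eq] at hx ⊢
    by_contra! hcon
    refine absurd hx (not_lt.2 ?_)
    calc ∫⁻ y, m y * ψ (y + x) ∂μ ≤ ∫⁻ y, (m y * ENNReal.ofReal (τ / 2) + m y * ψ' (y + x)) ∂μ := by
          refine lintegral_mono fun y => ?_
          rw [← mul_add]
          exact mul_le_mul_right (hsplit _) _
      _ = (∫⁻ y, m y ∂μ) * ENNReal.ofReal (τ / 2) + ∫⁻ y, m y * ψ' (y + x) ∂μ := by
          rw [lintegral_add_left (hm.mul_const _), lintegral_mul_const _ hm]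
      _ ≤ ENNReal.ofReal V * ENNReal.ofReal (τ / 2) + ENNReal.ofReal (V * (τ / 2)) := by gcongr
      _ = _ := by
          rw [← ENNReal.ofReal_mul hV.le, ← ENNReal.ofReal_add (by positivity) (by positivity)]
          congr 1; ring
  have htail := lintegral_rpow_tail_le (μ := μ) (A := A) hψ one_pos hu (half_pos hτ)
    fun t ht => hA t ((half_pos hτ).trans_le ht)
  simp only [ENNReal.rpow_one] at htail
  have hu1 : 0 < u - 1 := by linarith
  calc _ ≤ _ := measure_mono hsub
    _ ≤ ENNReal.ofReal (τ / 2)⁻¹ * ∫⁻ x, ψ' x ∂μ :=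
        measure_lintegral_mul_add_le hm hψ'm hV (half_pos hτ) hmV
    _ ≤ ENNReal.ofReal (τ / 2)⁻¹ *
        (ENNReal.ofReal (u / (u - 1)) * A * ENNReal.ofReal ((τ / 2) ^ (1 - u))) := by
        rw [hψ', lintegral_indicator hset]
        gcongr
    _ = _ := by
        have e : u / (u - 1) * 2 ^ u * τ ^ (-u) =
            (τ / 2)⁻¹ * (u / (u - 1)) * (τ / 2) ^ (1 - u) := by
          rw [Real.rpow_sub (half_pos hτ), Real.rpow_one, Real.div_rpow hτ.le zero_le_two,
            Real.rpow_neg hτ.le]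
          have : (τ ^ u) ≠ 0 := (Real.rpow_pos_of_pos hτ u).ne'
          have : ((2 : ℝ) ^ u) ≠ 0 := (Real.rpow_pos_of_pos two_pos u).ne'
          field_simp
        calc _ = A * (ENNReal.ofReal (τ / 2)⁻¹ * ENNReal.ofReal (u / (u - 1)) *
              ENNReal.ofReal ((τ / 2) ^ (1 - u))) := by ring
          _ = A * ENNReal.ofReal (u / (u - 1) * 2 ^ u * τ ^ (-u)) := by
              rw [e, ENNReal.ofReal_mul (by positivity), ENNReal.ofReal_mul (by positivity)]
          _ = _ := by rw [ENNReal.ofReal_mul (by positivity)]; ring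

end Correlation

/-! ### The standard deviation terms and their suprema over larger bandwidths. -/

variable {d : ℕ}

namespace Setting

/-- The variance proxy `∫ M²(z - x, h) dP(z)`. -/
noncomputable def sigmaSq (M : (Fin d → ℝ) → (Fin d → ℝ) → ℝ) (P : Measure (Fin d → ℝ))
    (x h : Fin d → ℝ) : ℝ :=
  ∫ z, M (z - x) h ^ 2 ∂P

/-- The theoretical counterpart of `Uhat`. -/
noncomputable def Ubar (S : Setting d) (M : (Fin d → ℝ) → (Fin d → ℝ) → ℝ)
    (P : Measure (Fin d → ℝ)) (n : ℕ) (x h : Fin d → ℝ) : ℝ :=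
  bernsteinBound (S.lamN n h) (S.Minf * S.weight h) (sigmaSq M P x h) n

/-- The supremum of `Ubar` over the larger bandwidths. -/
noncomputable def UbarStar (S : Setting d) (M : (Fin d → ℝ) → (Fin d → ℝ) → ℝ)
    (P : Measure (Fin d → ℝ)) (H : Set (Fin d → ℝ)) (n : ℕ) (h x : Fin d → ℝ) : ℝ≥0∞ :=
  ⨆ η ∈ {η ∈ H | h ≤ η}, ENNReal.ofReal (S.Ubar M P n x η)

/-- The supremum of the standard deviation terms over the larger bandwidths. -/
noncomputable def noiseSup (S : Setting d) (M : (Fin d → ℝ) → (Fin d → ℝ) → ℝ)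
    (P : Measure (Fin d → ℝ)) (H : Set (Fin d → ℝ)) (n : ℕ) (h x : Fin d → ℝ) : ℝ≥0∞ :=
  ⨆ η ∈ {η ∈ H | h ≤ η}, ENNReal.ofReal (√(2 * S.lamN n η * sigmaSq M P x η / n))

theorem Uhat_eq (S : Setting d) (M : (Fin d → ℝ) → (Fin d → ℝ) → ℝ) {n : ℕ}
    (z : Fin n → Fin d → ℝ) (x h : Fin d → ℝ) :
    S.Uhat M z x h = bernsteinBound (S.lamN n h) (S.Minf * S.weight h)
      ((n : ℝ)⁻¹ * ∑ i, M (z i - x) h ^ 2) n := by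
  rw [Uhat, bernsteinBound, sigmaHatSq, weight]
  congr 1
  rw [div_eq_mul_inv, div_eq_mul_inv, mul_inv, mul_inv]
  ring

/-- The linear term of Bernstein's bound is a multiple of `G_n`, which decreases in the bandwidth;
only the square root term has to be kept as a supremum. -/
theorem Valid.exists_UbarStar_le {S : Setting d} (hS : S.Valid) :
    ∃ C : ℝ≥0, ∀ (M : (Fin d → ℝ) → (Fin d → ℝ) → ℝ) (P : Measure (Fin d → ℝ))
      (H : Set (Fin d → ℝ)) (n : ℕ) (h x : Fin d → ℝ), 3 ≤ n → (∀ j, 0 < h j) →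
      S.UbarStar M P H n h x ≤ S.noiseSup M P H n h x + C * ENNReal.ofReal (S.Gn n h) := by
  obtain ⟨C, hC0, hC⟩ := hS.exists_lamN_le
  have hM1 := S.one_le_Minf
  refine ⟨Real.toNNReal (2 * S.Minf * C), fun M P H n h x hn hh => iSup₂_le fun η hη => ?_⟩
  have hη0 : ∀ j, 0 < η j := fun j => (hh j).trans_le (hη.2 j)
  have hG0 : 0 ≤ S.Gn n h := by
    rw [Gn_eq]
    have := one_le_logTerm hn h
    have := S.weight_nonneg hh
    positivity
  rw [Ubar, bernsteinBound, ENNReal.ofNNReal_toNNReal]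
  refine ENNReal.ofReal_add_le.trans (add_le_add ?_ ?_)
  · exact le_iSup₂ (f := fun η (_ : η ∈ {η ∈ H | h ≤ η}) =>
      ENNReal.ofReal (√(2 * S.lamN n η * sigmaSq M P x η / n))) η hη
  · rw [← ENNReal.ofReal_mul (by positivity)]
    refine ENNReal.ofReal_le_ofReal ?_
    have h1 := hC n η hn
    have h2 := hS.Gn_mono hn hh hη.2
    have hw := S.weight_nonneg hη0
    have hL := one_le_logTerm hn η
    have hn0 : (0 : ℝ) < n := by positivity
    calc 4 * (S.Minf * S.weight η) * S.lamN n η / (3 * n) ≤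
          4 * (S.Minf * S.weight η) * (C * logTerm n η) / (3 * n) := by gcongr
      _ = 4 / 3 * S.Minf * C * S.Gn n η := by
          rw [Gn_eq]
          field_simp
      _ ≤ 2 * S.Minf * C * S.Gn n h := by
          have : 0 ≤ S.Minf * C := by positivity
          nlinarith [mul_le_mul_of_nonneg_left h2 this, mul_nonneg this hG0]

theorem ofReal_sigmaSq_le {M : (Fin d → ℝ) → (Fin d → ℝ) → ℝ} {h : Fin d → ℝ}
    (hM : Measurable fun y => M y h) {π : (Fin d → ℝ) → ℝ≥0∞} (hπ : Measurable π)
    (x : Fin d → ℝ) :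
    ENNReal.ofReal (sigmaSq M (volume.withDensity π) x h) ≤
      ∫⁻ y, ENNReal.ofReal (M y h ^ 2) * π (y + x) := by
  have hm : Measurable fun z : Fin d → ℝ => ENNReal.ofReal (M (z - x) h ^ 2) :=
    ENNReal.measurable_ofReal.comp ((hM.comp (measurable_id.sub_const x)).pow_const 2)
  have h1 : ∫⁻ y, ENNReal.ofReal (M y h ^ 2) * π (y + x) =
      ∫⁻ z, ENNReal.ofReal (M (z - x) h ^ 2) ∂(volume.withDensity π) := by
    rw [lintegral_withDensity_eq_lintegral_mul _ hπ hm,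
      ← lintegral_add_right_eq_self (μ := volume)
        (π * fun z : Fin d → ℝ => ENNReal.ofReal (M (z - x) h ^ 2)) x]
    refine lintegral_congr fun y => ?_
    simp [mul_comm]
  have hm2 : Measurable fun z : Fin d → ℝ => M (z - x) h ^ 2 :=
    (hM.comp (measurable_id.sub_const x)).pow_const 2
  rw [h1, sigmaSq, integral_eq_lintegral_of_nonneg_ae
    (Filter.Eventually.of_forall fun _ => sq_nonneg _) hm2.aestronglyMeasurable]
  exact ENNReal.ofReal_toReal_le

theorem Fn_sq_pos (S : Setting d) {n : ℕ} (hn : 3 ≤ n) {h : Fin d → ℝ} (hh : ∀ j, 0 < h j) :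
    0 < S.Fn n h ^ 2 := by
  rw [Fn_sq S hn hh]
  have h1 := one_le_logTerm hn h
  have h2 := S.weight_pos hh
  have h3 : 0 < ∏ j, h j := Finset.prod_pos fun j _ => hh j
  have hn0 : (0 : ℝ) < n := by positivity
  positivity

/-- The level sets of the standard deviation term at a single bandwidth. -/
theorem IsDeconvKernel.exists_level_subset {S : Setting d} (hS : S.Valid) (hd : 1 ≤ d)
    {M : (Fin d → ℝ) → (Fin d → ℝ) → ℝ} (hM : S.IsDeconvKernel M) :
    ∃ c : ℝ, 0 < c ∧ ∀ (n : ℕ) (η : Fin d → ℝ), 3 ≤ n → (∀ j, 0 < η j) → ∃ V : ℝ, 0 < V ∧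
      ∫⁻ y, ENNReal.ofReal (M y η ^ 2) ≤ ENNReal.ofReal V ∧
      ∀ (π : (Fin d → ℝ) → ℝ≥0∞) (t : ℝ), Measurable π → 0 < t →
      {x | ENNReal.ofReal t <
          ENNReal.ofReal (√(2 * S.lamN n η * sigmaSq M (volume.withDensity π) x η / n))} ⊆
        {x | ENNReal.ofReal (V * (c * t ^ 2 / S.Fn n η ^ 2)) <
          ∫⁻ y, ENNReal.ofReal (M y η ^ 2) * π (y + x)} := by
  obtain ⟨C, hC0, hC⟩ := hS.exists_lamN_le
  obtain ⟨Cv, hCv⟩ := hM.lintegral_sq_le hS hd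
  refine ⟨(2 * C * (Cv + 1))⁻¹, by positivity, fun n η hn hη => ?_⟩
  have hF := Fn_sq S hn hη
  have hw := S.weight_pos hη
  have hp : 0 < ∏ j, η j := Finset.prod_pos fun j _ => hη j
  have hL := one_le_logTerm hn η
  have hn0 : (0 : ℝ) < n := by positivity
  -- `V` bounds the squared `L_2` norm of the kernel. Since `F_n²` is `V / (Cv + 1)` times the
  -- logarithmic factor over `n`, the threshold for the variance becomes `V` times `t² / F_n²` up to
  -- a constant.
  refine ⟨(Cv + 1) * (S.weight η ^ 2 * ∏ j, η j), by positivity, ?_, fun π t hπ ht x hx => ?_⟩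
  · refine (hCv η hη).trans ?_
    have hle : (Cv : ℝ≥0∞) ≤ ENNReal.ofReal ((Cv : ℝ) + 1) := by
      rw [← ENNReal.ofReal_coe_nnreal]
      exact ENNReal.ofReal_le_ofReal (by linarith)
    rw [ENNReal.ofReal_mul (show (0 : ℝ) ≤ (Cv : ℝ) + 1 by positivity)]
    exact mul_le_mul' hle le_rfl
  · simp only [mem_ofPred_eq] at hx ⊢
    refine lt_of_lt_of_le ?_ (ofReal_sigmaSq_le (hM η hη).1 hπ x)
    set σ := sigmaSq M (volume.withDensity π) x η with hσ
    have hσ0 : 0 ≤ σ := integral_nonneg fun _ => sq_nonneg _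
    have h1 : t < √(2 * S.lamN n η * σ / n) := (ENNReal.ofReal_lt_ofReal_iff_of_nonneg ht.le).1 hx
    rw [Real.lt_sqrt ht.le] at h1
    have h2 : 2 * S.lamN n η * σ / n ≤ 2 * (C * logTerm n η) * σ / n := by
      have := hC n η hn
      gcongr
    refine (ENNReal.ofReal_lt_ofReal_iff_of_nonneg (by positivity)).2 ?_
    rw [hF]
    have h3 : t ^ 2 * n < 2 * (C * logTerm n η) * σ := by
      rw [← lt_div_iff₀ hn0]; exact h1.trans_le h2
    have e : (Cv + 1) * (S.weight η ^ 2 * ∏ j, η j) * ((2 * C * (Cv + 1))⁻¹ * t ^ 2 /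
        (logTerm n η * (S.weight η ^ 2 * ∏ j, η j) / n)) = t ^ 2 * n / (2 * (C * logTerm n η)) := by
      field_simp
    rw [e, div_lt_iff₀ (by positivity)]
    linarith

theorem noiseSup_level_subset {S : Setting d} {M : (Fin d → ℝ) → (Fin d → ℝ) → ℝ}
    {P : Measure (Fin d → ℝ)} {Hf : Family} {n : ℕ} {h : Fin d → ℝ} (hh : h ∈ Hf.toSet d)
    {t : ℝ} : {x | ENNReal.ofReal t < S.noiseSup M P (Hf.toSet d) n h x} ⊆
      ⋃ m : Fin d → ℕ, {x | ENNReal.ofReal t < ENNReal.ofReal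
        (√(2 * S.lamN n (fun j => h j * Real.exp (m j)) *
          sigmaSq M P x (fun j => h j * Real.exp (m j)) / n))} := by
  intro x hx
  simp only [mem_ofPred_eq, noiseSup, lt_iSup_iff] at hx
  obtain ⟨η, hη, hx⟩ := hx
  obtain ⟨m, rfl⟩ := exists_nat_of_grid_le (mem_grid_of_mem_toSet hh) (mem_grid_of_mem_toSet hη.1) hη.2
  exact mem_iUnion.2 ⟨m, hx⟩

/-- A union bound over the grid above `h`, the series being dominated by its value at `h`. The
predicate `Q` stands for the information on the density: total mass one, with `u = 1`, or a weak
`L_u` bound. -/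
theorem IsDeconvKernel.exists_noiseSup_measure_le {S : Setting d} (hS : S.Valid) (hd : 1 ≤ d)
    {M : (Fin d → ℝ) → (Fin d → ℝ) → ℝ} (hM : S.IsDeconvKernel M) {u : ℝ} (hu : 1 ≤ u)
    {K : ℝ≥0} {Q : ((Fin d → ℝ) → ℝ≥0∞) → Prop}
    (hQ : ∀ (π m : (Fin d → ℝ) → ℝ≥0∞) (V τ : ℝ), Q π → Measurable π → Measurable m → 0 < V →
      0 < τ → ∫⁻ y, m y ≤ ENNReal.ofReal V →
      volume {x | ENNReal.ofReal (V * τ) < ∫⁻ y, m y * π (y + x)} ≤ K * ENNReal.ofReal (τ ^ (-u))) :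
    ∃ C : ℝ≥0, ∀ (n : ℕ) (Hf : Family) (π : (Fin d → ℝ) → ℝ≥0∞) (h : Fin d → ℝ) (t : ℝ), 3 ≤ n →
      Measurable π → Q π → h ∈ Hf.toSet d → 0 < t →
      volume {x | ENNReal.ofReal t < S.noiseSup M (volume.withDensity π) (Hf.toSet d) n h x} ≤
        C * ENNReal.ofReal ((S.Fn n h ^ 2) ^ u * t ^ (-(2 * u))) := by
  obtain ⟨c, hc, hlev⟩ := hM.exists_level_subset hS hd
  obtain ⟨C, hC⟩ := S.exists_tsum_Fn_le hS hu
  refine ⟨K * Real.toNNReal (c ^ (-u)) * C, fun n Hf π h t hn hπ hQπ hh ht => ?_⟩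
  have hh0 : ∀ j, 0 < h j := fun j => grid_pos (mem_grid_of_mem_toSet hh j)
  refine (measure_mono (noiseSup_level_subset hh)).trans ((measure_iUnion_le _).trans ?_)
  have hone : ∀ m : Fin d → ℕ, volume {x | ENNReal.ofReal t < ENNReal.ofReal
        (√(2 * S.lamN n (fun j => h j * Real.exp (m j)) *
          sigmaSq M (volume.withDensity π) x (fun j => h j * Real.exp (m j)) / n))} ≤
      (K * ENNReal.ofReal (c ^ (-u) * t ^ (-(2 * u)))) *
        ENNReal.ofReal ((S.Fn n (fun j => h j * Real.exp (m j)) ^ 2) ^ u) := by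
    intro m
    have hη0 : ∀ j, 0 < h j * Real.exp (m j) := fun j => mul_pos (hh0 j) (Real.exp_pos _)
    obtain ⟨V, hV, hmV, hsub⟩ := hlev n _ hn hη0
    have hF := Fn_sq_pos S hn hη0
    refine (measure_mono (hsub π t hπ ht)).trans ?_
    refine (hQ π _ V _ hQπ hπ ?_ hV (by positivity) hmV).trans (le_of_eq ?_)
    · exact ENNReal.measurable_ofReal.comp ((hM _ hη0).1.pow_const 2)
    · rw [mul_assoc, ← ENNReal.ofReal_mul (by positivity)]
      congr 2
      rw [Real.div_rpow (by positivity) hF.le, Real.mul_rpow hc.le (by positivity),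
        Real.rpow_neg hF.le, div_inv_eq_mul, ← Real.rpow_natCast t 2, ← Real.rpow_mul ht.le]
      congr 3
      push_cast; ring
  refine (ENNReal.tsum_le_tsum hone).trans ?_
  rw [ENNReal.tsum_mul_left]
  calc _ ≤ (K * ENNReal.ofReal (c ^ (-u) * t ^ (-(2 * u)))) *
        (C * ENNReal.ofReal ((S.Fn n h ^ 2) ^ u)) := by
        gcongr
        exact hC n h hn hh0
    _ = _ := by
        rw [ENNReal.ofReal_mul (by positivity), ENNReal.ofReal_mul (by positivity), ENNReal.coe_mul,
          ENNReal.coe_mul, ENNReal.ofNNReal_toNNReal]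
        ring

/-- For a bounded density the standard deviation terms are bounded by `F_n`. -/
theorem IsDeconvKernel.exists_noiseSup_le {S : Setting d} (hS : S.Valid) (hd : 1 ≤ d)
    {M : (Fin d → ℝ) → (Fin d → ℝ) → ℝ} (hM : S.IsDeconvKernel M) {D : ℝ} (hD : 0 < D) :
    ∃ C : ℝ, 0 < C ∧ ∀ (n : ℕ) (Hf : Family) (π : (Fin d → ℝ) → ℝ≥0∞) (h x : Fin d → ℝ), 3 ≤ n →
      Measurable π → (∀ᵐ y, π y ≤ ENNReal.ofReal D) → h ∈ Hf.toSet d →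
      S.noiseSup M (volume.withDensity π) (Hf.toSet d) n h x ≤ ENNReal.ofReal (C * S.Fn n h) := by
  obtain ⟨c, hc, hlev⟩ := hM.exists_level_subset hS hd
  refine ⟨√(D / c), by positivity, fun n Hf π h x hn hπ hπD hh => ?_⟩
  have hh0 : ∀ j, 0 < h j := fun j => grid_pos (mem_grid_of_mem_toSet hh j)
  have hFh := Fn_sq_pos S hn hh0
  have hFh0 : 0 ≤ S.Fn n h := by
    unfold Fn
    refine div_nonneg (Real.sqrt_nonneg _) (mul_nonneg (Real.sqrt_nonneg _)
      (Finset.prod_nonneg fun j _ => mul_nonneg (Real.rpow_nonneg (hh0 j).le _)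
        (Real.rpow_nonneg (le_min (hh0 j).le zero_le_one) _)))
  have hFpos : 0 < S.Fn n h := lt_of_le_of_ne hFh0 (by rintro h; rw [← h] at hFh; simp at hFh)
  by_contra! hcon
  have hx := noiseSup_level_subset hh (show x ∈ {x | _} from hcon)
  obtain ⟨m, hm⟩ := mem_iUnion.1 hx
  have hη0 : ∀ j, 0 < h j * Real.exp (m j) := fun j => mul_pos (hh0 j) (Real.exp_pos _)
  obtain ⟨V, hV, hmV, hsub⟩ := hlev n _ hn hη0
  have h1 := hsub π _ hπ (by positivity) hm
  have hF := Fn_sq_pos S hn hη0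
  have hFle : S.Fn n (fun j => h j * Real.exp (m j)) ^ 2 ≤ S.Fn n h ^ 2 := by
    refine (hS.Fn_sq_le hn hh0 (m := fun j => (m j : ℝ)) (fun j => Nat.cast_nonneg _)
      (fun j => rfl)).trans ?_
    refine mul_le_of_le_one_right (by positivity) ?_
    rw [Finset.prod_mul_distrib]
    exact prod_one_add_mul_exp_neg_le_one fun j => Nat.cast_nonneg _
  simp only [mem_ofPred_eq] at h1
  refine absurd h1 (not_lt.2 ?_)
  have hπx : ∀ᵐ y, π (y + x) ≤ ENNReal.ofReal D :=
    (measurePreserving_add_right volume x).quasiMeasurePreserving.ae hπD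
  have hDle : D ≤ c * (√(D / c) * S.Fn n h) ^ 2 / S.Fn n (fun j => h j * Real.exp (m j)) ^ 2 := by
    rw [mul_pow, Real.sq_sqrt (by positivity), le_div_iff₀ hF]
    calc _ ≤ D * S.Fn n h ^ 2 := by gcongr
      _ = _ := by field_simp
  calc _ ≤ ∫⁻ y, ENNReal.ofReal (M y (fun j => h j * Real.exp (m j)) ^ 2) * ENNReal.ofReal D := by
        refine lintegral_mono_ae ?_
        filter_upwards [hπx] with y hy
        gcongr
    _ ≤ ENNReal.ofReal V * ENNReal.ofReal D := by
        rw [lintegral_mul_const' _ _ ENNReal.ofReal_ne_top]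
        gcongr
    _ ≤ _ := by
        rw [← ENNReal.ofReal_mul hV.le]
        gcongr

end Setting

end ConvDensity

/-! ### The mean of the kernel estimator and the oracle inequality. -/

namespace ConvDensity

variable {d : ℕ}

namespace Setting

/-- The mean of the kernel estimator. -/
theorem IsDeconvKernel.integral_eq_smooth {S : Setting d} (hS : S.Valid) (hd : 1 ≤ d)
    {M : (Fin d → ℝ) → (Fin d → ℝ) → ℝ} (hM : S.IsDeconvKernel M) {f : (Fin d → ℝ) → ℝ}
    (hf : Integrable f) (hob : Integrable (S.obsDensity f)) (hob0 : ∀ᵐ x, 0 ≤ S.obsDensity f x)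
    {h : Fin d → ℝ} (hh : ∀ j, 0 < h j) (x : Fin d → ℝ) :
    ∫ z, M (z - x) h ∂(volume.withDensity fun z => ENNReal.ofReal (S.obsDensity f z)) =
      S.smooth h f x := by
  have hMm := (hM h hh).1
  have hMx : Measurable fun z : Fin d → ℝ => M (z - x) h := hMm.comp (measurable_id.sub_const x)
  have hMb : ∀ᵐ z : Fin d → ℝ, ‖M (z - x) h‖ ≤ S.Minf * S.weight h :=
    (measurePreserving_sub_right volume x).quasiMeasurePreserving.ae (hM.ae_abs_le hS hd hh)
  have h1 : ∫ z, M (z - x) h ∂(volume.withDensity fun z => ENNReal.ofReal (S.obsDensity f z)) =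
      ∫ z, S.obsDensity f z * M (z - x) h := by
    rw [integral_withDensity_eq_integral_toReal_smul₀ hob.1.aemeasurable.ennreal_ofReal
      (Filter.Eventually.of_forall fun _ => ENNReal.ofReal_lt_top)]
    refine integral_congr_ae ?_
    filter_upwards [hob0] with z hz
    rw [ENNReal.toReal_ofReal hz, smul_eq_mul]
  have hconv : ∀ z, conv f S.g z = ∫ y, f y * S.g (z - y) := by
    intro z
    rw [conv, ← integral_sub_left_eq_self _ volume z]
    simp
  have hI : Integrable (fun q : (Fin d → ℝ) × (Fin d → ℝ) =>
      f q.2 * S.g (q.1 - q.2) * M (q.1 - x) h) (volume.prod volume) := by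
    have hi := hf.convolution_integrand (ContinuousLinearMap.mul ℝ ℝ) hS.g_integrable
    refine hi.mul_bdd (c := S.Minf * S.weight h) (hMx.comp measurable_fst).aestronglyMeasurable ?_
    exact Measure.quasiMeasurePreserving_fst.ae hMb
  have hi1 : Integrable fun z => f z * M (z - x) h :=
    hf.mul_bdd (c := S.Minf * S.weight h) hMx.aestronglyMeasurable hMb
  have hi2 : Integrable fun z => conv f S.g z * M (z - x) h := by
    have := hI.integral_prod_left
    refine this.congr (Filter.Eventually.of_forall fun z => ?_)
    simp only [integral_mul_const, hconv]
  -- Fubini moves the convolution with `g` from `f` to `M`; the two terms then recombine into the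
  -- left-hand side of the equation that defines `M`.
  have e2 : ∫ z, conv f S.g z * M (z - x) h = ∫ y, f y * ∫ t, S.g (t - (y - x)) * M t h := by
    calc ∫ z, conv f S.g z * M (z - x) h = ∫ z, ∫ y, f y * S.g (z - y) * M (z - x) h := by
          congr 1 with z
          rw [integral_mul_const, hconv]
      _ = ∫ y, ∫ z, f y * S.g (z - y) * M (z - x) h := integral_integral_swap hI
      _ = _ := by
          congr 1 with y
          rw [← integral_const_mul, ← integral_add_right_eq_self _ x]
          congr 1 with t
          rw [add_sub_cancel_right, mul_assoc]
          congr 3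
          abel
  have hi3 : Integrable fun y => f y * ∫ t, S.g (t - (y - x)) * M t h := by
    have := hI.integral_prod_right
    refine this.congr (Filter.Eventually.of_forall fun y => ?_)
    dsimp only
    rw [← integral_const_mul, ← integral_add_right_eq_self _ x]
    congr 1 with t
    rw [add_sub_cancel_right, mul_assoc]
    congr 3
    abel
  rw [h1]
  calc ∫ z, S.obsDensity f z * M (z - x) h =
        ∫ z, ((1 - S.α) * (f z * M (z - x) h) + S.α * (conv f S.g z * M (z - x) h)) := by
        congr 1 with z
        rw [obsDensity]; ring
    _ = (1 - S.α) * (∫ z, f z * M (z - x) h) + S.α * ∫ y, f y * ∫ t, S.g (t - (y - x)) * M t h := by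
        rw [integral_add (hi1.const_mul _) (hi2.const_mul _), integral_const_mul,
          integral_const_mul, e2]
    _ = ∫ y, ((1 - S.α) * (f y * M (y - x) h) +
        S.α * (f y * ∫ t, S.g (t - (y - x)) * M t h)) := by
        rw [integral_add (hi1.const_mul _) (hi3.const_mul _), integral_const_mul,
          integral_const_mul]
    _ = _ := by
        rw [smooth]
        congr 1 with y
        rw [(hM h hh).2.2]
        ring

section Oracle

variable (S : Setting d) (M : (Fin d → ℝ) → (Fin d → ℝ) → ℝ) (P : Measure (Fin d → ℝ))
  (f : (Fin d → ℝ) → ℝ) {n : ℕ}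

/-- The deviation of the kernel estimator beyond its theoretical bound. -/
noncomputable def devExcess (z : Fin n → Fin d → ℝ) (x h : Fin d → ℝ) : ℝ≥0∞ :=
  ENNReal.ofReal (|kernelEst M z x h - S.smooth h f x| - S.Ubar M P n x h)

/-- The excess of the theoretical bound over the empirical one. -/
noncomputable def lowerExcess (z : Fin n → Fin d → ℝ) (x h : Fin d → ℝ) : ℝ≥0∞ :=
  ENNReal.ofReal (S.Ubar M P n x h - 4 * S.Uhat M z x h)

/-- The excess of the empirical bound over the theoretical one. -/
noncomputable def upperExcess (z : Fin n → Fin d → ℝ) (x h : Fin d → ℝ) : ℝ≥0∞ :=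
  ENNReal.ofReal (S.Uhat M z x h - 4 * S.Ubar M P n x h)

/-- The remainder of the oracle inequality. -/
noncomputable def remainder (H : Set (Fin d → ℝ)) (z : Fin n → Fin d → ℝ) (x : Fin d → ℝ) : ℝ≥0∞ :=
  (⨆ h ∈ H, S.devExcess M P f z x h) + (⨆ h ∈ H, S.lowerExcess M P z x h) +
    ⨆ h ∈ H, S.upperExcess M P z x h

variable {S M P f}

theorem Valid.lamN_nonneg (hS : S.Valid) (n : ℕ) (h : Fin d → ℝ) : 0 ≤ S.lamN n h := by
  have h2 := Real.log_nonneg S.one_le_Minf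
  have h1 := Real.log_natCast_nonneg n
  have h3 : 0 ≤ ∑ j, (1 + S.lam j) * |Real.log (h j)| := Finset.sum_nonneg fun j _ =>
    mul_nonneg (by linarith [hS.lam_nonneg j]) (abs_nonneg _)
  have h4 := hS.one_lt_p
  unfold lamN
  positivity

theorem Valid.Uhat_nonneg (hS : S.Valid) (z : Fin n → Fin d → ℝ) (x : Fin d → ℝ) {h : Fin d → ℝ}
    (hh : ∀ j, 0 < h j) : 0 ≤ S.Uhat M z x h := by
  rw [Uhat_eq, bernsteinBound]
  have h1 := hS.lamN_nonneg n h
  have h2 := S.weight_nonneg hh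
  have h3 := S.one_le_Minf
  positivity

theorem enorm_sub_le_triple (a b c e : ℝ) : ‖a - e‖ₑ ≤ ‖a - b‖ₑ + ‖b - c‖ₑ + ‖c - e‖ₑ := by
  calc ‖a - e‖ₑ = ‖((a - b) + (b - c)) + (c - e)‖ₑ := by congr 1; ring
    _ ≤ _ := (enorm_add_le _ _).trans (add_le_add (enorm_add_le _ _) le_rfl)

/-- The pointwise oracle inequality for the selected estimator. -/
theorem IsSelection.oracle (hS : S.Valid) {Hf : Family} {δ : (Fin d → ℝ) → ℝ}
    {hsel : (Fin n → Fin d → ℝ) → (Fin d → ℝ) → (Fin d → ℝ)}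
    (hsl : S.IsSelection M (Hf.toSet d) n δ hsel) (z : Fin n → Fin d → ℝ) {x : Fin d → ℝ}
    {h : Fin d → ℝ} (hh : h ∈ Hf.toSet d)
    (hbias : ‖S.smooth h f x - f x‖ₑ ≤ S.biasSup (Hf.toSet d) h f x) :
    ‖selectedEst M hsel z x - f x‖ₑ ≤
      (3 * S.biasSup (Hf.toSet d) h f x + 80 * S.UbarStar M P (Hf.toSet d) n h x) +
        20 * S.remainder M P f (Hf.toSet d) z x + ENNReal.ofReal (δ x) := by
  set H := Hf.toSet d with hH
  have hpos : ∀ {η : Fin d → ℝ}, η ∈ H → ∀ j, 0 < η j := fun hη j =>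
    grid_pos (mem_grid_of_mem_toSet hη j)
  set ζ₁ := ⨆ h ∈ H, S.devExcess M P f z x h with hζ₁
  set ζ₂ := ⨆ h ∈ H, S.upperExcess M P z x h with hζ₂
  set ζ₃ := ⨆ h ∈ H, S.lowerExcess M P z x h with hζ₃
  set B := S.biasSup H h f x with hB
  have hU0 : ∀ {η : Fin d → ℝ}, η ∈ H → 0 ≤ S.Uhat M z x η := fun hη => hS.Uhat_nonneg z x (hpos hη)
  -- The deviation is first compared with the theoretical bound and then with four times the
  -- empirical one; the two excesses go into the remainder.
  have hdev : ∀ {η : Fin d → ℝ}, η ∈ H → ‖kernelEst M z x η - S.smooth η f x‖ₑ ≤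
      4 * ENNReal.ofReal (S.Uhat M z x η) + (ζ₁ + ζ₃) := by
    intro η hη
    have e : |kernelEst M z x η - S.smooth η f x| =
        4 * S.Uhat M z x η + ((|kernelEst M z x η - S.smooth η f x| - S.Ubar M P n x η) +
          (S.Ubar M P n x η - 4 * S.Uhat M z x η)) := by ring
    rw [← ofReal_norm, Real.norm_eq_abs, e]
    refine ENNReal.ofReal_add_le.trans (add_le_add ?_ (ENNReal.ofReal_add_le.trans
      (add_le_add ?_ ?_)))
    · rw [ENNReal.ofReal_mul zero_le_four]; simp
    · exact le_iSup₂ (f := fun h (_ : h ∈ H) => S.devExcess M P f z x h) η hη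
    · exact le_iSup₂ (f := fun h (_ : h ∈ H) => S.lowerExcess M P z x h) η hη
  have hR : S.Rhat M H z x h ≤ B + 2 * (ζ₁ + ζ₃) := by
    refine iSup₂_le fun η hη => ?_
    have hs := sup_mem_toSet hh hη
    rw [ENNReal.ofReal_sub _ (mul_nonneg zero_le_four (hU0 hη)),
      ENNReal.ofReal_sub _ (mul_nonneg zero_le_four (hU0 hs)), tsub_le_iff_right,
      tsub_le_iff_right, ENNReal.ofReal_mul zero_le_four, ENNReal.ofReal_mul zero_le_four,
      ← Real.norm_eq_abs, ofReal_norm]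
    have hb : ‖S.smooth (h ⊔ η) f x - S.smooth η f x‖ₑ ≤ B :=
      le_iSup₂ (f := fun η (_ : η ∈ H) => ‖S.smooth (h ⊔ η) f x - S.smooth η f x‖ₑ) η hη
    have h3 := hdev hη
    rw [enorm_sub_rev] at h3
    refine (enorm_sub_le_triple _ (S.smooth (h ⊔ η) f x) (S.smooth η f x) _).trans
      ((add_le_add (add_le_add (hdev hs) hb) h3).trans (le_of_eq ?_))
    simp only [ENNReal.ofReal_ofNat]
    ring
  -- By construction of `Rhat`, the two estimators differ by at most `Rhat` at `a` plus empirical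
  -- bounds. It is used for the pair `h`, `𝐡(x)` in both orders, since `a ∨ b` is symmetric.
  have hpair : ∀ {a b : Fin d → ℝ}, a ∈ H → b ∈ H →
      ‖kernelEst M z x (a ⊔ b) - kernelEst M z x b‖ₑ ≤ S.Rhat M H z x a +
        4 * S.UhatStar M H z x a + 4 * S.UhatStar M H z x b := by
    intro a b ha hb
    have e : |kernelEst M z x (a ⊔ b) - kernelEst M z x b| =
        (|kernelEst M z x (a ⊔ b) - kernelEst M z x b| - 4 * S.Uhat M z x (a ⊔ b) -
          4 * S.Uhat M z x b) + 4 * S.Uhat M z x (a ⊔ b) + 4 * S.Uhat M z x b := by ring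
    rw [← ofReal_norm, Real.norm_eq_abs, e]
    refine ENNReal.ofReal_add_le.trans (add_le_add (ENNReal.ofReal_add_le.trans
      (add_le_add ?_ ?_)) ?_)
    · exact le_iSup₂ (f := fun η (_ : η ∈ H) => ENNReal.ofReal
        (|kernelEst M z x (a ⊔ η) - kernelEst M z x η| - 4 * S.Uhat M z x (a ⊔ η) -
          4 * S.Uhat M z x η)) b hb
    · rw [ENNReal.ofReal_mul zero_le_four, ENNReal.ofReal_ofNat]
      gcongr
      exact le_iSup₂ (f := fun η (_ : η ∈ {η ∈ H | a ≤ η}) => ENNReal.ofReal (S.Uhat M z x η))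
        (a ⊔ b) ⟨sup_mem_toSet ha hb, le_sup_left⟩
    · rw [ENNReal.ofReal_mul zero_le_four, ENNReal.ofReal_ofNat]
      gcongr
      exact le_iSup₂ (f := fun η (_ : η ∈ {η ∈ H | b ≤ η}) => ENNReal.ofReal (S.Uhat M z x η))
        b ⟨hb, le_rfl⟩
  have hUh : ENNReal.ofReal (S.Uhat M z x h) ≤ S.UhatStar M H z x h :=
    le_iSup₂ (f := fun η (_ : η ∈ {η ∈ H | h ≤ η}) => ENNReal.ofReal (S.Uhat M z x η))
      h ⟨hh, le_rfl⟩
  have hUstar : S.UhatStar M H z x h ≤ 4 * S.UbarStar M P H n h x + ζ₂ := by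
    refine iSup₂_le fun η hη => ?_
    have e : S.Uhat M z x η = 4 * S.Ubar M P n x η + (S.Uhat M z x η - 4 * S.Ubar M P n x η) := by
      ring
    rw [e]
    refine ENNReal.ofReal_add_le.trans (add_le_add ?_ ?_)
    · rw [ENNReal.ofReal_mul zero_le_four, ENNReal.ofReal_ofNat]
      gcongr
      exact le_iSup₂ (f := fun η (_ : η ∈ {η ∈ H | h ≤ η}) => ENNReal.ofReal (S.Ubar M P n x η))
        η hη
    · exact le_iSup₂ (f := fun h (_ : h ∈ H) => S.upperExcess M P z x h) η hη.1
  set ĥ := hsel z x with hhat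
  have hĥ : ĥ ∈ H := hsl.mem z x
  have hmin : S.Rhat M H z x ĥ + 8 * S.UhatStar M H z x ĥ ≤
      (S.Rhat M H z x h + 8 * S.UhatStar M H z x h) + ENNReal.ofReal (δ x) :=
    (hsl.nearly_min z x).trans (add_le_add (iInf₂_le h hh) le_rfl)
  have s1 := hpair hh hĥ
  have s2 := hpair hĥ hh
  rw [enorm_sub_rev] at s1
  rw [sup_comm] at s2
  have s3 := (hdev hh).trans (add_le_add (mul_le_mul_right hUh 4) le_rfl)
  have s4 : ‖kernelEst M z x ĥ - f x‖ₑ ≤ ‖kernelEst M z x ĥ - kernelEst M z x (h ⊔ ĥ)‖ₑ +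
      ‖kernelEst M z x (h ⊔ ĥ) - kernelEst M z x h‖ₑ + (‖kernelEst M z x h - S.smooth h f x‖ₑ +
        ‖S.smooth h f x - f x‖ₑ) := by
    refine (enorm_sub_le_triple _ (kernelEst M z x (h ⊔ ĥ)) (kernelEst M z x h) _).trans ?_
    gcongr
    calc ‖kernelEst M z x h - f x‖ₑ =
          ‖(kernelEst M z x h - S.smooth h f x) + (S.smooth h f x - f x)‖ₑ := by congr 1; ring
      _ ≤ _ := enorm_add_le _ _
  have hsele : selectedEst M hsel z x = kernelEst M z x ĥ := rfl
  rw [hsele]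
  have hrem : S.remainder M P f H z x = ζ₁ + ζ₃ + ζ₂ := rfl
  rw [hrem]
  generalize S.Rhat M H z x h = R at *
  generalize S.Rhat M H z x ĥ = R' at *
  generalize S.UhatStar M H z x h = U at *
  generalize S.UhatStar M H z x ĥ = U' at *
  generalize S.UbarStar M P H n h x = Ub at *
  generalize ENNReal.ofReal (δ x) = dl at *
  -- The terms at `𝐡(x)` combine to exactly `R' + 8 U'`, the minimised criterion, and are replaced
  -- by those at `h` up to `δ`.
  calc _ ≤ (R + 4 * U + 4 * U') + (R' + 4 * U' + 4 * U) + ((4 * U + (ζ₁ + ζ₃)) + B) :=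
        s4.trans (add_le_add (add_le_add s1 s2) (add_le_add s3 hbias))
    _ = (R + 8 * U) + (R' + 8 * U') + (4 * U + (ζ₁ + ζ₃) + B) := by ring
    _ ≤ (R + 8 * U) + (R + 8 * U + dl) + (4 * U + (ζ₁ + ζ₃) + B) := by gcongr
    _ = 2 * R + 20 * U + (ζ₁ + ζ₃) + B + dl := by ring
    _ ≤ 2 * (B + 2 * (ζ₁ + ζ₃)) + 20 * (4 * Ub + ζ₂) + (ζ₁ + ζ₃) + B + dl := by gcongr
    _ = (3 * B + 80 * Ub) + (5 * (ζ₁ + ζ₃) + 20 * ζ₂) + dl := by ring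
    _ ≤ (3 * B + 80 * Ub) + (20 * (ζ₁ + ζ₃) + 20 * ζ₂) + dl := by
        have : (5 : ℝ≥0∞) ≤ 20 := by norm_num
        gcongr
    _ = _ := by ring

end Oracle

end Setting

end ConvDensity

/-! ### Moments and measurability of the remainder. -/

namespace ConvDensity

variable {d : ℕ}

namespace Setting

theorem Valid.weight_exp_le {S : Setting d} (hS : S.Valid) (k : Fin d → ℤ) :
    S.weight (fun j => Real.exp (k j)) ≤ Real.exp (∑ j, (1 + S.lam j) * |(k j : ℝ)|) := by
  rw [weight, ← Finset.prod_inv_distrib, Real.exp_sum]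
  refine Finset.prod_le_prod (fun j _ => by positivity) fun j _ => ?_
  have hl := hS.lam_nonneg j
  have e : min (Real.exp (k j : ℝ)) 1 = Real.exp (min (k j : ℝ) 0) := by
    rw [← Real.exp_zero, Real.exp_monotone.map_min]
  rw [e, ← Real.exp_mul, ← Real.exp_add, ← Real.exp_neg]
  refine Real.exp_le_exp.2 ?_
  have h1 : -|(k j : ℝ)| ≤ (k j : ℝ) := neg_abs_le _
  have h2 : -|(k j : ℝ)| ≤ min (k j : ℝ) 0 := le_min h1 (by simp)
  nlinarith [mul_le_mul_of_nonneg_right h2 hl]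

/-- The weight of a bandwidth in the expansion of the remainder is summable over the grid. -/
theorem Valid.exists_exp_bound {S : Setting d} (hS : S.Valid) :
    ∃ C : ℝ, 0 < C ∧ ∀ (n : ℕ) (k : Fin d → ℤ), 3 ≤ n →
      (S.Minf * S.weight (fun j => Real.exp (k j)) / √n) ^ S.p *
        (n / (S.Minf * S.weight (fun j => Real.exp (k j))) ^ 2) *
        Real.exp (-(S.lamN n (fun j => Real.exp (k j)) / 4)) *
        (S.weight (fun j => Real.exp (k j)) ^ 2 * ∏ j, Real.exp (k j)) ≤
      C * (n : ℝ) ^ (-(S.p / 2)) * ∏ j, Real.exp (-|(k j : ℝ)|) := by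
  have hM1 := S.one_le_Minf
  have hp := hS.one_lt_p
  refine ⟨S.Minf ^ S.p * (S.Minf ^ 2)⁻¹, by positivity, fun n k hn => ?_⟩
  set Λ := ∑ j, (1 + S.lam j) * |(k j : ℝ)| with hΛ
  have hw := S.weight_pos (h := fun j => Real.exp (k j)) fun j => Real.exp_pos _
  have hwle := hS.weight_exp_le k
  rw [← hΛ] at hwle
  have hn0 : (0 : ℝ) < n := by positivity
  have hterm : ∀ j, |(k j : ℝ)| ≤ (1 + S.lam j) * |(k j : ℝ)| := fun j =>
    le_mul_of_one_le_left (abs_nonneg _) (by linarith [hS.lam_nonneg j])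
  have hsum : ∑ j, |(k j : ℝ)| ≤ Λ := Finset.sum_le_sum fun j _ => hterm j
  have hΛ0 : 0 ≤ Λ := le_trans (Finset.sum_nonneg fun j _ => abs_nonneg _) hsum
  have hprod : ∏ j, Real.exp (k j : ℝ) ≤ Real.exp Λ := by
    rw [← Real.exp_sum]
    exact Real.exp_le_exp.2 ((Finset.sum_le_sum fun j _ => le_abs_self _).trans hsum)
  have hlast : Real.exp (-Λ) ≤ ∏ j, Real.exp (-|(k j : ℝ)|) := by
    rw [← Real.exp_sum, Finset.sum_neg_distrib]
    exact Real.exp_le_exp.2 (by linarith)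
  -- A quarter of `λ_n` contains at least `log n` and `(p + 2) Λ`. The first cancels the factor `n`.
  -- The second compensates `exp (p Λ)` from the weight and `exp Λ` from `∏ h_j`, and leaves `exp
  -- (-Λ)` for the summation.
  have hexp : Real.exp (-(S.lamN n (fun j => Real.exp (k j)) / 4)) ≤
      (n : ℝ)⁻¹ * Real.exp (-((S.p + 2) * Λ)) := by
    have e : (n : ℝ)⁻¹ = Real.exp (-Real.log n) := by rw [Real.exp_neg, Real.exp_log hn0]
    rw [e, ← Real.exp_add]
    refine Real.exp_le_exp.2 ?_
    have h1 := Real.log_nonneg S.one_le_Minf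
    have h2 := Real.log_natCast_nonneg n
    simp only [lamN, Real.log_exp]
    rw [← hΛ]
    nlinarith
  have hsqrt : (√(n : ℝ)) ^ S.p = (n : ℝ) ^ (S.p / 2) := by
    rw [Real.sqrt_eq_rpow, ← Real.rpow_mul hn0.le]
    congr 1; ring
  have hwp : S.weight (fun j => Real.exp (k j)) ^ S.p ≤ Real.exp (S.p * Λ) := by
    rw [mul_comm, Real.exp_mul]
    exact Real.rpow_le_rpow hw.le hwle (by linarith)
  rw [Real.div_rpow (by positivity) (Real.sqrt_nonneg _), hsqrt,
    Real.mul_rpow (by positivity) hw.le, Real.rpow_neg hn0.le]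
  have hnp : 0 < (n : ℝ) ^ (S.p / 2) := Real.rpow_pos_of_pos hn0 _
  have hMp : 0 < S.Minf ^ S.p := by positivity
  have hP0 : 0 < ∏ j, Real.exp (k j : ℝ) := Finset.prod_pos fun j _ => Real.exp_pos _
  have key : S.weight (fun j => Real.exp (k j)) ^ S.p * (∏ j, Real.exp (k j : ℝ)) *
      Real.exp (-(S.lamN n (fun j => Real.exp (k j)) / 4)) ≤
      (n : ℝ)⁻¹ * ∏ j, Real.exp (-|(k j : ℝ)|) := by
    calc _ ≤ Real.exp (S.p * Λ) * Real.exp Λ * ((n : ℝ)⁻¹ * Real.exp (-((S.p + 2) * Λ))) := by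
          gcongr
      _ = (n : ℝ)⁻¹ * Real.exp (-Λ) := by
          rw [mul_left_comm, ← Real.exp_add, ← Real.exp_add]
          congr 2; ring
      _ ≤ _ := by gcongr
  generalize S.weight (fun j => Real.exp (k j)) = w at *
  generalize Real.exp (-(S.lamN n (fun j => Real.exp (k j)) / 4)) = e₁ at *
  generalize ∏ j, Real.exp (k j : ℝ) = P₁ at *
  generalize ∏ j, Real.exp (-|(k j : ℝ)|) = P₂ at *
  generalize (n : ℝ) ^ (S.p / 2) = N at *
  have hM0 : S.Minf ≠ 0 := by positivity
  calc S.Minf ^ S.p * w ^ S.p / N * (n / (S.Minf * w) ^ 2) * e₁ * (w ^ 2 * P₁) =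
        S.Minf ^ S.p * (S.Minf ^ 2)⁻¹ * N⁻¹ * n * (w ^ S.p * P₁ * e₁) := by
        field_simp
    _ ≤ S.Minf ^ S.p * (S.Minf ^ 2)⁻¹ * N⁻¹ * n * ((n : ℝ)⁻¹ * P₂) := by gcongr
    _ = _ := by field_simp

/-- The `p`-th moment of a supremum over the bandwidths. -/
theorem IsDeconvKernel.exists_lintegral_iSup_rpow_le {S : Setting d} (hS : S.Valid) (hd : 1 ≤ d)
    {M : (Fin d → ℝ) → (Fin d → ℝ) → ℝ} (hM : S.IsDeconvKernel M) {C₀ : ℝ} (hC₀ : 0 ≤ C₀) :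
    ∃ C : ℝ≥0, ∀ (n : ℕ) (Hf : Family) (π : (Fin d → ℝ) → ℝ≥0∞)
      (Q : Measure (Fin n → Fin d → ℝ)) (ψ : (Fin n → Fin d → ℝ) → (Fin d → ℝ) → (Fin d → ℝ) → ℝ≥0∞),
      3 ≤ n → Measurable π → ∫⁻ x, π x = 1 → SFinite Q →
      (∀ h : Fin d → ℝ, (∀ j, 0 < h j) →
        Measurable fun q : (Fin n → Fin d → ℝ) × (Fin d → ℝ) => ψ q.1 q.2 h) →
      (∀ x h : Fin d → ℝ, (∀ j, 0 < h j) → ∫⁻ z, ψ z x h ^ S.p ∂Q ≤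
        ENNReal.ofReal (C₀ * ((S.Minf * S.weight h / √n) ^ S.p *
          (n * sigmaSq M (volume.withDensity π) x h / (S.Minf * S.weight h) ^ 2) *
          Real.exp (-(S.lamN n h / 4))))) →
      ∫⁻ z, (∫⁻ x, (⨆ h ∈ Hf.toSet d, ψ z x h) ^ S.p) ∂Q ≤
        C * ENNReal.ofReal ((n : ℝ) ^ (-(S.p / 2))) := by
  obtain ⟨Cv, hCv⟩ := hM.lintegral_sq_le hS hd
  obtain ⟨C₁, hC₁, hexp⟩ := hS.exists_exp_bound
  have hp0 : 0 < S.p := by linarith [hS.one_lt_p]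
  set T₀ := (∑' k : ℤ, ENNReal.ofReal (Real.exp (-|(k : ℝ)|))) ^ d with hT
  have hTtop : T₀ ≠ ∞ := ENNReal.pow_ne_top
    (tsum_ofReal_ne_top summable_exp_neg_abs_int fun _ => (Real.exp_pos _).le)
  refine ⟨Cv * Real.toNNReal (C₀ * C₁) * T₀.toNNReal, fun n Hf π Q ψ hn hπ hπ1 hQ hψ hbd => ?_⟩
  set e : (Fin d → ℤ) → Fin d → ℝ := fun k j => Real.exp (k j) with he
  have he0 : ∀ k j, 0 < e k j := fun k j => Real.exp_pos _
  -- The supremum is bounded by the sum over the full grid, which serves both families.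
  have hsup : ∀ z x, (⨆ h ∈ Hf.toSet d, ψ z x h) ^ S.p ≤ ∑' k, ψ z x (e k) ^ S.p := by
    intro z x
    rw [← ENNReal.le_rpow_inv_iff hp0]
    refine iSup₂_le fun h hh => ?_
    have hg : ∀ j, h j ∈ grid := mem_grid_of_mem_toSet hh
    choose k hk using hg
    have hek : h = e k := funext fun j => (hk j).symm
    rw [ENNReal.le_rpow_inv_iff hp0, hek]
    exact ENNReal.le_tsum k
  have hψp : ∀ k, Measurable fun q : (Fin n → Fin d → ℝ) × (Fin d → ℝ) => ψ q.1 q.2 (e k) ^ S.p :=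
    fun k => (hψ (e k) (he0 k)).pow_const _
  -- Integrating the variance over `x` removes the density, which has mass one, and leaves the
  -- squared `L_2` norm of the kernel.
  have hσ : ∀ k, ∫⁻ x, ENNReal.ofReal (sigmaSq M (volume.withDensity π) x (e k)) ≤
      Cv * ENNReal.ofReal (S.weight (e k) ^ 2 * ∏ j, e k j) := by
    intro k
    calc _ ≤ ∫⁻ x, ∫⁻ y, ENNReal.ofReal (M y (e k) ^ 2) * π (y + x) :=
          lintegral_mono fun x => ofReal_sigmaSq_le (hM _ (he0 k)).1 hπ x
      _ = (∫⁻ y, ENNReal.ofReal (M y (e k) ^ 2)) * 1 := by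
          have hm : Measurable fun y => ENNReal.ofReal (M y (e k) ^ 2) :=
            ((hM _ (he0 k)).1.pow_const 2).ennreal_ofReal
          rw [lintegral_lintegral_mul_add hm hπ, hπ1]
      _ ≤ _ := by rw [mul_one]; exact hCv _ (he0 k)
  have hone : ∀ k, ∫⁻ z, (∫⁻ x, ψ z x (e k) ^ S.p) ∂Q ≤
      (Cv * ENNReal.ofReal (C₀ * C₁) * ENNReal.ofReal ((n : ℝ) ^ (-(S.p / 2)))) *
        ∏ j, ENNReal.ofReal (Real.exp (-|(k j : ℝ)|)) := by
    intro k
    have hw := S.weight_pos (he0 k)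
    have hM1 := S.one_le_Minf
    rw [lintegral_lintegral_swap (hψp k).aemeasurable]
    set A : ℝ := (S.Minf * S.weight (e k) / √n) ^ S.p *
      (n / (S.Minf * S.weight (e k)) ^ 2) * Real.exp (-(S.lamN n (e k) / 4)) with hA
    have hA0 : 0 ≤ A := by positivity
    calc _ ≤ ∫⁻ x, ENNReal.ofReal (C₀ * A) *
          ENNReal.ofReal (sigmaSq M (volume.withDensity π) x (e k)) := by
          refine lintegral_mono fun x => (hbd x (e k) (he0 k)).trans (le_of_eq ?_)
          rw [← ENNReal.ofReal_mul (by positivity)]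
          congr 1
          rw [hA]; ring
      _ = ENNReal.ofReal (C₀ * A) *
          ∫⁻ x, ENNReal.ofReal (sigmaSq M (volume.withDensity π) x (e k)) :=
          lintegral_const_mul' _ _ ENNReal.ofReal_ne_top
      _ ≤ ENNReal.ofReal (C₀ * A) * (Cv * ENNReal.ofReal (S.weight (e k) ^ 2 * ∏ j, e k j)) := by
          gcongr
          exact hσ k
      _ = Cv * ENNReal.ofReal (C₀ * (A * (S.weight (e k) ^ 2 * ∏ j, e k j))) := by
          rw [mul_left_comm, ← ENNReal.ofReal_mul (by positivity)]
          congr 2; ring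
      _ ≤ Cv * ENNReal.ofReal (C₀ * (C₁ * (n : ℝ) ^ (-(S.p / 2)) *
          ∏ j, Real.exp (-|(k j : ℝ)|))) := by
          exact mul_le_mul' le_rfl
            (ENNReal.ofReal_le_ofReal (mul_le_mul_of_nonneg_left (hexp n k hn) hC₀))
      _ = _ := by
          rw [← ENNReal.ofReal_prod_of_nonneg (fun j _ => (Real.exp_pos _).le), ← mul_assoc C₀,
            ← mul_assoc C₀, ENNReal.ofReal_mul (by positivity), ENNReal.ofReal_mul (by positivity)]
          ring
  calc _ ≤ ∫⁻ z, (∫⁻ x, ∑' k, ψ z x (e k) ^ S.p) ∂Q :=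
        lintegral_mono fun z => lintegral_mono fun x => hsup z x
    _ = ∑' k, ∫⁻ z, (∫⁻ x, ψ z x (e k) ^ S.p) ∂Q := by
        have h1 : ∀ z, ∫⁻ x, ∑' k, ψ z x (e k) ^ S.p = ∑' k, ∫⁻ x, ψ z x (e k) ^ S.p := fun z =>
          lintegral_tsum fun k => ((hψp k).comp measurable_prodMk_left).aemeasurable
        simp_rw [h1]
        exact lintegral_tsum fun k => (hψp k).lintegral_prod_right'.aemeasurable
    _ ≤ ∑' k, (Cv * ENNReal.ofReal (C₀ * C₁) * ENNReal.ofReal ((n : ℝ) ^ (-(S.p / 2)))) *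
        ∏ j, ENNReal.ofReal (Real.exp (-|((k : Fin d → ℤ) j : ℝ)|)) := ENNReal.tsum_le_tsum hone
    _ = _ := by
        rw [ENNReal.tsum_mul_left, tsum_prod_pi d fun k : ℤ => ENNReal.ofReal (Real.exp (-|(k : ℝ)|)),
          ← hT, ENNReal.coe_mul, ENNReal.coe_mul, ENNReal.coe_toNNReal hTtop,
          ENNReal.ofNNReal_toNNReal]
        ring

section Measurability

variable {S : Setting d} {M : (Fin d → ℝ) → (Fin d → ℝ) → ℝ}

theorem measurable_smooth (hS : S.Valid) {f : (Fin d → ℝ) → ℝ} (hf : Measurable f)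
    (h : Fin d → ℝ) : Measurable (S.smooth h f) := by
  have : Measurable fun q : (Fin d → ℝ) × (Fin d → ℝ) => S.Kh h (q.2 - q.1) * f q.2 :=
    ((hS.continuous_Kh h).measurable.comp (measurable_snd.sub measurable_fst)).mul
      (hf.comp measurable_snd)
  exact this.stronglyMeasurable.integral_prod_right.measurable

theorem measurable_sigmaSq {P : Measure (Fin d → ℝ)} [SFinite P] {h : Fin d → ℝ}
    (hM : Measurable fun y => M y h) : Measurable fun x => sigmaSq M P x h := by
  have : Measurable fun q : (Fin d → ℝ) × (Fin d → ℝ) => M (q.2 - q.1) h ^ 2 :=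
    (hM.comp (measurable_snd.sub measurable_fst)).pow_const 2
  exact this.stronglyMeasurable.integral_prod_right.measurable

theorem measurable_Ubar {P : Measure (Fin d → ℝ)} [SFinite P] {h : Fin d → ℝ}
    (hM : Measurable fun y => M y h) (n : ℕ) : Measurable fun x => S.Ubar M P n x h := by
  unfold Ubar bernsteinBound
  have := measurable_sigmaSq (P := P) hM
  fun_prop

theorem measurable_kernelEst {h : Fin d → ℝ} (hM : Measurable fun y => M y h) (n : ℕ) :
    Measurable fun q : (Fin n → Fin d → ℝ) × (Fin d → ℝ) => kernelEst M q.1 q.2 h := by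
  unfold kernelEst
  refine Measurable.const_mul (Finset.measurable_sum _ fun i _ => ?_) _
  exact hM.comp (((measurable_pi_apply i).comp measurable_fst).sub measurable_snd)

theorem measurable_Uhat {h : Fin d → ℝ} (hM : Measurable fun y => M y h) (n : ℕ) :
    Measurable fun q : (Fin n → Fin d → ℝ) × (Fin d → ℝ) => S.Uhat M q.1 q.2 h := by
  have : Measurable fun q : (Fin n → Fin d → ℝ) × (Fin d → ℝ) => sigmaHatSq M q.1 q.2 h := by
    unfold sigmaHatSq
    refine Measurable.const_mul (Finset.measurable_sum _ fun i _ => ?_) _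
    exact (hM.comp (((measurable_pi_apply i).comp measurable_fst).sub measurable_snd)).pow_const 2
  unfold Uhat
  fun_prop

theorem countable_toSet (Hf : Family) : (Hf.toSet d).Countable := by
  refine (countable_pi (s := fun _ : Fin d => grid) fun _ => countable_grid).mono ?_
  exact fun h hh j => mem_grid_of_mem_toSet hh j

theorem toSet_pos {Hf : Family} {h : Fin d → ℝ} (hh : h ∈ Hf.toSet d) (j : Fin d) : 0 < h j :=
  grid_pos (mem_grid_of_mem_toSet hh j)

variable {P : Measure (Fin d → ℝ)} [SFinite P] {f : (Fin d → ℝ) → ℝ} {n : ℕ}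

theorem measurable_devExcess (hS : S.Valid) (hM : S.IsDeconvKernel M) (hf : Measurable f)
    {h : Fin d → ℝ} (hh : ∀ j, 0 < h j) :
    Measurable fun q : (Fin n → Fin d → ℝ) × (Fin d → ℝ) => S.devExcess M P f q.1 q.2 h := by
  have h1 := measurable_kernelEst (hM h hh).1 n
  have h2 : Measurable fun q : (Fin n → Fin d → ℝ) × (Fin d → ℝ) => S.smooth h f q.2 :=
    (measurable_smooth hS hf h).comp measurable_snd
  have h3 : Measurable fun q : (Fin n → Fin d → ℝ) × (Fin d → ℝ) => S.Ubar M P n q.2 h :=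
    (measurable_Ubar (hM h hh).1 n).comp measurable_snd
  exact ((h1.sub h2).abs.sub h3).ennreal_ofReal

theorem measurable_lowerExcess (hM : S.IsDeconvKernel M) {h : Fin d → ℝ} (hh : ∀ j, 0 < h j) :
    Measurable fun q : (Fin n → Fin d → ℝ) × (Fin d → ℝ) => S.lowerExcess M P q.1 q.2 h :=
  (((measurable_Ubar (S := S) (P := P) (hM h hh).1 n).comp measurable_snd).sub
    ((measurable_Uhat (hM h hh).1 n).const_mul 4)).ennreal_ofReal

theorem measurable_upperExcess (hM : S.IsDeconvKernel M) {h : Fin d → ℝ} (hh : ∀ j, 0 < h j) :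
    Measurable fun q : (Fin n → Fin d → ℝ) × (Fin d → ℝ) => S.upperExcess M P q.1 q.2 h :=
  ((measurable_Uhat (hM h hh).1 n).sub
    (((measurable_Ubar (S := S) (P := P) (hM h hh).1 n).comp measurable_snd).const_mul
      4)).ennreal_ofReal

theorem measurable_iSup_devExcess (hS : S.Valid) (hM : S.IsDeconvKernel M) (hf : Measurable f)
    (Hf : Family) : Measurable fun q : (Fin n → Fin d → ℝ) × (Fin d → ℝ) =>
      ⨆ h ∈ Hf.toSet d, S.devExcess M P f q.1 q.2 h :=
  Measurable.biSup _ (countable_toSet Hf) fun _ hh => measurable_devExcess hS hM hf (toSet_pos hh)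

theorem measurable_iSup_lowerExcess (hM : S.IsDeconvKernel M) (Hf : Family) :
    Measurable fun q : (Fin n → Fin d → ℝ) × (Fin d → ℝ) =>
      ⨆ h ∈ Hf.toSet d, S.lowerExcess M P q.1 q.2 h :=
  Measurable.biSup _ (countable_toSet Hf) fun _ hh => measurable_lowerExcess hM (toSet_pos hh)

theorem measurable_iSup_upperExcess (hM : S.IsDeconvKernel M) (Hf : Family) :
    Measurable fun q : (Fin n → Fin d → ℝ) × (Fin d → ℝ) =>
      ⨆ h ∈ Hf.toSet d, S.upperExcess M P q.1 q.2 h :=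
  Measurable.biSup _ (countable_toSet Hf) fun _ hh => measurable_upperExcess hM (toSet_pos hh)

theorem measurable_remainder (hS : S.Valid) (hM : S.IsDeconvKernel M) (hf : Measurable f)
    (Hf : Family) : Measurable fun q : (Fin n → Fin d → ℝ) × (Fin d → ℝ) =>
      S.remainder M P f (Hf.toSet d) q.1 q.2 :=
  ((measurable_iSup_devExcess hS hM hf Hf).add (measurable_iSup_lowerExcess hM Hf)).add
    (measurable_iSup_upperExcess hM Hf)

theorem measurable_UbarStar (hM : S.IsDeconvKernel M) {Hf : Family} {h : Fin d → ℝ} :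
    Measurable (S.UbarStar M P (Hf.toSet d) n h) :=
  Measurable.biSup _ ((countable_toSet Hf).mono fun _ hη => hη.1)
    fun _ hη => (measurable_Ubar (hM _ (toSet_pos hη.1)).1 n).ennreal_ofReal

theorem measurable_noiseSup (hM : S.IsDeconvKernel M) {Hf : Family} {h : Fin d → ℝ} :
    Measurable (S.noiseSup M P (Hf.toSet d) n h) := by
  refine Measurable.biSup _ ((countable_toSet Hf).mono fun _ hη => hη.1) fun η hη => ?_
  have := measurable_sigmaSq (P := P) (hM _ (toSet_pos hη.1)).1
  fun_prop

theorem measurable_biasSup (hS : S.Valid) (hf : Measurable f) {Hf : Family} {h : Fin d → ℝ} :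
    Measurable (S.biasSup (Hf.toSet d) h f) :=
  Measurable.biSup _ (countable_toSet Hf)
    fun _ _ => ((measurable_smooth hS hf _).sub (measurable_smooth hS hf _)).enorm

end Measurability

theorem add_add_rpow_le (a b c : ℝ≥0∞) {p : ℝ} (hp : 0 ≤ p) :
    (a + b + c) ^ p ≤ ENNReal.ofReal (3 ^ p) * (a ^ p + b ^ p + c ^ p) := by
  have h : a + b + c ≤ 3 * max (max a b) c := by
    calc a + b + c ≤ max (max a b) c + max (max a b) c + max (max a b) c := by
          gcongr
          · exact (le_max_left _ _).trans (le_max_left _ _)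
          · exact (le_max_right _ _).trans (le_max_left _ _)
          · exact le_max_right _ _
      _ = _ := by ring
  refine (ENNReal.rpow_le_rpow h hp).trans ?_
  rw [ENNReal.mul_rpow_of_nonneg _ _ hp, ← ENNReal.ofReal_rpow_of_pos (by norm_num)]
  simp only [ENNReal.ofReal_ofNat]
  gcongr
  rw [(ENNReal.monotone_rpow_of_nonneg hp).map_max, (ENNReal.monotone_rpow_of_nonneg hp).map_max]
  refine max_le (max_le ?_ ?_) ?_
  · exact le_self_add.trans le_self_add
  · exact le_add_self.trans le_self_add
  · exact le_add_self

theorem lintegral_lintegral_add_add_rpow_le {X Y : Type*} [MeasurableSpace X] [MeasurableSpace Y]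
    {μ : Measure X} {ν : Measure Y} [SFinite ν] {φ₁ φ₂ : X × Y → ℝ≥0∞} (φ₃ : X × Y → ℝ≥0∞)
    (h₁ : Measurable φ₁) (h₂ : Measurable φ₂) {p : ℝ} (hp : 0 ≤ p) :
    ∫⁻ x, (∫⁻ y, (φ₁ (x, y) + φ₂ (x, y) + φ₃ (x, y)) ^ p ∂ν) ∂μ ≤
      ENNReal.ofReal (3 ^ p) * ((∫⁻ x, (∫⁻ y, φ₁ (x, y) ^ p ∂ν) ∂μ) +
        (∫⁻ x, (∫⁻ y, φ₂ (x, y) ^ p ∂ν) ∂μ) + ∫⁻ x, (∫⁻ y, φ₃ (x, y) ^ p ∂ν) ∂μ) := by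
  have m₁ := h₁.pow_const p
  have m₂ := h₂.pow_const p
  have i₁ : Measurable fun x => ∫⁻ y, φ₁ (x, y) ^ p ∂ν := m₁.lintegral_prod_right' (ν := ν)
  have i₂ : Measurable fun x => (∫⁻ y, φ₁ (x, y) ^ p ∂ν) + ∫⁻ y, φ₂ (x, y) ^ p ∂ν :=
    i₁.add (m₂.lintegral_prod_right' (ν := ν))
  rw [← lintegral_add_left i₁, ← lintegral_add_left i₂,
    ← lintegral_const_mul' _ _ ENNReal.ofReal_ne_top]
  refine lintegral_mono fun x => ?_
  have j₁ : Measurable fun y => φ₁ (x, y) ^ p := m₁.comp measurable_prodMk_left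
  have j₂ : Measurable fun y => φ₁ (x, y) ^ p + φ₂ (x, y) ^ p :=
    j₁.add (m₂.comp measurable_prodMk_left)
  rw [← lintegral_add_left j₁, ← lintegral_add_left j₂,
    ← lintegral_const_mul' _ _ ENNReal.ofReal_ne_top]
  exact lintegral_mono fun y => add_add_rpow_le _ _ _ hp

/-- The moment bound for the remainder of the oracle inequality. -/
theorem IsDeconvKernel.exists_remainder_le {S : Setting d} (hS : S.Valid) (hd : 1 ≤ d)
    {M : (Fin d → ℝ) → (Fin d → ℝ) → ℝ} (hM : S.IsDeconvKernel M) :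
    ∃ C : ℝ≥0, ∀ (n : ℕ) (Hf : Family) (π : (Fin d → ℝ) → ℝ≥0∞) (f : (Fin d → ℝ) → ℝ),
      3 ≤ n → Measurable π → ∫⁻ x, π x = 1 → Measurable f →
      (∀ x h : Fin d → ℝ, (∀ j, 0 < h j) →
        ∫ z, M (z - x) h ∂(volume.withDensity π) = S.smooth h f x) →
      ∫⁻ z : Fin n → Fin d → ℝ, (∫⁻ x,
          S.remainder M (volume.withDensity π) f (Hf.toSet d) z x ^ S.p)
          ∂(Measure.pi fun _ => volume.withDensity π) ≤
        C * ENNReal.ofReal ((n : ℝ) ^ (-(S.p / 2))) := by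
  have hp := hS.one_lt_p
  have hp0 : 0 < S.p := by linarith
  obtain ⟨C₁, h₁⟩ := hM.exists_lintegral_iSup_rpow_le hS hd (C₀ := 16 * (2 * S.p) ^ S.p)
    (by positivity)
  obtain ⟨C₂, h₂⟩ := hM.exists_lintegral_iSup_rpow_le hS hd (C₀ := (8 * S.p) ^ S.p)
    (by positivity)
  obtain ⟨C₃, h₃⟩ := hM.exists_lintegral_iSup_rpow_le hS hd (C₀ := 4 * (2 * S.p) ^ S.p)
    (by positivity)
  refine ⟨Real.toNNReal (3 ^ S.p) * (C₁ + C₂ + C₃), fun n Hf π f hn hπ hπ1 hf hmean => ?_⟩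
  set P := volume.withDensity π with hP
  have hPp : IsProbabilityMeasure P :=
    ⟨by rw [hP, withDensity_apply _ MeasurableSet.univ, setLIntegral_univ, hπ1]⟩
  have hn0 : 0 < n := by omega
  have hn1 : (1 : ℝ) ≤ n := by exact_mod_cast hn0
  have hφ : ∀ x h : Fin d → ℝ, (∀ j, 0 < h j) → Measurable fun z : Fin d → ℝ => M (z - x) h :=
    fun x h hh => (hM h hh).1.comp (measurable_id.sub_const x)
  have hb0 : ∀ h : Fin d → ℝ, (∀ j, 0 < h j) → 0 < S.Minf * S.weight h := fun h hh =>
    mul_pos (by linarith [S.one_le_Minf]) (S.weight_pos hh)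
  have hb : ∀ x h : Fin d → ℝ, (∀ j, 0 < h j) → ∀ᵐ z ∂P, |M (z - x) h| ≤ S.Minf * S.weight h :=
    fun x h hh => (withDensity_absolutelyContinuous volume π).ae_le
      ((measurePreserving_sub_right volume x).quasiMeasurePreserving.ae (hM.ae_abs_le hS hd hh))
  -- The comparisons of the variances give the better scale `b / n`; it is weakened to the scale `b
  -- / √n` of the deviations so that one summation lemma covers all three terms.
  have hle : ∀ (C₀ : ℝ) (x h : Fin d → ℝ), 0 ≤ C₀ → (∀ j, 0 < h j) →
      ENNReal.ofReal (C₀ * ((S.Minf * S.weight h / n) ^ S.p *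
          (n * (∫ z, M (z - x) h ^ 2 ∂P) / (S.Minf * S.weight h) ^ 2) *
          Real.exp (-(S.lamN n h / 4)))) ≤
      ENNReal.ofReal (C₀ * ((S.Minf * S.weight h / √n) ^ S.p *
          (n * sigmaSq M P x h / (S.Minf * S.weight h) ^ 2) *
          Real.exp (-(S.lamN n h / 4)))) := by
    intro C₀ x h hC₀ hh
    have h1 := hb0 h hh
    have h2 : 0 ≤ sigmaSq M P x h := integral_nonneg fun _ => sq_nonneg _
    have h3 : √(n : ℝ) ≤ n := Real.sqrt_le_iff.mpr ⟨by linarith, by nlinarith⟩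
    refine ENNReal.ofReal_le_ofReal ?_
    change C₀ * ((S.Minf * S.weight h / n) ^ S.p *
          (n * sigmaSq M P x h / (S.Minf * S.weight h) ^ 2) * _) ≤ _
    gcongr
  have e₁ := h₁ n Hf π (Measure.pi fun _ => P) (fun z x h => S.devExcess M P f z x h) hn hπ hπ1
    inferInstance (fun h hh => measurable_devExcess hS hM hf hh) (fun x h hh => by
      have := lintegral_mean_deviation_le (P := P) (hφ x h hh) (hb0 h hh) (hb x h hh) hn0 hp0
        (hS.six_le_lamN hn h)
      rw [hmean x h hh] at this
      exact this)
  have e₂ := h₂ n Hf π (Measure.pi fun _ => P) (fun z x h => S.lowerExcess M P z x h) hn hπ hπ1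
    inferInstance (fun h hh => measurable_lowerExcess hM hh) (fun x h hh => by
      have := lintegral_bernstein_sub_empirical_le (P := P) (hφ x h hh) (hb0 h hh) (hb x h hh) hn0
        hp0 (hS.six_le_lamN hn h)
      simp only [lowerExcess, Uhat_eq]
      exact this.trans (hle _ x h (by positivity) hh))
  have e₃ := h₃ n Hf π (Measure.pi fun _ => P) (fun z x h => S.upperExcess M P z x h) hn hπ hπ1
    inferInstance (fun h hh => measurable_upperExcess hM hh) (fun x h hh => by
      have := lintegral_empirical_sub_bernstein_le (P := P) (hφ x h hh) (hb0 h hh) (hb x h hh) hn0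
        hp0 (hS.six_le_lamN hn h)
      simp only [upperExcess, Uhat_eq]
      exact this.trans (hle _ x h (by positivity) hh))
  have key := lintegral_lintegral_add_add_rpow_le (μ := Measure.pi fun _ : Fin n => P)
    (ν := volume) (fun q => ⨆ h ∈ Hf.toSet d, S.upperExcess M P q.1 q.2 h)
    (measurable_iSup_devExcess (P := P) hS hM hf Hf)
    (measurable_iSup_lowerExcess (S := S) (P := P) hM Hf) hp0.le
  refine key.trans ?_
  refine (mul_le_mul' le_rfl (add_le_add (add_le_add e₁ e₂) e₃)).trans (le_of_eq ?_)
  rw [ENNReal.coe_mul, ENNReal.ofNNReal_toNNReal]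
  push_cast
  ring

end Setting

end ConvDensity

/-! ### Level sets and tails of the noise, and the oracle bound. -/

namespace ConvDensity

variable {d : ℕ}

theorem setLIntegral_rpow_le {X : Type*} [MeasurableSpace X] {μ : Measure X} {F : X → ℝ≥0∞}
    (hF : Measurable F) {p q τ : ℝ} (hpq : p ≤ q) (hτ : 0 < τ) (hq : 0 ≤ p) :
    ∫⁻ x in {x | ENNReal.ofReal τ < F x}, F x ^ p ∂μ ≤
      ENNReal.ofReal (τ ^ (p - q)) * ∫⁻ x, F x ^ q ∂μ := by
  have hs : MeasurableSet {x | ENNReal.ofReal τ < F x} := measurableSet_lt measurable_const hF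
  have hτ0 : ENNReal.ofReal τ ≠ 0 := by simpa using hτ
  calc _ ≤ ∫⁻ x in {x | ENNReal.ofReal τ < F x}, ENNReal.ofReal (τ ^ (p - q)) * F x ^ q ∂μ := by
        refine setLIntegral_mono' hs fun x hx => ?_
        rw [mem_ofPred_eq] at hx
        rw [← ENNReal.ofReal_rpow_of_pos hτ]
        have h1 : F x ^ q = F x ^ p * F x ^ (q - p) := by
          rw [← ENNReal.rpow_add_of_nonneg _ _ hq (sub_nonneg.2 hpq)]
          congr 1; ring
        have h2 : ENNReal.ofReal τ ^ (q - p) ≤ F x ^ (q - p) :=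
          ENNReal.rpow_le_rpow hx.le (sub_nonneg.2 hpq)
        have h3 : ENNReal.ofReal τ ^ (p - q) * ENNReal.ofReal τ ^ (q - p) = 1 := by
          rw [← ENNReal.rpow_add _ _ hτ0 ENNReal.ofReal_ne_top]
          simp
        calc F x ^ p = F x ^ p * (ENNReal.ofReal τ ^ (p - q) * ENNReal.ofReal τ ^ (q - p)) := by
              rw [h3, mul_one]
          _ ≤ F x ^ p * (ENNReal.ofReal τ ^ (p - q) * F x ^ (q - p)) := by gcongr
          _ = _ := by rw [h1]; ring
    _ ≤ ∫⁻ x, ENNReal.ofReal (τ ^ (p - q)) * F x ^ q ∂μ := setLIntegral_le_lintegral _ _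
    _ = _ := lintegral_const_mul' _ _ ENNReal.ofReal_ne_top

theorem measure_lt_le_lintegral_rpow {X : Type*} [MeasurableSpace X] {μ : Measure X}
    {F : X → ℝ≥0∞} (hF : Measurable F) {q τ : ℝ} (hq : 0 ≤ q) (hτ : 0 < τ) :
    μ {x | ENNReal.ofReal τ < F x} ≤ ENNReal.ofReal (τ ^ (-q)) * ∫⁻ x, F x ^ q ∂μ := by
  have := setLIntegral_rpow_le (μ := μ) hF hq hτ le_rfl
  simpa using this

/-- The condition `‖π‖_{u,∞} ≤ D`, or `π ≤ D` almost everywhere if `u = ∞`. -/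
def WeakBounded (u : ℝ≥0∞) (D : ℝ) (π : (Fin d → ℝ) → ℝ≥0∞) : Prop :=
  if u = ∞ then ∀ᵐ y, π y ≤ ENNReal.ofReal D
  else ∀ z : ℝ, 0 < z → volume {y | ENNReal.ofReal z < π y} ≤
    ENNReal.ofReal (D ^ u.toReal) * ENNReal.ofReal (z ^ (-u.toReal))

namespace Setting

theorem a_nonneg (S : Setting d) (D : ℝ) : 0 ≤ S.a D := by
  have : 0 ≤ S.M2 := zero_le_one.trans (le_max_right _ _)
  exact inv_nonneg.2 (mul_nonneg (by norm_num) (le_max_of_le_left (by positivity)))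

theorem IsDeconvKernel.exists_noiseSup_measure_le_Fn_sq {S : Setting d} (hS : S.Valid)
    (hd : 1 ≤ d) {M : (Fin d → ℝ) → (Fin d → ℝ) → ℝ} (hM : S.IsDeconvKernel M) :
    ∃ C : ℝ≥0, ∀ (n : ℕ) (Hf : Family) (π : (Fin d → ℝ) → ℝ≥0∞) (h : Fin d → ℝ) (v : ℝ), 3 ≤ n →
      Measurable π → ∫⁻ y, π y = 1 → h ∈ Hf.toSet d → 0 < v →
      volume {x | ENNReal.ofReal v < S.noiseSup M (volume.withDensity π) (Hf.toSet d) n h x} ≤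
        C * ENNReal.ofReal (v ^ (-2 : ℤ) * S.Fn n h ^ 2) := by
  obtain ⟨C, hC⟩ := hM.exists_noiseSup_measure_le hS hd (u := 1) le_rfl (K := 1)
    (Q := fun π => ∫⁻ y, π y = 1) (fun π m V τ hπ1 hπ hm hV hτ hmV => by
      refine (measure_lintegral_mul_add_le hm hπ hV hτ hmV).trans (le_of_eq ?_)
      rw [hπ1, Real.rpow_neg_one, ENNReal.coe_one]
      ring)
  refine ⟨C, fun n Hf π h v hn hπ hπ1 hh hv => (hC n Hf π h v hn hπ hπ1 hh hv).trans
    (le_of_eq ?_)⟩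
  rw [Real.rpow_one, show (-(2 * 1) : ℝ) = ((-2 : ℤ) : ℝ) by norm_num, Real.rpow_intCast,
    mul_comm (S.Fn n h ^ 2)]

/-- For finite `u` the level sets decay with order `2 u`. Inserting `F_n ≤ a v z^{-1/2}` turns the
bound at level `v` into `z^{-u}`, and `p < 2 u` makes the tail integral of the `p`-th power
converge. -/
theorem IsDeconvKernel.exists_noiseSup_bounds {S : Setting d} (hS : S.Valid) (hd : 1 ≤ d)
    {M : (Fin d → ℝ) → (Fin d → ℝ) → ℝ} (hM : S.IsDeconvKernel M) {D : ℝ} (hD : 0 < D)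
    {u : ℝ≥0∞} (hu : 1 < u) (hpu : ENNReal.ofReal S.p / 2 < u) :
    ∃ κ : ℝ, 1 ≤ κ ∧ ∃ C : ℝ≥0, ∀ (n : ℕ) (Hf : Family) (π : (Fin d → ℝ) → ℝ≥0∞)
      (h : Fin d → ℝ) (v z : ℝ), 3 ≤ n → Measurable π → WeakBounded u D π → h ∈ Hf.toSet d →
      0 < v → 2 ≤ z → S.Fn n h ≤ S.a D * v * z ^ (-(1 / 2) : ℝ) →
      volume {x | ENNReal.ofReal (κ * v) <
          S.noiseSup M (volume.withDensity π) (Hf.toSet d) n h x} ≤ C * negPow z u ∧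
      ∫⁻ x in {x | ENNReal.ofReal (κ * v) <
          S.noiseSup M (volume.withDensity π) (Hf.toSet d) n h x},
          S.noiseSup M (volume.withDensity π) (Hf.toSet d) n h x ^ S.p ≤
        C * (ENNReal.ofReal (v ^ S.p) * negPow z u) := by
  have ha := S.a_nonneg D
  have hp := hS.one_lt_p
  by_cases hui : u = ∞
  · obtain ⟨C, hC, hle⟩ := hM.exists_noiseSup_le hS hd hD
    -- For a bounded density the noise is at most `C F_n ≤ C a v`, so with this `κ` the level set is
    -- empty.
    refine ⟨max 1 (C * S.a D), le_max_left _ _, 0, fun n Hf π h v z hn hπ hπu hh hv hz hF => ?_⟩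
    rw [WeakBounded, if_pos hui] at hπu
    have hz1 : z ^ (-(1 / 2) : ℝ) ≤ 1 :=
      Real.rpow_le_one_of_one_le_of_nonpos (by linarith) (by norm_num)
    have hemp : {x | ENNReal.ofReal (max 1 (C * S.a D) * v) <
          S.noiseSup M (volume.withDensity π) (Hf.toSet d) n h x} = ∅ := by
      refine eq_empty_of_forall_notMem fun x hx => ?_
      rw [mem_ofPred_eq] at hx
      refine absurd (hle n Hf π h x hn hπ hπu hh) (not_le.2 (lt_of_le_of_lt ?_ hx))
      refine ENNReal.ofReal_le_ofReal ?_
      calc C * S.Fn n h ≤ C * (S.a D * v * 1) := by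
            gcongr
            exact hF.trans (by gcongr)
        _ = C * S.a D * v := by ring
        _ ≤ _ := by gcongr; exact le_max_right _ _
    rw [hemp]
    simp
  · set r := u.toReal with hr
    have hur : u = ENNReal.ofReal r := (ENNReal.ofReal_toReal hui).symm
    have hr1 : 1 < r := by
      rw [hur, ← ENNReal.ofReal_one] at hu
      exact (ENNReal.ofReal_lt_ofReal_iff_of_nonneg zero_le_one).1 hu
    have hpr : S.p < 2 * r := by
      rw [hur, show (2 : ℝ≥0∞) = ENNReal.ofReal 2 by simp,
        ← ENNReal.ofReal_div_of_pos (by norm_num)] at hpu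
      have := (ENNReal.ofReal_lt_ofReal_iff_of_nonneg (by linarith)).1 hpu
      linarith
    obtain ⟨C, hC⟩ := hM.exists_noiseSup_measure_le hS hd (u := r) hr1.le
      (K := Real.toNNReal (r / (r - 1) * 2 ^ r) * Real.toNNReal (D ^ r))
      (Q := fun π => ∀ z : ℝ, 0 < z → volume {y | ENNReal.ofReal z < π y} ≤
        ENNReal.ofReal (D ^ r) * ENNReal.ofReal (z ^ (-r)))
      (fun π m V τ hπw hπ hm hV hτ hmV => by
        refine (measure_lintegral_mul_add_le_of_weak hm hπ hV hτ hr1 hmV hπw).trans (le_of_eq ?_)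
        rw [ENNReal.coe_mul, ENNReal.ofNNReal_toNNReal, ENNReal.ofNNReal_toNNReal])
    have hA0 : 0 ≤ S.a D ^ (2 * r) := by positivity
    have hB0 : 0 ≤ 2 * r / (2 * r - S.p) := div_nonneg (by linarith) (by linarith)
    refine ⟨1, le_rfl, C * Real.toNNReal (S.a D ^ (2 * r)) *
      (1 + Real.toNNReal (2 * r / (2 * r - S.p))), fun n Hf π h v z hn hπ hπu hh hv hz hF => ?_⟩
    rw [WeakBounded, if_neg hui] at hπu
    have hneg : negPow z u = ENNReal.ofReal (z ^ (-r)) := if_neg hui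
    have hz0 : 0 < z := by linarith
    have hF0 : 0 ≤ S.Fn n h := div_nonneg (Real.sqrt_nonneg _) (mul_nonneg (Real.sqrt_nonneg _)
      (Finset.prod_nonneg fun j _ => mul_nonneg (Real.rpow_nonneg (toSet_pos hh j).le _)
        (Real.rpow_nonneg (le_min (toSet_pos hh j).le zero_le_one) _)))
    have hFr : (S.Fn n h ^ 2) ^ r ≤ S.a D ^ (2 * r) * v ^ (2 * r) * z ^ (-r) := by
      rw [← Real.rpow_natCast, ← Real.rpow_mul hF0, Nat.cast_ofNat]
      refine (Real.rpow_le_rpow hF0 hF (by linarith)).trans (le_of_eq ?_)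
      rw [Real.mul_rpow (by positivity) (by positivity), Real.mul_rpow ha hv.le,
        ← Real.rpow_mul hz0.le]
      congr 2; ring
    have key : ∀ t : ℝ, 0 < t → volume {x | ENNReal.ofReal t <
        S.noiseSup M (volume.withDensity π) (Hf.toSet d) n h x} ≤
        C * ENNReal.ofReal (S.a D ^ (2 * r) * v ^ (2 * r) * z ^ (-r)) *
          ENNReal.ofReal (t ^ (-(2 * r))) := fun t ht => by
      refine (hC n Hf π h t hn hπ hπu hh ht).trans ?_
      rw [mul_assoc, ← ENNReal.ofReal_mul (by positivity)]
      gcongr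
    have hv1 : v ^ (2 * r) * v ^ (-(2 * r)) = 1 := by
      rw [← Real.rpow_add hv, add_neg_cancel, Real.rpow_zero]
    rw [one_mul, hneg]
    constructor
    · refine (key v hv).trans ?_
      rw [mul_assoc, ← ENNReal.ofReal_mul (by positivity), show S.a D ^ (2 * r) * v ^ (2 * r) *
        z ^ (-r) * v ^ (-(2 * r)) = S.a D ^ (2 * r) * z ^ (-r) * (v ^ (2 * r) * v ^ (-(2 * r))) by
          ring, hv1, mul_one, ENNReal.ofReal_mul hA0, ENNReal.coe_mul, ENNReal.coe_mul,
        ENNReal.ofNNReal_toNNReal]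
      calc _ = C * ENNReal.ofReal (S.a D ^ (2 * r)) * 1 * ENNReal.ofReal (z ^ (-r)) := by ring
        _ ≤ _ := by
          gcongr
          rw [ENNReal.coe_add, ENNReal.coe_one]
          exact le_self_add
    · have hmeas : Measurable (S.noiseSup M (volume.withDensity π) (Hf.toSet d) n h) :=
        measurable_noiseSup hM
      refine (lintegral_rpow_tail_le hmeas (by linarith) hpr hv
        fun t ht => key t (hv.trans_le ht)).trans ?_
      have hv2 : v ^ (2 * r) * v ^ (S.p - 2 * r) = v ^ S.p := by
        rw [← Real.rpow_add hv]
        congr 1; ring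
      calc _ = C * ENNReal.ofReal (2 * r / (2 * r - S.p)) * (ENNReal.ofReal (S.a D ^ (2 * r) *
            v ^ (2 * r) * z ^ (-r)) * ENNReal.ofReal (v ^ (S.p - 2 * r))) := by ring
        _ = C * ENNReal.ofReal (2 * r / (2 * r - S.p)) * (ENNReal.ofReal (S.a D ^ (2 * r)) *
            (ENNReal.ofReal (v ^ S.p) * ENNReal.ofReal (z ^ (-r)))) := by
          rw [← ENNReal.ofReal_mul (by positivity), ← ENNReal.ofReal_mul (by positivity),
            ← ENNReal.ofReal_mul hA0, ← hv2]
          congr 2; ring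
        _ = C * ENNReal.ofReal (S.a D ^ (2 * r)) * ENNReal.ofReal (2 * r / (2 * r - S.p)) *
            (ENNReal.ofReal (v ^ S.p) * ENNReal.ofReal (z ^ (-r))) := by ring
        _ ≤ _ := by
          rw [ENNReal.coe_mul, ENNReal.coe_mul, ENNReal.ofNNReal_toNNReal, ENNReal.coe_add,
            ENNReal.ofNNReal_toNNReal]
          gcongr
          exact le_add_self

/-- The infimum over the bandwidths of the bound in the oracle inequality. -/
noncomputable def oracleBound (S : Setting d) (M : (Fin d → ℝ) → (Fin d → ℝ) → ℝ)
    (P : Measure (Fin d → ℝ)) (Hf : Family) (n : ℕ) (f : (Fin d → ℝ) → ℝ) (x : Fin d → ℝ) :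
    ℝ≥0∞ :=
  ⨅ h ∈ Hf.toSet d, (3 * S.biasSup (Hf.toSet d) h f x + 80 * S.UbarStar M P (Hf.toSet d) n h x)

theorem measurable_oracleBound {S : Setting d} (hS : S.Valid)
    {M : (Fin d → ℝ) → (Fin d → ℝ) → ℝ} (hM : S.IsDeconvKernel M) (P : Measure (Fin d → ℝ))
    [SFinite P] (Hf : Family) (n : ℕ) {f : (Fin d → ℝ) → ℝ} (hf : Measurable f) :
    Measurable (S.oracleBound M P Hf n f) :=
  Measurable.biInf _ (countable_toSet Hf) fun _ _ =>
    ((measurable_biasSup hS hf).const_mul 3).add ((measurable_UbarStar hM).const_mul 80)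

theorem tendsto_Gn_const (S : Setting d) (hd : 1 ≤ d) (n : ℕ) :
    Filter.Tendsto (fun m : ℕ => S.Gn n fun _ => Real.exp (m : ℤ)) Filter.atTop (nhds 0) := by
  have hd0 : (0 : ℝ) < d := by exact_mod_cast hd
  have h1 : Filter.Tendsto (fun m : ℕ => (d : ℝ) * m) Filter.atTop Filter.atTop :=
    tendsto_natCast_atTop_atTop.const_mul_atTop hd0
  have h2 := ((Real.tendsto_pow_mul_exp_neg_atTop_nhds_zero 0).comp h1).const_mul (Real.log n)
  have h3 := (Real.tendsto_pow_mul_exp_neg_atTop_nhds_zero 1).comp h1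
  have h4 := (h2.add h3).div_const (n : ℝ)
  simp only [mul_zero, add_zero, zero_div] at h4
  refine h4.congr fun m => ?_
  have hw : S.weight (fun _ => Real.exp (m : ℤ)) = Real.exp (-(d * m)) := by
    have hmin : min (Real.exp ((m : ℤ) : ℝ)) 1 = 1 :=
      min_eq_right (Real.one_le_exp (by positivity))
    simp only [weight, hmin, Real.one_rpow, mul_one, Finset.prod_const, Finset.card_univ,
      Fintype.card_fin]
    rw [← Real.exp_nat_mul, ← Real.exp_neg]
    simp
  rw [Gn_eq, hw, logTerm]
  simp
  ring

/-- The error bound is dominated by the maximal function. -/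
theorem IsDeconvKernel.exists_oracleBound_le_maxFun {S : Setting d} (hS : S.Valid) (hd : 1 ≤ d)
    {M : (Fin d → ℝ) → (Fin d → ℝ) → ℝ} (hM : S.IsDeconvKernel M) :
    ∃ C : ℝ≥0, ∀ (n : ℕ) (Hf : Family) (π : (Fin d → ℝ) → ℝ≥0∞) (f : (Fin d → ℝ) → ℝ)
      (x : Fin d → ℝ), 3 ≤ n → Measurable π → ∫⁻ y, π y = 1 → Measurable f →
      S.oracleBound M (volume.withDensity π) Hf n f x ≤ C * S.maxFun Hf f x := by
  obtain ⟨C₁, hC₁⟩ := hS.exists_biasSup_le_maxFun hd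
  obtain ⟨C₂, hC₂⟩ := hS.exists_UbarStar_le
  obtain ⟨C₃, hC₃0, hC₃⟩ := hS.exists_lamN_le
  refine ⟨3 * C₁, fun n Hf π f x hn hπ hπ1 hf => ?_⟩
  set P := volume.withDensity π with hP
  have hPp : IsProbabilityMeasure P :=
    ⟨by rw [hP, withDensity_apply _ MeasurableSet.univ, setLIntegral_univ, hπ1]⟩
  have hM1 := S.one_le_Minf
  have hn1 : (1 : ℝ) ≤ n := by exact_mod_cast (by omega : 1 ≤ n)
  -- A crude bound from the sup norm of the kernel; the factor `n` is harmless, because `n` is fixed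
  -- while the bandwidth tends to infinity.
  have hnoise : ∀ h ∈ Hf.toSet d, S.noiseSup M P (Hf.toSet d) n h x ≤
      ENNReal.ofReal ((1 + 2 * C₃) * S.Minf * n * S.Gn n h) := by
    intro h hh
    refine iSup₂_le fun η hη => ENNReal.ofReal_le_ofReal ?_
    have hη0 := toSet_pos hη.1
    have hw := S.weight_pos hη0
    have hL := one_le_logTerm hn η
    have hσ : sigmaSq M P x η ≤ (S.Minf * S.weight η) ^ 2 := by
      have hb : ∀ᵐ z ∂P, M (z - x) η ^ 2 ≤ (S.Minf * S.weight η) ^ 2 :=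
        have hae : ∀ᵐ z ∂P, |M (z - x) η| ≤ S.Minf * S.weight η :=
          (withDensity_absolutelyContinuous volume π).ae_le
            ((measurePreserving_sub_right volume x).quasiMeasurePreserving.ae
              (hM.ae_abs_le hS hd hη0))
        hae.mono fun z hz => by
          rw [← sq_abs]
          exact pow_le_pow_left₀ (abs_nonneg _) hz 2
      calc sigmaSq M P x η ≤ ∫ _, (S.Minf * S.weight η) ^ 2 ∂P :=
            integral_mono_of_nonneg (Filter.Eventually.of_forall fun _ => sq_nonneg _)
              (integrable_const _) hb
        _ = _ := by simp
    have hG : logTerm n η * S.weight η ≤ n * S.Gn n h := by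
      have := hS.Gn_mono hn (toSet_pos hh) hη.2
      rw [Gn_eq, div_le_iff₀ (by linarith)] at this
      linarith
    have hlam := hC₃ n η hn
    have hlam0 := hS.lamN_nonneg n η
    calc √(2 * S.lamN n η * sigmaSq M P x η / n) ≤
          √((1 + 2 * C₃) ^ 2 * logTerm n η ^ 2 * (S.Minf * S.weight η) ^ 2) := by
          refine Real.sqrt_le_sqrt ?_
          rw [div_le_iff₀ (by linarith)]
          have h1 : 2 * S.lamN n η ≤ (1 + 2 * C₃) ^ 2 * logTerm n η ^ 2 := by nlinarith
          have h2 : 0 ≤ sigmaSq M P x η := integral_nonneg fun _ => sq_nonneg _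
          calc 2 * S.lamN n η * sigmaSq M P x η ≤
                (1 + 2 * C₃) ^ 2 * logTerm n η ^ 2 * (S.Minf * S.weight η) ^ 2 := by gcongr
            _ ≤ _ := le_mul_of_one_le_right (by positivity) hn1
      _ = (1 + 2 * C₃) * S.Minf * (logTerm n η * S.weight η) := by
          rw [← mul_pow, ← mul_pow, Real.sqrt_sq (by positivity)]
          ring
      _ ≤ (1 + 2 * C₃) * S.Minf * (n * S.Gn n h) := by gcongr
      _ = _ := by ring
  -- Along isotropic bandwidths tending to infinity the noise and `G_n` vanish, and the bias is
  -- bounded by the maximal function throughout.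
  have hbd : ∀ m : ℕ, S.oracleBound M P Hf n f x ≤ ((3 * C₁ : ℝ≥0) : ℝ≥0∞) * S.maxFun Hf f x +
      80 * (ENNReal.ofReal ((1 + 2 * C₃) * S.Minf * n * S.Gn n fun _ => Real.exp (m : ℤ)) +
        C₂ * ENNReal.ofReal (S.Gn n fun _ => Real.exp (m : ℤ))) := by
    intro m
    have hm : (fun _ => Real.exp (m : ℤ)) ∈ Hf.toSet d := const_mem_toSet Hf m
    refine (iInf₂_le _ hm).trans ?_
    rw [ENNReal.coe_mul, mul_assoc]
    gcongr
    · norm_num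
    · exact hC₁ Hf f _ x hf hm
    · exact (hC₂ M P (Hf.toSet d) n _ x hn (toSet_pos hm)).trans (by gcongr; exact hnoise _ hm)
  have ht := S.tendsto_Gn_const hd n
  have h1 := ENNReal.tendsto_ofReal (ht.const_mul ((1 + 2 * C₃) * S.Minf * n))
  have h2 := ENNReal.Tendsto.const_mul (a := (C₂ : ℝ≥0∞)) (ENNReal.tendsto_ofReal ht)
    (Or.inr ENNReal.coe_ne_top)
  have h3 := (ENNReal.Tendsto.const_mul (a := 80) (h1.add h2) (Or.inr (by norm_num))).const_add
    (((3 * C₁ : ℝ≥0) : ℝ≥0∞) * S.maxFun Hf f x)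
  simp only [mul_zero, ENNReal.ofReal_zero, add_zero] at h3
  exact ge_of_tendsto' h3 hbd

end Setting

end ConvDensity

/-! ### From level sets of the bias and the noise to those of the oracle bound. -/

namespace ConvDensity

variable {d : ℕ}

/-- Pigeonhole: if every `β j` is at most `v` and `W` is at most `κ v`, the sum cannot exceed the
threshold. -/
theorem measure_lt_le_of_le_sum {X ι : Type*} [MeasurableSpace X] {μ : Measure X}
    {F W : X → ℝ≥0∞} {β : ι → X → ℝ≥0∞} {J : Finset ι} {C κ : ℝ≥0} {N : ℕ} (hJ : J.card ≤ N)
    {v : ℝ} (hv : 0 ≤ v)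
    (hle : ∀ᵐ x ∂μ, F x ≤ C * ENNReal.ofReal v + 3 * ∑ j ∈ J, β j x + 80 * W x) :
    μ {x | ENNReal.ofReal ((C + 3 * N + 80 * κ) * v) < F x} ≤
      (∑ j ∈ J, μ {x | ENNReal.ofReal v < β j x}) + μ {x | ENNReal.ofReal (κ * v) < W x} := by
  refine le_trans ?_ (add_le_add (measure_biUnion_finset_le J _) le_rfl)
  refine le_trans ?_ (measure_union_le _ _)
  refine measure_mono_ae ?_
  filter_upwards [hle] with x hx hF
  change ENNReal.ofReal _ < F x at hF
  change x ∈ (⋃ j ∈ J, {x | ENNReal.ofReal v < β j x}) ∪ {x | ENNReal.ofReal (κ * v) < W x}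
  by_contra hcon
  simp only [mem_union, mem_iUnion, mem_ofPred_eq, not_or, not_exists, not_lt] at hcon
  obtain ⟨h1, h2⟩ := hcon
  refine absurd (hx.trans ?_) (not_le.2 hF)
  calc (C : ℝ≥0∞) * ENNReal.ofReal v + 3 * ∑ j ∈ J, β j x + 80 * W x ≤
        C * ENNReal.ofReal v + 3 * (N * ENNReal.ofReal v) + 80 * ENNReal.ofReal (κ * v) := by
        gcongr
        calc ∑ j ∈ J, β j x ≤ ∑ _j ∈ J, ENNReal.ofReal v := Finset.sum_le_sum h1
          _ = J.card * ENNReal.ofReal v := by rw [Finset.sum_const, nsmul_eq_mul]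
          _ ≤ _ := by gcongr
    _ = _ := by
        rw [add_mul, add_mul, ENNReal.ofReal_add (by positivity) (by positivity),
          ENNReal.ofReal_add (by positivity) (by positivity), mul_assoc 3, mul_assoc 80,
          ENNReal.ofReal_mul (by positivity), ENNReal.ofReal_mul (by positivity),
          ENNReal.ofReal_mul (by positivity), ENNReal.ofReal_mul (p := 80) (by positivity)]
        simp

/-- On the level set at least one summand exceeds its own threshold. All the others, and `v` itself,
are then dominated by the large ones, so only the tails of the summands enter. -/
theorem setLIntegral_rpow_le_of_le_sum {X ι : Type*} [MeasurableSpace X] {μ : Measure X}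
    {F W : X → ℝ≥0∞} {β : ι → X → ℝ≥0∞} {J : Finset ι} {C κ : ℝ≥0} {N : ℕ} (hJ : J.card ≤ N)
    (hκ : 1 ≤ κ) {v p : ℝ} (hv : 0 ≤ v) (hp : 0 < p) (hF : Measurable F) (hW : Measurable W)
    (hβ : ∀ j, Measurable (β j))
    (hle : ∀ᵐ x ∂μ, F x ≤ C * ENNReal.ofReal v + 3 * ∑ j ∈ J, β j x + 80 * W x) :
    ∫⁻ x in {x | ENNReal.ofReal ((C + 3 * N + 80 * κ) * v) < F x}, F x ^ p ∂μ ≤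
      ((C + 6 * N + 80 * (κ + 1) : ℝ≥0) : ℝ≥0∞) ^ p *
        ((∑ j ∈ J, ∫⁻ x in {x | ENNReal.ofReal v < β j x}, β j x ^ p ∂μ) +
          ∫⁻ x in {x | ENNReal.ofReal (κ * v) < W x}, W x ^ p ∂μ) := by
  have sF : MeasurableSet {x | ENNReal.ofReal ((C + 3 * N + 80 * κ) * v) < F x} :=
    measurableSet_lt measurable_const hF
  have sW : MeasurableSet {x | ENNReal.ofReal (κ * v) < W x} :=
    measurableSet_lt measurable_const hW
  have sβ : ∀ j, MeasurableSet {x | ENNReal.ofReal v < β j x} := fun j =>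
    measurableSet_lt measurable_const (hβ j)
  set I : ι → X → ℝ≥0∞ := fun j => indicator {x | ENNReal.ofReal v < β j x} fun x => β j x ^ p
  set Iw : X → ℝ≥0∞ := indicator {x | ENNReal.ofReal (κ * v) < W x} fun x => W x ^ p
  have mI : ∀ j, Measurable (I j) := fun j => ((hβ j).pow_const p).indicator (sβ j)
  have mS : Measurable fun x => ∑ j ∈ J, I j x := Finset.measurable_sum _ fun j _ => mI j
  have hpt : ∀ᵐ x ∂μ, x ∈ {x | ENNReal.ofReal ((C + 3 * N + 80 * κ) * v) < F x} →
      F x ^ p ≤ ((C + 6 * N + 80 * (κ + 1) : ℝ≥0) : ℝ≥0∞) ^ p * (∑ j ∈ J, I j x + Iw x) := by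
    filter_upwards [hle] with x hx hFx
    -- `Y` is the `ℓ^p` size of the summands that exceed their thresholds. The point is `v ≤ Y`,
    -- after which every summand is a multiple of `Y`.
    set Y := (∑ j ∈ J, I j x + Iw x) ^ p⁻¹ with hY
    have hYp : Y ^ p = ∑ j ∈ J, I j x + Iw x := by
      rw [hY, ← ENNReal.rpow_mul, inv_mul_cancel₀ hp.ne', ENNReal.rpow_one]
    have hβY : ∀ j ∈ J, ENNReal.ofReal v < β j x → β j x ≤ Y := fun j hj h => by
      rw [hY, ENNReal.le_rpow_inv_iff hp]
      calc β j x ^ p = I j x :=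
            (indicator_of_mem (show x ∈ {x | ENNReal.ofReal v < β j x} from h)
              fun x => β j x ^ p).symm
        _ ≤ ∑ j ∈ J, I j x := Finset.single_le_sum (f := fun i => I i x) (fun _ _ => zero_le) hj
        _ ≤ _ := le_self_add
    have hWY : ENNReal.ofReal (κ * v) < W x → W x ≤ Y := fun h => by
      rw [hY, ENNReal.le_rpow_inv_iff hp]
      calc W x ^ p = Iw x :=
            (indicator_of_mem (show x ∈ {x | ENNReal.ofReal (κ * v) < W x} from h)
              fun x => W x ^ p).symm
        _ ≤ _ := le_add_self
    have hκv : ENNReal.ofReal v ≤ ENNReal.ofReal (κ * v) :=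
      ENNReal.ofReal_le_ofReal (le_mul_of_one_le_left hv (by exact_mod_cast hκ))
    have hvY : ENNReal.ofReal v ≤ Y := by
      by_contra hcon
      have h1 : ∀ j ∈ J, β j x ≤ ENNReal.ofReal v := fun j hj => by
        by_contra h
        exact hcon ((not_le.1 h).le.trans (hβY j hj (not_le.1 h)))
      have h2 : W x ≤ ENNReal.ofReal (κ * v) := by
        by_contra h
        exact hcon (hκv.trans ((not_le.1 h).le.trans (hWY (not_le.1 h))))
      refine absurd (hx.trans ?_) (not_le.2 hFx)
      calc (C : ℝ≥0∞) * ENNReal.ofReal v + 3 * ∑ j ∈ J, β j x + 80 * W x ≤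
            C * ENNReal.ofReal v + 3 * (N * ENNReal.ofReal v) + 80 * ENNReal.ofReal (κ * v) := by
            gcongr
            calc ∑ j ∈ J, β j x ≤ ∑ _j ∈ J, ENNReal.ofReal v := Finset.sum_le_sum h1
              _ = J.card * ENNReal.ofReal v := by rw [Finset.sum_const, nsmul_eq_mul]
              _ ≤ _ := by gcongr
        _ = _ := by
            rw [add_mul, add_mul, ENNReal.ofReal_add (by positivity) (by positivity),
              ENNReal.ofReal_add (by positivity) (by positivity), mul_assoc 3, mul_assoc 80,
              ENNReal.ofReal_mul (by positivity), ENNReal.ofReal_mul (by positivity),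
              ENNReal.ofReal_mul (by positivity), ENNReal.ofReal_mul (p := 80) (by positivity)]
            simp
    have h3 : ∀ j ∈ J, β j x ≤ 2 * Y := fun j hj => by
      rcases le_or_gt (β j x) (ENNReal.ofReal v) with h | h
      · exact (h.trans hvY).trans (le_mul_of_one_le_left' (by norm_num))
      · exact (hβY j hj h).trans (le_mul_of_one_le_left' (by norm_num))
    have h4 : W x ≤ (κ + 1) * Y := by
      rcases le_or_gt (W x) (ENNReal.ofReal (κ * v)) with h | h
      · rw [ENNReal.ofReal_mul κ.coe_nonneg, ENNReal.ofReal_coe_nnreal] at h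
        refine h.trans ?_
        gcongr
        exact le_self_add
      · exact (hWY h).trans (le_mul_of_one_le_left' le_add_self)
    rw [← hYp, ← ENNReal.mul_rpow_of_nonneg _ _ hp.le]
    refine ENNReal.rpow_le_rpow (hx.trans ?_) hp.le
    calc (C : ℝ≥0∞) * ENNReal.ofReal v + 3 * ∑ j ∈ J, β j x + 80 * W x ≤
          C * Y + 3 * (N * (2 * Y)) + 80 * ((κ + 1) * Y) := by
          gcongr
          calc ∑ j ∈ J, β j x ≤ ∑ _j ∈ J, 2 * Y := Finset.sum_le_sum h3
            _ = J.card * (2 * Y) := by rw [Finset.sum_const, nsmul_eq_mul]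
            _ ≤ _ := by gcongr
      _ = _ := by push_cast; ring
  calc _ ≤ ∫⁻ x in {x | ENNReal.ofReal ((C + 3 * N + 80 * κ) * v) < F x},
        ((C + 6 * N + 80 * (κ + 1) : ℝ≥0) : ℝ≥0∞) ^ p * (∑ j ∈ J, I j x + Iw x) ∂μ :=
        setLIntegral_mono_ae' sF hpt
    _ ≤ ∫⁻ x, ((C + 6 * N + 80 * (κ + 1) : ℝ≥0) : ℝ≥0∞) ^ p * (∑ j ∈ J, I j x + Iw x) ∂μ :=
        setLIntegral_le_lintegral _ _
    _ = _ := by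
        rw [lintegral_const_mul' _ _ (ENNReal.rpow_ne_top_of_nonneg hp.le ENNReal.coe_ne_top),
          lintegral_add_left mS, lintegral_finsetSum _ fun j _ => mI j]
        congr 2
        · exact Finset.sum_congr rfl fun j _ => lintegral_indicator (sβ j) _
        · exact lintegral_indicator sW _

namespace Setting

/-- The bias functionals of `f` are dominated by those of the class `F`. -/
structure BiasDominated (S : Setting d) (F : Set ((Fin d → ℝ) → ℝ))
    (N : ((Fin d → ℝ) → ℝ) → Fin d → ℝ≥0∞ → ℝ → ℝ≥0∞) (B : Fin d → ℝ≥0∞ → ℝ → ℝ≥0∞)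
    (f : (Fin d → ℝ) → ℝ) : Prop where
  sup : ∀ (j : Fin d) (h : ℝ), 0 < h → eLpNorm (S.bSup h f j) ∞ volume ≤ S.biasB F j ∞ h
  norm : ∀ (j : Fin d) (s : ℝ≥0∞) (h : ℝ), 0 < h → N f j s h ≤ B j s h

/-- Membership in `ℌ(v)` makes the linear noise term at most a multiple of `v`, and the coordinates
outside `J̄(h, v)` have bias at most `𝐜 v` almost everywhere. What can exceed the level `v` is the
bias in `J̄` and the standard deviation term. -/
theorem BiasControlled.exists_oracleBound_le {S : Setting d} (hS : S.Valid) (D : ℝ)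
    {Hf : Family} {N : ((Fin d → ℝ) → ℝ) → Fin d → ℝ≥0∞ → ℝ → ℝ≥0∞} {s : Fin d → ℝ}
    (hs : ∀ j, 0 ≤ s j) (hN : S.BiasControlled Hf N s) :
    ∃ C : ℝ≥0, ∀ (M : (Fin d → ℝ) → (Fin d → ℝ) → ℝ) (P : Measure (Fin d → ℝ)) (n : ℕ)
      (F : Set ((Fin d → ℝ) → ℝ)) (B : Fin d → ℝ≥0∞ → ℝ → ℝ≥0∞) (f : (Fin d → ℝ) → ℝ)
      (h : Fin d → ℝ) (v : ℝ), 3 ≤ n → Measurable f → Integrable f → S.BiasDominated F N B f →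
      h ∈ S.frakH D (Hf.toSet d) n v → 0 < v →
      ∃ β : Fin d → (Fin d → ℝ) → ℝ≥0∞, (∀ j, Measurable (β j)) ∧
        (∀ᵐ x, S.oracleBound M P Hf n f x ≤ C * ENNReal.ofReal v +
          3 * ∑ j ∈ S.Jbar F h v, β j x + 80 * S.noiseSup M P (Hf.toSet d) n h x) ∧
        ∀ j, ∫⁻ x, β j x ^ s j ≤ C * B j (ENNReal.ofReal (s j)) (h j) ^ s j := by
  obtain ⟨C₁, hC₁⟩ := hN
  obtain ⟨C₂, hC₂⟩ := hS.exists_UbarStar_le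
  refine ⟨3 * C₁ * Real.toNNReal S.cBold + 80 * C₂ * Real.toNNReal (S.a D) + C₁,
    fun M P n F B f h v hn hf hfi hdom hh hv => ?_⟩
  have hpos := toSet_pos hh.1
  obtain ⟨β, hβm, hβ, hβs⟩ := hC₁ f h (S.Jbar F h v) (ENNReal.ofReal (S.cBold * v)) hf hfi hh.1
    fun j hj => by
      have hj' : S.biasB F j ∞ (h j) ≤ ENNReal.ofReal (S.cBold * v) := by
        by_contra hcon
        exact hj (by simpa [Jbar] using hcon)
      have h1 := (hdom.sup j (h j) (hpos j)).trans hj'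
      rw [eLpNorm_exponent_top] at h1
      exact (ae_le_eLpNormEssSup (f := S.bSup (h j) f j)).mono fun x hx => by
        rw [enorm_eq_self] at hx
        exact hx.trans h1
  refine ⟨β, hβm, ?_, fun j => (hβs j).trans ?_⟩
  · filter_upwards [hβ] with x hx
    refine (iInf₂_le h hh.1).trans ?_
    have hG : ENNReal.ofReal (S.Gn n h) ≤ ENNReal.ofReal (S.a D) * ENNReal.ofReal v := by
      rw [← ENNReal.ofReal_mul (S.a_nonneg D)]
      exact ENNReal.ofReal_le_ofReal hh.2
    calc 3 * S.biasSup (Hf.toSet d) h f x + 80 * S.UbarStar M P (Hf.toSet d) n h x ≤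
          3 * (C₁ * (ENNReal.ofReal S.cBold * ENNReal.ofReal v) + ∑ j ∈ S.Jbar F h v, β j x) +
          80 * (S.noiseSup M P (Hf.toSet d) n h x +
            C₂ * (ENNReal.ofReal (S.a D) * ENNReal.ofReal v)) := by
          rw [← ENNReal.ofReal_mul' hv.le]
          gcongr
          exact (hC₂ M P (Hf.toSet d) n h x hn hpos).trans (by gcongr)
      _ = (3 * C₁ * ENNReal.ofReal S.cBold + 80 * C₂ * ENNReal.ofReal (S.a D)) *
          ENNReal.ofReal v + 3 * ∑ j ∈ S.Jbar F h v, β j x +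
          80 * S.noiseSup M P (Hf.toSet d) n h x := by ring
      _ ≤ _ := by
          push_cast
          rw [ENNReal.ofNNReal_toNNReal, ENNReal.ofNNReal_toNNReal]
          exact add_le_add (add_le_add (mul_le_mul' le_self_add le_rfl) le_rfl) le_rfl
  · refine mul_le_mul' (ENNReal.coe_le_coe.2 le_add_self) ?_
    exact ENNReal.rpow_le_rpow (hdom.norm j _ _ (hpos j)) (hs j)

theorem le_coe_mul_LLu {S : Setting d} {D : ℝ} {H : Set (Fin d → ℝ)} {n : ℕ}
    {F : Set ((Fin d → ℝ) → ℝ)} {B : Fin d → ℝ≥0∞ → ℝ → ℝ≥0∞} {s : Fin d → ℝ} {v : ℝ} {u : ℝ≥0∞}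
    {K : ℝ≥0∞} (hK : K ≠ 0) (hK' : K ≠ ∞) {y : ℝ≥0∞}
    (hy : ∀ z, 2 ≤ z → ∀ h ∈ S.frakHz D H n v z, y ≤ K * (S.biasSum F B s h v + negPow z u)) :
    y ≤ K * S.LLu D H n F B s v u := by
  rw [← ENNReal.div_le_iff' hK hK']
  refine le_iInf₂ fun z hz => le_iInf₂ fun h hh => ?_
  rw [ENNReal.div_le_iff' hK hK']
  exact hy z hz h hh

theorem le_coe_mul_LL {S : Setting d} {D : ℝ} {H : Set (Fin d → ℝ)} {n : ℕ}
    {F : Set ((Fin d → ℝ) → ℝ)} {B : Fin d → ℝ≥0∞ → ℝ → ℝ≥0∞} {s : Fin d → ℝ} {v : ℝ}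
    {K : ℝ≥0∞} (hK : K ≠ 0) (hK' : K ≠ ∞) {y : ℝ≥0∞}
    (hy : ∀ h ∈ S.frakH D H n v,
      y ≤ K * (S.biasSum F B s h v + ENNReal.ofReal (v ^ (-2 : ℤ) * S.Fn n h ^ 2))) :
    y ≤ K * S.LL D H n F B s v := by
  rw [← ENNReal.div_le_iff' hK hK']
  refine le_iInf₂ fun h hh => ?_
  rw [ENNReal.div_le_iff' hK hK']
  exact hy h hh

/-- The bounds for the level sets and for the tail of `oracleBound`. -/
theorem IsDeconvKernel.exists_oracleBound_level_bounds {S : Setting d} (hS : S.Valid) (hd : 1 ≤ d)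
    {M : (Fin d → ℝ) → (Fin d → ℝ) → ℝ} (hM : S.IsDeconvKernel M) {D : ℝ} (hD : 0 < D)
    {u : ℝ≥0∞} (hu : 1 < u) (hpu : ENNReal.ofReal S.p / 2 < u) {Hf : Family}
    {N : ((Fin d → ℝ) → ℝ) → Fin d → ℝ≥0∞ → ℝ → ℝ≥0∞} {s : Fin d → ℝ}
    (hs : ∀ j, 0 ≤ s j) (hN : S.BiasControlled Hf N s) :
    ∃ c : ℝ, 0 < c ∧ ∃ K : ℝ≥0, ∀ (n : ℕ) (π : (Fin d → ℝ) → ℝ≥0∞)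
      (F : Set ((Fin d → ℝ) → ℝ)) (B : Fin d → ℝ≥0∞ → ℝ → ℝ≥0∞) (f : (Fin d → ℝ) → ℝ) (v : ℝ),
      3 ≤ n → Measurable π → ∫⁻ y, π y = 1 → WeakBounded u D π → Measurable f → Integrable f →
      S.BiasDominated F N B f → 0 < v →
      (volume {x | ENNReal.ofReal (c * v) < S.oracleBound M (volume.withDensity π) Hf n f x} ≤
        K * min (S.LLu D (Hf.toSet d) n F B s v u) (S.LL D (Hf.toSet d) n F B s v)) ∧
      ((∀ j, S.p ≤ s j) →
        ∫⁻ x in {x | ENNReal.ofReal (c * v) < S.oracleBound M (volume.withDensity π) Hf n f x},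
          S.oracleBound M (volume.withDensity π) Hf n f x ^ S.p ≤
        K * (ENNReal.ofReal (v ^ S.p) * S.LLu D (Hf.toSet d) n F B s v u)) := by
  obtain ⟨C₁, hC₁⟩ := hN.exists_oracleBound_le hS D hs
  obtain ⟨C₂, hC₂⟩ := hM.exists_noiseSup_measure_le_Fn_sq hS hd
  obtain ⟨κ, hκ, C₃, hC₃⟩ := hM.exists_noiseSup_bounds hS hd hD hu hpu
  have hp0 : 0 < S.p := by linarith [hS.one_lt_p]
  lift κ to ℝ≥0 using by linarith
  have hκ' : 1 ≤ κ := by exact_mod_cast hκ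
  set Q : ℝ≥0 := (C₁ + 6 * d + 80 * (κ + 1)) ^ S.p with hQ
  -- The summand 1 keeps the constant nonzero, so that it can be divided out of the infima defining
  -- `𝕃`.
  set K₀ : ℝ≥0 := 1 + C₁ + C₂ + C₃ with hK₀
  refine ⟨C₁ + 3 * d + 80 * κ, by positivity, K₀ + Q * K₀,
    fun n π F B f v hn hπ hπ1 hπu hf hfi hdom hv => ?_⟩
  have hK1 : (K₀ : ℝ≥0∞) ≠ 0 := by
    rw [ENNReal.coe_ne_zero, hK₀]; positivity
  have hcard : ∀ J : Finset (Fin d), J.card ≤ d := fun J => by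
    simpa using Finset.card_le_univ J
  have hβv : ∀ h (β : Fin d → (Fin d → ℝ) → ℝ≥0∞), (∀ j, Measurable (β j)) →
      (∀ j, ∫⁻ x, β j x ^ s j ≤ C₁ * B j (ENNReal.ofReal (s j)) (h j) ^ s j) →
      ∑ j ∈ S.Jbar F h v, volume {x | ENNReal.ofReal v < β j x} ≤ C₁ * S.biasSum F B s h v := by
    intro h β hβm hβs
    rw [biasSum, Finset.mul_sum]
    refine Finset.sum_le_sum fun j _ => (measure_lt_le_lintegral_rpow (hβm j) (hs j) hv).trans ?_
    rw [mul_left_comm]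
    gcongr
    exact hβs j
  constructor
  · refine le_trans ?_ (mul_le_mul' (ENNReal.coe_le_coe.2 (le_self_add : K₀ ≤ _)) le_rfl)
    have hmin : ∀ {y a b : ℝ≥0∞}, y ≤ K₀ * a → y ≤ K₀ * b → y ≤ K₀ * min a b := by
      intro y a b ha hb
      rcases min_choice a b with h | h <;> rwa [h]
    refine hmin (le_coe_mul_LLu hK1 ENNReal.coe_ne_top fun z hz h hh => ?_)
      (le_coe_mul_LL hK1 ENNReal.coe_ne_top fun h hh => ?_)
    · obtain ⟨β, hβm, hβ, hβs⟩ := hC₁ M (volume.withDensity π) n F B f h v hn hf hfi hdom hh.1 hv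
      refine (measure_lt_le_of_le_sum (κ := κ) (hcard _) hv.le hβ).trans ?_
      rw [mul_add]
      refine add_le_add ((hβv h β hβm hβs).trans ?_)
        ((hC₃ n Hf π h v z hn hπ hπu hh.1.1 hv hz hh.2).1.trans ?_)
      · gcongr
        rw [hK₀]
        exact (le_add_self.trans le_self_add).trans le_self_add
      · gcongr
        exact le_add_self
    · obtain ⟨β, hβm, hβ, hβs⟩ := hC₁ M (volume.withDensity π) n F B f h v hn hf hfi hdom hh hv
      refine (measure_lt_le_of_le_sum (κ := κ) (hcard _) hv.le hβ).trans ?_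
      rw [mul_add]
      refine add_le_add ((hβv h β hβm hβs).trans ?_) ?_
      · gcongr
        rw [hK₀]
        exact (le_add_self.trans le_self_add).trans le_self_add
      · refine (measure_mono fun x hx => ?_).trans
          ((hC₂ n Hf π h v hn hπ hπ1 hh.1 hv).trans ?_)
        · exact lt_of_le_of_lt
            (ENNReal.ofReal_le_ofReal (le_mul_of_one_le_left hv.le hκ)) hx
        · gcongr
          rw [hK₀]
          exact le_add_self.trans le_self_add
  -- Above the level `v` one has `β_j^p ≤ v^{p - s_j} β_j^{s_j}`, which requires `p ≤ s_j`.
  · intro hps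
    refine le_trans ?_ (mul_le_mul' (ENNReal.coe_le_coe.2 (le_add_self : Q * K₀ ≤ _)) le_rfl)
    have hvp : 0 < v ^ S.p := Real.rpow_pos_of_pos hv _
    have hQ0 : Q ≠ 0 := by
      rw [hQ]; positivity
    rw [← mul_assoc]
    refine le_coe_mul_LLu (by simp [hQ0, hK1, hvp])
      (ENNReal.mul_ne_top ENNReal.coe_ne_top ENNReal.ofReal_ne_top) fun z hz h hh => ?_
    obtain ⟨β, hβm, hβ, hβs⟩ := hC₁ M (volume.withDensity π) n F B f h v hn hf hfi hdom hh.1 hv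
    have hW : Measurable (S.noiseSup M (volume.withDensity π) (Hf.toSet d) n h) :=
      measurable_noiseSup hM
    refine (setLIntegral_rpow_le_of_le_sum (hcard _) hκ' hv.le hp0
      (measurable_oracleBound hS hM _ Hf n hf) hW hβm hβ).trans ?_
    have hQe : ((C₁ + 6 * d + 80 * (κ + 1) : ℝ≥0) : ℝ≥0∞) ^ S.p = Q := by
      rw [hQ, ENNReal.coe_rpow_of_nonneg _ hp0.le]
    rw [hQe, ENNReal.coe_mul, mul_assoc, mul_assoc]
    gcongr
    rw [mul_add, mul_add]
    refine add_le_add ?_ ((hC₃ n Hf π h v z hn hπ hπu hh.1.1 hv hz hh.2).2.trans ?_)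
    · rw [biasSum, Finset.mul_sum, Finset.mul_sum]
      refine Finset.sum_le_sum fun j _ =>
        (setLIntegral_rpow_le (hβm j) (hps j) hv hp0.le).trans ?_
      calc ENNReal.ofReal (v ^ (S.p - s j)) * ∫⁻ x, β j x ^ s j ≤
            ENNReal.ofReal (v ^ (S.p - s j)) *
              (C₁ * B j (ENNReal.ofReal (s j)) (h j) ^ s j) := by gcongr; exact hβs j
        _ = C₁ * (ENNReal.ofReal (v ^ S.p) * (ENNReal.ofReal (v ^ (-s j)) *
            B j (ENNReal.ofReal (s j)) (h j) ^ s j)) := by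
            rw [sub_eq_add_neg, Real.rpow_add hv, ENNReal.ofReal_mul hvp.le]
            ring
        _ ≤ _ := by
            gcongr
            rw [hK₀]
            exact (le_add_self.trans le_self_add).trans le_self_add
    · gcongr
      exact le_add_self

end Setting

end ConvDensity

/-! ### The `p`-th moment of the oracle bound. -/

namespace ConvDensity

variable {d : ℕ}

/-- The weak type bound with logarithms needs some finite exponent `r > 1`. For finite `q` take `r =
q`; for `q = ∞` interpolate between `L_1` and `L_∞` with `r = 2`. -/
theorem exists_lintegral_rpow_le {q : ℝ≥0∞} (hq : 1 < q) (R D : ℝ) :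
    ∃ r : ℝ, 1 < r ∧ ∃ B : ℝ≥0, ∀ f : (Fin d → ℝ) → ℝ, ∫⁻ x, ‖f x‖ₑ ≤ ENNReal.ofReal R →
      eLpNorm f q volume ≤ ENNReal.ofReal D → ∫⁻ x, ‖f x‖ₑ ^ r ≤ B := by
  by_cases hqi : q = ∞
  · refine ⟨2, by norm_num, Real.toNNReal D * Real.toNNReal R, fun f hf1 hf2 => ?_⟩
    rw [hqi, eLpNorm_exponent_top] at hf2
    calc ∫⁻ x, ‖f x‖ₑ ^ (2 : ℝ) ≤ ∫⁻ x, ENNReal.ofReal D * ‖f x‖ₑ := by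
          refine lintegral_mono_ae ((ae_le_eLpNormEssSup (f := f)).mono fun x hx => ?_)
          rw [ENNReal.rpow_two, sq]
          gcongr
          exact hx.trans hf2
      _ = ENNReal.ofReal D * ∫⁻ x, ‖f x‖ₑ := lintegral_const_mul' _ _ ENNReal.ofReal_ne_top
      _ ≤ ENNReal.ofReal D * ENNReal.ofReal R := by gcongr
      _ = _ := by rw [ENNReal.coe_mul, ENNReal.ofNNReal_toNNReal, ENNReal.ofNNReal_toNNReal]
  · have hr : 1 < q.toReal := by
      rw [← ENNReal.toReal_one]
      exact (ENNReal.toReal_lt_toReal ENNReal.one_ne_top hqi).2 hq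
    refine ⟨q.toReal, hr, Real.toNNReal D ^ q.toReal, fun f _ hf2 => ?_⟩
    rw [eLpNorm_eq_lintegral_rpow_enorm_toReal (zero_lt_one.trans hq).ne' hqi, one_div,
      ENNReal.rpow_inv_le_iff (by linarith)] at hf2
    rwa [ENNReal.coe_rpow_of_nonneg _ (by linarith), ENNReal.ofNNReal_toNNReal]

namespace Setting

/-- The `p`-th moment of `oracleBound`, with the three possible last terms. -/
theorem IsDeconvKernel.exists_lintegral_oracleBound_le {S : Setting d} (hS : S.Valid) (hd : 1 ≤ d)
    {M : (Fin d → ℝ) → (Fin d → ℝ) → ℝ} (hM : S.IsDeconvKernel M) (R : ℝ) {D : ℝ} (hD : 0 < D)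
    {q u : ℝ≥0∞} (hq : 1 < q) (hu : 1 < u) (hpu : ENNReal.ofReal S.p / 2 < u) {Hf : Family}
    {N : ((Fin d → ℝ) → ℝ) → Fin d → ℝ≥0∞ → ℝ → ℝ≥0∞} {s qv : Fin d → ℝ}
    (hs : ∀ j, 0 ≤ s j) (hN : S.BiasControlled Hf N s) (hqv : ∀ j, S.p ≤ qv j)
    (hNq : S.BiasControlled Hf N qv) :
    ∃ K : ℝ≥0, ∀ (n : ℕ) (π : (Fin d → ℝ) → ℝ≥0∞) (F : Set ((Fin d → ℝ) → ℝ))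
      (B : Fin d → ℝ≥0∞ → ℝ → ℝ≥0∞) (f : (Fin d → ℝ) → ℝ) (v₁ v₂ : ℝ) (T : ℝ≥0∞),
      3 ≤ n → Measurable π → ∫⁻ y, π y = 1 → WeakBounded u D π → Measurable f → Integrable f →
      ∫⁻ x, ‖f x‖ₑ ≤ ENNReal.ofReal R → eLpNorm f q volume ≤ ENNReal.ofReal D →
      S.BiasDominated F N B f → 0 < v₁ → v₁ ≤ v₂ →
      (T = ENNReal.ofReal (v₂ ^ S.p) * S.LLu D (Hf.toSet d) n F B qv v₂ u ∨
        (ENNReal.ofReal S.p < q ∧ q < ∞ ∧ T = ENNReal.ofReal (v₂ ^ (S.p - q.toReal))) ∨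
        (q = ∞ ∧ T = S.LLu D (Hf.toSet d) n F B s v₂ u)) →
      ∫⁻ x, S.oracleBound M (volume.withDensity π) Hf n f x ^ S.p ≤
        K * (ENNReal.ofReal (S.lH Hf v₁) +
          (∫⁻ v in Icc v₁ v₂, ENNReal.ofReal (v ^ (S.p - 1)) *
            min (S.LLu D (Hf.toSet d) n F B s v u) (S.LL D (Hf.toSet d) n F B s v)) + T) := by
  have hp0 : 0 < S.p := by linarith [hS.one_lt_p]
  obtain ⟨C₀, hC₀⟩ := hM.exists_oracleBound_le_maxFun hS hd
  obtain ⟨r, hr, Br, hBr⟩ := exists_lintegral_rpow_le (d := d) hq R D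
  obtain ⟨Cm, hCm⟩ := hS.exists_maxFun_measure_le hd hr (Real.toNNReal R) Br
  obtain ⟨c₁, hc₁, K₁, hK₁⟩ := hM.exists_oracleBound_level_bounds hS hd hD hu hpu hs hN
  obtain ⟨c₂, hc₂, K₂, hK₂⟩ := hM.exists_oracleBound_level_bounds hS hd hD hu hpu
    (fun j => hp0.le.trans (hqv j)) hNq
  set c : ℝ := C₀ + c₁ + c₂ with hc
  have hc0 : 0 < c := by positivity
  -- For `p < q < ∞` the oracle bound inherits an `L_q` bound from the maximal function, and
  -- restricting to a level set trades `L_q` for `v^{p - q}`.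
  have hTq : ∃ K₃ : ℝ≥0, ∀ (n : ℕ) (π : (Fin d → ℝ) → ℝ≥0∞) (f : (Fin d → ℝ) → ℝ) (v : ℝ),
      3 ≤ n → Measurable π → ∫⁻ y, π y = 1 → Measurable f →
      eLpNorm f q volume ≤ ENNReal.ofReal D → 0 < v → ENNReal.ofReal S.p < q → q < ∞ →
      ∫⁻ x in {x | ENNReal.ofReal (c * v) < S.oracleBound M (volume.withDensity π) Hf n f x},
          S.oracleBound M (volume.withDensity π) Hf n f x ^ S.p ≤
        K₃ * ENNReal.ofReal (v ^ (S.p - q.toReal)) := by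
    by_cases hqi : q = ∞
    · exact ⟨0, fun n π f v _ _ _ _ _ _ _ h => absurd hqi h.ne⟩
    · have hr' : 1 < q.toReal := by
        rw [← ENNReal.toReal_one]
        exact (ENNReal.toReal_lt_toReal ENNReal.one_ne_top hqi).2 hq
      have hq0 : 0 ≤ q.toReal := by linarith
      obtain ⟨Cq, hCq⟩ := hS.exists_lintegral_maxFun_rpow_le hd hr'
      refine ⟨Real.toNNReal (c ^ (S.p - q.toReal)) *
        (C₀ ^ q.toReal * (Cq * Real.toNNReal D ^ q.toReal)),
        fun n π f v hn hπ hπ1 hf hfq hv hpq _ => ?_⟩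
      have hpq' : S.p ≤ q.toReal := by
        rw [← ENNReal.ofReal_toReal hqi] at hpq
        exact ((ENNReal.ofReal_lt_ofReal_iff_of_nonneg hp0.le).1 hpq).le
      refine (setLIntegral_rpow_le (measurable_oracleBound hS hM _ Hf n hf) hpq'
        (mul_pos hc0 hv) hp0.le).trans ?_
      have h1 : ∫⁻ x, S.oracleBound M (volume.withDensity π) Hf n f x ^ q.toReal ≤
          C₀ ^ q.toReal * (Cq * ENNReal.ofReal D ^ q.toReal) := by
        calc _ ≤ ∫⁻ x, (C₀ : ℝ≥0∞) ^ q.toReal * S.maxFun Hf f x ^ q.toReal :=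
              lintegral_mono fun x => by
                rw [← ENNReal.mul_rpow_of_nonneg _ _ hq0]
                exact ENNReal.rpow_le_rpow (hC₀ n Hf π f x hn hπ hπ1 hf) hq0
          _ = (C₀ : ℝ≥0∞) ^ q.toReal * ∫⁻ x, S.maxFun Hf f x ^ q.toReal :=
              lintegral_const_mul' _ _ (ENNReal.rpow_ne_top_of_nonneg hq0 ENNReal.coe_ne_top)
          _ ≤ _ := by
              gcongr
              refine (hCq Hf f hf).trans ?_
              gcongr
              rwa [eLpNorm_eq_lintegral_rpow_enorm_toReal (zero_lt_one.trans hq).ne' hqi, one_div,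
                ENNReal.rpow_inv_le_iff (by linarith)] at hfq
      calc _ ≤ ENNReal.ofReal ((c * v) ^ (S.p - q.toReal)) *
            (C₀ ^ q.toReal * (Cq * ENNReal.ofReal D ^ q.toReal)) := by gcongr
        _ = _ := by
            rw [Real.mul_rpow hc0.le hv.le, ENNReal.ofReal_mul (by positivity), ENNReal.coe_mul,
              ENNReal.coe_mul, ENNReal.coe_mul, ENNReal.coe_rpow_of_nonneg _ hq0,
              ENNReal.coe_rpow_of_nonneg _ hq0, ENNReal.ofNNReal_toNNReal,
              ENNReal.ofNNReal_toNNReal]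
            ring
  obtain ⟨K₃, hK₃⟩ := hTq
  set K₄ : ℝ≥0 := (C₀ * Real.toNNReal D) ^ S.p * K₁ with hK₄
  obtain ⟨K, hK⟩ := exists_lintegral_rpow_le_of_level_sets (μ := (volume : Measure (Fin d → ℝ)))
    hS.one_lt_p (Hf.t d) hc0 (Cm + K₁ + K₂ + K₃ + K₄)
  refine ⟨K, fun n π F B f v₁ v₂ T hn hπ hπ1 hπu hf hfi hfR hfq hdom hv₁ hv₁₂ hT => ?_⟩
  have hmA := measurable_oracleBound hS hM (volume.withDensity π) Hf n hf
  have hA₀ : ∀ x, S.oracleBound M (volume.withDensity π) Hf n f x ≤ C₀ * S.maxFun Hf f x :=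
    fun x => hC₀ n Hf π f x hn hπ hπ1 hf
  have hsub : ∀ {c' : ℝ} (v : ℝ), 0 < v → c' ≤ c →
      {x | ENNReal.ofReal (c * v) < S.oracleBound M (volume.withDensity π) Hf n f x} ⊆
      {x | ENNReal.ofReal (c' * v) < S.oracleBound M (volume.withDensity π) Hf n f x} :=
    fun v hv hc' x hx => lt_of_le_of_lt
      (ENNReal.ofReal_le_ofReal (mul_le_mul_of_nonneg_right hc' hv.le)) hx
  have hcc₁ : c₁ ≤ c := by rw [hc]; linarith [C₀.coe_nonneg]
  have hcc₂ : c₂ ≤ c := by rw [hc]; linarith [C₀.coe_nonneg]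
  have hle₁ : (K₁ : ℝ≥0∞) ≤ ((Cm + K₁ + K₂ + K₃ + K₄ : ℝ≥0) : ℝ≥0∞) := ENNReal.coe_le_coe.2
    (((le_add_self.trans le_self_add).trans le_self_add).trans le_self_add)
  refine hK _ (fun v => min (S.LLu D (Hf.toSet d) n F B s v u) (S.LL D (Hf.toSet d) n F B s v))
    T v₁ v₂ hmA hv₁ hv₁₂ (fun v hv => ?_) (fun v hv => ?_) ?_
  · calc _ ≤ volume {x | ENNReal.ofReal v < S.maxFun Hf f x} := by
          refine measure_mono fun x hx => ?_
          change ENNReal.ofReal _ < _ at hx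
          change ENNReal.ofReal v < _
          by_contra hcon
          refine absurd ((hA₀ x).trans ?_) (not_le.2 hx)
          calc (C₀ : ℝ≥0∞) * S.maxFun Hf f x ≤ C₀ * ENNReal.ofReal v := by
                gcongr
                exact not_lt.1 hcon
            _ = ENNReal.ofReal (C₀ * v) := by
                rw [ENNReal.ofReal_mul C₀.coe_nonneg, ENNReal.ofReal_coe_nnreal]
            _ ≤ _ := by
                refine ENNReal.ofReal_le_ofReal (mul_le_mul_of_nonneg_right ?_ hv.le)
                rw [hc]; linarith
      _ ≤ Cm * ENNReal.ofReal (v⁻¹ * (1 + |Real.log v|) ^ Hf.t d) :=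
          hCm Hf f hf hfR (hBr f hfR hfq) v hv
      _ ≤ _ := by
          gcongr
          exact ((le_self_add.trans le_self_add).trans le_self_add).trans le_self_add
  · exact (measure_mono (hsub v hv hcc₁)).trans
      ((hK₁ n π F B f v hn hπ hπ1 hπu hf hfi hdom hv).1.trans (mul_le_mul' hle₁ le_rfl))
  · have hv₂ : 0 < v₂ := hv₁.trans_le hv₁₂
    rcases hT with hT | ⟨hpq, hqi, hT⟩ | ⟨hqi, hT⟩
    · refine (lintegral_mono_set (hsub v₂ hv₂ hcc₂)).trans
        (((hK₂ n π F B f v₂ hn hπ hπ1 hπu hf hfi hdom hv₂).2 hqv).trans ?_)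
      rw [hT]
      gcongr
      exact (le_add_self.trans le_self_add).trans le_self_add
    · refine (hK₃ n π f v₂ hn hπ hπ1 hf hfq hv₂ hpq hqi).trans ?_
      rw [hT]
      gcongr
      exact le_add_self.trans le_self_add
    -- For bounded `f` the oracle bound is itself bounded, so its moment over the level set is a
    -- constant times the measure of that set.
    · have hfD : ∀ᵐ x, ‖f x‖ₑ ≤ ENNReal.ofReal D := by
        rw [hqi, eLpNorm_exponent_top] at hfq
        exact (ae_le_eLpNormEssSup (f := f)).mono fun x hx => hx.trans hfq
      have hAD : ∀ᵐ x, S.oracleBound M (volume.withDensity π) Hf n f x ≤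
          ((C₀ * Real.toNNReal D : ℝ≥0) : ℝ≥0∞) := (hS.ae_maxFun_le hf hfD Hf).mono fun x hx => by
        rw [ENNReal.coe_mul, ENNReal.ofNNReal_toNNReal]
        exact (hA₀ x).trans (mul_le_mul' le_rfl hx)
      calc _ ≤ ∫⁻ _ in {x | ENNReal.ofReal (c * v₂) <
            S.oracleBound M (volume.withDensity π) Hf n f x},
            ((C₀ * Real.toNNReal D : ℝ≥0) : ℝ≥0∞) ^ S.p :=
            lintegral_mono_ae ((ae_restrict_of_ae hAD).mono fun x hx =>
              ENNReal.rpow_le_rpow hx hp0.le)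
        _ = ((C₀ * Real.toNNReal D : ℝ≥0) : ℝ≥0∞) ^ S.p * volume {x | ENNReal.ofReal (c * v₂) <
            S.oracleBound M (volume.withDensity π) Hf n f x} := setLIntegral_const _ _
        _ ≤ ((C₀ * Real.toNNReal D : ℝ≥0) : ℝ≥0∞) ^ S.p * (K₁ * T) := by
            gcongr
            rw [hT]
            exact (measure_mono (hsub v₂ hv₂ hcc₁)).trans
              ((hK₁ n π F B f v₂ hn hπ hπ1 hπu hf hfi hdom hv₂).1.trans
                (mul_le_mul' le_rfl (min_le_left _ _)))
        _ = K₄ * T := by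
            rw [← ENNReal.coe_rpow_of_nonneg _ hp0.le, ← mul_assoc, ← ENNReal.coe_mul]
        _ ≤ _ := by
            gcongr
            exact le_add_self

end Setting

end ConvDensity

/-! ### Measurable versions, and the reduction of the risk to the oracle bound. -/

namespace ConvDensity

variable {d : ℕ}

theorem weakBounded_of_mem_weakBall {u : ℝ≥0∞} {D : ℝ} {φ : (Fin d → ℝ) → ℝ}
    (hφ : φ ∈ weakBall d u D) {π : (Fin d → ℝ) → ℝ≥0∞}
    (hπ : π =ᵐ[volume] fun x => ENNReal.ofReal (φ x)) : WeakBounded u D π := by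
  unfold WeakBounded
  by_cases hu : u = ∞
  · rw [if_pos hu]
    have h := hφ
    rw [weakBall, mem_ofPred_eq, if_pos hu] at h
    have h2 := h.2
    rw [eLpNorm_exponent_top] at h2
    filter_upwards [hπ, ae_le_eLpNormEssSup (f := φ)] with x hx hx2
    rw [hx]
    exact (Real.ofReal_le_enorm _).trans (hx2.trans h2)
  · rw [if_neg hu]
    intro z hz
    have h := hφ
    rw [weakBall, mem_ofPred_eq, if_neg hu] at h
    obtain ⟨C, hC, hCD⟩ := sInf_lt_iff.1 h.2
    have hD : 0 < D := by
      by_contra hD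
      rw [ENNReal.ofReal_of_nonpos (not_lt.1 hD)] at hCD
      exact not_lt_zero hCD
    calc volume {y | ENNReal.ofReal z < π y} ≤ volume {y | z < |φ y|} := by
          refine measure_mono_ae (hπ.mono fun y hy h => ?_)
          change ENNReal.ofReal z < π y at h
          rw [hy] at h
          exact ((ENNReal.ofReal_lt_ofReal_iff_of_nonneg hz.le).1 h).trans_le (le_abs_self _)
      _ ≤ C ^ u.toReal * ENNReal.ofReal z ^ (-u.toReal) := hC z hz
      _ ≤ ENNReal.ofReal D ^ u.toReal * ENNReal.ofReal z ^ (-u.toReal) := by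
          gcongr
      _ = _ := by rw [ENNReal.ofReal_rpow_of_pos hD, ENNReal.ofReal_rpow_of_pos hz]

namespace Setting

theorem smooth_congr_ae (S : Setting d) {f f₀ : (Fin d → ℝ) → ℝ} (hff : f =ᵐ[volume] f₀)
    (h : Fin d → ℝ) : S.smooth h f = S.smooth h f₀ :=
  funext fun x => integral_congr_ae (hff.mono fun y hy => by
    change S.Kh h (y - x) * f y = S.Kh h (y - x) * f₀ y
    rw [hy])

/-- A line may meet the null set where `f` and `f₀` differ. But the coordinate average of the
indicator of a null set has integral zero, so for almost every `x` the two functions agree almost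
everywhere on the part of the line where the kernel is nonzero. -/
theorem Valid.bStar_congr_ae {S : Setting d} (hS : S.Valid) (hd : 1 ≤ d)
    {f f₀ : (Fin d → ℝ) → ℝ} (hff : f =ᵐ[volume] f₀) {h : ℝ} (hh : 0 < h) (j : Fin d) :
    S.bStar h f j =ᵐ[volume] S.bStar h f₀ j := by
  set A := toMeasurable volume {x | f x ≠ f₀ x} with hA
  have hA0 : volume A = 0 := by rw [hA, measure_toMeasurable]; exact hff
  have hAm : MeasurableSet A := measurableSet_toMeasurable _ _
  have hφ : Measurable (A.indicator fun _ : Fin d → ℝ => (1 : ℝ≥0∞)) :=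
    measurable_const.indicator hAm
  have hk : Measurable fun t => ‖S.scaledKernel h t‖ₑ :=
    (hS.continuous_scaledKernel hd h).measurable.enorm
  have h0 : ∫⁻ x, coordAvg (fun t => ‖S.scaledKernel h t‖ₑ) j (A.indicator fun _ => 1) x = 0 := by
    have := lintegral_coordAvg_rpow_le hk le_rfl hφ (i := j)
    simp only [ENNReal.rpow_one] at this
    rw [lintegral_indicator_const hAm, hA0, mul_zero, mul_zero] at this
    exact le_antisymm this zero_le
  rw [lintegral_eq_zero_iff (measurable_coordAvg hk hφ)] at h0
  filter_upwards [h0, hff] with x hx hfx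
  rw [bStar_eq S hh, bStar_eq S hh, hfx]
  congr 2
  refine integral_congr_ae ?_
  have hm : Measurable fun t => ‖S.scaledKernel h (t - x j)‖ₑ *
      A.indicator (fun _ => (1 : ℝ≥0∞)) (Function.update x j t) :=
    (hk.comp (measurable_id.sub_const _)).mul (hφ.comp (measurable_update x))
  have hx' := (lintegral_eq_zero_iff hm).1 hx
  filter_upwards [hx'] with t ht
  rcases mul_eq_zero.1 ht with h1 | h1
  · rw [enorm_eq_zero.1 h1, zero_mul, zero_mul]
  · have hn : Function.update x j t ∉ A := by
      intro hmem
      rw [indicator_of_mem hmem] at h1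
      exact one_ne_zero h1
    have : f (Function.update x j t) = f₀ (Function.update x j t) := by
      by_contra hne
      exact hn (subset_toMeasurable _ _ hne)
    rw [this]

theorem Valid.bSup_congr_ae {S : Setting d} (hS : S.Valid) (hd : 1 ≤ d)
    {f f₀ : (Fin d → ℝ) → ℝ} (hff : f =ᵐ[volume] f₀) (h : ℝ) (j : Fin d) :
    S.bSup h f j =ᵐ[volume] S.bSup h f₀ j := by
  have h1 : ∀ᵐ x, ∀ η ∈ {η ∈ grid | η ≤ h}, S.bStar η f j x = S.bStar η f₀ j x :=
    (ae_ball_iff (countable_grid.mono fun _ hη => hη.1)).2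
      fun η hη => hS.bStar_congr_ae hd hff (grid_pos hη.1) j
  filter_upwards [h1] with x hx
  exact iSup_congr fun η => iSup_congr fun hη => hx η hη

/-- The risk is bounded by the norm of `oracleBound`, up to the remainder `Cp n^{-1/2}`. Here `f₀`
and `π` are measurable versions of `f` and of the density of the observations. -/
def OracleRiskBound (S : Setting d) (M : (Fin d → ℝ) → (Fin d → ℝ) → ℝ) (Cp : ℝ≥0) : Prop :=
    ∀ (n : ℕ) (Hf : Family) (δ : (Fin d → ℝ) → ℝ)
      (hsel : (Fin n → Fin d → ℝ) → (Fin d → ℝ) → (Fin d → ℝ)) (f f₀ : (Fin d → ℝ) → ℝ)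
      (π : (Fin d → ℝ) → ℝ≥0∞), 3 ≤ n → S.IsSelection M (Hf.toSet d) n δ hsel → Integrable f →
      S.obsDensity f ∈ probDensities d → Measurable f₀ → f =ᵐ[volume] f₀ → Measurable π →
      (π =ᵐ[volume] fun x => ENNReal.ofReal (S.obsDensity f x)) → ∫⁻ x, π x = 1 →
      S.risk (selectedEst M hsel) f ≤
        3 * (∫⁻ x, S.oracleBound M (volume.withDensity π) Hf n f₀ x ^ S.p) ^ (1 / S.p) +
          Cp * ENNReal.ofReal ((n : ℝ) ^ (-(1 / 2) : ℝ))

/-- The oracle inequality is raised to the power `p` and integrated: its main term is deterministic,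
while the moment of the remainder and the norm of `δ` are of order `n^{-p/2}` uniformly in `f`.
Hence `Cp` is chosen before `R`, `D` and all exponents. -/
theorem IsDeconvKernel.exists_oracleRiskBound {S : Setting d} (hS : S.Valid) (hd : 1 ≤ d)
    {M : (Fin d → ℝ) → (Fin d → ℝ) → ℝ} (hM : S.IsDeconvKernel M) :
    ∃ Cp : ℝ≥0, S.OracleRiskBound M Cp := by
  have hp := hS.one_lt_p
  have hp0 : 0 < S.p := by linarith
  obtain ⟨C, hC⟩ := hM.exists_remainder_le hS hd
  refine ⟨3 * (20 ^ S.p * C + 1) ^ (1 / S.p),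
    fun n Hf δ hsel f f₀ π hn hsl hfi hob hf₀ hff hπ hππ hπ1 => ?_⟩
  set P := volume.withDensity π with hP
  have hPp : IsProbabilityMeasure P :=
    ⟨by rw [hP, withDensity_apply _ MeasurableSet.univ, setLIntegral_univ, hπ1]⟩
  have hlaw : S.sampleLaw n f = Measure.pi fun _ => P := by
    rw [sampleLaw, hP, withDensity_congr_ae hππ]
  have hmean : ∀ x h : Fin d → ℝ, (∀ j, 0 < h j) → ∫ z, M (z - x) h ∂P = S.smooth h f₀ x :=
    fun x h hh => by
      rw [← S.smooth_congr_ae hff h, hP, withDensity_congr_ae hππ]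
      exact hM.integral_eq_smooth hS hd hfi hob.1 hob.2.1 hh x
  have hn0 : (0 : ℝ) < n := by exact_mod_cast (by omega : 0 < n)
  set A := S.oracleBound M P Hf n f₀ with hA
  set rem := fun q : (Fin n → Fin d → ℝ) × (Fin d → ℝ) =>
    20 * S.remainder M P f₀ (Hf.toSet d) q.1 q.2 with hrem
  have hmA : Measurable A := measurable_oracleBound hS hM _ Hf n hf₀
  have hmr : Measurable rem := (measurable_remainder hS hM hf₀ Hf).const_mul 20
  -- The exceptional null set is common to all `h`, so the infimum over `h` may be taken pointwise,
  -- under the integral.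
  have hpt : ∀ z, ∫⁻ x, ‖selectedEst M hsel z x - f x‖ₑ ^ S.p ≤
      ∫⁻ x, (A x + rem (z, x) + ENNReal.ofReal (δ x)) ^ S.p := by
    intro z
    refine lintegral_mono_ae ?_
    filter_upwards [hff, hS.ae_enorm_smooth_sub_le_biasSup hd (hfi.congr hff) Hf] with x hx hbias
    refine ENNReal.rpow_le_rpow ?_ hp0.le
    rw [hx, add_assoc, ← tsub_le_iff_right, hA]
    refine le_iInf₂ fun h hh => ?_
    rw [tsub_le_iff_right, ← add_assoc]
    exact hsl.oracle hS z hh (hbias h hh)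
  have hδ : ∫⁻ x, ENNReal.ofReal (δ x) ^ S.p ≤ ENNReal.ofReal ((n : ℝ) ^ (-(S.p / 2))) := by
    have h1 := hsl.tol_norm
    rw [eLpNorm_eq_lintegral_rpow_enorm_toReal (by simpa using hp0) ENNReal.ofReal_ne_top, one_div,
      ENNReal.toReal_ofReal hp0.le, ENNReal.rpow_inv_le_iff hp0,
      ENNReal.ofReal_rpow_of_pos (Real.rpow_pos_of_pos hn0 _), ← Real.rpow_mul hn0.le] at h1
    convert h1 using 2
    · funext x
      rw [Real.enorm_of_nonneg (hsl.tol_nonneg x)]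
    · congr 1; ring
  have hI : ∫⁻ z, eLpNorm (fun x => selectedEst M hsel z x - f x) (ENNReal.ofReal S.p) volume ^ S.p
      ∂(S.sampleLaw n f) ≤ ENNReal.ofReal (3 ^ S.p) * ((∫⁻ x, A x ^ S.p) +
        ((20 ^ S.p * C + 1 : ℝ≥0) : ℝ≥0∞) * ENNReal.ofReal ((n : ℝ) ^ (-(S.p / 2)))) := by
    rw [hlaw]
    have h20 : ∀ z : Fin n → Fin d → ℝ, ∫⁻ x, rem (z, x) ^ S.p =
        20 ^ S.p * ∫⁻ x, S.remainder M P f₀ (Hf.toSet d) z x ^ S.p := fun z => by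
      rw [← lintegral_const_mul' _ _ (ENNReal.rpow_ne_top_of_nonneg hp0.le (by norm_num))]
      exact lintegral_congr fun x => ENNReal.mul_rpow_of_nonneg _ _ hp0.le
    calc _ ≤ ∫⁻ z : Fin n → Fin d → ℝ,
          (∫⁻ x, (A x + rem (z, x) + ENNReal.ofReal (δ x)) ^ S.p) ∂(Measure.pi fun _ => P) := by
          refine lintegral_mono fun z => le_trans (le_of_eq ?_) (hpt z)
          rw [eLpNorm_eq_lintegral_rpow_enorm_toReal (by simpa using hp0) ENNReal.ofReal_ne_top,
            ENNReal.toReal_ofReal hp0.le, ← ENNReal.rpow_mul, one_div, inv_mul_cancel₀ hp0.ne',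
            ENNReal.rpow_one]
      _ ≤ ENNReal.ofReal (3 ^ S.p) *
          ((∫⁻ _ : Fin n → Fin d → ℝ, (∫⁻ x, A x ^ S.p) ∂(Measure.pi fun _ => P)) +
          (∫⁻ z : Fin n → Fin d → ℝ, (∫⁻ x, rem (z, x) ^ S.p) ∂(Measure.pi fun _ => P)) +
          ∫⁻ _ : Fin n → Fin d → ℝ,
            (∫⁻ x, ENNReal.ofReal (δ x) ^ S.p) ∂(Measure.pi fun _ => P)) :=
          lintegral_lintegral_add_add_rpow_le (μ := Measure.pi fun _ : Fin n => P) (ν := volume)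
            (φ₁ := fun q => A q.2) (fun q => ENNReal.ofReal (δ q.2)) (hmA.comp measurable_snd) hmr
            hp0.le
      _ ≤ ENNReal.ofReal (3 ^ S.p) * ((∫⁻ x, A x ^ S.p) +
          20 ^ S.p * (C * ENNReal.ofReal ((n : ℝ) ^ (-(S.p / 2)))) +
          ENNReal.ofReal ((n : ℝ) ^ (-(S.p / 2)))) := by
          refine mul_le_mul' le_rfl (add_le_add (add_le_add ?_ ?_) ?_)
          · simp
          · simp_rw [h20]
            rw [lintegral_const_mul' _ _ (ENNReal.rpow_ne_top_of_nonneg hp0.le (by norm_num))]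
            exact mul_le_mul' le_rfl (hC n Hf π f₀ hn hπ hπ1 hf₀ hmean)
          · simpa using hδ
      _ = _ := by
          rw [ENNReal.coe_add, ENNReal.coe_mul, ENNReal.coe_rpow_of_nonneg _ hp0.le]
          push_cast
          ring
  have hinv : S.p * (1 / S.p) = 1 := mul_one_div_cancel hp0.ne'
  have hi0 : 0 ≤ 1 / S.p := by positivity
  have hi1 : 1 / S.p ≤ 1 := by rw [div_le_one hp0]; exact hp.le
  refine (ENNReal.rpow_le_rpow hI hi0).trans ?_
  rw [ENNReal.mul_rpow_of_nonneg _ _ hi0, ENNReal.ofReal_rpow_of_pos (by positivity),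
    ← Real.rpow_mul (by norm_num), hinv, Real.rpow_one]
  -- The power `1 / p ≤ 1` is subadditive, which separates the `n^{-1/2}` term with constant one in
  -- front of the main part.
  refine (mul_le_mul' le_rfl (ENNReal.rpow_add_le_add_rpow _ _ hi0 hi1)).trans (le_of_eq ?_)
  rw [ENNReal.mul_rpow_of_nonneg _ _ hi0, ENNReal.ofReal_rpow_of_pos (by positivity),
    ← Real.rpow_mul hn0.le, show -(S.p / 2) * (1 / S.p) = -(1 / 2) by field_simp,
    ENNReal.coe_mul, ENNReal.coe_rpow_of_nonneg _ hi0]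
  simp only [ENNReal.ofReal_ofNat, ENNReal.coe_ofNat]
  ring

end Setting

end ConvDensity

/-! ### Uniformity over the class, and conclusion. -/

namespace ConvDensity

variable {d : ℕ}

namespace Setting

theorem upperBound_mono_const {S : Setting d} {D : ℝ} {Hf : Family} {n : ℕ}
    {F : Set ((Fin d → ℝ) → ℝ)} {B : Fin d → ℝ≥0∞ → ℝ → ℝ≥0∞} {s : Fin d → ℝ} {u : ℝ≥0∞}
    {v₁ v₂ : ℝ} {C C' Cp : ℝ≥0} (hC : C ≤ C') (T : ℝ≥0∞) :
    S.upperBound D Hf n F B s u v₁ v₂ C Cp T ≤ S.upperBound D Hf n F B s u v₁ v₂ C' Cp T := by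
  unfold upperBound
  gcongr

theorem MaxRiskBounds.mono_const {S : Setting d} {D : ℝ} {Hf : Family} {n : ℕ}
    {F : Set ((Fin d → ℝ) → ℝ)} {B : Fin d → ℝ≥0∞ → ℝ → ℝ≥0∞} {s qv : Fin d → ℝ} {q u : ℝ≥0∞}
    {v₁ v₂ : ℝ} {C C' Cp : ℝ≥0} {fhat : (Fin n → Fin d → ℝ) → (Fin d → ℝ) → ℝ}
    (h : S.MaxRiskBounds D Hf F B s qv q u v₁ v₂ C Cp fhat) (hC : C ≤ C') :
    S.MaxRiskBounds D Hf F B s qv q u v₁ v₂ C' Cp fhat :=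
  ⟨h.1.trans (upperBound_mono_const hC _),
    fun h1 h2 => (h.2.1 h1 h2).trans (upperBound_mono_const hC _),
    fun h1 => (h.2.2 h1).trans (upperBound_mono_const hC _)⟩

/-- Members of the class are only almost everywhere measurable, so each `f` is replaced by a
measurable version; the bias norms are insensitive to this. Keeping `N` and `B` abstract treats the
norms of suprema and the sums of norms at once. -/
theorem OracleRiskBound.exists_maxRiskBounds {S : Setting d} (hS : S.Valid) (hd : 1 ≤ d)
    {M : (Fin d → ℝ) → (Fin d → ℝ) → ℝ} (hM : S.IsDeconvKernel M) {Cp : ℝ≥0}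
    (hCp : S.OracleRiskBound M Cp) (R : ℝ) {D : ℝ} (hD : 0 < D) {q u : ℝ≥0∞} (hq : 1 < q)
    (hqu : q ≤ u) (hpu : ENNReal.ofReal S.p / 2 < u) {Hf : Family}
    {N : ((Fin d → ℝ) → ℝ) → Fin d → ℝ≥0∞ → ℝ → ℝ≥0∞} {s qv : Fin d → ℝ}
    (hs : ∀ j, 0 ≤ s j) (hN : S.BiasControlled Hf N s) (hqv : ∀ j, S.p ≤ qv j)
    (hNq : S.BiasControlled Hf N qv) :
    ∃ C : ℝ≥0, ∀ (n : ℕ) (F : Set ((Fin d → ℝ) → ℝ)) (B : Fin d → ℝ≥0∞ → ℝ → ℝ≥0∞) (v₁ v₂ : ℝ)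
      (δ : (Fin d → ℝ) → ℝ) (hsel : (Fin n → Fin d → ℝ) → (Fin d → ℝ) → (Fin d → ℝ)),
      3 ≤ n → F ⊆ lpBall d q D ∩ S.classFu u R D → 0 < v₁ → v₁ ≤ v₂ →
      (∀ f ∈ F, ∀ f₀, f =ᵐ[volume] f₀ → ∀ j s h, 0 < h → N f₀ j s h ≤ B j s h) →
      S.IsSelection M (Hf.toSet d) n δ hsel →
      S.MaxRiskBounds D Hf F B s qv q u v₁ v₂ C Cp (selectedEst M hsel) := by
  have hp0 : 0 < S.p := by linarith [hS.one_lt_p]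
  have hi0 : 0 ≤ 1 / S.p := by positivity
  obtain ⟨K, hK⟩ := hM.exists_lintegral_oracleBound_le hS hd R hD hq (hq.trans_le hqu) hpu hs hN
    hqv hNq
  refine ⟨3 * K ^ (1 / S.p), fun n F B v₁ v₂ δ hsel hn hF hv₁ hv₁₂ hB hsl => ?_⟩
  have key : ∀ T : ℝ≥0∞,
      (T = ENNReal.ofReal (v₂ ^ S.p) * S.LLu D (Hf.toSet d) n F B qv v₂ u ∨
        (ENNReal.ofReal S.p < q ∧ q < ∞ ∧ T = ENNReal.ofReal (v₂ ^ (S.p - q.toReal))) ∨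
        (q = ∞ ∧ T = S.LLu D (Hf.toSet d) n F B s v₂ u)) →
      (⨆ f ∈ F, S.risk (selectedEst M hsel) f) ≤
        S.upperBound D Hf n F B s u v₁ v₂ (3 * K ^ (1 / S.p)) Cp T := by
    intro T hT
    refine iSup₂_le fun f hf => ?_
    obtain ⟨⟨hfq, hfqD⟩, ⟨⟨hf1, hf1R⟩, hob⟩, hweak⟩ := hF hf
    obtain ⟨hobi, hob0, hob1⟩ := hob
    have hfi : Integrable f := memLp_one_iff_integrable.1 hf1
    set f₀ := hfi.aestronglyMeasurable.mk f with hf₀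
    have hf₀m : Measurable f₀ := hfi.aestronglyMeasurable.stronglyMeasurable_mk.measurable
    have hff : f =ᵐ[volume] f₀ := hfi.aestronglyMeasurable.ae_eq_mk
    set π : (Fin d → ℝ) → ℝ≥0∞ := fun x => ENNReal.ofReal (hobi.aestronglyMeasurable.mk _ x) with hπ
    have hπm : Measurable π := hobi.aestronglyMeasurable.stronglyMeasurable_mk.measurable.ennreal_ofReal
    have hππ : π =ᵐ[volume] fun x => ENNReal.ofReal (S.obsDensity f x) :=
      hobi.aestronglyMeasurable.ae_eq_mk.mono fun x hx => congrArg ENNReal.ofReal hx.symm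
    have hπ1 : ∫⁻ x, π x = 1 := by
      rw [lintegral_congr_ae hππ, ← ofReal_integral_eq_lintegral_ofReal hobi hob0, hob1,
        ENNReal.ofReal_one]
    have hdom : S.BiasDominated F N B f₀ :=
      ⟨fun j h _ => by
        rw [← eLpNorm_congr_ae (hS.bSup_congr_ae hd hff h j)]
        exact le_iSup₂ (f := fun f _ => eLpNorm (S.bSup h f j) ∞ volume) f hf,
        fun j s h hh => hB f hf f₀ hff j s h hh⟩
    have h1 : ∫⁻ x, ‖f₀ x‖ₑ ≤ ENNReal.ofReal R := by
      rw [← eLpNorm_one_eq_lintegral_enorm, ← eLpNorm_congr_ae hff]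
      exact hf1R
    have h2 : eLpNorm f₀ q volume ≤ ENNReal.ofReal D := by
      rw [← eLpNorm_congr_ae hff]
      exact hfqD
    have hA := hK n π F B f₀ v₁ v₂ T hn hπm hπ1 (weakBounded_of_mem_weakBall hweak hππ) hf₀m
      (hfi.congr hff) h1 h2 hdom hv₁ hv₁₂ hT
    refine (hCp n Hf δ hsel f f₀ π hn hsl hfi ⟨hobi, hob0, hob1⟩ hf₀m hff hπm hππ hπ1).trans ?_
    unfold upperBound
    refine add_le_add ?_ le_rfl
    refine (mul_le_mul' le_rfl (ENNReal.rpow_le_rpow hA hi0)).trans (le_of_eq ?_)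
    rw [ENNReal.mul_rpow_of_nonneg _ _ hi0, ENNReal.coe_mul, ENNReal.coe_rpow_of_nonneg _ hi0,
      ENNReal.coe_ofNat, mul_assoc]
  exact ⟨key _ (Or.inl rfl), fun h1 h2 => key _ (Or.inr (Or.inl ⟨h1, h2, rfl⟩)),
    fun h1 => key _ (Or.inr (Or.inr ⟨h1, rfl⟩))⟩

end Setting

end ConvDensity

theorem theorem3 {d : ℕ} (hd : 1 ≤ d) (S : ConvDensity.Setting d) (hS : S.Valid)
    (M : (Fin d → ℝ) → (Fin d → ℝ) → ℝ) (hM : S.IsDeconvKernel M) :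
    ∃ Cp : ℝ≥0, ∀ (R D : ℝ) (q u : ℝ≥0∞) (s qv : Fin d → ℝ),
      1 < R → 0 < D → 1 < q → ENNReal.ofReal S.p / 2 < u → q ≤ u →
      (∀ j, 1 ≤ s j) → (∀ j, S.p ≤ qv j) →
      ∃ C : ℝ≥0, ∀ (n : ℕ) (F : Set ((Fin d → ℝ) → ℝ)) (v₁ v₂ : ℝ),
        3 ≤ n → F ⊆ ConvDensity.lpBall d q D ∩ S.classFu u R D → 0 < v₁ → v₁ ≤ v₂ →
        ((∀ j, 1 < s j) →
          ∀ (Hf : ConvDensity.Family) (δ : (Fin d → ℝ) → ℝ)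
            (hsel : (Fin n → Fin d → ℝ) → (Fin d → ℝ) → (Fin d → ℝ)),
            S.IsSelection M (Hf.toSet d) n δ hsel →
            S.MaxRiskBounds D Hf F (S.biasB F) s qv q u v₁ v₂ C Cp
              (ConvDensity.Setting.selectedEst M hsel)) ∧
        (∀ (δ : (Fin d → ℝ) → ℝ)
            (hsel : (Fin n → Fin d → ℝ) → (Fin d → ℝ) → (Fin d → ℝ)),
            S.IsSelection M (ConvDensity.Family.isotropic.toSet d) n δ hsel →
            S.MaxRiskBounds D ConvDensity.Family.isotropic F (S.biasBStar F) s qv q u v₁ v₂ C Cp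
              (ConvDensity.Setting.selectedEst M hsel)) := by
  obtain ⟨Cp, hCp⟩ := hM.exists_oracleRiskBound hS hd
  refine ⟨Cp, fun R D q u s qv _ hD hq hpu hqu hs hqv => ?_⟩
  have hqv1 : ∀ j, 1 < qv j := fun j => hS.one_lt_p.trans_le (hqv j)
  have hs0 : ∀ j, 0 ≤ s j := fun j => zero_le_one.trans (hs j)
  -- The constant is chosen before it is known whether all `s j` exceed one; if not, the claim is
  -- vacuous and zero serves.
  have hfull : ∀ Hf : ConvDensity.Family, ∃ C : ℝ≥0, (∀ j, 1 < s j) →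
      ∀ (n : ℕ) (F : Set ((Fin d → ℝ) → ℝ)) (v₁ v₂ : ℝ) (δ : (Fin d → ℝ) → ℝ)
        (hsel : (Fin n → Fin d → ℝ) → (Fin d → ℝ) → (Fin d → ℝ)),
        3 ≤ n → F ⊆ ConvDensity.lpBall d q D ∩ S.classFu u R D → 0 < v₁ → v₁ ≤ v₂ →
        S.IsSelection M (Hf.toSet d) n δ hsel →
        S.MaxRiskBounds D Hf F (S.biasB F) s qv q u v₁ v₂ C Cp
          (ConvDensity.Setting.selectedEst M hsel) := by
    intro Hf
    by_cases hs1 : ∀ j, 1 < s j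
    · obtain ⟨C, hC⟩ := hCp.exists_maxRiskBounds hS hd hM R hD hq hqu hpu hs0
        (hS.biasControlled hd Hf hs1) hqv (hS.biasControlled hd Hf hqv1)
      refine ⟨C, fun _ n F v₁ v₂ δ hsel hn hF hv₁ hv₁₂ hsl =>
        hC n F (S.biasB F) v₁ v₂ δ hsel hn hF hv₁ hv₁₂ (fun f hf f₀ hff j s h _ => ?_) hsl⟩
      rw [← eLpNorm_congr_ae (hS.bSup_congr_ae hd hff h j)]
      exact le_iSup₂ (f := fun f _ => eLpNorm (S.bSup h f j) s volume) f hf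
    · exact ⟨0, fun h => absurd h hs1⟩
  choose C hC using hfull
  -- The isotropic control of the bias allows `s j = 1`; the constants of all cases are added at the
  -- end.
  obtain ⟨C', hC'⟩ := hCp.exists_maxRiskBounds hS hd hM R hD hq hqu hpu hs0
    (hS.biasControlled_isotropic hd hs) hqv
    (hS.biasControlled_isotropic hd fun j => (hqv1 j).le)
  refine ⟨C .full + C .isotropic + C', fun n F v₁ v₂ hn hF hv₁ hv₁₂ =>
    ⟨fun hs1 Hf δ hsel hsl => (hC Hf hs1 n F v₁ v₂ δ hsel hn hF hv₁ hv₁₂ hsl).mono_const ?_,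
      fun δ hsel hsl => ?_⟩⟩
  · cases Hf
    · exact le_self_add.trans le_self_add
    · exact le_add_self.trans le_self_add
  · refine (hC' n F (S.biasBStar F) v₁ v₂ δ hsel hn hF hv₁ hv₁₂
      (fun f hf f₀ hff j s h _ => ?_) hsl).mono_const le_add_self
    refine le_trans (le_of_eq (tsum_congr fun η => ?_))
      (le_iSup₂ (f := fun f _ => ∑' η : {η : ℝ // η ∈ ConvDensity.grid ∧ η ≤ h},
        eLpNorm (S.bStar η f j) s volume) f hf)
    rw [← eLpNorm_congr_ae (hS.bStar_congr_ae hd hff (ConvDensity.Setting.grid_pos η.2.1) j)]
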